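/- Let $\alpha\in(1/2,1)$, let $\mathbb T=\mathbb R/2\pi\mathbb Z$, and for $s\ge 0$ let $H^s=H^s(\mathbb T)\subset L^2(\mathbb T)$ carry the norm $\|f\|_{H^s}=\big(\sum_{k\in\mathbb Z}(1+k^2)^{s}|\widehat f(k)|^2\big)^{1/2}$, $\widehat f(k)=\frac1{2\pi}\int_0^{2\pi}f(x)e^{-ikx}\,dx$. For $\gamma\in\{1,-1\}$ consider on $\mathbb T$ $$ iu_t+(-\Delta)^\alpha u=\gamma|u|^2u,\qquad u(0)=u_0, \tag{1}$$ where $(-\Delta)^\alpha$ has symbol $|k|^{2\alpha}$, and, for $N\in\mathbb N$, its truncation $$ i\partial_tu_N+(-\Delta)^\alpha u_N=\gamma P_N(|u_N|^2u_N),\qquad u_N(0)=P_Nu_0, \tag{2}$$ where $P_N$ is the projection onto the frequencies $|k|\le N$. For $b>1/2$ let $X^{s,b}_T$ be the space of restrictions to $[0,T]$ of functions $u$ on $\mathbb R\times\mathbb T$ with $\|u\|_{X^{s,b}}^2=\sum_k\int\langle\tau-|k|^{2\alpha}\rangle^{2b}\langle k\rangle^{2s}|\widehat u(k,\tau)|^2d\tau<\infty$,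 with the restriction norm. A solution of (1) on $[0,T]$ is a function $u\in X^{s,b}_T\cap C([0,T];H^s)$ satisfying the Duhamel formula for (1) on $[0,T]$. We say that (1) is well-posed on $[0,T]$ at $u_0$ if there is exactly one solution on $[0,T]$ with datum $u_0$, the same holds for all data in some $H^s$-neighbourhood of $u_0$, and the solution, in $X^{s,b}_T$ and in $C([0,T];H^s)$, depends continuously on the datum at $u_0$. **Lemma.** There are $b>1/2$ and $C_2>0$, depending only on $\alpha$, and for every $S\in\mathbb R$ there are $C_0,C_1>0$, depending only on $\alpha$ and $S$, such that the following holds for all $\gamma\in\{1,-1\}$, all $s$ with $\frac{1-\alpha}2<s\le S$, all $A\in\mathbb R$ and all $T>0$, with a number $N_0=N_0(\alpha,\gamma,S,s,A,T)$. Let $u_0\in H^s$ with $\|u_0\|_{H^s}<A$, and assume that for some $N\ge N_0$ the solution $u_N$ of (2) satisfies $\|u_N(t)\|_{H^s}<A$ for $0\le t\le T$. Then (1) is well-posed on $[0,T]$ at $u_0$. Moreover, if $u$ is its solution, then for every $M\ge1$ such that the solution $u_M$ of (2) (with $M$ in place of $N$) satisfies $\|u_M(t)\|_{H^s}<A$ for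 $0\le t\le T$ (in particular for $M=N$ if $N\geq 1$), for every $0\le s'<s$ and every $t\in[0,T]$, $$\|u(t)-u_M(t)\|_{H^{s'}}\le C_0\,A\,e^{C_1(1+A)^{C_2}T}M^{s'-s},$$ and, if $T\ge1$, $$\|u(t)-u_M(t)\|_{H^{s'}}\le e^{C_1(1+A)^{C_2}T}M^{s'-s}.$$ In particular, if $\|u_N(t)\|_{H^s}<A$ on $[0,T]$ for all $N\ge1$, then (1) is well-posed on $[0,T]$ at $u_0$ and both bounds hold for all $M\ge1$. -/

import Mathlib

open Real Set Filter Topology MeasureTheory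
open scoped ENNReal

noncomputable section

namespace FracNLS

instance factTwoPiPos : Fact ((0 : ℝ) < 2 * π) := ⟨Real.two_pi_pos⟩

/-- The torus `ℝ / 2πℤ`. -/
abbrev Torus : Type := AddCircle (2 * π)

/-- `L²(𝕋)` for the normalized measure `dx / 2π`, so that `fourierCoeff f k` is
`(1 / 2π) ∫₀^{2π} f(x) e^{-ikx} dx`. -/
abbrev L2 : Type := Lp ℂ 2 (AddCircle.haarAddCircle (T := 2 * π))

/-- The `k`-th Fourier coefficient of `f ∈ L²(𝕋)`. -/
def coeff (f : L2) (k : ℤ) : ℂ := fourierCoeff (f : Torus → ℂ) k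

/-- The `k`-th Fourier coefficient of `|f|² f`. -/
def cubicCoeff (f : L2) (k : ℤ) : ℂ :=
  fourierCoeff (fun x : Torus => ((‖f x‖ ^ 2 : ℝ) : ℂ) * f x) k

/-- The Sobolev norm `(∑ₖ (1 + k²)^s |f̂(k)|²)^{1/2}`, equal to `∞` exactly when `f ∉ H^s(𝕋)`. -/
def hsNorm (s : ℝ) (f : L2) : ℝ≥0∞ :=
  (∑' k : ℤ, ENNReal.ofReal ((1 + (k : ℝ) ^ 2) ^ s) * ‖coeff f k‖ₑ ^ 2) ^ (1 / 2 : ℝ)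

/-- The symbol `|k|^{2α}` of `(-Δ)^α`. -/
def symbol (α : ℝ) (k : ℤ) : ℝ := |(k : ℝ)| ^ (2 * α)

/-- The projection `P_N` onto the frequencies `|k| ≤ N`. -/
def freqProj (N : ℕ) (f : L2) : L2 :=
  ∑ k ∈ Finset.Icc (-(N : ℤ)) (N : ℤ), coeff f k • fourierLp (T := 2 * π) 2 k

/-- `u ∈ C([0,T]; H^s(𝕋))`. -/
def ContinuousInHs (s T : ℝ) (u : ℝ → L2) : Prop :=
  ∀ t ∈ Icc 0 T, hsNorm s (u t) < ⊤ ∧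
    Tendsto (fun r => hsNorm s (u r - u t)) (𝓝[Icc 0 T] t) (𝓝 0)

/-- The square of the Bourgain norm, `∑ₖ ∫ ⟨τ - |k|^{2α}⟩^{2b} ⟨k⟩^{2s} |F(k,τ)|² dτ`,
of the function on `ℝ × 𝕋` whose space-time Fourier transform is `F`. -/
def xsbEnergy (α s b : ℝ) (F : ℤ → ℝ → ℂ) : ℝ≥0∞ :=
  ∑' k : ℤ, ∫⁻ τ : ℝ,
    ENNReal.ofReal ((1 + (τ - symbol α k) ^ 2) ^ b * (1 + (k : ℝ) ^ 2) ^ s) * ‖F k τ‖ₑ ^ 2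

/-- `F` is the space-time Fourier transform of an extension of `u` from `[0,T]` to `ℝ`. For
`b > 1/2`, finiteness of `xsbEnergy α s b F` makes each `F k` integrable, so that the inversion
integral below converges absolutely and is continuous in `t`. -/
def IsExtensionTransform (T : ℝ) (u : ℝ → L2) (F : ℤ → ℝ → ℂ) : Prop :=
  ∀ k : ℤ, AEStronglyMeasurable (F k) volume ∧
    ∀ t ∈ Icc 0 T, coeff (u t) k =
      ((2 * π : ℝ) : ℂ)⁻¹ * ∫ τ : ℝ, F k τ * Complex.exp (Complex.I * ((t * τ : ℝ) : ℂ))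

/-- The norm of the restriction space `X^{s,b}_T`, for `b > 1/2`: the infimum of the `X^{s,b}`
norms of all extensions, equal to `∞` exactly when `u ∉ X^{s,b}_T`. -/
def xsbNorm (α s b T : ℝ) (u : ℝ → L2) : ℝ≥0∞ :=
  (⨅ (F : ℤ → ℝ → ℂ) (_ : IsExtensionTransform T u F), xsbEnergy α s b F) ^ (1 / 2 : ℝ)

/-- `u` is a solution on `[0,T]`, in `X^{s,b}_T ∩ C([0,T]; H^s)`, of
`i u_t + (-Δ)^α u = γ |u|² u`, `u(0) = u₀`. The equation is understood in the Duhamel sense,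
Fourier coefficient by Fourier coefficient. -/
structure IsSolution (α γ s b T : ℝ) (u₀ : L2) (u : ℝ → L2) : Prop where
  continuousInHs : ContinuousInHs s T u
  mem_xsb : xsbNorm α s b T u < ⊤
  memLp_three : ∀ᵐ t ∂(volume.restrict (Icc 0 T)),
    MemLp (u t : Torus → ℂ) 3 AddCircle.haarAddCircle
  integrable_cubic : ∀ k : ℤ, IntegrableOn (fun t => cubicCoeff (u t) k) (Icc 0 T)
  duhamel : ∀ k : ℤ, ∀ t ∈ Icc 0 T,
    coeff (u t) k = Complex.exp (Complex.I * ((t * symbol α k : ℝ) : ℂ)) * coeff u₀ k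
      - Complex.I * (γ : ℂ) * ∫ τ in (0 : ℝ)..t,
          Complex.exp (Complex.I * (((t - τ) * symbol α k : ℝ) : ℂ)) * cubicCoeff (u τ) k

/-- `u` is a solution on `[0,T]` with initial datum `u₀`, and the only one. -/
def IsUniqueSolution (α γ s b T : ℝ) (u₀ : L2) (u : ℝ → L2) : Prop :=
  IsSolution α γ s b T u₀ u ∧
    ∀ w : ℝ → L2, IsSolution α γ s b T u₀ w → EqOn w u (Icc 0 T)

/-- Well-posedness in `H^s` on `[0,T]` at the datum `u₀`: there is a unique solution on `[0,T]`,
this remains so for all data in an `H^s`-neighbourhood of `u₀`, and the solution depends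
continuously on the datum at `u₀`, in `X^{s,b}_T` and in `C([0,T]; H^s)`. -/
def WellPosedOn (α γ s b T : ℝ) (u₀ : L2) : Prop :=
  ∃ u : ℝ → L2, IsUniqueSolution α γ s b T u₀ u ∧
    ∀ ε : ℝ, 0 < ε → ∃ δ : ℝ, 0 < δ ∧ ∀ v₀ : L2, hsNorm s (v₀ - u₀) < ENNReal.ofReal δ →
      ∃ v : ℝ → L2, IsUniqueSolution α γ s b T v₀ v ∧
        xsbNorm α s b T (fun t => v t - u t) ≤ ENNReal.ofReal ε ∧
        ∀ t ∈ Icc 0 T, hsNorm s (v t - u t) ≤ ENNReal.ofReal ε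

/-- `v` is a solution on `[0,T]` of the truncated equation
`i v_t + (-Δ)^α v = γ P_N(|v|² v)`, `v(0) = P_N u₀`. On the Fourier side the equation reads
`v̂ₖ' = i (|k|^{2α} v̂ₖ - γ 1_{|k| ≤ N} (|v|²v)^ₖ)`; it forces `v̂ₖ = 0` for `|k| > N`. -/
structure IsTruncatedSolution (α γ : ℝ) (N : ℕ) (T : ℝ) (u₀ : L2) (v : ℝ → L2) : Prop where
  init : v 0 = freqProj N u₀
  equation : ∀ k : ℤ, ∀ t ∈ Icc 0 T,
    HasDerivWithinAt (fun r => coeff (v r) k)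
      (Complex.I * ((symbol α k : ℂ) * coeff (v t) k
        - (γ : ℂ) * (if |k| ≤ (N : ℤ) then cubicCoeff (v t) k else 0))) (Icc 0 T) t

/-- The solution of the `N`-th truncated equation (`v`) stays in the open ball of radius `A`
of `H^s` on `[0,T]`. -/
def StaysInBall (α γ s A T : ℝ) (N : ℕ) (u₀ : L2) (v : ℝ → L2) : Prop :=
  IsTruncatedSolution α γ N T u₀ v ∧ ∀ t ∈ Icc 0 T, hsNorm s (v t) < ENNReal.ofReal A

end FracNLS

end

open Real Set Filter Topology MeasureTheory
open scoped ENNReal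

noncomputable section

namespace FracNLS

section

/-! ### Counting lemmas for the dispersion relation -/

/-! The proof is Bourgain's Fourier restriction method in the interaction picture. On a time
interval a function is described by a density `f (k, τ)`: the coefficient of `e^{ikx}`, multiplied
by `e^{-it|k|^{2α}}`, equals `∫ f (k, τ) e^{itτ} dτ` (`Rep`). The `X^{s,b}` norm becomes the `L²`
norm of `f` with weight `(1+|k|)^s (1+|τ|)^b`. Densities are not unique, and every estimate sees
only `|f|`.

Trilinear estimate. In a cubic interaction put `k = k₁ + k₃ = k₀ + k₂`. The phase is the difference
of the values of `x ↦ |k-x|^{2α} + |x|^{2α}` at `k₂` and at `k₃`. This function is convex, so few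
integers give it a value close to a prescribed one; `counting` makes this precise with the weight
`(1+|x|)^{α-1}`, increased by `1` when `|x| ≥ 2|k|`. Cauchy–Schwarz turns two such weights into
`majorant_mult23`, and trading weights between the frequencies gives `majorant_triWeight`: the cubic
term is controlled with `(1-α)/2` derivatives on two factors and none on the third. Hence
differences of solutions can be measured in `L²`. Restricting time to an interval of length `δ`
gains `δ^ε` (`kernel_bound`), and the Duhamel integral gains one power of the modulation
(`exists_densityBound`). Duality turns the trilinear estimate into an `L⁴` Strichartz estimate,
which makes the cubic term integrable in time and lets the bounds for truncated factors pass to the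
limit (`integrable_tri_and_osc_le`).

Short times. If the norm is at most `R` and `δ^ε R²` is small, then a contraction gives existence
(`exists_sol`), the size in time controls a density (`Sol.exists_rep_le`), and errors grow by a
constant factor (`exists_rep_sub_le`, `Sol.cn_sub_le`).

Long times. Boundedness is assumed only for one truncated solution, while the `H^s` norm of `u` may
a priori be multiplied by a constant in each step; the step length must not shrink with it. The
remedy is the weight `(1+|k|)^{(1-α)/2} + λ (1+|k|)^s` (`mixWeight`) with `λ = A/B`, where `B` is
the current `H^s` bound. Its trilinear constant does not depend on `λ`, and the norm of `u` in it is
`O(A)` as long as the critical norm is. The step length is therefore of order `(1+A)^{-2/ε}`, and `n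
≲ 1 + (1+A)^{2/ε} T` steps reach `T`.

Both the tail of the datum and the part of the nonlinearity above frequency `N` have size `N^{-s}`
in `L²`, so `u - u_N` is at most `N^{-s}` times an exponential in `n` (`cn_sub_truncated_le`).
Interpolation with the `H^s` bound makes the difference small in the critical norm, because `s >
(1-α)/2` and `N` is large. Thus the critical norm of `u` returns below `2A` after each step and the
construction continues (`exists_global_sol`). The same comparison with any bounded `u_M`,
interpolated at `s'`, gives the rate `M^{s'-s}` (`hsNorm_sub_truncated_le`), and the exponential in
`n` becomes the one in the statement. -/

lemma second_difference_abs_rpow {p : ℝ} (hp : 1 < p) (hp2 : p ≤ 2) (a d : ℝ) (hd : 0 < d) :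
    p * (p - 1) * (d ^ 2 * (|a| + d) ^ (p - 2)) ≤ |a + d| ^ p + |a - d| ^ p - 2 * |a| ^ p := by
  set R := |a| + d with hR
  have hRpos : 0 < R := by positivity
  -- On `[-R, R]` the second derivative of `|x|^p` is at least `p (p-1) R^{p-2} = 2c`, since `p ≤
  -- 2`. So `|x|^p - c x²` is convex there, and midpoint convexity at `a ± d` is the claim.
  set c := p * (p - 1) / 2 * R ^ (p - 2) with hc
  have hder : ∀ x : ℝ, HasDerivAt (fun x : ℝ => |x| ^ p - c * x ^ 2)
      (p * |x| ^ (p - 2) * x - c * (2 * x)) x := by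
    intro x
    have h1 := hasDerivAt_abs_rpow x hp
    have h2 := ((hasDerivAt_id x).pow 2).const_mul c
    exact (h1.sub h2).congr_deriv (by simp)
  -- The second derivative is singular at `0`, so monotonicity of the first derivative is proved on
  -- `[0, R]` and carried to `[-R, R]` by oddness.
  have hodd : MonotoneOn (fun x : ℝ => p * |x| ^ (p - 2) * x - c * (2 * x)) (Icc 0 R) := by
    intro x hx y hy hxy
    have key : ∀ z ∈ Icc (0 : ℝ) R, p * |z| ^ (p - 2) * z - c * (2 * z)
        = p * (z ^ (p - 1) - (p - 1) * R ^ (p - 2) * z) := by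
      intro z hz
      rcases hz.1.eq_or_lt with h | h
      · subst h; simp [Real.zero_rpow (by linarith : p - 1 ≠ 0)]
      · rw [abs_of_pos h, hc]
        have : z ^ (p - 1) = z ^ (p - 2) * z := by
          rw [← Real.rpow_add_one h.ne']; congr 1; ring
        rw [this]; ring
    simp only [key x hx, key y hy]
    refine mul_le_mul_of_nonneg_left ?_ (by linarith)
    rcases hxy.eq_or_lt with h | h
    · rw [h]
    have hmono : MonotoneOn (fun z : ℝ => z ^ (p - 1) - (p - 1) * R ^ (p - 2) * z) (Icc 0 R) := by
      have hd' : ∀ z ∈ Ioo 0 R, HasDerivAt (fun z : ℝ => z ^ (p - 1) - (p - 1) * R ^ (p - 2) * z)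
          ((p - 1) * z ^ (p - 1 - 1) - (p - 1) * R ^ (p - 2) * 1) z := by
        intro z hz
        exact (Real.hasDerivAt_rpow_const (Or.inl hz.1.ne')).sub ((hasDerivAt_id z).const_mul _)
      refine monotoneOn_of_deriv_nonneg (convex_Icc _ _) ?_ ?_ ?_
      · refine ContinuousOn.sub ?_ (by fun_prop)
        exact (Real.continuous_rpow_const (by linarith)).continuousOn
      · rw [interior_Icc]
        exact fun z hz => (hd' z hz).differentiableAt.differentiableWithinAt
      · rw [interior_Icc]
        intro z hz
        rw [(hd' z hz).deriv]
        have : R ^ (p - 2) ≤ z ^ (p - 1 - 1) := by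
          rw [show p - 1 - 1 = p - 2 by ring]
          exact Real.rpow_le_rpow_of_nonpos hz.1 hz.2.le (by linarith)
        nlinarith
    exact hmono hx hy hxy
  have hmono : MonotoneOn (fun x : ℝ => p * |x| ^ (p - 2) * x - c * (2 * x)) (Icc (-R) R) := by
    intro x hx y hy hxy
    have h0 : (0 : ℝ) ∈ Icc (0 : ℝ) R := ⟨le_rfl, hRpos.le⟩
    rcases le_total 0 x with h | h
    · exact hodd ⟨h, hx.2⟩ ⟨h.trans hxy, hy.2⟩ hxy
    · have hx' : -x ∈ Icc (0 : ℝ) R := ⟨by linarith, by linarith [hx.1]⟩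
      rcases le_total 0 y with h' | h'
      · have h1 := hodd h0 hx' hx'.1
        have h2 := hodd h0 ⟨h', hy.2⟩ h'
        simp only [abs_neg] at h1 h2 ⊢
        linarith
      · have hy' : -y ∈ Icc (0 : ℝ) R := ⟨by linarith, by linarith [hy.1]⟩
        have h1 := hodd hy' hx' (by linarith)
        simp only [abs_neg] at h1 ⊢
        linarith
  have hconv : ConvexOn ℝ (Icc (-R) R) (fun x : ℝ => |x| ^ p - c * x ^ 2) := by
    refine MonotoneOn.convexOn_of_deriv (convex_Icc _ _) ?_ ?_ ?_
    · exact fun x _ => (hder x).continuousAt.continuousWithinAt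
    · exact fun x _ => (hder x).differentiableAt.differentiableWithinAt
    · have : deriv (fun x : ℝ => |x| ^ p - c * x ^ 2)
          = fun x : ℝ => p * |x| ^ (p - 2) * x - c * (2 * x) := funext fun x => (hder x).deriv
      rw [this]
      exact hmono.mono interior_subset
  have hm1 : a + d ∈ Icc (-R) R := ⟨by linarith [neg_abs_le a], by linarith [le_abs_self a]⟩
  have hm2 : a - d ∈ Icc (-R) R := ⟨by linarith [neg_abs_le a], by linarith [le_abs_self a]⟩
  have := hconv.2 hm1 hm2 (by norm_num : (0 : ℝ) ≤ 1 / 2) (by norm_num : (0 : ℝ) ≤ 1 / 2)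
    (by norm_num)
  simp only [smul_eq_mul] at this
  rw [show 1 / 2 * (a + d) + 1 / 2 * (a - d) = a by ring] at this
  have h3 : c * d ^ 2 * 2 ≤ |a + d| ^ p + |a - d| ^ p - 2 * |a| ^ p := by nlinarith
  calc p * (p - 1) * (d ^ 2 * (|a| + d) ^ (p - 2)) = c * d ^ 2 * 2 := by rw [hc]; ring
    _ ≤ _ := h3

/-- The points `a - d` and `a'` lie between `a' - d` and `a` and have the same sum as these two, so
convexity of `|x|^p` applies with complementary barycentric weights. -/
lemma abs_rpow_sub_antitone {p : ℝ} (hp : 1 < p) (d : ℝ) (hd : 0 ≤ d) {a a' : ℝ} (h : a' ≤ a) :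
    |a - d| ^ p - |a| ^ p ≤ |a' - d| ^ p - |a'| ^ p := by
  have hconv : ConvexOn ℝ univ (fun x : ℝ => |x| ^ p) := by
    have h1 : ConvexOn ℝ univ (fun x : ℝ => ‖x‖) := convexOn_univ_norm
    have h2 : (fun x : ℝ => ‖x‖) '' univ ⊆ Ici 0 := by rintro _ ⟨x, _, rfl⟩; exact norm_nonneg x
    have hc : Convex ℝ ((fun x : ℝ => ‖x‖) '' univ) := by
      have : (fun x : ℝ => ‖x‖) '' univ = Ici 0 := by
        ext y; simp only [image_univ, mem_range, Real.norm_eq_abs, mem_Ici]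
        exact ⟨fun ⟨x, hx⟩ => hx ▸ abs_nonneg x, fun hy => ⟨y, abs_of_nonneg hy⟩⟩
      rw [this]; exact convex_Ici 0
    exact ((convexOn_rpow hp.le).subset h2 hc).comp h1
      ((Real.monotoneOn_rpow_Ici_of_exponent_nonneg (by linarith)).mono h2)
  rcases eq_or_lt_of_le (by linarith : 0 ≤ a - a' + d) with h0 | hL
  · have h1 : d = 0 := by linarith
    subst h1; simp
  have e1 := hconv.2 (mem_univ (a' - d)) (mem_univ a)
    (by positivity : 0 ≤ d / (a - a' + d)) (div_nonneg (by linarith) hL.le : 0 ≤ (a - a') / (a - a' + d))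
    (by field_simp; ring)
  have e2 := hconv.2 (mem_univ (a' - d)) (mem_univ a)
    (div_nonneg (by linarith) hL.le : 0 ≤ (a - a') / (a - a' + d)) (by positivity : 0 ≤ d / (a - a' + d))
    (by field_simp)
  simp only [smul_eq_mul] at e1 e2
  rw [show d / (a - a' + d) * (a' - d) + (a - a') / (a - a' + d) * a = a - d by field_simp; ring] at e1
  rw [show (a - a') / (a - a' + d) * (a' - d) + d / (a - a' + d) * a = a' by field_simp; ring] at e2
  have e3 : d / (a - a' + d) + (a - a') / (a - a' + d) = 1 := by field_simp; ring
  have e4 : |a - d| ^ p + |a'| ^ p ≤ (d / (a - a' + d) + (a - a') / (a - a' + d)) * (|a' - d| ^ p)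
      + (d / (a - a' + d) + (a - a') / (a - a' + d)) * |a| ^ p := by linarith
  rw [e3] at e4
  linarith

/-- The discrete form of `∫₀ⁿ x^{α-1} dx = n^α / α`. The induction step is Bernoulli's inequality
for `(1 - 1/(n+1))^α`. -/
lemma sum_rpow_sub_one_le {α : ℝ} (hα : 0 < α) (hα1 : α ≤ 1) (n : ℕ) :
    ∑ j ∈ Finset.range n, (1 + (j : ℝ)) ^ (α - 1) ≤ (n : ℝ) ^ α / α := by
  induction n with
  | zero => simp [Real.zero_rpow hα.ne']
  | succ n ih =>
    rw [Finset.sum_range_succ]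
    have hn : (0 : ℝ) < n + 1 := by positivity
    have h1 : (n : ℝ) ^ α ≤ ((n : ℝ) + 1) ^ α * (1 - α / (n + 1)) := by
      have := rpow_one_add_le_one_add_mul_self (s := -(1 / ((n : ℝ) + 1)))
        (by rw [neg_le_neg_iff, div_le_one hn]; linarith) hα.le hα1
      have h2 : (n : ℝ) = (n + 1) * (1 + -(1 / ((n : ℝ) + 1))) := by field_simp; ring
      calc (n : ℝ) ^ α = ((n + 1) * (1 + -(1 / ((n : ℝ) + 1)))) ^ α := by rw [← h2]
        _ = ((n : ℝ) + 1) ^ α * (1 + -(1 / ((n : ℝ) + 1))) ^ α := by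
            rw [Real.mul_rpow hn.le]
            have : 1 / ((n : ℝ) + 1) ≤ 1 := by rw [div_le_one hn]; linarith
            linarith
        _ ≤ ((n : ℝ) + 1) ^ α * (1 + α * -(1 / ((n : ℝ) + 1))) := by gcongr
        _ = _ := by ring
    have h2 : (1 + (n : ℝ)) ^ (α - 1) = ((n : ℝ) + 1) ^ α / (n + 1) := by
      rw [add_comm, Real.rpow_sub_one hn.ne']
    have h3 : ((n : ℝ) + 1) ^ α * (1 - α / (n + 1)) / α
        = ((n : ℝ) + 1) ^ α / α - ((n : ℝ) + 1) ^ α / (n + 1) := by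
      field_simp
    have h4 := div_le_div_of_nonneg_right h1 hα.le
    push_cast
    rw [h2]
    linarith

/-- If `2d ≤ |a|`, the weight is comparable to `(|a|+d)^{α-1}` on the whole interval. Otherwise the
interval lies in `[-m, m]` with `m = |a| + d < 3d`, and the full sum, of order `m^α`, is at most a
multiple of `d m^{α-1}`. -/
lemma sum_Icc_weight_le {α : ℝ} (hα : 1 / 2 < α) (hα1 : α < 1) (a : ℤ) (d : ℕ) (hd : 1 ≤ d) :
    ∑ x ∈ Finset.Icc a (a + d), (1 + |(x : ℝ)|) ^ (α - 1)
      ≤ 48 * (d * (|(a : ℝ)| + d) ^ (α - 1)) := by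
  have hd' : (1 : ℝ) ≤ d := by exact_mod_cast hd
  have hm : (0 : ℝ) < |(a : ℝ)| + d := by positivity
  by_cases h : 2 * (d : ℝ) ≤ |(a : ℝ)|
  · have hterm : ∀ x ∈ Finset.Icc a (a + d), (1 + |(x : ℝ)|) ^ (α - 1)
        ≤ 3 * (|(a : ℝ)| + d) ^ (α - 1) := by
      intro x hx
      rw [Finset.mem_Icc] at hx
      have h1 : (a : ℝ) ≤ x := by exact_mod_cast hx.1
      have h2 : (x : ℝ) ≤ a + d := by exact_mod_cast hx.2
      have h3 : |(a : ℝ)| ≤ |(x : ℝ)| + d := by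
        have := abs_sub_abs_le_abs_sub (a : ℝ) x
        have h4 : |(a : ℝ) - x| ≤ d := by rw [abs_le]; constructor <;> linarith
        linarith
      calc (1 + |(x : ℝ)|) ^ (α - 1) ≤ ((|(a : ℝ)| + d) / 3) ^ (α - 1) :=
            Real.rpow_le_rpow_of_nonpos (by positivity) (by linarith) (by linarith)
        _ = (|(a : ℝ)| + d) ^ (α - 1) * 3 ^ (1 - α) := by
            rw [Real.div_rpow hm.le (by norm_num), div_eq_mul_inv, ← Real.rpow_neg (by norm_num)]
            congr 2; ring
        _ ≤ (|(a : ℝ)| + d) ^ (α - 1) * 3 ^ (1 : ℝ) := by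
            gcongr
            · norm_num
            · linarith
        _ = _ := by rw [Real.rpow_one]; ring
    have hcard : (Finset.Icc a (a + d)).card = d + 1 := by simp; omega
    calc _ ≤ (Finset.Icc a (a + d)).card • (3 * (|(a : ℝ)| + d) ^ (α - 1)) :=
          Finset.sum_le_card_nsmul _ _ _ hterm
      _ = ((d : ℝ) + 1) * (3 * (|(a : ℝ)| + d) ^ (α - 1)) := by rw [hcard]; simp
      _ ≤ (16 * d) * (3 * (|(a : ℝ)| + d) ^ (α - 1)) := by gcongr; linarith
      _ = _ := by ring
  · push Not at h
    obtain ⟨m, hm_eq⟩ : ∃ m : ℕ, (m : ℝ) = |(a : ℝ)| + d :=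
      ⟨a.natAbs + d, by push_cast; rw [Nat.cast_natAbs]; push_cast; rfl⟩
    have hsub : Finset.Icc a (a + d) ⊆ (Finset.range (m + 1)).image (fun j : ℕ => (j : ℤ)) ∪
        (Finset.range (m + 1)).image (fun j : ℕ => -(j : ℤ)) := by
      intro x hx
      rw [Finset.mem_Icc] at hx
      have hxm : (x.natAbs : ℤ) ≤ m := by
        have : ((m : ℤ) : ℝ) = ((|a| + d : ℤ) : ℝ) := by push_cast; exact hm_eq
        have h5 : (m : ℤ) = |a| + d := by exact_mod_cast this
        rw [h5]; push_cast
        rw [abs_le]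
        constructor
        · linarith [neg_abs_le a, hx.1, (by positivity : (0:ℤ) ≤ (d:ℤ))]
        · linarith [le_abs_self a, hx.2]
      simp only [Finset.mem_union, Finset.mem_image, Finset.mem_range]
      rcases le_total 0 x with h0 | h0
      · exact Or.inl ⟨x.natAbs, by omega, by omega⟩
      · exact Or.inr ⟨x.natAbs, by omega, by omega⟩
    have hnn : ∀ x : ℤ, 0 ≤ (1 + |(x : ℝ)|) ^ (α - 1) := fun x => by positivity
    have hbound : ∑ j ∈ Finset.range (m + 1), (1 + (j : ℝ)) ^ (α - 1) ≤ 8 * (d * (m : ℝ) ^ (α - 1)) := by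
      refine (sum_rpow_sub_one_le (by linarith) hα1.le (m + 1)).trans ?_
      have hm1 : (1 : ℝ) ≤ m := by rw [hm_eq]; linarith [abs_nonneg (a : ℝ)]
      rw [div_le_iff₀ (by linarith)]
      have h6 : ((m + 1 : ℕ) : ℝ) ^ α ≤ (m + 1 : ℕ) * (m : ℝ) ^ (α - 1) := by
        have : ((m + 1 : ℕ) : ℝ) ^ α = (m + 1 : ℕ) * ((m + 1 : ℕ) : ℝ) ^ (α - 1) := by
          rw [mul_comm, ← Real.rpow_add_one (by positivity)]; congr 1; ring
        rw [this]
        exact mul_le_mul_of_nonneg_left (Real.rpow_le_rpow_of_nonpos (by linarith)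
          (by push_cast; linarith) (by linarith)) (by positivity)
      have h7 : 0 ≤ (m : ℝ) ^ (α - 1) := by positivity
      refine h6.trans ?_
      have h8 : ((m + 1 : ℕ) : ℝ) ≤ 4 * d := by push_cast; rw [hm_eq]; linarith
      have h9 : ((m + 1 : ℕ) : ℝ) * (m : ℝ) ^ (α - 1) ≤ 4 * d * (m : ℝ) ^ (α - 1) := by gcongr
      have h10 : 0 ≤ (d : ℝ) * (m : ℝ) ^ (α - 1) := by positivity
      nlinarith
    calc _ ≤ ∑ x ∈ (Finset.range (m + 1)).image (fun j : ℕ => (j : ℤ)) ∪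
        (Finset.range (m + 1)).image (fun j : ℕ => -(j : ℤ)), (1 + |(x : ℝ)|) ^ (α - 1) :=
          Finset.sum_le_sum_of_subset_of_nonneg hsub (fun x _ _ => hnn x)
      _ ≤ ∑ x ∈ (Finset.range (m + 1)).image (fun j : ℕ => (j : ℤ)), (1 + |(x : ℝ)|) ^ (α - 1) +
          ∑ x ∈ (Finset.range (m + 1)).image (fun j : ℕ => -(j : ℤ)), (1 + |(x : ℝ)|) ^ (α - 1) := by
          rw [← Finset.sum_union_inter]
          exact le_add_of_nonneg_right (Finset.sum_nonneg fun x _ => hnn x)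
      _ = ∑ j ∈ Finset.range (m + 1), (1 + (j : ℝ)) ^ (α - 1)
          + ∑ j ∈ Finset.range (m + 1), (1 + (j : ℝ)) ^ (α - 1) := by
          rw [Finset.sum_image (by intro x _ y _ h; simpa using h),
            Finset.sum_image (by intro x _ y _ h; simpa using h)]
          simp
      _ ≤ _ := by
          rw [← hm_eq]
          have : 0 ≤ (d : ℝ) * (m : ℝ) ^ (α - 1) := by positivity
          linarith

/-- The weight in the one-dimensional counting lemma. -/
def countWeight (α : ℝ) (k x : ℤ) : ℝ :=
  (1 + |(x : ℝ)|) ^ (α - 1) + if 2 * |k| ≤ |x| then 1 else 0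

/-- Since `k - a ≤ a`, replacing `k - a` by `a` only lowers the increment of the reflected term.
What remains is the symmetric second difference of `|x|^{2α}` at `a` with step `b - a`. -/
lemma symbol_increment {α : ℝ} (hα : 1 / 2 < α) {k a b : ℤ} (hk : k ≤ 2 * a) (hab : a < b)
    (hα1 : α < 1) :
    2 * α * (2 * α - 1) * (((b : ℝ) - a) ^ 2 * (|(a : ℝ)| + (b - a)) ^ (2 * α - 2)) ≤
      (symbol α (k - b) + symbol α b) - (symbol α (k - a) + symbol α a) := by
  have hd : (0 : ℝ) < (b : ℝ) - a := by
    have : (a : ℝ) < b := by exact_mod_cast hab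
    linarith
  have h1 := second_difference_abs_rpow (p := 2 * α) (by linarith) (by linarith) a _ hd
  have h2 := abs_rpow_sub_antitone (p := 2 * α) (by linarith) ((b : ℝ) - a) hd.le
    (a := a) (a' := k - a) (by
      have : (k : ℝ) ≤ 2 * a := by exact_mod_cast hk
      linarith)
  simp only [symbol]
  push_cast
  rw [show (a : ℝ) + (b - a) = b by ring] at h1
  rw [show (k : ℝ) - a - (b - a) = k - b by ring] at h2
  linarith

/-- Beyond `2|k|` both terms increase with `x`, and superadditivity of `x^{2α}` bounds the increment
of the second one. -/
lemma symbol_increment' {α : ℝ} (hα : 1 / 2 < α) {k a b : ℤ} (hk : 2 * |k| ≤ a) (hab : a ≤ b) :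
    ((b : ℝ) - a) ^ (2 * α) ≤
      (symbol α (k - b) + symbol α b) - (symbol α (k - a) + symbol α a) := by
  have hk' : 2 * |(k : ℝ)| ≤ a := by exact_mod_cast hk
  have hab' : (a : ℝ) ≤ b := by exact_mod_cast hab
  have hka := le_abs_self (k : ℝ)
  have h0 := abs_nonneg (k : ℝ)
  have h1 : (a : ℝ) ^ (2 * α) + ((b : ℝ) - a) ^ (2 * α) ≤ (b : ℝ) ^ (2 * α) := by
    have := Real.add_rpow_le_rpow_add (a := (a : ℝ)) (b := (b : ℝ) - a) (by linarith) (by linarith)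
      (p := 2 * α) (by linarith)
    rwa [show (a : ℝ) + (b - a) = b by ring] at this
  have h2 : ((a : ℝ) - k) ^ (2 * α) ≤ ((b : ℝ) - k) ^ (2 * α) :=
    Real.rpow_le_rpow (by linarith) (by linarith) (by linarith)
  simp only [symbol]
  push_cast
  rw [abs_sub_comm (k : ℝ) b, abs_sub_comm (k : ℝ) a, abs_of_nonneg (by linarith : 0 ≤ (b : ℝ) - k),
    abs_of_nonneg (by linarith : 0 ≤ (a : ℝ) - k), abs_of_nonneg (by linarith : 0 ≤ (b : ℝ)),
    abs_of_nonneg (by linarith : 0 ≤ (a : ℝ))]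
  linarith

/-- Let `a` and `b = a + d` be the extreme points of `S`. The increment between them is at most
`2M`, so `d² (|a|+d)^{2α-2} ≲ M`. The square root of the left side is the size of the weighted count
of `[a, b]`. -/
lemma levelset_half {α : ℝ} (hα : 1 / 2 < α) (hα1 : α < 1) :
    ∃ C : ℝ, 0 < C ∧ ∀ (k : ℤ) (y M : ℝ), 1 ≤ M → ∀ S : Finset ℤ,
      (∀ x ∈ S, k ≤ 2 * x ∧ |y - (symbol α (k - x) + symbol α x)| ≤ M) →
      ∑ x ∈ S, (1 + |(x : ℝ)|) ^ (α - 1) ≤ C * M ^ (1 / 2 : ℝ) := by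
  have hc : 0 < 2 * α * (2 * α - 1) := mul_pos (by linarith) (by linarith)
  set c := 2 * α * (2 * α - 1) with hc_def
  refine ⟨48 * (2 / c) ^ (1 / 2 : ℝ) + 1, by positivity, fun k y M hM S hS => ?_⟩
  have hM2 : 1 ≤ M ^ (1 / 2 : ℝ) := Real.one_le_rpow hM (by norm_num)
  have hnn : ∀ x : ℤ, 0 ≤ (1 + |(x : ℝ)|) ^ (α - 1) := fun x => by positivity
  rcases S.eq_empty_or_nonempty with rfl | hne
  · simp; positivity
  set a := S.min' hne
  set b := S.max' hne
  have hab : a ≤ b := S.min'_le_max' hne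
  have hSsub : S ⊆ Finset.Icc a b := fun x hx =>
    Finset.mem_Icc.2 ⟨S.min'_le x hx, S.le_max' x hx⟩
  have hfirst : (1 + |(a : ℝ)|) ^ (α - 1) ≤ 1 :=
    Real.rpow_le_one_of_one_le_of_nonpos (by linarith [abs_nonneg (a : ℝ)]) (by linarith)
  have hA : 0 ≤ 48 * (2 / c) ^ (1 / 2 : ℝ) * M ^ (1 / 2 : ℝ) := by positivity
  rcases hab.eq_or_lt with h | h
  · have hS1 : S ⊆ {a} := by
      intro x hx
      have := Finset.mem_Icc.1 (hSsub hx)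
      rw [Finset.mem_singleton]; omega
    calc _ ≤ ∑ x ∈ ({a} : Finset ℤ), (1 + |(x : ℝ)|) ^ (α - 1) :=
          Finset.sum_le_sum_of_subset_of_nonneg hS1 fun x _ _ => hnn x
      _ ≤ 1 := by simpa using hfirst
      _ ≤ _ := by linarith
  · obtain ⟨d, hd⟩ : ∃ d : ℕ, b = a + d := ⟨(b - a).toNat, by omega⟩
    have hd1 : 1 ≤ d := by omega
    have hbd : (b : ℝ) - a = d := by rw [hd]; push_cast; ring
    have hsum := sum_Icc_weight_le hα hα1 a d hd1
    have hinc := symbol_increment hα (hS a (S.min'_mem hne)).1 h hα1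
    have ha2 := abs_le.1 (hS a (S.min'_mem hne)).2
    have hb2 := abs_le.1 (hS b (S.max'_mem hne)).2
    rw [hbd] at hinc
    have hq : (d : ℝ) ^ 2 * (|(a : ℝ)| + d) ^ (2 * α - 2) ≤ 2 / c * M := by
      rw [div_mul_eq_mul_div, le_div_iff₀ hc]
      linarith [ha2.1, ha2.2, hb2.1, hb2.2]
    have hd' : (0 : ℝ) < d := by exact_mod_cast hd1
    have hm : (0 : ℝ) < |(a : ℝ)| + d := by positivity
    have hsq : (d : ℝ) * (|(a : ℝ)| + d) ^ (α - 1) ≤ (2 / c) ^ (1 / 2 : ℝ) * M ^ (1 / 2 : ℝ) := by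
      rw [← Real.mul_rpow (by positivity) (by linarith)]
      have : (d : ℝ) * (|(a : ℝ)| + d) ^ (α - 1)
          = ((d : ℝ) ^ 2 * (|(a : ℝ)| + d) ^ (2 * α - 2)) ^ (1 / 2 : ℝ) := by
        rw [Real.mul_rpow (by positivity) (by positivity), ← Real.rpow_mul hm.le,
          ← Real.rpow_natCast (d : ℝ) 2, ← Real.rpow_mul hd'.le]
        rw [show (2 * α - 2) * (1 / 2) = α - 1 by ring,
          show (((2 : ℕ) : ℝ)) * (1 / 2) = 1 by norm_num, Real.rpow_one]
      rw [this]
      exact Real.rpow_le_rpow (by positivity) hq (by norm_num)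
    calc _ ≤ ∑ x ∈ Finset.Icc a b, (1 + |(x : ℝ)|) ^ (α - 1) :=
          Finset.sum_le_sum_of_subset_of_nonneg hSsub fun x _ _ => hnn x
      _ ≤ 48 * ((d : ℝ) * (|(a : ℝ)| + d) ^ (α - 1)) := by rw [hd]; exact hsum
      _ ≤ 48 * ((2 / c) ^ (1 / 2 : ℝ) * M ^ (1 / 2 : ℝ)) := by gcongr
      _ ≤ _ := by linarith

/-- Far from `k` the phase grows like a full power, so the diameter of a level set is at most
`(2M)^{1/(2α)}` and points can be counted without weight. -/
lemma levelset_card_half {α : ℝ} (hα : 1 / 2 < α) (k : ℤ) (y M : ℝ) (hM : 1 ≤ M)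
    (S : Finset ℤ)
    (hS : ∀ x ∈ S, 2 * |k| ≤ x ∧ |y - (symbol α (k - x) + symbol α x)| ≤ M) :
    (S.card : ℝ) ≤ 3 * M ^ (1 / (2 * α)) := by
  have hM2 : 1 ≤ M ^ (1 / (2 * α)) := Real.one_le_rpow hM (by positivity)
  rcases S.eq_empty_or_nonempty with rfl | hne
  · simp; positivity
  set a := S.min' hne
  set b := S.max' hne
  have hab : a ≤ b := S.min'_le_max' hne
  have hSsub : S ⊆ Finset.Icc a b := fun x hx =>
    Finset.mem_Icc.2 ⟨S.min'_le x hx, S.le_max' x hx⟩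
  have hcard : (S.card : ℝ) ≤ (b : ℝ) - a + 1 := by
    have h1 := Finset.card_le_card hSsub
    rw [Int.card_Icc] at h1
    have h2 : (S.card : ℤ) ≤ b - a + 1 := by omega
    exact_mod_cast h2
  have hinc := symbol_increment' hα (hS a (S.min'_mem hne)).1 hab
  have ha2 := abs_le.1 (hS a (S.min'_mem hne)).2
  have hb2 := abs_le.1 (hS b (S.max'_mem hne)).2
  have hab' : (a : ℝ) ≤ b := by exact_mod_cast hab
  have h3 : (b : ℝ) - a ≤ 2 * M ^ (1 / (2 * α)) := by
    have h4 : ((b : ℝ) - a) ^ (2 * α) ≤ 2 * M := by linarith [ha2.1, ha2.2, hb2.1, hb2.2]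
    have h5 := Real.rpow_le_rpow (by positivity) h4 (by positivity : 0 ≤ 1 / (2 * α))
    rw [← Real.rpow_mul (by linarith), mul_one_div_cancel (by linarith), Real.rpow_one,
      Real.mul_rpow (by norm_num) (by linarith)] at h5
    have h6 : (2 : ℝ) ^ (1 / (2 * α)) ≤ 2 ^ (1 : ℝ) :=
      Real.rpow_le_rpow_of_exponent_le (by norm_num) (by rw [div_le_one (by linarith)]; linarith)
    rw [Real.rpow_one] at h6
    nlinarith
  linarith

lemma symbol_neg (α : ℝ) (k : ℤ) : symbol α (-k) = symbol α k := by simp [symbol]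

/-- The reflection `(k, x) ↦ (-k, -x)` preserves the phase and reduces both sums to half-lines. As
`α < 1`, `M^{1/2} ≤ M^{1/(2α)}`, so the unweighted count of the far points fixes the exponent. -/
lemma levelset_sum {α : ℝ} (hα : 1 / 2 < α) (hα1 : α < 1) :
    ∃ C : ℝ, 0 < C ∧ ∀ (k : ℤ) (y M : ℝ), 1 ≤ M → ∀ S : Finset ℤ,
      (∀ x ∈ S, |y - (symbol α (k - x) + symbol α x)| ≤ M) →
      ∑ x ∈ S, countWeight α k x ≤ C * M ^ (1 / (2 * α)) := by
  obtain ⟨C, hC, h⟩ := levelset_half hα hα1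
  refine ⟨2 * C + 6, by positivity, fun k y M hM S hS => ?_⟩
  have hrefl : ∀ x, symbol α (-k - -x) + symbol α (-x) = symbol α (k - x) + symbol α x := by
    intro x
    rw [symbol_neg, show -k - -x = -(k - x) by ring, symbol_neg]
  have hMle : M ^ (1 / 2 : ℝ) ≤ M ^ (1 / (2 * α)) := by
    refine Real.rpow_le_rpow_of_exponent_le hM ?_
    exact one_div_le_one_div_of_le (by linarith) (by linarith)
  have h1 : ∑ x ∈ S, (1 + |(x : ℝ)|) ^ (α - 1) ≤ 2 * (C * M ^ (1 / 2 : ℝ)) := by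
    rw [← Finset.sum_filter_add_sum_filter_not S (fun x => k ≤ 2 * x)]
    have e1 := h k y M hM (S.filter fun x => k ≤ 2 * x) (fun x hx => by
      rw [Finset.mem_filter] at hx; exact ⟨hx.2, hS x hx.1⟩)
    have e2 := h (-k) y M hM ((S.filter fun x => ¬ k ≤ 2 * x).image Neg.neg) (fun x hx => by
      rw [Finset.mem_image] at hx
      obtain ⟨z, hz, rfl⟩ := hx
      rw [Finset.mem_filter] at hz
      exact ⟨by omega, by rw [hrefl]; exact hS z hz.1⟩)
    rw [Finset.sum_image (by intro x _ y _ h; simpa using h)] at e2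
    simp only [Int.cast_neg, abs_neg] at e2
    linarith
  have h2 : ∑ x ∈ S, (if 2 * |k| ≤ |x| then (1 : ℝ) else 0) ≤ 6 * M ^ (1 / (2 * α)) := by
    rw [← Finset.sum_filter, Finset.sum_const, nsmul_eq_mul, mul_one,
      ← Finset.card_filter_add_card_filter_not (s := S.filter fun x => 2 * |k| ≤ |x|)
        (fun x => 0 ≤ x)]
    have e1 := levelset_card_half hα k y M hM
      ((S.filter fun x => 2 * |k| ≤ |x|).filter fun x => 0 ≤ x) (fun x hx => by
      simp only [Finset.mem_filter] at hx
      exact ⟨by rw [abs_of_nonneg hx.2] at hx; exact hx.1.2, hS x hx.1.1⟩)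
    have e2 := levelset_card_half hα (-k) y M hM
      (((S.filter fun x => 2 * |k| ≤ |x|).filter fun x => ¬ 0 ≤ x).image Neg.neg) (fun x hx => by
      rw [Finset.mem_image] at hx
      obtain ⟨z, hz, rfl⟩ := hx
      simp only [Finset.mem_filter, not_le] at hz
      exact ⟨by rw [abs_of_neg hz.2] at hz; rw [abs_neg]; exact hz.1.2,
        by rw [hrefl]; exact hS z hz.1.1⟩)
    rw [Finset.card_image_of_injective _ neg_injective] at e2
    push_cast
    linarith
  simp only [countWeight, Finset.sum_add_distrib]
  have h3 : C * M ^ (1 / 2 : ℝ) ≤ C * M ^ (1 / (2 * α)) := by gcongr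
  nlinarith

/-- Passing from polynomial bounds on level sets to sums with polynomial decay. -/
lemma tsum_decay_le_of_levelset {ι : Type*} {η β : ℝ} (hη : 0 ≤ η) (hηβ : η < β) :
    ∃ K : ℝ, 0 < K ∧ ∀ (C : ℝ) (w z : ι → ℝ), 0 ≤ C → (∀ x, 0 ≤ w x) →
      (∀ M : ℝ, 1 ≤ M → ∀ S : Finset ι, (∀ x ∈ S, |z x| ≤ M) → ∑ x ∈ S, w x ≤ C * M ^ η) →
      ∑' x, ENNReal.ofReal (w x * (1 + |z x|) ^ (-β)) ≤ ENNReal.ofReal (C * K) := by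
  -- Ratio of the geometric series obtained by sorting `x` into dyadic blocks `2^j ≤ 1 + |z x| <
  -- 2^{j+1}`: the count contributes `2^{jη}` and the decay `2^{-jβ}`.
  set r : ℝ := 2 ^ (η - β) with hr
  have hr0 : 0 < r := by positivity
  have hr1 : r < 1 := Real.rpow_lt_one_of_one_lt_of_neg (by norm_num) (by linarith)
  refine ⟨2 ^ η * (1 - r)⁻¹, mul_pos (by positivity) (inv_pos.2 (by linarith)),
    fun C w z hC hw h => ?_⟩
  rw [ENNReal.tsum_eq_iSup_sum]
  refine iSup_le fun S => ?_
  rw [← ENNReal.ofReal_sum_of_nonneg (fun x _ => mul_nonneg (hw x) (by positivity))]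
  refine ENNReal.ofReal_le_ofReal ?_
  obtain ⟨n, hn⟩ : ∃ n : ℕ, ∀ x ∈ S, Nat.log 2 ⌊1 + |z x|⌋₊ < n :=
    ⟨(S.sup fun x => Nat.log 2 ⌊1 + |z x|⌋₊) + 1, fun x hx =>
      Nat.lt_succ_of_le (Finset.le_sup (f := fun x => Nat.log 2 ⌊1 + |z x|⌋₊) hx)⟩
  have hmaps : ∀ x ∈ S, Nat.log 2 ⌊1 + |z x|⌋₊ ∈ Finset.range n :=
    fun x hx => Finset.mem_range.2 (hn x hx)
  rw [← Finset.sum_fiberwise_of_maps_to hmaps]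
  have hlog : ∀ x, (2 : ℝ) ^ (Nat.log 2 ⌊1 + |z x|⌋₊) ≤ 1 + |z x| ∧
      |z x| ≤ 2 ^ (Nat.log 2 ⌊1 + |z x|⌋₊ + 1) := by
    intro x
    have h1 : 1 ≤ ⌊1 + |z x|⌋₊ := Nat.le_floor (by push_cast; linarith [abs_nonneg (z x)])
    constructor
    · have h2 : ((2 ^ Nat.log 2 ⌊1 + |z x|⌋₊ : ℕ) : ℝ) ≤ ⌊1 + |z x|⌋₊ := by
        exact_mod_cast Nat.pow_log_le_self 2 (by omega)
      push_cast at h2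
      exact h2.trans (Nat.floor_le (by positivity))
    · have h2 : ((⌊1 + |z x|⌋₊ + 1 : ℕ) : ℝ) ≤ (2 ^ (Nat.log 2 ⌊1 + |z x|⌋₊ + 1) : ℕ) := by
        exact_mod_cast Nat.lt_pow_succ_log_self (by norm_num) _
      have h3 := Nat.lt_floor_add_one (1 + |z x|)
      push_cast at h2
      linarith
  have hblock : ∀ j : ℕ, ∑ x ∈ S with Nat.log 2 ⌊1 + |z x|⌋₊ = j, w x * (1 + |z x|) ^ (-β)
      ≤ C * 2 ^ η * r ^ j := by
    intro j
    have h1 : ∑ x ∈ S with Nat.log 2 ⌊1 + |z x|⌋₊ = j, w x ≤ C * ((2 : ℝ) ^ (j + 1)) ^ η := by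
      refine h _ (one_le_pow₀ (by norm_num)) _ fun x hx => ?_
      have := (hlog x).2
      rwa [(Finset.mem_filter.1 hx).2] at this
    calc _ ≤ ∑ x ∈ S with Nat.log 2 ⌊1 + |z x|⌋₊ = j, w x * ((2 : ℝ) ^ j) ^ (-β) := by
          refine Finset.sum_le_sum fun x hx => mul_le_mul_of_nonneg_left ?_ (hw x)
          have h2 := (hlog x).1
          rw [(Finset.mem_filter.1 hx).2] at h2
          exact Real.rpow_le_rpow_of_nonpos (by positivity) h2 (by linarith)
      _ ≤ C * ((2 : ℝ) ^ (j + 1)) ^ η * ((2 : ℝ) ^ j) ^ (-β) := by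
          rw [← Finset.sum_mul]; gcongr
      _ = C * 2 ^ η * r ^ j := by
          rw [hr, pow_succ, Real.mul_rpow (by positivity) (by norm_num), ← Real.rpow_natCast 2 j,
            ← Real.rpow_mul (by norm_num), ← Real.rpow_mul (by norm_num), ← Real.rpow_natCast,
            ← Real.rpow_mul (by norm_num), sub_mul, sub_eq_add_neg, Real.rpow_add (by norm_num),
            mul_comm (j : ℝ) η, mul_comm (j : ℝ) (-β), neg_mul]
          ring
  calc _ ≤ ∑ j ∈ Finset.range n, C * 2 ^ η * r ^ j := Finset.sum_le_sum fun j _ => hblock j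
    _ = C * 2 ^ η * ∑ j ∈ Finset.range n, r ^ j := by rw [Finset.mul_sum]
    _ ≤ C * 2 ^ η * (1 - r)⁻¹ := by
        gcongr
        rw [← tsum_geometric_of_lt_one hr0.le hr1]
        exact (summable_geometric_of_lt_one hr0.le hr1).sum_le_tsum _ (fun i _ => by positivity)
    _ = _ := by ring

lemma countWeight_nonneg (α : ℝ) (k x : ℤ) : 0 ≤ countWeight α k x := by
  unfold countWeight; split_ifs <;> positivity

/-- The counting lemma behind the bilinear estimates. -/
lemma counting {α β : ℝ} (hα : 1 / 2 < α) (hα1 : α < 1) (hβ : 1 / (2 * α) < β) :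
    ∃ C : ℝ, 0 < C ∧ ∀ (k : ℤ) (y : ℝ),
      ∑' x : ℤ, ENNReal.ofReal (countWeight α k x *
        (1 + |y - (symbol α (k - x) + symbol α x)|) ^ (-β)) ≤ ENNReal.ofReal C := by
  obtain ⟨C, hC, h⟩ := levelset_sum hα hα1
  obtain ⟨K, hK, h'⟩ := tsum_decay_le_of_levelset (ι := ℤ) (η := 1 / (2 * α)) (by positivity) hβ
  exact ⟨C * K, by positivity, fun k y => h' C _ _ hC.le (countWeight_nonneg α k)
    fun M hM S hS => h k y M hM S hS⟩

end

section

/-! ### Exponents and weights -/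

/-- A small parameter measuring the room `α > 1/2`. -/
def eps (α : ℝ) : ℝ := (1 - 1 / (2 * α)) / 8

/-- The modulation exponent `b > 1/2`. -/
def bexp (α : ℝ) : ℝ := 1 / 2 + eps α

/-- The exponent of the time-localization kernel. -/
def qexp (α : ℝ) : ℝ := 1 - eps α

/-- The critical regularity `(1 - α) / 2` of the method. -/
def sexp (α : ℝ) : ℝ := (1 - α) / 2

lemma eps_pos {α : ℝ} (hα : 1 / 2 < α) : 0 < eps α := by
  unfold eps
  have : 1 / (2 * α) < 1 := by rw [div_lt_one (by linarith)]; linarith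
  linarith

lemma eps_lt {α : ℝ} (hα : 1 / 2 < α) (hα1 : α < 1) : eps α < 1 / 16 := by
  unfold eps
  have : 1 / 2 < 1 / (2 * α) := one_div_lt_one_div_of_lt (by linarith) (by linarith)
  linarith

lemma half_lt_bexp {α : ℝ} (hα : 1 / 2 < α) : 1 / 2 < bexp α := by
  have := eps_pos hα
  unfold bexp; linarith

/-- The weight `(1 + |τ|)^r`, with values in `ℝ≥0∞`. -/
def jp (r τ : ℝ) : ℝ≥0∞ := ENNReal.ofReal ((1 + |τ|) ^ r)

@[fun_prop]
lemma measurable_jp (r : ℝ) : Measurable (jp r) := by unfold jp; fun_prop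

@[fun_prop]
lemma measurable_symbol (α : ℝ) : Measurable (symbol α) := Measurable.of_discrete

lemma jp_mul (r r' τ : ℝ) : jp r τ * jp r' τ = jp (r + r') τ := by
  unfold jp
  rw [← ENNReal.ofReal_mul (by positivity), Real.rpow_add (by positivity)]

lemma jp_sq (r τ : ℝ) : jp r τ ^ 2 = jp (2 * r) τ := by rw [sq, jp_mul]; ring_nf

lemma jp_zero (τ : ℝ) : jp 0 τ = 1 := by simp [jp]

lemma jp_neg_mul (r τ : ℝ) : jp (-r) τ * jp r τ = 1 := by rw [jp_mul]; simp [jp_zero]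

lemma jp_ne_top (r τ : ℝ) : jp r τ ≠ ⊤ := ENNReal.ofReal_ne_top

lemma jp_ne_zero (r τ : ℝ) : jp r τ ≠ 0 := by
  have : 0 < (1 + |τ|) ^ r := by positivity
  simpa [jp] using this

lemma jp_mono {r r' : ℝ} (h : r ≤ r') (τ : ℝ) : jp r τ ≤ jp r' τ :=
  ENNReal.ofReal_le_ofReal (Real.rpow_le_rpow_of_exponent_le (by linarith [abs_nonneg τ]) h)

lemma jp_rpow (r τ t : ℝ) (ht : 0 ≤ t) : jp r τ ^ t = jp (r * t) τ := by
  unfold jp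
  rw [ENNReal.ofReal_rpow_of_nonneg (by positivity) ht, ← Real.rpow_mul (by positivity)]

lemma lintegral_jp_lt_top {r : ℝ} (hr : 1 < r) : ∫⁻ τ, jp (-r) τ < ⊤ := by
  have := finite_integral_one_add_norm (E := ℝ) (μ := volume) (r := r) (by simpa using hr)
  simpa [jp] using this

/-- Since `1 + |y| ≤ (1 + |τ|) + (1 + |τ+y|)`, the larger of the two brackets pays for `(1+|y|)^β`.
The smaller one is left with the exponent `p + q - β > 1`, which is integrable. -/
lemma convolution_weight {p q β : ℝ} (hβ : 0 ≤ β) (hp : β ≤ p) (hq : β ≤ q) (h : 1 < p + q - β) :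
    ∃ C : ℝ≥0∞, C ≠ ⊤ ∧ ∀ y, ∫⁻ τ, jp (-p) τ * jp (-q) (τ + y) ≤ C * jp (-β) y := by
  set I := ∫⁻ τ, jp (-(p + q - β)) τ with hI
  refine ⟨ENNReal.ofReal (2 ^ β) * (I + I), ENNReal.mul_ne_top ENNReal.ofReal_ne_top
    (ENNReal.add_ne_top.2 ⟨(lintegral_jp_lt_top h).ne, (lintegral_jp_lt_top h).ne⟩), fun y => ?_⟩
  have hpt : ∀ τ, jp (-p) τ * jp (-q) (τ + y) ≤
      ENNReal.ofReal (2 ^ β) * jp (-β) y * (jp (-(p + q - β)) τ + jp (-(p + q - β)) (τ + y)) := by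
    intro τ
    unfold jp
    rw [← ENNReal.ofReal_mul (by positivity), ← ENNReal.ofReal_add (by positivity) (by positivity),
      ← ENNReal.ofReal_mul (by positivity), ← ENNReal.ofReal_mul (by positivity)]
    refine ENNReal.ofReal_le_ofReal ?_
    set a := 1 + |τ|
    set d := 1 + |τ + y|
    have ha : 1 ≤ a := by simp [a]
    have hd : 1 ≤ d := by simp [d]
    have hy : 1 + |y| ≤ a + d := by
      have := abs_sub (τ + y) τ
      rw [add_sub_cancel_left] at this
      simp only [a, d]; linarith
    have hy0 : 0 < 1 + |y| := by positivity
    have key : ∀ u v : ℝ, 1 ≤ u → 1 ≤ v → u ≤ v → ∀ p q : ℝ, β ≤ p → β ≤ q →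
        u ^ (-p) * v ^ (-q) * v ^ β ≤ u ^ (-(p + q - β)) := by
      intro u v hu hv huv p q hp hq
      rw [mul_assoc, ← Real.rpow_add (by linarith)]
      calc u ^ (-p) * v ^ (-q + β) ≤ u ^ (-p) * u ^ (-q + β) :=
            mul_le_mul_of_nonneg_left
              (Real.rpow_le_rpow_of_nonpos (by linarith) huv (by linarith)) (by positivity)
        _ = _ := by rw [← Real.rpow_add (by linarith)]; ring_nf
    have hmul : a ^ (-p) * d ^ (-q) * (1 + |y|) ^ β ≤
        2 ^ β * (a ^ (-(p + q - β)) + d ^ (-(p + q - β))) := by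
      rcases le_total a d with h1 | h1
      · have e1 : (1 + |y|) ^ β ≤ 2 ^ β * d ^ β := by
          rw [← Real.mul_rpow (by norm_num) (by linarith)]
          exact Real.rpow_le_rpow (by positivity) (by linarith) hβ
        calc _ ≤ a ^ (-p) * d ^ (-q) * (2 ^ β * d ^ β) := by gcongr
          _ = 2 ^ β * (a ^ (-p) * d ^ (-q) * d ^ β) := by ring
          _ ≤ 2 ^ β * (a ^ (-(p + q - β)) + d ^ (-(p + q - β))) := by
              gcongr
              have := key a d ha hd h1 p q hp hq
              have h2 : 0 ≤ d ^ (-(p + q - β)) := by positivity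
              linarith
      · have e1 : (1 + |y|) ^ β ≤ 2 ^ β * a ^ β := by
          rw [← Real.mul_rpow (by norm_num) (by linarith)]
          exact Real.rpow_le_rpow (by positivity) (by linarith) hβ
        calc _ ≤ a ^ (-p) * d ^ (-q) * (2 ^ β * a ^ β) := by gcongr
          _ = 2 ^ β * (d ^ (-q) * a ^ (-p) * a ^ β) := by ring
          _ ≤ 2 ^ β * (a ^ (-(p + q - β)) + d ^ (-(p + q - β))) := by
              gcongr
              have := key d a hd ha h1 q p hq hp
              rw [show -(q + p - β) = -(p + q - β) by ring] at this
              have h2 : 0 ≤ a ^ (-(p + q - β)) := by positivity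
              linarith
    have e2 : (1 + |y|) ^ β * (1 + |y|) ^ (-β) = 1 := by
      rw [← Real.rpow_add hy0]; simp
    calc a ^ (-p) * d ^ (-q) = a ^ (-p) * d ^ (-q) * ((1 + |y|) ^ β * (1 + |y|) ^ (-β)) := by
          rw [e2, mul_one]
      _ = a ^ (-p) * d ^ (-q) * (1 + |y|) ^ β * (1 + |y|) ^ (-β) := by ring
      _ ≤ 2 ^ β * (a ^ (-(p + q - β)) + d ^ (-(p + q - β))) * (1 + |y|) ^ (-β) := by gcongr
      _ = _ := by ring
  calc _ ≤ ∫⁻ τ, ENNReal.ofReal (2 ^ β) * jp (-β) y *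
        (jp (-(p + q - β)) τ + jp (-(p + q - β)) (τ + y)) := lintegral_mono hpt
    _ = ENNReal.ofReal (2 ^ β) * jp (-β) y * (I + I) := by
        rw [lintegral_const_mul _ (by fun_prop), lintegral_add_left (by fun_prop),
          lintegral_add_right_eq_self (fun τ => jp (-(p + q - β)) τ) y]
    _ = _ := by ring

/-! ### The trilinear majorant -/

/-- Counting measure times Lebesgue measure on `ℤ × ℝ`. -/
abbrev freqMeasure : Measure (ℤ × ℝ) := (Measure.count : Measure ℤ).prod volume

/-- The counting weight with values in `ℝ≥0∞`. -/
def cw (α : ℝ) (k x : ℤ) : ℝ≥0∞ := ENNReal.ofReal (countWeight α k x)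

@[fun_prop]
lemma measurable_cw (α : ℝ) : Measurable (fun p : ℤ × ℤ => cw α p.1 p.2) := Measurable.of_discrete

/-- The phase `τ₀ + Φ - τ₁ + τ₂ - τ₃`. -/
def phase (α : ℝ) (z0 : ℤ × ℝ) (z2 z3 : ℤ × ℝ) (τ1 : ℝ) : ℝ :=
  z0.2 + symbol α z0.1 - symbol α (z0.1 + z2.1 - z3.1) + symbol α z2.1 - symbol α z3.1
    - τ1 + z2.2 - z3.2

/-- The trilinear majorant with a multiplier `m (k₁, k₂, k₃)`. -/
def majorant (α : ℝ) (m : ℤ × ℤ × ℤ → ℝ≥0∞) (φ1 φ2 φ3 : ℤ × ℝ → ℝ≥0∞) (z0 : ℤ × ℝ) : ℝ≥0∞ :=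
  ∫⁻ z2, ∫⁻ z3, ∫⁻ τ1, m (z0.1 + z2.1 - z3.1, z2.1, z3.1) *
    (φ1 (z0.1 + z2.1 - z3.1, τ1) * φ2 z2 * φ3 z3 * jp (-qexp α) (phase α z0 z2 z3 τ1))
    ∂volume ∂freqMeasure ∂freqMeasure

/-- The multiplier `√(V(k, k₂) V(k, k₃))`, `k = k₁ + k₃`. -/
def mult23 (α : ℝ) (p : ℤ × ℤ × ℤ) : ℝ≥0∞ :=
  cw α (p.1 + p.2.2) p.2.1 ^ (1 / 2 : ℝ) * cw α (p.1 + p.2.2) p.2.2 ^ (1 / 2 : ℝ)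

/-- The squared weighted norm `∫ (w(k) (1+|τ|)^r φ)²`. -/
def sqNorm (r : ℝ) (w : ℤ → ℝ≥0∞) (φ : ℤ × ℝ → ℝ≥0∞) : ℝ≥0∞ :=
  ∫⁻ z, (w z.1 * jp r z.2 * φ z) ^ 2 ∂freqMeasure

lemma counting_ennreal {α : ℝ} (hα : 1 / 2 < α) (hα1 : α < 1) :
    ∃ C : ℝ≥0∞, C ≠ ⊤ ∧ ∀ (k : ℤ) (y : ℝ),
      ∑' x : ℤ, cw α k x * jp (-(1 - 4 * eps α)) (y - (symbol α (k - x) + symbol α x)) ≤ C := by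
  -- By definition `1 - 1/(2α) = 8 eps α`, so losing `4 eps α` in the decay still leaves the
  -- exponent admissible in `counting`.
  have h : 1 / (2 * α) < 1 - 4 * eps α := by
    have h1 := eps_pos hα
    have : 1 - 1 / (2 * α) = 8 * eps α := by unfold eps; ring
    linarith
  obtain ⟨C, hC, hc⟩ := counting hα hα1 h
  refine ⟨ENNReal.ofReal C, ENNReal.ofReal_ne_top, fun k y => ?_⟩
  refine le_trans (le_of_eq ?_) (hc k y)
  refine tsum_congr fun x => ?_
  rw [cw, jp, ENNReal.ofReal_mul (countWeight_nonneg α k x)]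

lemma lintegral_freqMeasure {f : ℤ × ℝ → ℝ≥0∞} (hf : Measurable f) :
    ∫⁻ z, f z ∂freqMeasure = ∑' k, ∫⁻ τ, f (k, τ) := by
  rw [lintegral_prod _ hf.aemeasurable, lintegral_count]

lemma lintegral_freqMeasure_symm {f : ℤ × ℝ → ℝ≥0∞} (hf : Measurable f) :
    ∫⁻ z, f z ∂freqMeasure = ∫⁻ τ, ∑' k, f (k, τ) := by
  rw [lintegral_prod_symm _ hf.aemeasurable]
  simp_rw [lintegral_count]


lemma lintegral_mul_sq_le {X : Type*} [MeasurableSpace X] (μ : Measure X) {P Q : X → ℝ≥0∞}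
    (hP : Measurable P) (hQ : Measurable Q) :
    (∫⁻ x, P x * Q x ∂μ) ^ 2 ≤ (∫⁻ x, P x ^ 2 ∂μ) * ∫⁻ x, Q x ^ 2 ∂μ := by
  have h := ENNReal.lintegral_mul_le_Lp_mul_Lq μ Real.HolderConjugate.two_two hP.aemeasurable
    hQ.aemeasurable
  simp only [Pi.mul_apply, ENNReal.rpow_ofNat] at h
  calc _ ≤ _ := pow_le_pow_left₀ (zero_le) h 2
    _ = _ := by
      rw [mul_pow, ← ENNReal.rpow_natCast, ← ENNReal.rpow_natCast, ← ENNReal.rpow_mul,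
        ← ENNReal.rpow_mul]
      norm_num

/-- This is the half of Cauchy–Schwarz that must be integrated in `z0`, and `z0` is integrated
first. The `τ₀` integral convolves the exponents `2 - 2b = 1 - 2ε` and `q = 1 - ε`, leaving decay `1
- 4ε`. After substituting `k₁` for `k₀`, the sum over `k₂` at fixed `k₁ + k₃` is the counting lemma,
and `τ₂` is integrated against `(1+|τ₂|)^{-2b}`. -/
lemma majorant_base_fst {α : ℝ} (hα : 1 / 2 < α) (hα1 : α < 1) :
    ∃ C : ℝ≥0∞, C ≠ ⊤ ∧ ∀ ψ1 ψ3 : ℤ × ℝ → ℝ≥0∞, Measurable ψ1 → Measurable ψ3 →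
      ∫⁻ z0, jp (2 * bexp α - 2) z0.2 * (∫⁻ z2, ∫⁻ z3, ∫⁻ τ1,
        ψ1 (z0.1 + z2.1 - z3.1, τ1) ^ 2 * ψ3 z3 ^ 2 * jp (-(2 * bexp α)) z2.2 *
          cw α (z0.1 + z2.1) z2.1 * jp (-qexp α) (phase α z0 z2 z3 τ1)
          ∂volume ∂freqMeasure ∂freqMeasure) ∂freqMeasure ≤
      C * (∫⁻ z, ψ1 z ^ 2 ∂freqMeasure) * ∫⁻ z, ψ3 z ^ 2 ∂freqMeasure := by
  have he := eps_pos hα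
  have he' := eps_lt hα hα1
  obtain ⟨C1, hC1, h1⟩ := counting_ennreal hα hα1
  obtain ⟨C2, hC2, h2⟩ := convolution_weight (p := 2 - 2 * bexp α) (q := qexp α)
    (β := 1 - 4 * eps α) (by linarith) (by unfold bexp; linarith) (by unfold qexp; linarith)
    (by unfold bexp qexp; linarith)
  set I := ∫⁻ τ, jp (-(2 * bexp α)) τ with hI
  have hIt : I ≠ ⊤ := (lintegral_jp_lt_top (by unfold bexp; linarith)).ne
  refine ⟨C2 * C1 * I, ENNReal.mul_ne_top (ENNReal.mul_ne_top hC2 hC1) hIt, fun ψ1 ψ3 m1 m3 => ?_⟩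
  have key : ∀ z2 z3 : ℤ × ℝ, ∀ τ1 : ℝ, ∫⁻ z0 : ℤ × ℝ, jp (2 * bexp α - 2) z0.2 *
        (ψ1 (z0.1 + z2.1 - z3.1, τ1) ^ 2 * ψ3 z3 ^ 2 * jp (-(2 * bexp α)) z2.2 *
          cw α (z0.1 + z2.1) z2.1 * jp (-qexp α) (phase α z0 z2 z3 τ1)) ∂freqMeasure ≤
      ∑' k1 : ℤ, C2 * (ψ1 (k1, τ1) ^ 2 * ψ3 z3 ^ 2 * jp (-(2 * bexp α)) z2.2 *
        (cw α (k1 + z3.1) z2.1 * jp (-(1 - 4 * eps α)) ((symbol α k1 + symbol α z3.1 + τ1 - z2.2 + z3.2) -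
          (symbol α (k1 + z3.1 - z2.1) + symbol α z2.1)))) := by
    intro z2 z3 τ1
    rw [lintegral_freqMeasure (by unfold phase; fun_prop),
      ← (Equiv.addRight (z3.1 - z2.1)).tsum_eq]
    refine ENNReal.tsum_le_tsum fun k1 => ?_
    simp only [Equiv.coe_addRight, phase]
    have e2 : k1 + (z3.1 - z2.1) + z2.1 = k1 + z3.1 := by ring
    have e3 : k1 + (z3.1 - z2.1) = k1 + z3.1 - z2.1 := by ring
    simp only [e2, add_sub_cancel_right]
    rw [e3]
    set y := symbol α (k1 + z3.1 - z2.1) - symbol α k1 + symbol α z2.1 - symbol α z3.1 - τ1 + z2.2 - z3.2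
      with hy
    have hyj : jp (-(1 - 4 * eps α)) y = jp (-(1 - 4 * eps α))
        ((symbol α k1 + symbol α z3.1 + τ1 - z2.2 + z3.2) -
          (symbol α (k1 + z3.1 - z2.1) + symbol α z2.1)) := by
      unfold jp
      rw [← abs_neg y]
      congr 4
      rw [hy]; ring
    calc _ = ∫⁻ τ, (ψ1 (k1, τ1) ^ 2 * ψ3 z3 ^ 2 * jp (-(2 * bexp α)) z2.2 * cw α (k1 + z3.1) z2.1) *
          (jp (-(2 - 2 * bexp α)) τ * jp (-qexp α) (τ + y)) := by
          refine lintegral_congr fun τ => ?_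
          rw [show τ + symbol α (k1 + z3.1 - z2.1) - symbol α k1 + symbol α z2.1 - symbol α z3.1 - τ1 +
            z2.2 - z3.2 = τ + y by rw [hy]; ring, neg_sub]
          ring
      _ ≤ (ψ1 (k1, τ1) ^ 2 * ψ3 z3 ^ 2 * jp (-(2 * bexp α)) z2.2 * cw α (k1 + z3.1) z2.1) *
          (C2 * jp (-(1 - 4 * eps α)) y) := by
          rw [lintegral_const_mul _ (by fun_prop)]
          gcongr
          exact h2 y
      _ = _ := by rw [hyj]; ring
  calc _ = ∫⁻ z0, ∫⁻ z2, ∫⁻ z3, ∫⁻ τ1, jp (2 * bexp α - 2) z0.2 *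
        (ψ1 (z0.1 + z2.1 - z3.1, τ1) ^ 2 * ψ3 z3 ^ 2 * jp (-(2 * bexp α)) z2.2 *
          cw α (z0.1 + z2.1) z2.1 * jp (-qexp α) (phase α z0 z2 z3 τ1))
          ∂volume ∂freqMeasure ∂freqMeasure ∂freqMeasure := by
        unfold phase
        simp_rw [← lintegral_const_mul' _ _ (jp_ne_top _ _)]
    _ = ∫⁻ z2, ∫⁻ z3, ∫⁻ τ1, ∫⁻ z0, jp (2 * bexp α - 2) z0.2 *
        (ψ1 (z0.1 + z2.1 - z3.1, τ1) ^ 2 * ψ3 z3 ^ 2 * jp (-(2 * bexp α)) z2.2 *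
          cw α (z0.1 + z2.1) z2.1 * jp (-qexp α) (phase α z0 z2 z3 τ1))
          ∂freqMeasure ∂volume ∂freqMeasure ∂freqMeasure := by
        unfold phase
        rw [lintegral_lintegral_swap (by fun_prop)]
        refine lintegral_congr fun z2 => ?_
        rw [lintegral_lintegral_swap (by fun_prop)]
        refine lintegral_congr fun z3 => ?_
        rw [lintegral_lintegral_swap (by fun_prop)]
    _ ≤ ∫⁻ z2, ∫⁻ z3, ∫⁻ τ1, ∑' k1 : ℤ, C2 * (ψ1 (k1, τ1) ^ 2 * ψ3 z3 ^ 2 * jp (-(2 * bexp α)) z2.2 *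
        (cw α (k1 + z3.1) z2.1 * jp (-(1 - 4 * eps α)) ((symbol α k1 + symbol α z3.1 + τ1 - z2.2 + z3.2) -
          (symbol α (k1 + z3.1 - z2.1) + symbol α z2.1)))) ∂volume ∂freqMeasure ∂freqMeasure := by
        gcongr with z2 z3 τ1
        exact key z2 z3 τ1
    _ = ∫⁻ z2, ∫⁻ z3, ∫⁻ z1, C2 * (ψ1 z1 ^ 2 * ψ3 z3 ^ 2 * jp (-(2 * bexp α)) z2.2 *
        (cw α (z1.1 + z3.1) z2.1 * jp (-(1 - 4 * eps α)) ((symbol α z1.1 + symbol α z3.1 + z1.2 - z2.2 + z3.2) -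
          (symbol α (z1.1 + z3.1 - z2.1) + symbol α z2.1)))) ∂freqMeasure ∂freqMeasure ∂freqMeasure := by
        refine lintegral_congr fun z2 => lintegral_congr fun z3 => ?_
        rw [lintegral_freqMeasure_symm (by fun_prop)]
    _ = ∫⁻ z3, ∫⁻ z1, ∫⁻ z2, C2 * (ψ1 z1 ^ 2 * ψ3 z3 ^ 2 * jp (-(2 * bexp α)) z2.2 *
        (cw α (z1.1 + z3.1) z2.1 * jp (-(1 - 4 * eps α)) ((symbol α z1.1 + symbol α z3.1 + z1.2 - z2.2 + z3.2) -
          (symbol α (z1.1 + z3.1 - z2.1) + symbol α z2.1)))) ∂freqMeasure ∂freqMeasure ∂freqMeasure := by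
        rw [lintegral_lintegral_swap (by fun_prop)]
        refine lintegral_congr fun z3 => ?_
        rw [lintegral_lintegral_swap (by fun_prop)]
    _ ≤ ∫⁻ z3, ∫⁻ z1, C2 * (ψ1 z1 ^ 2 * ψ3 z3 ^ 2) * (C1 * I) ∂freqMeasure ∂freqMeasure := by
        gcongr with z3 z1
        rw [lintegral_freqMeasure_symm (by fun_prop)]
        calc _ = ∫⁻ τ, C2 * (ψ1 z1 ^ 2 * ψ3 z3 ^ 2) * (jp (-(2 * bexp α)) τ * ∑' k,
              (cw α (z1.1 + z3.1) k * jp (-(1 - 4 * eps α))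
                ((symbol α z1.1 + symbol α z3.1 + z1.2 - τ + z3.2) -
                (symbol α (z1.1 + z3.1 - k) + symbol α k)))) := by
              refine lintegral_congr fun τ => ?_
              rw [← ENNReal.tsum_mul_left, ← ENNReal.tsum_mul_left]
              refine tsum_congr fun k => ?_
              ring
          _ ≤ ∫⁻ τ, C2 * (ψ1 z1 ^ 2 * ψ3 z3 ^ 2) * (jp (-(2 * bexp α)) τ * C1) := by
              gcongr with τ
              exact h1 _ _
          _ = _ := by
              rw [lintegral_const_mul _ (by fun_prop), lintegral_mul_const _ (by fun_prop)]
              ring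
    _ = _ := by
        calc _ = ∫⁻ z3, ψ3 z3 ^ 2 * (C2 * (∫⁻ z, ψ1 z ^ 2 ∂freqMeasure) * (C1 * I)) ∂freqMeasure := by
              refine lintegral_congr fun z3 => ?_
              rw [lintegral_mul_const _ (by fun_prop), lintegral_const_mul _ (by fun_prop),
                lintegral_mul_const _ (by fun_prop)]
              ring
          _ = _ := by
              rw [lintegral_mul_const _ (by fun_prop)]
              ring

/-- This is the half of Cauchy–Schwarz that is bounded pointwise in `z0`. For fixed `k₀ + k₂` the
counting lemma sums over `k₃`, and the integrals in `τ₁` and `τ₃` converge because `2b > 1`. -/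
lemma majorant_base_snd {α : ℝ} (hα : 1 / 2 < α) (hα1 : α < 1) :
    ∃ C : ℝ≥0∞, C ≠ ⊤ ∧ ∀ ψ2 : ℤ × ℝ → ℝ≥0∞, Measurable ψ2 → ∀ z0 : ℤ × ℝ,
      ∫⁻ z2, ∫⁻ z3, ∫⁻ τ1,
        ψ2 z2 ^ 2 * jp (-(2 * bexp α)) τ1 * jp (-(2 * bexp α)) z3.2 *
          cw α (z0.1 + z2.1) z3.1 * jp (-qexp α) (phase α z0 z2 z3 τ1)
          ∂volume ∂freqMeasure ∂freqMeasure ≤ C * ∫⁻ z, ψ2 z ^ 2 ∂freqMeasure := by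
  have he := eps_pos hα
  have he' := eps_lt hα hα1
  obtain ⟨C1, hC1, h1⟩ := counting_ennreal hα hα1
  set I := ∫⁻ τ, jp (-(2 * bexp α)) τ with hI
  have hIt : I ≠ ⊤ := (lintegral_jp_lt_top (by unfold bexp; linarith)).ne
  refine ⟨C1 * I * I, ENNReal.mul_ne_top (ENNReal.mul_ne_top hC1 hIt) hIt, fun ψ2 m2 z0 => ?_⟩
  rw [← lintegral_const_mul _ (by fun_prop)]
  refine lintegral_mono fun z2 => ?_
  unfold phase
  rw [lintegral_lintegral_swap (by fun_prop)]
  calc _ = ∫⁻ τ1, ∫⁻ τ3, ψ2 z2 ^ 2 * jp (-(2 * bexp α)) τ1 * jp (-(2 * bexp α)) τ3 *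
        ∑' k3, cw α (z0.1 + z2.1) k3 * jp (-qexp α) ((z0.2 + symbol α z0.1 + symbol α z2.1 - τ1 + z2.2 - τ3)
          - (symbol α (z0.1 + z2.1 - k3) + symbol α k3)) := by
        refine lintegral_congr fun τ1 => ?_
        rw [lintegral_freqMeasure_symm (by fun_prop)]
        refine lintegral_congr fun τ3 => ?_
        rw [← ENNReal.tsum_mul_left]
        refine tsum_congr fun k3 => ?_
        rw [mul_assoc _ (cw _ _ _)]
        congr 3
        ring
    _ ≤ ∫⁻ τ1, ∫⁻ τ3, ψ2 z2 ^ 2 * jp (-(2 * bexp α)) τ1 * jp (-(2 * bexp α)) τ3 * C1 := by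
        gcongr with τ1 τ3
        refine le_trans (ENNReal.tsum_le_tsum fun k3 => ?_) (h1 (z0.1 + z2.1)
          (z0.2 + symbol α z0.1 + symbol α z2.1 - τ1 + z2.2 - τ3))
        gcongr
        exact jp_mono (by unfold qexp; linarith) _
    _ = _ := by
        calc _ = ∫⁻ τ1, jp (-(2 * bexp α)) τ1 * (ψ2 z2 ^ 2 * I * C1) := by
              refine lintegral_congr fun τ1 => ?_
              rw [lintegral_mul_const _ (by fun_prop), lintegral_const_mul _ (by fun_prop)]
              ring
          _ = _ := by
              rw [lintegral_mul_const _ (by fun_prop)]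
              ring

lemma lintegral_triple_prod {F : (ℤ × ℝ) × (ℤ × ℝ) × ℝ → ℝ≥0∞} (hF : Measurable F) :
    ∫⁻ z2, ∫⁻ z3, ∫⁻ τ1, F (z2, z3, τ1) ∂volume ∂freqMeasure ∂freqMeasure =
      ∫⁻ p, F p ∂(freqMeasure.prod (freqMeasure.prod volume)) := by
  rw [lintegral_prod _ hF.aemeasurable]
  refine lintegral_congr fun z2 => ?_
  rw [lintegral_prod (fun p : (ℤ × ℝ) × ℝ => F (z2, p)) (by fun_prop)]

lemma half_rpow_sq (x : ℝ≥0∞) : (x ^ (1 / 2 : ℝ)) ^ 2 = x := by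
  rw [← ENNReal.rpow_natCast, ← ENNReal.rpow_mul]; norm_num

lemma measurable_mult {m : ℤ × ℤ × ℤ → ℝ≥0∞} : Measurable m := Measurable.of_discrete

lemma measurable_majorant {α : ℝ} {m : ℤ × ℤ × ℤ → ℝ≥0∞} {φ1 φ2 φ3 : ℤ × ℝ → ℝ≥0∞}
    (h1 : Measurable φ1) (h2 : Measurable φ2) (h3 : Measurable φ3) :
    Measurable (majorant α m φ1 φ2 φ3) := by
  have hm : Measurable m := measurable_mult
  unfold majorant phase
  fun_prop

/-- The trilinear estimate with two counting weights. -/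
lemma majorant_mult23 {α : ℝ} (hα : 1 / 2 < α) (hα1 : α < 1) :
    ∃ C : ℝ≥0∞, C ≠ ⊤ ∧ ∀ φ1 φ2 φ3 : ℤ × ℝ → ℝ≥0∞, Measurable φ1 → Measurable φ2 → Measurable φ3 →
      sqNorm (bexp α - 1) 1 (majorant α (mult23 α) φ1 φ2 φ3) ≤
        C * (sqNorm (bexp α) 1 φ1 * sqNorm (bexp α) 1 φ2 * sqNorm (bexp α) 1 φ3) := by
  obtain ⟨C1, hC1, h1⟩ := majorant_base_fst hα hα1
  obtain ⟨C2, hC2, h2⟩ := majorant_base_snd hα hα1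
  refine ⟨C1 * C2, ENNReal.mul_ne_top hC1 hC2, fun φ1 φ2 φ3 m1 m2 m3 => ?_⟩
  set ψ1 : ℤ × ℝ → ℝ≥0∞ := fun z => jp (bexp α) z.2 * φ1 z with hψ1
  set ψ2 : ℤ × ℝ → ℝ≥0∞ := fun z => jp (bexp α) z.2 * φ2 z with hψ2
  set ψ3 : ℤ × ℝ → ℝ≥0∞ := fun z => jp (bexp α) z.2 * φ3 z with hψ3
  have n1 : Measurable ψ1 := by fun_prop
  have n2 : Measurable ψ2 := by fun_prop
  have n3 : Measurable ψ3 := by fun_prop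
  have hback : ∀ (φ : ℤ × ℝ → ℝ≥0∞) (z : ℤ × ℝ), φ z = jp (-bexp α) z.2 * (jp (bexp α) z.2 * φ z) := by
    intro φ z
    rw [← mul_assoc, jp_neg_mul, one_mul]
  have hcs : ∀ z0 : ℤ × ℝ, (majorant α (mult23 α) φ1 φ2 φ3 z0) ^ 2 ≤
      (∫⁻ z2, ∫⁻ z3, ∫⁻ τ1,
        ψ1 (z0.1 + z2.1 - z3.1, τ1) ^ 2 * ψ3 z3 ^ 2 * jp (-(2 * bexp α)) z2.2 *
          cw α (z0.1 + z2.1) z2.1 * jp (-qexp α) (phase α z0 z2 z3 τ1)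
          ∂volume ∂freqMeasure ∂freqMeasure) * (C2 * ∫⁻ z, ψ2 z ^ 2 ∂freqMeasure) := by
    intro z0
    refine le_trans ?_ (mul_le_mul_right (h2 ψ2 n2 z0) _)
    -- The kernel is shared equally. The weight at `k₂` goes with factors one and three, the weight
    -- at `k₃` with factor two. In this way each weight is summed over the variable in which the
    -- remaining functions give no decay.
    set P : (ℤ × ℝ) × (ℤ × ℝ) × ℝ → ℝ≥0∞ := fun p => ψ1 (z0.1 + p.1.1 - p.2.1.1, p.2.2) * ψ3 p.2.1 *
      jp (-bexp α) p.1.2 * cw α (z0.1 + p.1.1) p.1.1 ^ (1 / 2 : ℝ) *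
      jp (-qexp α) (phase α z0 p.1 p.2.1 p.2.2) ^ (1 / 2 : ℝ) with hP
    set Q : (ℤ × ℝ) × (ℤ × ℝ) × ℝ → ℝ≥0∞ := fun p => ψ2 p.1 * jp (-bexp α) p.2.2 *
      jp (-bexp α) p.2.1.2 * cw α (z0.1 + p.1.1) p.2.1.1 ^ (1 / 2 : ℝ) *
      jp (-qexp α) (phase α z0 p.1 p.2.1 p.2.2) ^ (1 / 2 : ℝ) with hQ
    have hPm : Measurable P := by rw [hP]; unfold phase; fun_prop
    have hQm : Measurable Q := by rw [hQ]; unfold phase; fun_prop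
    have e0 : majorant α (mult23 α) φ1 φ2 φ3 z0 = ∫⁻ z2, ∫⁻ z3, ∫⁻ τ1, P (z2, z3, τ1) * Q (z2, z3, τ1)
        ∂volume ∂freqMeasure ∂freqMeasure := by
      unfold majorant
      refine lintegral_congr fun z2 => lintegral_congr fun z3 => lintegral_congr fun τ1 => ?_
      have e1 : jp (-qexp α) (phase α z0 z2 z3 τ1) = jp (-qexp α) (phase α z0 z2 z3 τ1) ^ (1 / 2 : ℝ) *
          jp (-qexp α) (phase α z0 z2 z3 τ1) ^ (1 / 2 : ℝ) := by
        rw [← sq, half_rpow_sq]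
      rw [hback φ1, hback φ2 z2, hback φ3 z3, e1]
      simp only [hP, hQ, mult23, hψ1, hψ2, hψ3, sub_add_cancel]
      ring
    have eP : ∫⁻ z2, ∫⁻ z3, ∫⁻ τ1, P (z2, z3, τ1) ^ 2 ∂volume ∂freqMeasure ∂freqMeasure =
      ∫⁻ z2, ∫⁻ z3, ∫⁻ τ1,
        ψ1 (z0.1 + z2.1 - z3.1, τ1) ^ 2 * ψ3 z3 ^ 2 * jp (-(2 * bexp α)) z2.2 *
          cw α (z0.1 + z2.1) z2.1 * jp (-qexp α) (phase α z0 z2 z3 τ1)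
          ∂volume ∂freqMeasure ∂freqMeasure := by
      refine lintegral_congr fun z2 => lintegral_congr fun z3 => lintegral_congr fun τ1 => ?_
      simp only [hP, mul_pow, half_rpow_sq, jp_sq, mul_neg]
    have eQ : ∫⁻ z2, ∫⁻ z3, ∫⁻ τ1, Q (z2, z3, τ1) ^ 2 ∂volume ∂freqMeasure ∂freqMeasure =
      ∫⁻ z2, ∫⁻ z3, ∫⁻ τ1,
        ψ2 z2 ^ 2 * jp (-(2 * bexp α)) τ1 * jp (-(2 * bexp α)) z3.2 *
          cw α (z0.1 + z2.1) z3.1 * jp (-qexp α) (phase α z0 z2 z3 τ1)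
          ∂volume ∂freqMeasure ∂freqMeasure := by
      refine lintegral_congr fun z2 => lintegral_congr fun z3 => lintegral_congr fun τ1 => ?_
      simp only [hQ, mul_pow, half_rpow_sq, jp_sq, mul_neg]
    rw [e0, ← eP, ← eQ, lintegral_triple_prod (F := fun p => P p * Q p) (by fun_prop),
      lintegral_triple_prod (F := fun p => P p ^ 2) (by fun_prop),
      lintegral_triple_prod (F := fun p => Q p ^ 2) (by fun_prop)]
    exact lintegral_mul_sq_le _ hPm hQm
  have hs : ∀ φ : ℤ × ℝ → ℝ≥0∞, sqNorm (bexp α) 1 φ = ∫⁻ z, (jp (bexp α) z.2 * φ z) ^ 2 ∂freqMeasure := by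
    intro φ; simp [sqNorm]
  rw [hs φ1, hs φ2, hs φ3]
  calc sqNorm (bexp α - 1) 1 (majorant α (mult23 α) φ1 φ2 φ3)
      ≤ ∫⁻ z0, (jp (2 * bexp α - 2) z0.2 * (∫⁻ z2, ∫⁻ z3, ∫⁻ τ1,
        ψ1 (z0.1 + z2.1 - z3.1, τ1) ^ 2 * ψ3 z3 ^ 2 * jp (-(2 * bexp α)) z2.2 *
          cw α (z0.1 + z2.1) z2.1 * jp (-qexp α) (phase α z0 z2 z3 τ1)
          ∂volume ∂freqMeasure ∂freqMeasure)) * (C2 * ∫⁻ z, ψ2 z ^ 2 ∂freqMeasure) ∂freqMeasure := by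
        refine lintegral_mono fun z0 => ?_
        simp only [Pi.one_apply, one_mul, mul_pow, jp_sq]
        rw [show 2 * (bexp α - 1) = 2 * bexp α - 2 by ring, mul_assoc]
        gcongr
        exact hcs z0
    _ = _ := lintegral_mul_const _ (by unfold phase; fun_prop)
    _ ≤ (C1 * (∫⁻ z, ψ1 z ^ 2 ∂freqMeasure) * ∫⁻ z, ψ3 z ^ 2 ∂freqMeasure) *
          (C2 * ∫⁻ z, ψ2 z ^ 2 ∂freqMeasure) := by
        gcongr
        exact h1 ψ1 ψ3 n1 n3
    _ = _ := by ring

/-- The first and third factors enter symmetrically: the substitution `k₃ ↦ k₀ + k₂ - k₃` exchanges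
them and leaves the phase unchanged. -/
lemma majorant_swap {α : ℝ} (m : ℤ × ℤ × ℤ → ℝ≥0∞) {φ1 φ2 φ3 : ℤ × ℝ → ℝ≥0∞}
    (h1 : Measurable φ1) (h3 : Measurable φ3) :
    majorant α m φ1 φ2 φ3 = majorant α (fun p => m (p.2.2, p.2.1, p.1)) φ3 φ2 φ1 := by
  have hm : Measurable m := measurable_mult
  ext z0
  unfold majorant phase
  refine lintegral_congr fun z2 => ?_
  calc _ = ∫⁻ τ1, ∫⁻ τ3, ∑' k3, m (z0.1 + z2.1 - k3, z2.1, k3) *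
      (φ1 (z0.1 + z2.1 - k3, τ1) * φ2 z2 * φ3 (k3, τ3) * jp (-qexp α)
        (z0.2 + symbol α z0.1 - symbol α (z0.1 + z2.1 - k3) + symbol α z2.1 - symbol α k3
          - τ1 + z2.2 - τ3)) := by
        rw [lintegral_lintegral_swap (by fun_prop)]
        refine lintegral_congr fun τ1 => ?_
        rw [lintegral_freqMeasure_symm (by fun_prop)]
    _ = ∫⁻ τ1, ∫⁻ τ3, ∑' k3, m (k3, z2.1, z0.1 + z2.1 - k3) *
      (φ3 (z0.1 + z2.1 - k3, τ3) * φ2 z2 * φ1 (k3, τ1) * jp (-qexp α)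
        (z0.2 + symbol α z0.1 - symbol α (z0.1 + z2.1 - k3) + symbol α z2.1 - symbol α k3
          - τ3 + z2.2 - τ1)) := by
        refine lintegral_congr fun τ1 => lintegral_congr fun τ3 => ?_
        rw [← (Equiv.subLeft (z0.1 + z2.1)).tsum_eq]
        refine tsum_congr fun k3 => ?_
        simp only [Equiv.subLeft_apply, sub_sub_cancel]
        congr 1
        rw [mul_comm (φ1 _ * _), mul_comm (φ1 _), ← mul_assoc]
        congr 2
        ring
    _ = ∫⁻ τ3, ∫⁻ τ1, ∑' k3, m (k3, z2.1, z0.1 + z2.1 - k3) *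
      (φ3 (z0.1 + z2.1 - k3, τ3) * φ2 z2 * φ1 (k3, τ1) * jp (-qexp α)
        (z0.2 + symbol α z0.1 - symbol α (z0.1 + z2.1 - k3) + symbol α z2.1 - symbol α k3
          - τ3 + z2.2 - τ1)) := by
        have hms : Measurable fun p : ℝ × ℝ => ∑' k3, m (k3, z2.1, z0.1 + z2.1 - k3) *
          (φ3 (z0.1 + z2.1 - k3, p.2) * φ2 z2 * φ1 (k3, p.1) * jp (-qexp α)
        (z0.2 + symbol α z0.1 - symbol α (z0.1 + z2.1 - k3) + symbol α z2.1 - symbol α k3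
          - p.2 + z2.2 - p.1)) := Measurable.tsum fun k3 => by fun_prop
        rw [lintegral_lintegral_swap hms.aemeasurable]
    _ = _ := by
        rw [lintegral_lintegral_swap (f := fun (z3 : ℤ × ℝ) (τ1 : ℝ) => _ * _) (by fun_prop)]
        refine lintegral_congr fun τ1 => ?_
        rw [lintegral_freqMeasure_symm (by fun_prop)]

end

/-! ### Weighted norms and the trilinear estimate with Sobolev weights. -/

section

/-- The weighted `L²` norm with weight `w(k) (1+|τ|)^r`. -/
def nrm (r : ℝ) (w : ℤ → ℝ≥0∞) (φ : ℤ × ℝ → ℝ≥0∞) : ℝ≥0∞ := sqNorm r w φ ^ (1 / 2 : ℝ)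

/-- The critical Sobolev weight. -/
def w0 (α : ℝ) (k : ℤ) : ℝ≥0∞ := jp (sexp α) k

lemma nrm_sq (r : ℝ) (w : ℤ → ℝ≥0∞) (φ : ℤ × ℝ → ℝ≥0∞) : nrm r w φ ^ 2 = sqNorm r w φ :=
  half_rpow_sq _

lemma nrm_mono {r : ℝ} {w w' : ℤ → ℝ≥0∞} {φ φ' : ℤ × ℝ → ℝ≥0∞} (hw : w ≤ w') (h : φ ≤ φ') :
    nrm r w φ ≤ nrm r w' φ' := by
  unfold nrm sqNorm
  gcongr with z
  · exact hw _
  · exact h z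

lemma nrm_add_le {r : ℝ} {w : ℤ → ℝ≥0∞} {φ φ' : ℤ × ℝ → ℝ≥0∞} (hφ : Measurable φ)
    (hφ' : Measurable φ') : nrm r w (φ + φ') ≤ nrm r w φ + nrm r w φ' := by
  have hw : Measurable w := Measurable.of_discrete
  have := ENNReal.lintegral_Lp_add_le (p := 2) (μ := freqMeasure)
    (f := fun z : ℤ × ℝ => w z.1 * jp r z.2 * φ z) (g := fun z : ℤ × ℝ => w z.1 * jp r z.2 * φ' z)
    (by fun_prop) (by fun_prop) (by norm_num)
  simp only [ENNReal.rpow_ofNat] at this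
  unfold nrm sqNorm
  refine le_trans (le_of_eq ?_) this
  congr 2
  ext z
  simp [mul_add]

lemma nrm_const_mul {r : ℝ} {w : ℤ → ℝ≥0∞} (c : ℝ≥0∞) {φ : ℤ × ℝ → ℝ≥0∞} (hφ : Measurable φ) :
    nrm r w (fun z => c * φ z) = c * nrm r w φ := by
  have hw : Measurable w := Measurable.of_discrete
  unfold nrm sqNorm
  have : ∀ z : ℤ × ℝ, (w z.1 * jp r z.2 * (c * φ z)) ^ 2 = c ^ 2 * (w z.1 * jp r z.2 * φ z) ^ 2 := by
    intro z; ring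
  simp_rw [this]
  rw [lintegral_const_mul _ (by fun_prop), ENNReal.mul_rpow_of_nonneg _ _ (by norm_num),
    ← ENNReal.rpow_natCast, ← ENNReal.rpow_mul]
  norm_num

lemma nrm_weight_mul {r : ℝ} (w v : ℤ → ℝ≥0∞) (φ : ℤ × ℝ → ℝ≥0∞) :
    nrm r w (fun z => v z.1 * φ z) = nrm r (fun k => w k * v k) φ := by
  unfold nrm sqNorm
  congr 2
  ext z
  ring

lemma majorant_mult23_nrm {α : ℝ} (hα : 1 / 2 < α) (hα1 : α < 1) :
    ∃ C : ℝ≥0∞, C ≠ ⊤ ∧ ∀ φ1 φ2 φ3 : ℤ × ℝ → ℝ≥0∞, Measurable φ1 → Measurable φ2 → Measurable φ3 →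
      nrm (bexp α - 1) 1 (majorant α (mult23 α) φ1 φ2 φ3) ≤
        C * (nrm (bexp α) 1 φ1 * nrm (bexp α) 1 φ2 * nrm (bexp α) 1 φ3) := by
  obtain ⟨C, hC, h⟩ := majorant_mult23 hα hα1
  refine ⟨C ^ (1 / 2 : ℝ), ENNReal.rpow_ne_top_of_nonneg (by norm_num) hC, fun φ1 φ2 φ3 m1 m2 m3 => ?_⟩
  have := ENNReal.rpow_le_rpow (h φ1 φ2 φ3 m1 m2 m3) (by norm_num : (0 : ℝ) ≤ 1 / 2)
  simp only [ENNReal.mul_rpow_of_nonneg _ _ (by norm_num : (0 : ℝ) ≤ 1 / 2)] at this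
  exact this

lemma jp_neg_le_four_mul {s x y : ℝ} (hs : 0 ≤ s) (hs1 : s ≤ 1) (h : |x| ≤ 4 * |y|) :
    jp (-s) y ≤ 4 * jp (-s) x := by
  unfold jp
  rw [show (4 : ℝ≥0∞) = ENNReal.ofReal 4 by simp, ← ENNReal.ofReal_mul (by norm_num)]
  refine ENNReal.ofReal_le_ofReal ?_
  have hx : 0 < 1 + |x| := by positivity
  calc (1 + |y|) ^ (-s) ≤ ((1 + |x|) / 4) ^ (-s) :=
        Real.rpow_le_rpow_of_nonpos (by positivity) (by linarith) (by linarith)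
    _ = 4 ^ s * (1 + |x|) ^ (-s) := by
        rw [Real.div_rpow hx.le (by norm_num), Real.rpow_neg (by norm_num : (0 : ℝ) ≤ 4)]
        field_simp
    _ ≤ 4 ^ (1 : ℝ) * (1 + |x|) ^ (-s) := by gcongr; norm_num
    _ = _ := by rw [Real.rpow_one]

/-- The decaying part of the counting weight is `(1+|x|)^{-2 sexp α}`, so a factor carrying the
critical weight can pay for one square root of it. -/
lemma jp_le_cw {α : ℝ} (k x : ℤ) : jp (-sexp α) x ≤ cw α k x ^ (1 / 2 : ℝ) := by
  have h1 : jp (-(2 * sexp α)) x ≤ cw α k x := by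
    unfold jp cw countWeight sexp
    refine ENNReal.ofReal_le_ofReal ?_
    rw [show -(2 * ((1 - α) / 2)) = α - 1 by ring]
    split_ifs <;> simp
  calc jp (-sexp α) x = jp (-(2 * sexp α)) x ^ (1 / 2 : ℝ) := by
        rw [jp_rpow _ _ _ (by norm_num)]; congr 1; ring
    _ ≤ _ := by gcongr

lemma one_le_cw {α : ℝ} {k x : ℤ} (h : 2 * |k| ≤ |x|) : 1 ≤ cw α k x ^ (1 / 2 : ℝ) := by
  have h1 : 1 ≤ cw α k x := by
    unfold cw countWeight
    rw [if_pos h, ENNReal.one_le_ofReal]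
    have : 0 ≤ (1 + |(x : ℝ)|) ^ (α - 1) := by positivity
    linarith
  exact ENNReal.one_le_rpow h1 (by norm_num)

lemma one_le_w0 {α : ℝ} (hα1 : α < 1) (k : ℤ) : 1 ≤ w0 α k := by
  unfold w0
  rw [← jp_zero (k : ℝ)]
  exact jp_mono (by unfold sexp; linarith) _

/-- Critical weights at `k₁` and `k₃` alone must pay for the multiplier. If `|k₂| ≥ 2|k₁+k₃|`, the
weight at `k₂` is at least `1` and costs nothing. Otherwise `|k₂| ≤ 4 max(|k₁|, |k₃|)`, and the
larger of the two frequencies gives its weight to `k₂`; the two permutations of the multiplier cover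
the two cases. -/
lemma one_le_mult {α : ℝ} (hα : 1 / 2 < α) (hα1 : α < 1) (k1 k2 k3 : ℤ) :
    1 ≤ 4 * (mult23 α (k1, k2, k3) + mult23 α (k3, k2, k1)) * (w0 α k1 * w0 α k3) := by
  have hs0 : 0 ≤ sexp α := by unfold sexp; linarith
  have hs1 : sexp α ≤ 1 := by unfold sexp; linarith
  simp only [mult23]
  rw [add_comm k3 k1]
  have hw : ∀ k : ℤ, jp (-sexp α) k * w0 α k = 1 := fun k => jp_neg_mul _ _
  by_cases h : 2 * |k1 + k3| ≤ |k2|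
  · calc (1 : ℝ≥0∞) = 1 * 1 * (1 * 1) := by simp
      _ = 1 * (1 * jp (-sexp α) k3) * (1 * w0 α k3) := by rw [← hw k3]; ring
      _ ≤ 4 * (cw α (k1 + k3) k2 ^ (1 / 2 : ℝ) * cw α (k1 + k3) k3 ^ (1 / 2 : ℝ) +
          cw α (k1 + k3) k2 ^ (1 / 2 : ℝ) * cw α (k1 + k3) k1 ^ (1 / 2 : ℝ)) * (w0 α k1 * w0 α k3) := by
        gcongr
        · norm_num
        · refine le_trans ?_ le_self_add
          exact mul_le_mul' (one_le_cw h) (jp_le_cw _ _)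
        · exact one_le_w0 hα1 k1
  · push Not at h
    have hk : |k1 + k3| ≤ |k1| + |k3| := abs_add_le k1 k3
    rcases le_total |k3| |k1| with h' | h'
    · have h4 : |(k2 : ℝ)| ≤ 4 * |(k1 : ℝ)| := by
        have : |k2| ≤ 4 * |k1| := by omega
        exact_mod_cast this
      calc (1 : ℝ≥0∞) = (jp (-sexp α) k1 * w0 α k1) * (jp (-sexp α) k3 * w0 α k3) := by
            rw [hw, hw, one_mul]
        _ = jp (-sexp α) k1 * jp (-sexp α) k3 * (w0 α k1 * w0 α k3) := by ring
        _ ≤ 4 * jp (-sexp α) k2 * jp (-sexp α) k3 * (w0 α k1 * w0 α k3) := by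
            gcongr
            exact jp_neg_le_four_mul hs0 hs1 h4
        _ ≤ _ := by
            rw [mul_assoc 4]
            gcongr
            refine le_trans ?_ le_self_add
            exact mul_le_mul' (jp_le_cw _ _) (jp_le_cw _ _)
    · have h4 : |(k2 : ℝ)| ≤ 4 * |(k3 : ℝ)| := by
        have : |k2| ≤ 4 * |k3| := by omega
        exact_mod_cast this
      calc (1 : ℝ≥0∞) = (jp (-sexp α) k1 * w0 α k1) * (jp (-sexp α) k3 * w0 α k3) := by
            rw [hw, hw, one_mul]
        _ = jp (-sexp α) k3 * jp (-sexp α) k1 * (w0 α k1 * w0 α k3) := by ring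
        _ ≤ 4 * jp (-sexp α) k2 * jp (-sexp α) k1 * (w0 α k1 * w0 α k3) := by
            gcongr
            exact jp_neg_le_four_mul hs0 hs1 h4
        _ ≤ _ := by
            rw [mul_assoc 4]
            gcongr
            refine le_trans ?_ le_add_self
            exact mul_le_mul' (jp_le_cw _ _) (jp_le_cw _ _)

lemma majorant_le_majorant {α : ℝ} {m m' : ℤ × ℤ × ℤ → ℝ≥0∞} {φ1 φ2 φ3 φ1' φ2' φ3' : ℤ × ℝ → ℝ≥0∞}
    (h : ∀ k1 k2 k3 τ1 τ2 τ3, m (k1, k2, k3) * (φ1 (k1, τ1) * φ2 (k2, τ2) * φ3 (k3, τ3)) ≤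
      m' (k1, k2, k3) * (φ1' (k1, τ1) * φ2' (k2, τ2) * φ3' (k3, τ3))) :
    majorant α m φ1 φ2 φ3 ≤ majorant α m' φ1' φ2' φ3' := by
  intro z0
  unfold majorant
  refine lintegral_mono fun z2 => lintegral_mono fun z3 => lintegral_mono fun τ1 => ?_
  have := mul_le_mul' (h (z0.1 + z2.1 - z3.1) z2.1 z3.1 τ1 z2.2 z3.2)
    (le_refl (jp (-qexp α) (phase α z0 z2 z3 τ1)))
  simpa only [mul_assoc] using this

/-- The weights of the trilinear estimate: trivial at position `j`, critical elsewhere. -/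
def triWeight (α : ℝ) (j i : Fin 3) : ℤ → ℝ≥0∞ := if i = j then 1 else w0 α

lemma majorant_add_mult {α : ℝ} (m m' : ℤ × ℤ × ℤ → ℝ≥0∞) {φ1 φ2 φ3 : ℤ × ℝ → ℝ≥0∞}
    (h1 : Measurable φ1) (h2 : Measurable φ2) (h3 : Measurable φ3) :
    majorant α (m + m') φ1 φ2 φ3 = majorant α m φ1 φ2 φ3 + majorant α m' φ1 φ2 φ3 := by
  have hm : Measurable m := measurable_mult
  have hm' : Measurable m' := measurable_mult
  ext z0
  simp only [Pi.add_apply]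
  unfold majorant phase
  rw [← lintegral_add_left (by fun_prop)]
  refine lintegral_congr fun z2 => ?_
  rw [← lintegral_add_left (by fun_prop)]
  refine lintegral_congr fun z3 => ?_
  rw [← lintegral_add_left (by fun_prop)]
  refine lintegral_congr fun τ1 => ?_
  simp only [Pi.add_apply]
  ring

/-- Two critical weights suffice, and the third factor stays in `L²`. If the free factor is the
first or the third, the other weights sit at the frequencies required by `mult23`, up to
`majorant_swap`. If it is the conjugated one, `one_le_mult` redistributes them. -/
lemma majorant_triWeight {α : ℝ} (hα : 1 / 2 < α) (hα1 : α < 1) :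
    ∃ C : ℝ≥0∞, C ≠ ⊤ ∧ ∀ (j : Fin 3) (φ1 φ2 φ3 : ℤ × ℝ → ℝ≥0∞),
      Measurable φ1 → Measurable φ2 → Measurable φ3 →
      nrm (bexp α - 1) 1 (majorant α 1 φ1 φ2 φ3) ≤
        C * (nrm (bexp α) (triWeight α j 0) φ1 * nrm (bexp α) (triWeight α j 1) φ2 *
          nrm (bexp α) (triWeight α j 2) φ3) := by
  obtain ⟨C, hC, h⟩ := majorant_mult23_nrm hα hα1
  have hw0 : Measurable (w0 α) := Measurable.of_discrete
  have hwn : ∀ φ, nrm (bexp α) 1 (fun z => w0 α z.1 * φ z) = nrm (bexp α) (w0 α) φ := by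
    intro φ; rw [nrm_weight_mul]; simp
  have hww : ∀ k : ℤ, jp (-sexp α) k * w0 α k = 1 := fun k => jp_neg_mul _ _
  have hfst : ∀ (φ1 φ2 φ3 : ℤ × ℝ → ℝ≥0∞), Measurable φ1 → Measurable φ2 → Measurable φ3 →
      nrm (bexp α - 1) 1 (majorant α 1 φ1 φ2 φ3) ≤
        C * (nrm (bexp α) 1 φ1 * nrm (bexp α) (w0 α) φ2 * nrm (bexp α) (w0 α) φ3) := by
    intro φ1 φ2 φ3 m1 m2 m3
    rw [← hwn φ2, ← hwn φ3]
    refine le_trans (nrm_mono le_rfl (majorant_le_majorant fun k1 k2 k3 τ1 τ2 τ3 => ?_))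
      (h _ _ _ m1 (by fun_prop) (by fun_prop))
    simp only [Pi.one_apply, mult23]
    calc 1 * (φ1 (k1, τ1) * φ2 (k2, τ2) * φ3 (k3, τ3))
        = (jp (-sexp α) k2 * jp (-sexp α) k3) * (φ1 (k1, τ1) * (w0 α k2 * φ2 (k2, τ2)) *
          (w0 α k3 * φ3 (k3, τ3))) := by
          calc _ = (jp (-sexp α) k2 * w0 α k2) * (jp (-sexp α) k3 * w0 α k3) *
                (φ1 (k1, τ1) * φ2 (k2, τ2) * φ3 (k3, τ3)) := by rw [hww, hww]; simp
            _ = _ := by ring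
      _ ≤ _ := by
          gcongr
          · exact jp_le_cw _ _
          · exact jp_le_cw _ _
  refine ⟨8 * C + C, ENNReal.add_ne_top.2 ⟨ENNReal.mul_ne_top (by simp) hC, hC⟩,
    fun j φ1 φ2 φ3 m1 m2 m3 => ?_⟩
  fin_cases j
  · simp only [triWeight]
    refine (hfst φ1 φ2 φ3 m1 m2 m3).trans ?_
    simp only [Fin.zero_eta, Fin.isValue, ↓reduceIte, one_ne_zero, Fin.reduceEq]
    gcongr
    exact le_add_self
  · have hle : majorant α 1 φ1 φ2 φ3 ≤ fun z => 4 *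
        (majorant α (mult23 α) (fun z => w0 α z.1 * φ1 z) φ2 (fun z => w0 α z.1 * φ3 z) +
        majorant α (mult23 α) (fun z => w0 α z.1 * φ3 z) φ2 (fun z => w0 α z.1 * φ1 z)) z := by
      have e1 : majorant α (mult23 α) (fun z => w0 α z.1 * φ3 z) φ2 (fun z => w0 α z.1 * φ1 z) =
          majorant α (fun p => mult23 α (p.2.2, p.2.1, p.1)) (fun z => w0 α z.1 * φ1 z) φ2
            (fun z => w0 α z.1 * φ3 z) := by
        rw [majorant_swap (mult23 α) (by fun_prop) (by fun_prop)]
      rw [e1, ← majorant_add_mult _ _ (by fun_prop) (by fun_prop) (by fun_prop)]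
      have hm : Measurable (mult23 α) := measurable_mult
      have hm' : Measurable (fun p : ℤ × ℤ × ℤ => mult23 α (p.2.2, p.2.1, p.1)) := measurable_mult
      have e2 : (fun z => 4 * majorant α (mult23 α + fun p => mult23 α (p.2.2, p.2.1, p.1))
          (fun z => w0 α z.1 * φ1 z) φ2 (fun z => w0 α z.1 * φ3 z) z) =
          majorant α (mult23 α + fun p => mult23 α (p.2.2, p.2.1, p.1))
          (fun z => 4 * (w0 α z.1 * φ1 z)) φ2 (fun z => w0 α z.1 * φ3 z) := by
        ext z
        unfold majorant
        simp_rw [← lintegral_const_mul' (4 : ℝ≥0∞) _ (by simp)]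
        refine lintegral_congr fun z2 => lintegral_congr fun z3 => lintegral_congr fun τ1 => ?_
        ring
      rw [e2]
      refine majorant_le_majorant fun k1 k2 k3 τ1 τ2 τ3 => ?_
      calc _ ≤ (4 * (mult23 α (k1, k2, k3) + mult23 α (k3, k2, k1)) * (w0 α k1 * w0 α k3)) *
            (φ1 (k1, τ1) * φ2 (k2, τ2) * φ3 (k3, τ3)) := by
            gcongr
            exact one_le_mult hα hα1 k1 k2 k3
        _ = _ := by simp only [Pi.add_apply]; ring
    have hmaj : ∀ m, ∀ φ1 φ2 φ3, Measurable φ1 → Measurable φ2 → Measurable φ3 →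
      Measurable (majorant α m φ1 φ2 φ3) := fun m φ1 φ2 φ3 => measurable_majorant
    simp only [triWeight]
    calc _ ≤ _ := nrm_mono le_rfl hle
      _ = _ := nrm_const_mul 4 ((hmaj _ _ _ _ (by fun_prop) m2 (by fun_prop)).add
          (hmaj _ _ _ _ (by fun_prop) m2 (by fun_prop)))
      _ ≤ 4 * (C * (nrm (bexp α) (w0 α) φ1 * nrm (bexp α) 1 φ2 * nrm (bexp α) (w0 α) φ3) +
          C * (nrm (bexp α) (w0 α) φ3 * nrm (bexp α) 1 φ2 * nrm (bexp α) (w0 α) φ1)) := by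
          gcongr
          refine (nrm_add_le (hmaj _ _ _ _ (by fun_prop) m2 (by fun_prop))
            (hmaj _ _ _ _ (by fun_prop) m2 (by fun_prop))).trans ?_
          rw [← hwn φ1, ← hwn φ3]
          exact add_le_add (h _ _ _ (by fun_prop) m2 (by fun_prop)) (h _ _ _ (by fun_prop) m2 (by fun_prop))
      _ = 8 * C * (nrm (bexp α) (w0 α) φ1 * nrm (bexp α) 1 φ2 * nrm (bexp α) (w0 α) φ3) := by ring
      _ ≤ _ := by
          simp only [Fin.mk_one, Fin.isValue, zero_ne_one, ↓reduceIte, Fin.reduceEq]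
          gcongr
          exact le_self_add
  · rw [majorant_swap 1 m1 m3]
    simp only [triWeight]
    refine (hfst φ3 φ2 φ1 m3 m2 m1).trans ?_
    simp only [Fin.reduceFinMk, Fin.isValue, Fin.reduceEq, ↓reduceIte]
    calc _ = C * (nrm (bexp α) (w0 α) φ1 * nrm (bexp α) (w0 α) φ2 * nrm (bexp α) 1 φ3) := by ring
      _ ≤ _ := by
        gcongr
        exact le_add_self

/-- Quasi-monotone weights dominating the critical one. -/
structure IsWeight (α : ℝ) (D : ℝ≥0∞) (w : ℤ → ℝ≥0∞) : Prop where
  le_sum : ∀ k1 k2 k3, w (k1 - k2 + k3) ≤ D * (w k1 + w k2 + w k3)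
  w0_le : w0 α ≤ w
  ne_top : ∀ k, w k ≠ ⊤

/-- The trilinear estimate for quasi-monotone weights. -/
lemma majorant_weight {α : ℝ} (hα : 1 / 2 < α) (hα1 : α < 1) :
    ∃ C : ℝ≥0∞, C ≠ ⊤ ∧ ∀ (D : ℝ≥0∞) (w : ℤ → ℝ≥0∞), IsWeight α D w →
      ∀ (φ1 φ2 φ3 : ℤ × ℝ → ℝ≥0∞), Measurable φ1 → Measurable φ2 → Measurable φ3 →
      nrm (bexp α - 1) w (majorant α 1 φ1 φ2 φ3) ≤
        D * C * (nrm (bexp α) w φ1 * nrm (bexp α) w φ2 * nrm (bexp α) w φ3) := by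
  obtain ⟨C, hC, h⟩ := majorant_triWeight hα hα1
  refine ⟨3 * C, ENNReal.mul_ne_top (by simp) hC, fun D w hw φ1 φ2 φ3 m1 m2 m3 => ?_⟩
  have hwm : Measurable w := Measurable.of_discrete
  have hmaj : ∀ m, ∀ φ1 φ2 φ3, Measurable φ1 → Measurable φ2 → Measurable φ3 →
      Measurable (majorant α m φ1 φ2 φ3) := fun m φ1 φ2 φ3 => measurable_majorant
  set M1 := majorant α 1 (fun z => w z.1 * φ1 z) φ2 φ3
  set M2 := majorant α 1 φ1 (fun z => w z.1 * φ2 z) φ3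
  set M3 := majorant α 1 φ1 φ2 (fun z => w z.1 * φ3 z)
  have hM1 : Measurable M1 := hmaj _ _ _ _ (by fun_prop) m2 m3
  have hM2 : Measurable M2 := hmaj _ _ _ _ m1 (by fun_prop) m3
  have hM3 : Measurable M3 := hmaj _ _ _ _ m1 m2 (by fun_prop)
  -- Quasi-monotonicity moves the output weight onto one input. That input then plays the free
  -- factor in `majorant_triWeight`, and the other two need only `w0 ≤ w`.
  have hle : (fun z => w z.1 * majorant α 1 φ1 φ2 φ3 z) ≤ fun z => D * (M1 + M2 + M3) z := by
    intro z0
    simp only [Pi.add_apply, M1, M2, M3]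
    unfold majorant phase
    rw [← lintegral_add_left (by fun_prop), ← lintegral_add_left (by fun_prop),
      ← lintegral_const_mul' _ _ (hw.ne_top _)]
    rw [← lintegral_const_mul _ (by fun_prop)]
    refine lintegral_mono fun z2 => ?_
    rw [← lintegral_add_left (by fun_prop), ← lintegral_add_left (by fun_prop),
      ← lintegral_const_mul _ (by fun_prop), ← lintegral_const_mul _ (by fun_prop)]
    refine lintegral_mono fun z3 => ?_
    rw [← lintegral_add_left (by fun_prop), ← lintegral_add_left (by fun_prop),
      ← lintegral_const_mul _ (by fun_prop), ← lintegral_const_mul _ (by fun_prop)]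
    refine lintegral_mono fun τ1 => ?_
    have := hw.le_sum (z0.1 + z2.1 - z3.1) z2.1 z3.1
    rw [show z0.1 + z2.1 - z3.1 - z2.1 + z3.1 = z0.1 by ring] at this
    simp only [Pi.one_apply, one_mul]
    refine (mul_le_mul_left this _).trans (le_of_eq ?_)
    ring
  have hone : ∀ φ, nrm (bexp α) 1 (fun z => w z.1 * φ z) = nrm (bexp α) w φ := by
    intro φ; rw [nrm_weight_mul]; simp
  have hw0 : ∀ φ, nrm (bexp α) (w0 α) φ ≤ nrm (bexp α) w φ := fun φ => nrm_mono hw.w0_le le_rfl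
  have b1 := h 0 _ _ _ (by fun_prop : Measurable fun z : ℤ × ℝ => w z.1 * φ1 z) m2 m3
  have b2 := h 1 _ _ _ m1 (by fun_prop : Measurable fun z : ℤ × ℝ => w z.1 * φ2 z) m3
  have b3 := h 2 _ _ _ m1 m2 (by fun_prop : Measurable fun z : ℤ × ℝ => w z.1 * φ3 z)
  simp only [triWeight, Fin.isValue, ↓reduceIte, one_ne_zero, Fin.reduceEq, zero_ne_one, hone] at b1 b2 b3
  calc nrm (bexp α - 1) w (majorant α 1 φ1 φ2 φ3)
      = nrm (bexp α - 1) 1 (fun z => w z.1 * majorant α 1 φ1 φ2 φ3 z) := by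
        rw [nrm_weight_mul]; simp
    _ ≤ _ := nrm_mono le_rfl hle
    _ = _ := nrm_const_mul D ((hM1.add hM2).add hM3)
    _ ≤ D * (C * (nrm (bexp α) w φ1 * nrm (bexp α) w φ2 * nrm (bexp α) w φ3) +
        C * (nrm (bexp α) w φ1 * nrm (bexp α) w φ2 * nrm (bexp α) w φ3) +
        C * (nrm (bexp α) w φ1 * nrm (bexp α) w φ2 * nrm (bexp α) w φ3)) := by
        gcongr
        refine (nrm_add_le (hM1.add hM2) hM3).trans ?_
        gcongr
        · refine (nrm_add_le hM1 hM2).trans ?_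
          gcongr
          · refine b1.trans ?_
            gcongr
            exacts [hw0 _, hw0 _]
          · refine b2.trans ?_
            gcongr
            exacts [hw0 _, hw0 _]
        · refine b3.trans ?_
          gcongr
          exacts [hw0 _, hw0 _]
    _ = _ := by ring

end

section

/-! ### Fourier truncations and the cubic product -/

open scoped ComplexConjugate

/-- The Fourier truncation to a finite set of frequencies. -/
def trunc (Λ : Finset ℤ) (f : L2) : L2 := ∑ k ∈ Λ, coeff f k • fourierLp (T := 2 * π) 2 k

/-- The trilinear form `(f \bar g h)^` at frequency `k`. -/
def tri (f g h : L2) (k : ℤ) : ℂ := fourierCoeff (fun x : Torus => f x * conj (g x) * h x) k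

lemma cubicCoeff_eq_tri (f : L2) (k : ℤ) : cubicCoeff f k = tri f f f k := by
  unfold cubicCoeff tri
  congr 1
  ext x
  rw [Complex.mul_conj, Complex.normSq_eq_norm_sq]

lemma coeff_eq_repr (f : L2) (k : ℤ) : coeff f k = fourierBasis.repr f k := (fourierBasis_repr f k).symm

@[simp] lemma coeff_add (f g : L2) (k : ℤ) : coeff (f + g) k = coeff f k + coeff g k := by
  simp [coeff_eq_repr]

@[simp] lemma coeff_sub (f g : L2) (k : ℤ) : coeff (f - g) k = coeff f k - coeff g k := by
  simp [coeff_eq_repr]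

@[simp] lemma coeff_smul (c : ℂ) (f : L2) (k : ℤ) : coeff (c • f) k = c * coeff f k := by
  simp [coeff_eq_repr]

@[simp] lemma coeff_zero (k : ℤ) : coeff 0 k = 0 := by
  simp [coeff_eq_repr]

lemma coeff_sum {ι : Type*} (s : Finset ι) (f : ι → L2) (k : ℤ) :
    coeff (∑ i ∈ s, f i) k = ∑ i ∈ s, coeff (f i) k := by
  classical
  induction s using Finset.induction_on with
  | empty => simp
  | insert a s ha ih => rw [Finset.sum_insert ha, Finset.sum_insert ha, coeff_add, ih]

lemma coeff_fourierLp (n k : ℤ) :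
    coeff (fourierLp (T := 2 * π) 2 n) k = if k = n then 1 else 0 := by
  unfold coeff
  rw [fourierCoeff_congr_ae (coeFn_fourierLp 2 n), fourierCoeff_fourier, Pi.single_apply]

lemma coeff_injective {f g : L2} (h : ∀ k, coeff f k = coeff g k) : f = g := by
  apply fourierBasis.repr.injective
  ext k
  rw [← coeff_eq_repr, ← coeff_eq_repr, h]

lemma coeff_trunc (Λ : Finset ℤ) (f : L2) (k : ℤ) :
    coeff (trunc Λ f) k = if k ∈ Λ then coeff f k else 0 := by
  unfold trunc
  rw [coeff_sum]
  simp [coeff_fourierLp]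

lemma trunc_ae (Λ : Finset ℤ) (f : L2) :
    (trunc Λ f : Torus → ℂ) =ᵐ[AddCircle.haarAddCircle]
      fun x => ∑ k ∈ Λ, coeff f k * fourier k x := by
  unfold trunc
  have h1 : ∀ s : Finset ℤ, ((∑ k ∈ s, coeff f k • fourierLp (T := 2 * π) 2 k : L2) : Torus → ℂ)
      =ᵐ[AddCircle.haarAddCircle] fun x => ∑ k ∈ s, coeff f k * fourier k x := by
    intro s
    induction s using Finset.induction_on with
    | empty =>
      simp only [Finset.sum_empty]
      exact Lp.coeFn_zero _ _ _
    | insert a s ha ih =>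
      rw [Finset.sum_insert ha]
      filter_upwards [Lp.coeFn_add (coeff f a • fourierLp (T := 2 * π) 2 a)
        (∑ k ∈ s, coeff f k • fourierLp (T := 2 * π) 2 k), ih,
        Lp.coeFn_smul (coeff f a) (fourierLp (T := 2 * π) 2 a), coeFn_fourierLp (T := 2 * π) 2 a]
        with x h1 h2 h3 h4
      rw [h1, Pi.add_apply, h2, h3, Pi.smul_apply, h4, Finset.sum_insert ha, smul_eq_mul]
  exact h1 Λ

lemma integrable_L2 (f : L2) : Integrable (f : Torus → ℂ) AddCircle.haarAddCircle :=
  (Lp.memLp f).integrable (by norm_num)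

/-- The cubic product with two truncated factors is a finite convolution. -/
lemma tri_trunc (Λ : Finset ℤ) (f g h : L2) (k : ℤ) :
    tri f (trunc Λ g) (trunc Λ h) k =
      ∑ k2 ∈ Λ, ∑ k3 ∈ Λ, coeff f (k + k2 - k3) * conj (coeff g k2) * coeff h k3 := by
  have hae : (fun x : Torus => f x * conj (trunc Λ g x) * trunc Λ h x) =ᵐ[AddCircle.haarAddCircle]
      ∑ k2 ∈ Λ, ∑ k3 ∈ Λ, fun x => (conj (coeff g k2) * coeff h k3) *
        (fourier (k3 - k2) x • f x) := by
    filter_upwards [trunc_ae Λ g, trunc_ae Λ h] with x hg hh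
    rw [hg, hh, map_sum, mul_assoc, Finset.sum_mul_sum, Finset.mul_sum]
    simp only [Finset.sum_apply, Finset.mul_sum]
    refine Finset.sum_congr rfl fun k2 _ => Finset.sum_congr rfl fun k3 _ => ?_
    rw [sub_eq_add_neg, fourier_add, fourier_neg, map_mul, smul_eq_mul]
    ring
  have hint : ∀ k2 k3 : ℤ, Integrable (fun x : Torus => (conj (coeff g k2) * coeff h k3) *
        (fourier (k3 - k2) x • f x)) AddCircle.haarAddCircle :=
    fun k2 k3 => ((integrable_L2 f).fourier_smul _).const_mul _
  unfold tri
  rw [fourierCoeff_congr_ae hae, fourierCoeff.sum _ _ fun k2 _ => by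
    exact integrable_finsetSum' _ fun k3 _ => hint k2 k3]
  rw [Finset.sum_apply]
  refine Finset.sum_congr rfl fun k2 _ => ?_
  rw [fourierCoeff.sum _ _ fun k3 _ => hint k2 k3, Finset.sum_apply]
  refine Finset.sum_congr rfl fun k3 _ => ?_
  rw [fourierCoeff.const_mul]
  have : fourierCoeff (fun x : Torus => fourier (k3 - k2) x • f x) k = coeff f (k + k2 - k3) := by
    unfold coeff fourierCoeff
    congr 1
    ext x
    rw [smul_smul, ← fourier_add]
    rw [show -k + (k3 - k2) = -(k + k2 - k3) by ring]
  rw [this]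
  ring

/-- The fourth power integral. -/
def Q4 (f : L2) : ℝ≥0∞ := ∫⁻ x : Torus, ‖f x‖ₑ ^ 4 ∂AddCircle.haarAddCircle

/-- The `L⁴` norm. -/
def N4 (f : L2) : ℝ≥0∞ := eLpNorm (f : Torus → ℂ) 4 AddCircle.haarAddCircle

lemma N4_pow (f : L2) : N4 f ^ 4 = Q4 f := by
  unfold N4 Q4
  rw [eLpNorm_eq_lintegral_rpow_enorm_toReal (by norm_num) (by norm_num)]
  rw [← ENNReal.rpow_natCast, ← ENNReal.rpow_mul]
  norm_num

lemma N4_add_le (f g : L2) : N4 (f + g) ≤ N4 f + N4 g := by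
  unfold N4
  rw [eLpNorm_congr_ae (Lp.coeFn_add f g)]
  exact eLpNorm_add_le (Lp.aestronglyMeasurable f) (Lp.aestronglyMeasurable g) (by norm_num)

lemma N4_neg (f : L2) : N4 (-f) = N4 f := by
  unfold N4
  rw [eLpNorm_congr_ae (Lp.coeFn_neg f), eLpNorm_neg]

lemma integrable_tri_of_N4 {f g h : L2} (hf : N4 f < ⊤) (hg : N4 g < ⊤) :
    Integrable (fun x : Torus => f x * conj (g x) * h x) AddCircle.haarAddCircle := by
  have h1 : ENNReal.HolderTriple 4 4 2 := ⟨by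
    rw [← ENNReal.toReal_eq_toReal_iff' (by simp) (by simp)]; norm_num [ENNReal.toReal_add]⟩
  have mf : MemLp (f : Torus → ℂ) 4 AddCircle.haarAddCircle := ⟨Lp.aestronglyMeasurable f, hf⟩
  have mg : MemLp (fun x => conj (g x) : Torus → ℂ) 4 AddCircle.haarAddCircle := by
    have : MemLp (g : Torus → ℂ) 4 AddCircle.haarAddCircle := ⟨Lp.aestronglyMeasurable g, hg⟩
    exact this.star
  have mh : MemLp (h : Torus → ℂ) 2 AddCircle.haarAddCircle := Lp.memLp h
  have m1 : MemLp (fun x : Torus => f x * conj (g x)) 2 AddCircle.haarAddCircle := mg.mul mf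
  exact memLp_one_iff_integrable.1 (mh.mul (p := 2) (q := 2) (r := 1) m1)

lemma tri_enorm_le (f g h : L2) (k : ℤ) : ‖tri f g h k‖ₑ ≤ N4 f * N4 g * N4 h := by
  have e1 : ‖tri f g h k‖ₑ ≤ ∫⁻ x : Torus, (‖f x‖ₑ * ‖g x‖ₑ) * ‖h x‖ₑ ∂AddCircle.haarAddCircle := by
    unfold tri fourierCoeff
    refine (enorm_integral_le_lintegral_enorm _).trans (le_of_eq ?_)
    refine lintegral_congr fun x => ?_
    have : ‖(fourier (-k) x : ℂ)‖ₑ = 1 := by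
      rw [fourier_apply, ← ofReal_norm, Circle.norm_coe, ENNReal.ofReal_one]
    rw [enorm_smul, this, one_mul, enorm_mul, enorm_mul, RCLike.enorm_conj]
  have mf := (Lp.aestronglyMeasurable f).enorm
  have mg := (Lp.aestronglyMeasurable g).enorm
  have mh := (Lp.aestronglyMeasurable h).enorm
  refine e1.trans ?_
  have e2 := ENNReal.lintegral_mul_le_Lp_mul_Lq AddCircle.haarAddCircle Real.HolderConjugate.two_two
    (mf.mul mg) mh
  refine e2.trans ?_
  have e3 := ENNReal.lintegral_mul_le_Lp_mul_Lq AddCircle.haarAddCircle Real.HolderConjugate.two_two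
    (mf.pow_const 2) (mg.pow_const 2)
  have e4 : eLpNorm (h : Torus → ℂ) 2 AddCircle.haarAddCircle ≤ N4 h :=
    eLpNorm_le_eLpNorm_of_exponent_le (by norm_num) (Lp.aestronglyMeasurable h)
  have e5 : (∫⁻ x : Torus, ‖h x‖ₑ ^ (2 : ℝ) ∂AddCircle.haarAddCircle) ^ (1 / 2 : ℝ) ≤ N4 h := by
    rw [eLpNorm_eq_lintegral_rpow_enorm_toReal (by norm_num) (by norm_num)] at e4
    simpa using e4
  have e6 : ∀ u : L2, (∫⁻ x : Torus, ((fun x => ‖u x‖ₑ ^ 2) x) ^ (2 : ℝ) ∂AddCircle.haarAddCircle)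
      ^ (1 / 2 : ℝ) = N4 u ^ 2 := by
    intro u
    have : ∀ x, ((fun x => ‖u x‖ₑ ^ 2) x) ^ (2 : ℝ) = ‖u x‖ₑ ^ 4 := by
      intro x; simp only [ENNReal.rpow_ofNat]; ring
    simp_rw [this]
    rw [← Q4, ← N4_pow, ← ENNReal.rpow_natCast, ← ENNReal.rpow_mul, ← ENNReal.rpow_natCast]
    norm_num
  gcongr
  · calc (∫⁻ x : Torus, ((fun x => ‖f x‖ₑ) * fun x => ‖g x‖ₑ) x ^ (2 : ℝ) ∂AddCircle.haarAddCircle)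
          ^ (1 / 2 : ℝ) ≤ (N4 f ^ 2 * N4 g ^ 2) ^ (1 / 2 : ℝ) := by
          rw [← e6 f, ← e6 g]
          refine ENNReal.rpow_le_rpow ?_ (by norm_num)
          refine le_trans (le_of_eq ?_) e3
          refine lintegral_congr fun x => ?_
          simp only [Pi.mul_apply, ENNReal.rpow_ofNat]
          ring
      _ = N4 f * N4 g := by
          rw [← mul_pow, ← ENNReal.rpow_natCast, ← ENNReal.rpow_mul]; norm_num
  
/-- For a trigonometric polynomial `V`, the integral of `|V|⁴` is the pairing of `V` with `|V|² V`.
In this form the trilinear bound will yield an `L⁴` bound. -/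
lemma Q4_trunc (Λ : Finset ℤ) (f : L2) : Q4 (trunc Λ f) < ⊤ ∧
    ∑ k ∈ Λ, conj (coeff f k) * tri (trunc Λ f) (trunc Λ f) (trunc Λ f) k =
      (((Q4 (trunc Λ f)).toReal : ℝ) : ℂ) := by
  set V : Torus → ℂ := fun x => ∑ k ∈ Λ, coeff f k * fourier k x with hV
  have hVc : Continuous V := by
    rw [hV]; fun_prop
  have hae := trunc_ae Λ f
  have hint : Integrable (fun x => ‖V x‖ ^ 4) AddCircle.haarAddCircle :=
    (hVc.norm.pow 4).integrable_of_hasCompactSupport (HasCompactSupport.of_compactSpace _)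
  have hQ : Q4 (trunc Λ f) = ENNReal.ofReal (∫ x, ‖V x‖ ^ 4 ∂AddCircle.haarAddCircle) := by
    rw [ofReal_integral_eq_lintegral_ofReal hint (ae_of_all _ fun x => by positivity)]
    unfold Q4
    refine lintegral_congr_ae ?_
    filter_upwards [hae] with x hx
    rw [hx, ENNReal.ofReal_pow (norm_nonneg _), ofReal_norm]
  refine ⟨by rw [hQ]; exact ENNReal.ofReal_lt_top, ?_⟩
  rw [hQ, ENNReal.toReal_ofReal (integral_nonneg fun x => by positivity), ← integral_complex_ofReal]
  have htri : ∀ k, tri (trunc Λ f) (trunc Λ f) (trunc Λ f) k =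
      fourierCoeff (fun x => V x * conj (V x) * V x) k := by
    intro k
    unfold tri
    rw [fourierCoeff_congr_ae]
    filter_upwards [hae] with x hx
    rw [hx]
  have hint2 : Integrable (fun x => V x * conj (V x) * V x) AddCircle.haarAddCircle :=
    Continuous.integrable_of_hasCompactSupport (by fun_prop) (HasCompactSupport.of_compactSpace _)
  simp_rw [htri]
  unfold fourierCoeff
  simp_rw [← integral_const_mul]
  rw [← integral_finsetSum _ fun k _ => (hint2.fourier_smul (-k)).const_mul _]
  congr 1
  ext x
  have e1 : ∑ k ∈ Λ, conj (coeff f k) * (fourier (-k) x • (V x * conj (V x) * V x)) =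
      conj (V x) * (V x * conj (V x) * V x) := by
    rw [hV]
    simp only [map_sum, map_mul, Finset.sum_mul, fourier_neg, smul_eq_mul]
    refine Finset.sum_congr rfl fun k _ => by ring
  rw [e1]
  have e2 : V x * conj (V x) = ((‖V x‖ ^ 2 : ℝ) : ℂ) := by
    rw [Complex.mul_conj, Complex.normSq_eq_norm_sq]
  calc conj (V x) * (V x * conj (V x) * V x) = (V x * conj (V x)) * (V x * conj (V x)) := by ring
    _ = _ := by rw [e2]; push_cast; ring

/-- The symmetric frequency window. -/
def window (n : ℕ) : Finset ℤ := Finset.Icc (-(n : ℤ)) n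

lemma trunc_tendsto (f : L2) : Tendsto (fun n => trunc (window n) f) atTop (𝓝 f) := by
  have h := hasSum_fourier_series_L2 f
  have hw : Tendsto window atTop atTop := by
    refine tendsto_atTop_finset_of_monotone ?_ ?_
    · intro m n hmn
      exact Finset.Icc_subset_Icc (by simpa using hmn) (by simpa using hmn)
    · intro k
      exact ⟨k.natAbs, by simp only [window, Finset.mem_Icc]; omega⟩
  exact h.comp hw

/-- The partial sums converge in `L²`, hence almost everywhere along a subsequence, and Fatou's
lemma applies. The subsequence is taken among indices where the quartic integral is below a number
exceeding the lower limit. -/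
lemma Q4_sub_trunc_le (f : L2) (Λ : Finset ℤ) :
    Q4 (f - trunc Λ f) ≤ liminf (fun m => Q4 (trunc (window m \ Λ) f)) atTop := by
  refine le_of_forall_gt_imp_ge_of_dense fun c hc => ?_
  have hfreq : ∃ᶠ m in atTop, Q4 (trunc (window m \ Λ) f) < c := frequently_lt_of_liminf_lt (by isBoundedDefault) hc
  obtain ⟨φ, hφ, hφc⟩ := extraction_of_frequently_atTop hfreq
  have hsub : ∀ᶠ m in atTop, trunc (window m \ Λ) f = trunc (window m) f - trunc Λ f := by
    obtain ⟨n, hn⟩ : ∃ n, ∀ k ∈ Λ, k ∈ window n := by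
      refine ⟨Λ.sup Int.natAbs, fun k hk => ?_⟩
      have := Finset.le_sup (f := Int.natAbs) hk
      simp only [window, Finset.mem_Icc]; omega
    filter_upwards [eventually_ge_atTop n] with m hm
    apply coeff_injective
    intro k
    simp only [coeff_sub, coeff_trunc, Finset.mem_sdiff]
    have : k ∈ Λ → k ∈ window m := fun hk => by
      have := hn k hk
      simp only [window, Finset.mem_Icc] at this ⊢; omega
    by_cases h1 : k ∈ Λ
    · simp [h1, this h1]
    · simp [h1]
  have hlim : Tendsto (fun m => trunc (window (φ m) \ Λ) f) atTop (𝓝 (f - trunc Λ f)) := by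
    refine Tendsto.congr' ?_ (((trunc_tendsto f).comp hφ.tendsto_atTop).sub_const (trunc Λ f))
    filter_upwards [hφ.tendsto_atTop.eventually hsub] with m hm
    rw [hm]; rfl
  have hmeas := tendstoInMeasure_of_tendsto_Lp hlim
  obtain ⟨ψ, hψ, hψae⟩ := hmeas.exists_seq_tendsto_ae
  have h4 := Lp.eLpNorm_lim_le_liminf_eLpNorm (p := 4) (μ := AddCircle.haarAddCircle)
    (f := fun n => (trunc (window (φ (ψ n)) \ Λ) f : Torus → ℂ))
    (fun n => Lp.aestronglyMeasurable _) _ hψae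
  have h5 : N4 (f - trunc Λ f) ≤ c ^ (1 / 4 : ℝ) := by
    refine h4.trans ?_
    refine liminf_le_of_frequently_le' (Eventually.of_forall fun n => ?_).frequently
    have : N4 (trunc (window (φ (ψ n)) \ Λ) f) ^ 4 ≤ c := by rw [N4_pow]; exact (hφc _).le
    have := ENNReal.rpow_le_rpow this (by norm_num : (0 : ℝ) ≤ 1 / 4)
    rw [← ENNReal.rpow_natCast, ← ENNReal.rpow_mul] at this
    norm_num at this
    simpa [N4] using this
  calc Q4 (f - trunc Λ f) = N4 (f - trunc Λ f) ^ 4 := (N4_pow _).symm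
    _ ≤ (c ^ (1 / 4 : ℝ)) ^ 4 := by gcongr
    _ = c := by rw [← ENNReal.rpow_natCast, ← ENNReal.rpow_mul]; norm_num

end

section

open scoped ComplexConjugate

/-! ### Oscillatory integrals in time -/

/-- The character `e^{ix}`. -/
def ex (x : ℝ) : ℂ := Complex.exp (Complex.I * (x : ℂ))

lemma ex_add (x y : ℝ) : ex (x + y) = ex x * ex y := by
  unfold ex; rw [← Complex.exp_add]; push_cast; ring_nf

@[simp] lemma ex_zero : ex 0 = 1 := by simp [ex]

@[simp] lemma norm_ex (x : ℝ) : ‖ex x‖ = 1 := by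
  unfold ex; rw [mul_comm]; exact Complex.norm_exp_ofReal_mul_I x

@[simp] lemma enorm_ex (x : ℝ) : ‖ex x‖ₑ = 1 := by
  rw [← ofReal_norm, norm_ex, ENNReal.ofReal_one]

lemma conj_ex (x : ℝ) : conj (ex x) = ex (-x) := by
  unfold ex; rw [← Complex.exp_conj]; simp

@[fun_prop] lemma continuous_ex : Continuous ex := by unfold ex; fun_prop

@[fun_prop] lemma measurable_ex : Measurable ex := continuous_ex.measurable

lemma ex_ne_zero (x : ℝ) : ex x ≠ 0 := Complex.exp_ne_zero _

lemma ex_neg_mul (x : ℝ) : ex (-x) * ex x = 1 := by rw [← ex_add]; simp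

/-- The gain from time localization. -/
def tfac (α δ : ℝ) : ℝ≥0∞ := ENNReal.ofReal (8 * (δ ^ eps α + δ))

lemma hasDerivAt_ex (c t : ℝ) : HasDerivAt (fun t : ℝ => ex (c * t)) (Complex.I * c * ex (c * t)) t := by
  unfold ex
  have h : HasDerivAt (fun t : ℝ => Complex.I * ((c * t : ℝ) : ℂ)) (Complex.I * c) t := by
    have := ((hasDerivAt_id t).const_mul c).ofReal_comp.const_mul Complex.I
    simpa using this
  exact h.cexp.congr_deriv (by ring)

lemma norm_integral_ex_le (x : ℝ) {t0 t1 : ℝ} (h : t0 ≤ t1) :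
    ‖∫ t in t0..t1, ex (x * t)‖ ≤ t1 - t0 ∧ |x| * ‖∫ t in t0..t1, ex (x * t)‖ ≤ 2 := by
  constructor
  · have := intervalIntegral.norm_integral_le_of_norm_le_const (a := t0) (b := t1) (C := 1)
      (f := fun t => ex (x * t)) (fun t _ => by simp)
    rwa [one_mul, abs_of_nonneg (by linarith)] at this
  · have h1 : ∫ t in t0..t1, Complex.I * x * ex (x * t) = ex (x * t1) - ex (x * t0) := by
      refine intervalIntegral.integral_eq_sub_of_hasDerivAt (fun t _ => hasDerivAt_ex x t) ?_
      exact Continuous.intervalIntegrable (by fun_prop) _ _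
    rw [intervalIntegral.integral_const_mul] at h1
    have h2 := congrArg norm h1
    rw [norm_mul, norm_mul, Complex.norm_I, one_mul, Complex.norm_real, Real.norm_eq_abs] at h2
    rw [h2]
    refine (norm_sub_le _ _).trans ?_
    simp; norm_num

/-- The integral `K` satisfies `|K| ≤ δ` and `|x| |K| ≤ 2`. For `|x| ≥ 1`, writing `|K| = |K|^ε
|K|^{1-ε}` and using one bound on each factor trades a loss `ε` in the decay for the gain `δ^ε`. For
`|x| ≤ 1` the first bound suffices. -/
lemma kernel_bound {α : ℝ} (hα : 1 / 2 < α) (hα1 : α < 1) (x : ℝ) {t0 t1 : ℝ} (h : t0 ≤ t1) :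
    ‖∫ t in t0..t1, ex (x * t)‖ₑ ≤ tfac α (t1 - t0) * jp (-qexp α) x := by
  have he := eps_pos hα
  have he' := eps_lt hα hα1
  obtain ⟨h1, h2⟩ := norm_integral_ex_le x h
  set K := ‖∫ t in t0..t1, ex (x * t)‖ with hK
  have hK0 : 0 ≤ K := norm_nonneg _
  set δ := t1 - t0
  have hδ : 0 ≤ δ := hK0.trans h1
  rw [← ofReal_norm, tfac, jp, ← ENNReal.ofReal_mul (by positivity)]
  refine ENNReal.ofReal_le_ofReal ?_
  have hq0 : 0 < qexp α := by unfold qexp; linarith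
  have hq1 : qexp α ≤ 1 := by unfold qexp; linarith
  have hJ : (1 + |x|) ^ (-qexp α) = ((1 + |x|) ^ qexp α)⁻¹ := Real.rpow_neg (by positivity) _
  have hpos : 0 < (1 + |x|) ^ qexp α := by positivity
  have hδe : 0 ≤ δ ^ eps α := by positivity
  rw [hJ, ← div_eq_mul_inv, le_div_iff₀ hpos]
  rcases le_total |x| 1 with hx | hx
  · have : (1 + |x|) ^ qexp α ≤ 2 := by
      calc _ ≤ (2 : ℝ) ^ qexp α := Real.rpow_le_rpow (by positivity) (by linarith) hq0.le
        _ ≤ (2 : ℝ) ^ (1 : ℝ) := Real.rpow_le_rpow_of_exponent_le (by norm_num) hq1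
        _ = 2 := Real.rpow_one 2
    nlinarith
  · have e1 : K * (1 + |x|) ≤ 4 := by nlinarith
    calc K * (1 + |x|) ^ qexp α = K ^ (eps α + qexp α) * (1 + |x|) ^ qexp α := by
          unfold qexp; rw [add_sub_cancel, Real.rpow_one]
      _ = K ^ eps α * (K * (1 + |x|)) ^ qexp α := by
          rw [Real.rpow_add_of_nonneg hK0 he.le hq0.le, Real.mul_rpow hK0 (by positivity)]; ring
      _ ≤ δ ^ eps α * 4 ^ (1 : ℝ) := by
          gcongr
          calc (K * (1 + |x|)) ^ qexp α ≤ 4 ^ qexp α := Real.rpow_le_rpow (by positivity) e1 hq0.le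
            _ ≤ 4 ^ (1 : ℝ) := Real.rpow_le_rpow_of_exponent_le (by norm_num) hq1
      _ ≤ _ := by rw [Real.rpow_one]; nlinarith

/-- A superposition of time oscillations. -/
def wave (g : ℝ → ℂ) (t : ℝ) : ℂ := ∫ τ, g τ * ex (t * τ)

lemma continuous_wave {g : ℝ → ℂ} (hg : Integrable g) : Continuous (wave g) := by
  unfold wave
  refine continuous_of_dominated (bound := fun τ => ‖g τ‖) (fun t => ?_) (fun t => ?_) hg.norm ?_
  · exact hg.aestronglyMeasurable.mul (by fun_prop)
  · exact ae_of_all _ fun τ => by simp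
  · exact ae_of_all _ fun τ => by fun_prop

lemma conj_wave (g : ℝ → ℂ) (t : ℝ) : conj (wave g t) = ∫ τ, conj (g τ) * ex (-1 * (t * τ)) := by
  unfold wave
  rw [← integral_conj]
  congr 1; ext τ
  rw [map_mul, conj_ex, neg_one_mul]

lemma integral_wave_mul {g : ℝ → ℂ} (hg : Integrable g) {H : ℝ → ℂ} {t0 t1 : ℝ} (h : t0 ≤ t1)
    (hH : IntervalIntegrable H volume t0 t1) (σ : ℝ) :
    ∫ t in t0..t1, (∫ τ, g τ * ex (σ * (t * τ))) * H t =
      ∫ τ, g τ * ∫ t in t0..t1, ex (σ * (t * τ)) * H t := by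
  rw [intervalIntegral.integral_of_le h]
  simp_rw [intervalIntegral.integral_of_le h, ← integral_mul_const, ← integral_const_mul]
  rw [integral_integral_swap]
  · refine integral_congr_ae (ae_of_all _ fun τ => ?_)
    refine integral_congr_ae (ae_of_all _ fun t => ?_)
    simp only; ring
  · have h1 : Integrable (fun p : ℝ × ℝ => H p.1 * g p.2) ((volume.restrict (Ioc t0 t1)).prod volume) :=
      ((intervalIntegrable_iff_integrableOn_Ioc_of_le h).1 hH).mul_prod hg
    have h2 : Integrable (fun p : ℝ × ℝ => ex (σ * (p.1 * p.2)) * (H p.1 * g p.2))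
        ((volume.restrict (Ioc t0 t1)).prod volume) :=
      h1.bdd_mul (c := 1) (by fun_prop) (ae_of_all _ fun p => by simp)
    refine h2.congr (ae_of_all _ fun p => ?_)
    simp only [Function.uncurry]; ring

lemma enorm_integral_wave_mul_le {g : ℝ → ℂ} (hg : Integrable g) {H : ℝ → ℂ} {t0 t1 : ℝ} (h : t0 ≤ t1)
    (hH : IntervalIntegrable H volume t0 t1) (σ : ℝ) :
    ‖∫ t in t0..t1, (∫ τ, g τ * ex (σ * (t * τ))) * H t‖ₑ ≤
      ∫⁻ τ, ‖g τ‖ₑ * ‖∫ t in t0..t1, ex (σ * (t * τ)) * H t‖ₑ := by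
  rw [integral_wave_mul hg h hH]
  refine (enorm_integral_le_lintegral_enorm _).trans (le_of_eq ?_)
  simp_rw [enorm_mul]

/-- Fubini takes the three densities out of the time integral one at a time. What remains is the
integral of a single character, bounded by `kernel_bound`. -/
lemma triple_wave_le {α : ℝ} (hα : 1 / 2 < α) (hα1 : α < 1) {g1 g2 g3 : ℝ → ℂ} (h1 : Integrable g1)
    (h2 : Integrable g2) (h3 : Integrable g3) {t0 t1 : ℝ} (h : t0 ≤ t1) (y : ℝ) :
    ‖∫ t in t0..t1, ex (-(t * y)) * (wave g1 t * conj (wave g2 t) * wave g3 t)‖ₑ ≤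
      ∫⁻ τ2, ∫⁻ τ3, ∫⁻ τ1, ‖g2 τ2‖ₑ * (‖g3 τ3‖ₑ * (‖g1 τ1‖ₑ *
        (tfac α (t1 - t0) * jp (-qexp α) (y - τ1 + τ2 - τ3)))) := by
  have c1 := continuous_wave h1
  have c3 := continuous_wave h3
  have e1 : ∀ t, ex (-(t * y)) * (wave g1 t * conj (wave g2 t) * wave g3 t) =
      (∫ τ, conj (g2 τ) * ex (-1 * (t * τ))) * (wave g3 t * (wave g1 t * ex (-(t * y)))) := by
    intro t; rw [← conj_wave]; ring
  simp_rw [e1]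
  refine (enorm_integral_wave_mul_le (g := fun τ => conj (g2 τ)) (by
    simpa using (LinearIsometryEquiv.integrable_comp_iff Complex.conjLIE).2 h2) h
    (Continuous.intervalIntegrable (by fun_prop) _ _) (-1)).trans ?_
  refine lintegral_mono fun τ2 => ?_
  rw [RCLike.enorm_conj, lintegral_congr (fun τ3 => lintegral_const_mul' _ _ enorm_ne_top),
    lintegral_const_mul' _ _ enorm_ne_top]
  gcongr
  have e2 : ∀ t, ex (-1 * (t * τ2)) * (wave g3 t * (wave g1 t * ex (-(t * y)))) =
      (∫ τ, g3 τ * ex (1 * (t * τ))) * (wave g1 t * (ex (-1 * (t * τ2)) * ex (-(t * y)))) := by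
    intro t; simp only [one_mul]; rw [← wave]; ring
  simp_rw [e2]
  refine (enorm_integral_wave_mul_le h3 h
    (Continuous.intervalIntegrable (by fun_prop) _ _) 1).trans ?_
  refine lintegral_mono fun τ3 => ?_
  rw [lintegral_const_mul' _ _ enorm_ne_top]
  gcongr
  have e3 : ∀ t, ex (1 * (t * τ3)) * (wave g1 t * (ex (-1 * (t * τ2)) * ex (-(t * y)))) =
      (∫ τ, g1 τ * ex (1 * (t * τ))) * (ex (1 * (t * τ3)) * (ex (-1 * (t * τ2)) * ex (-(t * y)))) := by
    intro t; simp only [one_mul]; rw [← wave]; ring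
  simp_rw [e3]
  refine (enorm_integral_wave_mul_le h1 h
    (Continuous.intervalIntegrable (by fun_prop) _ _) 1).trans ?_
  refine lintegral_mono fun τ1 => ?_
  gcongr
  have e4 : ∀ t, ex (1 * (t * τ1)) * (ex (1 * (t * τ3)) * (ex (-1 * (t * τ2)) * ex (-(t * y)))) =
      ex (-(y - τ1 + τ2 - τ3) * t) := by
    intro t; simp only [← ex_add]; congr 1; ring
  simp_rw [e4]
  refine (kernel_bound hα hα1 _ h).trans (le_of_eq ?_)
  simp only [jp, abs_neg]

/-! ### Space-time representations -/

/-- On `[t0, t1]` the interaction coefficients of `u` are superpositions of oscillations with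
density `f`. -/
structure Rep (α t0 t1 : ℝ) (u : ℝ → L2) (f : ℤ × ℝ → ℂ) : Prop where
  meas : Measurable f
  eq : ∀ k, ∀ t ∈ Icc t0 t1, ex (-(t * symbol α k)) * coeff (u t) k = wave (fun τ => f (k, τ)) t

/-- The absolute value of a density. -/
def absn (f : ℤ × ℝ → ℂ) (z : ℤ × ℝ) : ℝ≥0∞ := ‖f z‖ₑ

/-- The weighted `ℓ²` norm of a sequence. -/
def wn (w : ℤ → ℝ≥0∞) (a : ℤ → ℝ≥0∞) : ℝ≥0∞ := (∑' k, (w k * a k) ^ 2) ^ (1 / 2 : ℝ)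

lemma measurable_absn {f : ℤ × ℝ → ℂ} (hf : Measurable f) : Measurable (absn f) := hf.enorm

lemma sqNorm_eq_tsum {r : ℝ} {w : ℤ → ℝ≥0∞} {φ : ℤ × ℝ → ℝ≥0∞} (hφ : Measurable φ) :
    sqNorm r w φ = ∑' k, w k ^ 2 * ∫⁻ τ, (jp r τ * φ (k, τ)) ^ 2 := by
  have hw : Measurable w := Measurable.of_discrete
  unfold sqNorm
  rw [lintegral_freqMeasure (by fun_prop)]
  refine tsum_congr fun k => ?_
  rw [← lintegral_const_mul _ (by fun_prop)]
  refine lintegral_congr fun τ => ?_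
  simp only; ring

lemma row_lintegral_sq_le (α : ℝ) {φ : ℝ → ℝ≥0∞} (hφ : Measurable φ) :
    (∫⁻ τ, φ τ) ^ 2 ≤ (∫⁻ τ, jp (-(2 * bexp α)) τ) * ∫⁻ τ, (jp (bexp α) τ * φ τ) ^ 2 := by
  have h := lintegral_mul_sq_le volume (P := jp (-bexp α)) (Q := fun τ => jp (bexp α) τ * φ τ)
    (by fun_prop) (by fun_prop)
  have e1 : ∀ τ, jp (-bexp α) τ * (jp (bexp α) τ * φ τ) = φ τ := by
    intro τ; rw [← mul_assoc, jp_neg_mul, one_mul]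
  simp only [e1, jp_sq, mul_neg] at h
  exact h

lemma lintegral_jp_bexp {α : ℝ} (hα : 1 / 2 < α) : ∫⁻ τ, jp (-(2 * bexp α)) τ ≠ ⊤ :=
  (lintegral_jp_lt_top (by have := half_lt_bexp hα; linarith)).ne

/-- Cauchy–Schwarz in `τ` against `(1+|τ|)^{-b}`. For `b > 1/2` the constant is finite, and this is
the embedding of `X^{s,b}` into bounded functions of time with values in `H^s`. -/
lemma wn_row_le (α : ℝ) (w : ℤ → ℝ≥0∞) {φ : ℤ × ℝ → ℝ≥0∞} (hφ : Measurable φ) :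
    wn w (fun k => ∫⁻ τ, φ (k, τ)) ≤
      (∫⁻ τ, jp (-(2 * bexp α)) τ) ^ (1 / 2 : ℝ) * nrm (bexp α) w φ := by
  unfold wn nrm
  rw [← ENNReal.mul_rpow_of_nonneg _ _ (by norm_num), sqNorm_eq_tsum hφ, ← ENNReal.tsum_mul_left]
  refine ENNReal.rpow_le_rpow (ENNReal.tsum_le_tsum fun k => ?_) (by norm_num)
  rw [mul_pow]
  have := row_lintegral_sq_le α (φ := fun τ => φ (k, τ)) (by fun_prop)
  calc _ ≤ w k ^ 2 * ((∫⁻ τ, jp (-(2 * bexp α)) τ) * ∫⁻ τ, (jp (bexp α) τ * φ (k, τ)) ^ 2) := by gcongr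
    _ = _ := by ring

lemma le_wn (w a : ℤ → ℝ≥0∞) (k : ℤ) : w k * a k ≤ wn w a := by
  unfold wn
  calc w k * a k = ((w k * a k) ^ 2) ^ (1 / 2 : ℝ) := by
        rw [← ENNReal.rpow_natCast, ← ENNReal.rpow_mul]; norm_num
    _ ≤ _ := ENNReal.rpow_le_rpow (ENNReal.le_tsum k) (by norm_num)

lemma integrable_row {α : ℝ} (hα : 1 / 2 < α) {w : ℤ → ℝ≥0∞} (hw : 1 ≤ w) {f : ℤ × ℝ → ℂ}
    (hf : Measurable f) (h : nrm (bexp α) w (absn f) < ⊤) (k : ℤ) : Integrable (fun τ => f (k, τ)) := by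
  refine ⟨(hf.comp (by fun_prop)).aestronglyMeasurable, ?_⟩
  have h1 := wn_row_le α w (measurable_absn hf)
  have h2 := le_wn w (fun k => ∫⁻ τ, absn f (k, τ)) k
  have h3 : ∫⁻ τ, absn f (k, τ) ≤ w k * ∫⁻ τ, absn f (k, τ) := le_mul_of_one_le_left (zero_le) (hw k)
  exact (h3.trans (h2.trans h1)).trans_lt
    (ENNReal.mul_lt_top (ENNReal.rpow_lt_top_of_nonneg (by norm_num) (lintegral_jp_bexp hα)) h)

end

/-! ### The time Fourier transform of the cubic term and the `L⁴` Strichartz estimate. -/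

section

open scoped ComplexConjugate

/-- The time Fourier transform over `[t0, t1]` of the cubic product, in the interaction picture. -/
def osc (α t0 t1 : ℝ) (u1 u2 u3 : ℝ → L2) (z : ℤ × ℝ) : ℂ :=
  ∫ t in t0..t1, ex (-(t * (z.2 + symbol α z.1))) * tri (u1 t) (u2 t) (u3 t) z.1

/-- The restriction of a density to a finite set of frequencies. -/
def cut (Λ : Set ℤ) (φ : ℤ × ℝ → ℝ≥0∞) (z : ℤ × ℝ) : ℝ≥0∞ := (Prod.fst ⁻¹' Λ).indicator φ z

lemma measurable_cut (Λ : Set ℤ) {φ : ℤ × ℝ → ℝ≥0∞} (hφ : Measurable φ) : Measurable (cut Λ φ) :=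
  hφ.indicator (measurable_fst (MeasurableSet.of_discrete))

lemma cut_le (Λ : Set ℤ) (φ : ℤ × ℝ → ℝ≥0∞) : cut Λ φ ≤ φ := fun z => indicator_le_self _ _ z

variable {α t0 t1 : ℝ} {u u1 u2 u3 : ℝ → L2} {f f1 f2 f3 : ℤ × ℝ → ℂ}

lemma Rep.coeff_eq (h : Rep α t0 t1 u f) (k : ℤ) {t : ℝ} (ht : t ∈ Icc t0 t1) :
    coeff (u t) k = ex (t * symbol α k) * wave (fun τ => f (k, τ)) t := by
  rw [← h.eq k t ht, ← mul_assoc, mul_comm (ex _), ex_neg_mul, one_mul]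

lemma tri_trunc_eq_wave (h1 : Rep α t0 t1 u1 f1) (h2 : Rep α t0 t1 u2 f2) (h3 : Rep α t0 t1 u3 f3)
    (Λ : Finset ℤ) (k : ℤ) {t : ℝ} (ht : t ∈ Icc t0 t1) (τ : ℝ) :
    ex (-(t * (τ + symbol α k))) * tri (u1 t) (trunc Λ (u2 t)) (trunc Λ (u3 t)) k =
      ∑ k2 ∈ Λ, ∑ k3 ∈ Λ,
        ex (-(t * (τ + symbol α k - symbol α (k + k2 - k3) + symbol α k2 - symbol α k3))) *
        (wave (fun τ => f1 (k + k2 - k3, τ)) t * conj (wave (fun τ => f2 (k2, τ)) t) *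
          wave (fun τ => f3 (k3, τ)) t) := by
  rw [tri_trunc, Finset.mul_sum]
  refine Finset.sum_congr rfl fun k2 _ => ?_
  rw [Finset.mul_sum]
  refine Finset.sum_congr rfl fun k3 _ => ?_
  rw [h1.coeff_eq _ ht, h2.coeff_eq _ ht, h3.coeff_eq _ ht, map_mul, conj_ex]
  have : ex (-(t * (τ + symbol α k - symbol α (k + k2 - k3) + symbol α k2 - symbol α k3))) =
      ex (-(t * (τ + symbol α k))) * ex (t * symbol α (k + k2 - k3)) * ex (-(t * symbol α k2)) *
        ex (t * symbol α k3) := by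
    simp only [← ex_add]; congr 1; ring
  rw [this]
  ring

/-- Truncating the second and third factors makes the convolution a finite sum, since the frequency
of the first factor is then determined. Summation and time integration commute, and `triple_wave_le`
treats each term. -/
lemma osc_trunc_le (hα : 1 / 2 < α) (hα1 : α < 1) (ht : t0 ≤ t1)
    (h1 : Rep α t0 t1 u1 f1) (h2 : Rep α t0 t1 u2 f2) (h3 : Rep α t0 t1 u3 f3)
    (i1 : ∀ k, Integrable (fun τ => f1 (k, τ))) (i2 : ∀ k, Integrable (fun τ => f2 (k, τ)))
    (i3 : ∀ k, Integrable (fun τ => f3 (k, τ))) (Λ : Finset ℤ) (z : ℤ × ℝ) :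
    ‖osc α t0 t1 u1 (fun t => trunc Λ (u2 t)) (fun t => trunc Λ (u3 t)) z‖ₑ ≤
      tfac α (t1 - t0) * majorant α 1 (absn f1) (cut Λ (absn f2)) (cut Λ (absn f3)) z := by
  have m1 := measurable_absn h1.meas
  have m2 := measurable_cut Λ (measurable_absn h2.meas)
  have m3 := measurable_cut Λ (measurable_absn h3.meas)
  obtain ⟨k, τ⟩ := z
  have e1 : osc α t0 t1 u1 (fun t => trunc Λ (u2 t)) (fun t => trunc Λ (u3 t)) (k, τ) =
      ∑ k2 ∈ Λ, ∑ k3 ∈ Λ, ∫ t in t0..t1,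
        ex (-(t * (τ + symbol α k - symbol α (k + k2 - k3) + symbol α k2 - symbol α k3))) *
        (wave (fun τ => f1 (k + k2 - k3, τ)) t * conj (wave (fun τ => f2 (k2, τ)) t) *
          wave (fun τ => f3 (k3, τ)) t) := by
    have hc : ∀ k2 k3, Continuous fun t : ℝ =>
        ex (-(t * (τ + symbol α k - symbol α (k + k2 - k3) + symbol α k2 - symbol α k3))) *
        (wave (fun τ => f1 (k + k2 - k3, τ)) t * conj (wave (fun τ => f2 (k2, τ)) t) *
          wave (fun τ => f3 (k3, τ)) t) := by
      intro k2 k3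
      have c1 := continuous_wave (i1 (k + k2 - k3))
      have c2 := continuous_wave (i2 k2)
      have c3 := continuous_wave (i3 k3)
      have c2' : Continuous fun t => conj (wave (fun τ => f2 (k2, τ)) t) :=
        Complex.continuous_conj.comp c2
      fun_prop
    unfold osc
    rw [intervalIntegral.integral_congr (g := fun t => ∑ k2 ∈ Λ, ∑ k3 ∈ Λ,
        ex (-(t * (τ + symbol α k - symbol α (k + k2 - k3) + symbol α k2 - symbol α k3))) *
        (wave (fun τ => f1 (k + k2 - k3, τ)) t * conj (wave (fun τ => f2 (k2, τ)) t) *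
          wave (fun τ => f3 (k3, τ)) t))
      (fun t htt => by
        rw [uIcc_of_le ht] at htt
        exact tri_trunc_eq_wave h1 h2 h3 Λ k htt τ)]
    rw [intervalIntegral.integral_finsetSum fun k2 _ =>
      (continuous_finsetSum _ fun k3 _ => hc k2 k3).intervalIntegrable _ _]
    refine Finset.sum_congr rfl fun k2 _ => ?_
    rw [intervalIntegral.integral_finsetSum fun k3 _ => (hc k2 k3).intervalIntegrable _ _]
  rw [e1]
  have e2 : tfac α (t1 - t0) * majorant α 1 (absn f1) (cut Λ (absn f2)) (cut Λ (absn f3)) (k, τ) =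
      ∑' k2, ∑' k3, ∫⁻ τ2, ∫⁻ τ3, ∫⁻ τ1, cut Λ (absn f2) (k2, τ2) * (cut Λ (absn f3) (k3, τ3) *
        (absn f1 (k + k2 - k3, τ1) * (tfac α (t1 - t0) * jp (-qexp α)
          (τ + symbol α k - symbol α (k + k2 - k3) + symbol α k2 - symbol α k3 - τ1 + τ2 - τ3)))) := by
    have htf : tfac α (t1 - t0) ≠ ⊤ := ENNReal.ofReal_ne_top
    unfold majorant phase
    rw [lintegral_freqMeasure (by fun_prop), ← ENNReal.tsum_mul_left]
    refine tsum_congr fun k2 => ?_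
    rw [← lintegral_const_mul' _ _ htf, ← lintegral_tsum (fun k3 => by fun_prop)]
    refine lintegral_congr fun τ2 => ?_
    rw [lintegral_freqMeasure (by fun_prop), ← ENNReal.tsum_mul_left]
    refine tsum_congr fun k3 => ?_
    rw [← lintegral_const_mul' _ _ htf]
    refine lintegral_congr fun τ3 => ?_
    rw [← lintegral_const_mul' _ _ htf]
    refine lintegral_congr fun τ1 => ?_
    simp only [Pi.one_apply]
    ring
  rw [e2]
  calc _ ≤ ∑ k2 ∈ Λ, ‖∑ k3 ∈ Λ, ∫ t in t0..t1,
        ex (-(t * (τ + symbol α k - symbol α (k + k2 - k3) + symbol α k2 - symbol α k3))) *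
        (wave (fun τ => f1 (k + k2 - k3, τ)) t * conj (wave (fun τ => f2 (k2, τ)) t) *
          wave (fun τ => f3 (k3, τ)) t)‖ₑ := enorm_sum_le _ _
    _ ≤ ∑ k2 ∈ Λ, ∑ k3 ∈ Λ, ‖∫ t in t0..t1,
        ex (-(t * (τ + symbol α k - symbol α (k + k2 - k3) + symbol α k2 - symbol α k3))) *
        (wave (fun τ => f1 (k + k2 - k3, τ)) t * conj (wave (fun τ => f2 (k2, τ)) t) *
          wave (fun τ => f3 (k3, τ)) t)‖ₑ := Finset.sum_le_sum fun k2 _ => enorm_sum_le _ _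
    _ ≤ ∑ k2 ∈ Λ, ∑ k3 ∈ Λ, ∫⁻ τ2, ∫⁻ τ3, ∫⁻ τ1, cut Λ (absn f2) (k2, τ2) * (cut Λ (absn f3) (k3, τ3) *
        (absn f1 (k + k2 - k3, τ1) * (tfac α (t1 - t0) * jp (-qexp α)
          (τ + symbol α k - symbol α (k + k2 - k3) + symbol α k2 - symbol α k3 - τ1 + τ2 - τ3)))) := by
        refine Finset.sum_le_sum fun k2 hk2 => Finset.sum_le_sum fun k3 hk3 => ?_
        refine (triple_wave_le hα hα1 (i1 _) (i2 _) (i3 _) ht _).trans (le_of_eq ?_)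
        refine lintegral_congr fun τ2 => lintegral_congr fun τ3 => lintegral_congr fun τ1 => ?_
        have c2 : cut Λ (absn f2) (k2, τ2) = ‖f2 (k2, τ2)‖ₑ := indicator_of_mem (by simpa using hk2) _
        have c3 : cut Λ (absn f3) (k3, τ3) = ‖f3 (k3, τ3)‖ₑ := indicator_of_mem (by simpa using hk3) _
        rw [c2, c3, absn]
    _ ≤ _ := (Finset.sum_le_sum fun k2 _ => ENNReal.sum_le_tsum Λ).trans (ENNReal.sum_le_tsum Λ)

lemma Rep.trunc (h : Rep α t0 t1 u f) (Λ : Finset ℤ) : Rep α t0 t1 (fun t => trunc Λ (u t))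
    ((Prod.fst ⁻¹' (Λ : Set ℤ)).indicator f) where
  meas := h.meas.indicator (measurable_fst MeasurableSet.of_discrete)
  eq k t ht := by
    rw [coeff_trunc]
    by_cases hk : k ∈ Λ
    · rw [if_pos hk, h.eq k t ht]
      congr 1; ext τ
      rw [indicator_of_mem (by simpa using hk)]
    · rw [if_neg hk, mul_zero]
      unfold wave
      have : ∀ τ, (Prod.fst ⁻¹' (Λ : Set ℤ)).indicator f (k, τ) = 0 :=
        fun τ => indicator_of_notMem (by simpa using hk) _
      simp [this]

lemma absn_indicator (Λ : Set ℤ) (f : ℤ × ℝ → ℂ) :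
    absn ((Prod.fst ⁻¹' Λ).indicator f) = cut Λ (absn f) := by
  ext z
  exact enorm_indicator_eq_indicator_enorm _ _

lemma cut_cut (Λ : Set ℤ) (φ : ℤ × ℝ → ℝ≥0∞) : cut Λ (cut Λ φ) = cut Λ φ := by
  ext z; unfold cut; simp [indicator_indicator]

lemma trunc_trunc (Λ : Finset ℤ) (g : L2) : FracNLS.trunc Λ (FracNLS.trunc Λ g) = FracNLS.trunc Λ g := by
  apply coeff_injective
  intro k
  simp only [coeff_trunc]
  split_ifs <;> rfl

/-- The `L⁴` Strichartz estimate for truncations. -/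
lemma lintegral_Q4_trunc_le (hα : 1 / 2 < α) (hα1 : α < 1) : ∃ C : ℝ≥0∞, C ≠ ⊤ ∧
    ∀ (t0 t1 : ℝ) (u : ℝ → L2) (f : ℤ × ℝ → ℂ), t0 ≤ t1 → Rep α t0 t1 u f →
      nrm (bexp α) (w0 α) (absn f) < ⊤ → ∀ Λ : Finset ℤ,
      ∫⁻ t in Icc t0 t1, Q4 (FracNLS.trunc Λ (u t)) ≤
        C * tfac α (t1 - t0) * nrm (bexp α) (w0 α) (cut Λ (absn f)) ^ 4 := by
  obtain ⟨C, hC, hmaj⟩ := majorant_triWeight hα hα1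
  refine ⟨C, hC, fun t0 t1 u f ht hR hfin Λ => ?_⟩
  have he := eps_pos hα
  have he' := eps_lt hα hα1
  set φ := cut Λ (absn f) with hφ
  have mφ : Measurable φ := measurable_cut Λ (measurable_absn hR.meas)
  have hw01 : 1 ≤ w0 α := fun k => one_le_w0 hα1 k
  have iu := fun k => integrable_row hα hw01 hR.meas hfin k
  have hRt := hR.trunc Λ
  set g := (Prod.fst ⁻¹' (Λ : Set ℤ)).indicator f with hg
  have hgφ : absn g = φ := absn_indicator _ _
  have hfin' : nrm (bexp α) (w0 α) (absn g) < ⊤ := by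
    rw [hgφ]; exact (nrm_mono le_rfl (cut_le _ _)).trans_lt hfin
  have ig := fun k => integrable_row hα hw01 hRt.meas hfin' k
  set v : ℝ → L2 := fun t => FracNLS.trunc Λ (u t) with hv
  have hvv : (fun t => FracNLS.trunc Λ (v t)) = v := by ext1 t; exact trunc_trunc _ _
  have hosc := osc_trunc_le hα hα1 ht hRt hRt hRt ig ig ig Λ
  rw [hvv, hgφ, hφ, cut_cut, ← hφ] at hosc
  -- the integrand as a continuous function
  set H : ℤ → ℝ → ℂ := fun k t => ex (-(t * (0 + symbol α k))) * tri (v t) (v t) (v t) k with hH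
  have hHc : ∀ k, IntervalIntegrable (H k) volume t0 t1 := by
    intro k
    have hco : ContinuousOn (H k) (Icc t0 t1) := by
      have : ContinuousOn (fun t => ∑ k2 ∈ Λ, ∑ k3 ∈ Λ,
          ex (-(t * (0 + symbol α k - symbol α (k + k2 - k3) + symbol α k2 - symbol α k3))) *
          (wave (fun τ => g (k + k2 - k3, τ)) t * conj (wave (fun τ => g (k2, τ)) t) *
          wave (fun τ => g (k3, τ)) t)) (Icc t0 t1) := by
        refine Continuous.continuousOn (continuous_finsetSum _ fun k2 _ => continuous_finsetSum _ fun k3 _ => ?_)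
        have c1 := continuous_wave (ig (k + k2 - k3))
        have c2 := continuous_wave (ig k2)
        have c3 := continuous_wave (ig k3)
        have c2' : Continuous fun t => conj (wave (fun τ => g (k2, τ)) t) :=
          Complex.continuous_conj.comp c2
        fun_prop
      refine this.congr fun t htt => ?_
      beta_reduce
      rw [← tri_trunc_eq_wave hRt hRt hRt Λ k htt 0]
      simp only [hH]
      rw [show FracNLS.trunc Λ (FracNLS.trunc Λ (u t)) = v t from trunc_trunc _ _]
    exact (hco.mono (by rw [uIcc_of_le ht])).intervalIntegrable
  -- The fourth power is a pairing of `u` with the cubic term of its truncation. Expanding `u` in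
  -- its density turns the time integral into values of `osc`, to which the trilinear bound applies.
  have hsum : ∀ t ∈ Icc t0 t1, (((Q4 (v t)).toReal : ℝ) : ℂ) =
      ∑ k ∈ Λ, (∫ τ, conj (f (k, τ)) * ex (-1 * (t * τ))) * H k t := by
    intro t htt
    rw [← (Q4_trunc Λ (u t)).2]
    refine Finset.sum_congr rfl fun k hk => ?_
    rw [hR.coeff_eq k htt, map_mul, conj_ex, ← conj_wave]
    simp only [hH, zero_add]
    ring
  have hii : ∀ k, IntervalIntegrable (fun t => (∫ τ, conj (f (k, τ)) * ex (-1 * (t * τ))) * H k t)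
      volume t0 t1 := by
    intro k
    refine (hHc k).continuousOn_mul ?_
    simp_rw [← conj_wave]
    exact (Complex.continuous_conj.comp (continuous_wave (iu k))).continuousOn
  have hreal : ∫⁻ t in Icc t0 t1, Q4 (v t) = ‖∫ t in t0..t1, (((Q4 (v t)).toReal : ℝ) : ℂ)‖ₑ := by
    have hint : IntegrableOn (fun t => (((Q4 (v t)).toReal : ℝ) : ℂ)) (Ioc t0 t1) := by
      have : IntervalIntegrable (fun t => (((Q4 (v t)).toReal : ℝ) : ℂ)) volume t0 t1 := by
        refine (IntervalIntegrable.sum Λ fun k _ => hii k).congr ?_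
        intro t htt
        rw [uIoc_of_le ht] at htt
        simp only [Finset.sum_apply]
        exact (hsum t (Ioc_subset_Icc_self htt)).symm
      exact (intervalIntegrable_iff_integrableOn_Ioc_of_le ht).1 this
    have hint' : IntegrableOn (fun t => (Q4 (v t)).toReal) (Ioc t0 t1) := by
      have := hint.re
      simpa [IntegrableOn] using this
    rw [intervalIntegral.integral_ofReal, intervalIntegral.integral_of_le ht]
    have e0 : 0 ≤ ∫ t in Ioc t0 t1, (Q4 (v t)).toReal := integral_nonneg fun t => ENNReal.toReal_nonneg
    rw [← ofReal_norm, Complex.norm_real, Real.norm_eq_abs, abs_of_nonneg e0,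
      ofReal_integral_eq_lintegral_ofReal hint' (ae_of_all _ fun t => ENNReal.toReal_nonneg),
      setLIntegral_congr Ioc_ae_eq_Icc.symm]
    refine lintegral_congr fun t => ?_
    rw [ENNReal.ofReal_toReal (Q4_trunc Λ (u t)).1.ne]
  rw [hreal, intervalIntegral.integral_congr (g := fun t => ∑ k ∈ Λ,
    (∫ τ, conj (f (k, τ)) * ex (-1 * (t * τ))) * H k t) (fun t htt => by
      rw [uIcc_of_le ht] at htt; exact hsum t htt),
    intervalIntegral.integral_finsetSum fun k _ => hii k]
  have hbound : ∀ k ∈ Λ, ‖∫ t in t0..t1, (∫ τ, conj (f (k, τ)) * ex (-1 * (t * τ))) * H k t‖ₑ ≤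
      ∫⁻ τ, φ (k, τ) * (tfac α (t1 - t0) * majorant α 1 φ φ φ (k, τ)) := by
    intro k hk
    refine (enorm_integral_wave_mul_le (g := fun τ => conj (f (k, τ))) (by
      simpa using (LinearIsometryEquiv.integrable_comp_iff Complex.conjLIE).2 (iu k)) ht (hHc k) (-1)).trans ?_
    refine lintegral_mono fun τ => ?_
    have c2 : φ (k, τ) = ‖f (k, τ)‖ₑ := indicator_of_mem (by simpa using hk) _
    rw [RCLike.enorm_conj, c2]
    gcongr
    refine le_trans (le_of_eq ?_) (hosc (k, τ))
    unfold osc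
    congr 2
    ext t
    simp only [hH, ← mul_assoc, ← ex_add]
    congr 2
    ring
  have hmm : Measurable (majorant α 1 φ φ φ) := measurable_majorant mφ mφ mφ
  calc _ ≤ ∑ k ∈ Λ, ‖∫ t in t0..t1, (∫ τ, conj (f (k, τ)) * ex (-1 * (t * τ))) * H k t‖ₑ := enorm_sum_le _ _
    _ ≤ ∑ k ∈ Λ, ∫⁻ τ, φ (k, τ) * (tfac α (t1 - t0) * majorant α 1 φ φ φ (k, τ)) := Finset.sum_le_sum hbound
    _ ≤ ∑' k, ∫⁻ τ, φ (k, τ) * (tfac α (t1 - t0) * majorant α 1 φ φ φ (k, τ)) := ENNReal.sum_le_tsum Λ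
    _ = ∫⁻ z, φ z * (tfac α (t1 - t0) * majorant α 1 φ φ φ z) ∂freqMeasure := by
        rw [lintegral_freqMeasure (by fun_prop)]
    -- Duality between the modulation exponents `1 - b` and `b - 1`. The first factor is then
    -- absorbed in the `b`-norm because `1 - b ≤ b`.
    _ = tfac α (t1 - t0) * ∫⁻ z, (jp (1 - bexp α) z.2 * φ z) * (jp (bexp α - 1) z.2 * majorant α 1 φ φ φ z)
          ∂freqMeasure := by
        rw [← lintegral_const_mul _ (by fun_prop)]
        refine lintegral_congr fun z => ?_
        have : jp (1 - bexp α) z.2 * jp (bexp α - 1) z.2 = 1 := by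
          rw [jp_mul]; simp [jp_zero]
        calc _ = (jp (1 - bexp α) z.2 * jp (bexp α - 1) z.2) *
              (φ z * (tfac α (t1 - t0) * majorant α 1 φ φ φ z)) := by rw [this, one_mul]
          _ = _ := by ring
    _ ≤ tfac α (t1 - t0) * (nrm (1 - bexp α) 1 φ * nrm (bexp α - 1) 1 (majorant α 1 φ φ φ)) := by
        gcongr
        have := ENNReal.rpow_le_rpow (lintegral_mul_sq_le freqMeasure
          (P := fun z => jp (1 - bexp α) z.2 * φ z) (Q := fun z => jp (bexp α - 1) z.2 * majorant α 1 φ φ φ z)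
          (by fun_prop) (by fun_prop)) (by norm_num : (0 : ℝ) ≤ 1 / 2)
        rw [ENNReal.mul_rpow_of_nonneg _ _ (by norm_num), ← ENNReal.rpow_natCast, ← ENNReal.rpow_mul] at this
        norm_num at this
        simpa [nrm, sqNorm] using this
    _ ≤ tfac α (t1 - t0) * (nrm (bexp α) (w0 α) φ * (C * (nrm (bexp α) (w0 α) φ * nrm (bexp α) (w0 α) φ *
          nrm (bexp α) (w0 α) φ))) := by
        gcongr
        · unfold nrm sqNorm
          gcongr with z
          · exact hw01 z.1
          · exact jp_mono (by unfold bexp; linarith) _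
        · refine (hmaj 0 φ φ φ mφ mφ mφ).trans ?_
          simp only [triWeight, Fin.isValue, ↓reduceIte, one_ne_zero, Fin.reduceEq]
          gcongr
          exact nrm_mono hw01 le_rfl
    _ = _ := by ring

end

section

open scoped ComplexConjugate

/-! ### The trilinear estimate for functions with densities -/

lemma tri_sub_fst {f f' g h : L2} (hf : N4 f < ⊤) (hf' : N4 f' < ⊤) (hg : N4 g < ⊤) (k : ℤ) :
    tri (f - f') g h k = tri f g h k - tri f' g h k := by
  unfold tri fourierCoeff
  rw [← integral_sub ((integrable_tri_of_N4 hf hg).fourier_smul _)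
    ((integrable_tri_of_N4 hf' hg).fourier_smul _)]
  refine integral_congr_ae ?_
  filter_upwards [Lp.coeFn_sub f f'] with x hx
  rw [hx, Pi.sub_apply]
  simp only [smul_eq_mul]
  ring

lemma tri_sub_snd {f g g' h : L2} (hf : N4 f < ⊤) (hg : N4 g < ⊤) (hg' : N4 g' < ⊤) (k : ℤ) :
    tri f (g - g') h k = tri f g h k - tri f g' h k := by
  unfold tri fourierCoeff
  rw [← integral_sub ((integrable_tri_of_N4 hf hg).fourier_smul _)
    ((integrable_tri_of_N4 hf hg').fourier_smul _)]
  refine integral_congr_ae ?_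
  filter_upwards [Lp.coeFn_sub g g'] with x hx
  rw [hx, Pi.sub_apply, map_sub]
  simp only [smul_eq_mul]
  ring

lemma tri_sub_trd {f g h h' : L2} (hf : N4 f < ⊤) (hg : N4 g < ⊤) (k : ℤ) :
    tri f g (h - h') k = tri f g h k - tri f g h' k := by
  unfold tri fourierCoeff
  rw [← integral_sub ((integrable_tri_of_N4 hf hg).fourier_smul _)
    ((integrable_tri_of_N4 hf hg).fourier_smul _)]
  refine integral_congr_ae ?_
  filter_upwards [Lp.coeFn_sub h h'] with x hx
  rw [hx, Pi.sub_apply]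
  simp only [smul_eq_mul]
  ring

lemma N4_sub_le (f g : L2) : N4 (f - g) ≤ N4 f + N4 g := by
  rw [sub_eq_add_neg, ← N4_neg g]; exact N4_add_le _ _

lemma N4_eq (f : L2) : N4 f = Q4 f ^ (1 / 4 : ℝ) := by
  rw [← N4_pow, ← ENNReal.rpow_natCast, ← ENNReal.rpow_mul]; norm_num

/-- `Q4` of a truncation, as a function of time expressed through the density. -/
def quartic (α : ℝ) (f : ℤ × ℝ → ℂ) (Λ : Finset ℤ) (t : ℝ) : ℝ≥0∞ :=
  ∫⁻ x : Torus, ‖∑ k ∈ Λ, ex (t * symbol α k) * wave (fun τ => f (k, τ)) t * fourier k x‖ₑ ^ 4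
    ∂AddCircle.haarAddCircle

/-- A measurable majorant of `Q4 (u t - trunc Λ (u t))`. -/
def quarticTail (α : ℝ) (f : ℤ × ℝ → ℂ) (Λ : Finset ℤ) (t : ℝ) : ℝ≥0∞ :=
  liminf (fun m => quartic α f (window m \ Λ) t) atTop

variable {α t0 t1 : ℝ} {u u1 u2 u3 : ℝ → L2} {f f1 f2 f3 : ℤ × ℝ → ℂ}

lemma measurable_quartic (hf : ∀ k, Integrable (fun τ => f (k, τ))) (Λ : Finset ℤ) :
    Measurable (quartic α f Λ) := by
  unfold quartic
  refine Measurable.lintegral_prod_right' (f := fun p : ℝ × Torus =>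
    ‖∑ k ∈ Λ, ex (p.1 * symbol α k) * wave (fun τ => f (k, τ)) p.1 * fourier k p.2‖ₑ ^ 4) ?_
  have h1 : ∀ k, Measurable (wave (fun τ => f (k, τ))) := fun k => (continuous_wave (hf k)).measurable
  have h2 : ∀ k : ℤ, Measurable (fun x : Torus => (fourier k x : ℂ)) := fun k =>
    (map_continuous (fourier k)).measurable
  have h3 : ∀ k : ℤ, Measurable (fun p : ℝ × Torus => (fourier k p.2 : ℂ)) := fun k =>
    (h2 k).comp measurable_snd
  have h4 : ∀ k : ℤ, Measurable (fun p : ℝ × Torus => wave (fun τ => f (k, τ)) p.1) := fun k =>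
    (h1 k).comp measurable_fst
  fun_prop

lemma measurable_quarticTail (hf : ∀ k, Integrable (fun τ => f (k, τ))) (Λ : Finset ℤ) :
    Measurable (quarticTail α f Λ) :=
  Measurable.liminf fun _ => measurable_quartic hf _

lemma Rep.Q4_trunc_eq (h : Rep α t0 t1 u f) (Λ : Finset ℤ) {t : ℝ} (ht : t ∈ Icc t0 t1) :
    Q4 (FracNLS.trunc Λ (u t)) = quartic α f Λ t := by
  unfold Q4 quartic
  refine lintegral_congr_ae ?_
  filter_upwards [trunc_ae Λ (u t)] with x hx
  rw [hx]
  simp_rw [h.coeff_eq _ ht]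

lemma Rep.Q4_tail_le (h : Rep α t0 t1 u f) (Λ : Finset ℤ) {t : ℝ} (ht : t ∈ Icc t0 t1) :
    Q4 (u t - FracNLS.trunc Λ (u t)) ≤ quarticTail α f Λ t := by
  refine (Q4_sub_trunc_le _ _).trans (le_of_eq ?_)
  unfold quarticTail
  simp_rw [h.Q4_trunc_eq _ ht]

lemma trunc_empty (g : L2) : trunc ∅ g = 0 := by simp [trunc]

lemma Rep.Q4_le (h : Rep α t0 t1 u f) {t : ℝ} (ht : t ∈ Icc t0 t1) :
    Q4 (u t) ≤ quarticTail α f ∅ t := by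
  simpa [trunc_empty] using h.Q4_tail_le ∅ ht

/-- Fatou's lemma passes the Strichartz estimate from `window m \ Λ` to the tail, and only
frequencies outside `Λ` enter the bound. `quarticTail` replaces the quartic integral of `u t`
because it is built from the density and hence measurable in time, while `t ↦ u t` need not be. -/
lemma lintegral_quarticTail_le (hα : 1 / 2 < α) (hα1 : α < 1) : ∃ C : ℝ≥0∞, C ≠ ⊤ ∧
    ∀ (t0 t1 : ℝ) (u : ℝ → L2) (f : ℤ × ℝ → ℂ), t0 ≤ t1 → Rep α t0 t1 u f →
      nrm (bexp α) (w0 α) (absn f) < ⊤ → ∀ Λ : Finset ℤ,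
      ∫⁻ t in Icc t0 t1, quarticTail α f Λ t ≤
        C * tfac α (t1 - t0) * nrm (bexp α) (w0 α) (cut (Λ : Set ℤ)ᶜ (absn f)) ^ 4 := by
  obtain ⟨C, hC, h⟩ := lintegral_Q4_trunc_le hα hα1
  refine ⟨C, hC, fun t0 t1 u f ht hR hfin Λ => ?_⟩
  have hi := fun k => integrable_row hα (fun k => one_le_w0 hα1 k) hR.meas hfin k
  refine (lintegral_liminf_le fun m => measurable_quartic hi _).trans ?_
  refine (liminf_le_liminf (v := fun _ => C * tfac α (t1 - t0) *
    nrm (bexp α) (w0 α) (cut (Λ : Set ℤ)ᶜ (absn f)) ^ 4) (Eventually.of_forall fun m => ?_)).trans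
    (liminf_const _).le
  rw [← setLIntegral_congr_fun measurableSet_Icc fun t ht => hR.Q4_trunc_eq (window m \ Λ) ht]
  refine (h t0 t1 u f ht hR hfin _).trans ?_
  gcongr
  refine nrm_mono le_rfl fun z => ?_
  refine indicator_le_indicator_of_subset (preimage_mono ?_) (fun _ => zero_le) _
  intro k hk
  simp only [Finset.coe_sdiff] at hk
  exact hk.2

lemma tendsto_nrm_tail {r : ℝ} {w : ℤ → ℝ≥0∞} {φ : ℤ × ℝ → ℝ≥0∞} (hφ : Measurable φ)
    (h : nrm r w φ < ⊤) :
    Tendsto (fun n => nrm r w (cut (window n : Set ℤ)ᶜ φ)) atTop (𝓝 0) := by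
  have hw : Measurable w := Measurable.of_discrete
  have hs : sqNorm r w φ ≠ ⊤ := by
    rw [← nrm_sq]; exact ENNReal.pow_ne_top h.ne
  have key : Tendsto (fun n => sqNorm r w (cut (window n : Set ℤ)ᶜ φ)) atTop (𝓝 0) := by
    unfold sqNorm at hs ⊢
    have := tendsto_lintegral_of_dominated_convergence (μ := freqMeasure)
      (F := fun n z => (w z.1 * jp r z.2 * cut (window n : Set ℤ)ᶜ φ z) ^ 2) (f := fun _ => 0)
      (fun z => (w z.1 * jp r z.2 * φ z) ^ 2)
      (fun n => by have := measurable_cut (window n : Set ℤ)ᶜ hφ; fun_prop)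
      (fun n => ae_of_all _ fun z => by
        dsimp only
        gcongr
        exact cut_le _ _ z) hs
      (ae_of_all _ fun z => by
        refine tendsto_const_nhds.congr' ?_
        filter_upwards [eventually_ge_atTop z.1.natAbs] with n hn
        have : cut (window n : Set ℤ)ᶜ φ z = 0 := by
          refine indicator_of_notMem ?_ _
          simp only [window, mem_preimage, mem_compl_iff, not_not, Finset.coe_Icc, mem_Icc]
          omega
        rw [this, mul_zero]; simp)
    simpa using this
  have := key.ennrpow_const (1 / 2 : ℝ)
  simpa [nrm] using this

lemma measurable_three {X : Type*} [MeasurableSpace X] {a b c : X → ℝ≥0∞}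
    (ha : Measurable a) (hb : Measurable b) (hc : Measurable c) :
    Measurable fun x => a x ^ (1 / 4 : ℝ) * b x ^ (1 / 4 : ℝ) * c x ^ (1 / 4 : ℝ) := by fun_prop

lemma lintegral_three_le {X : Type*} [MeasurableSpace X] (μ : Measure X) {a b c : X → ℝ≥0∞}
    (ha : Measurable a) (hb : Measurable b) (hc : Measurable c) :
    ∫⁻ x, a x ^ (1 / 4 : ℝ) * b x ^ (1 / 4 : ℝ) * c x ^ (1 / 4 : ℝ) ∂μ ≤
      (∫⁻ x, a x ∂μ) ^ (1 / 4 : ℝ) * (∫⁻ x, b x ∂μ) ^ (1 / 4 : ℝ) * (∫⁻ x, c x ∂μ) ^ (1 / 4 : ℝ) *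
        μ univ ^ (1 / 4 : ℝ) := by
  have := ENNReal.lintegral_prod_norm_pow_le (μ := μ) (Finset.univ : Finset (Fin 4))
    (f := ![a, b, c, 1]) (p := fun _ => (1 / 4 : ℝ)) (by
      intro i _; fin_cases i
      · exact ha.aemeasurable
      · exact hb.aemeasurable
      · exact hc.aemeasurable
      · exact measurable_one.aemeasurable) (by norm_num) (by norm_num)
  simpa [Fin.prod_univ_four] using this

lemma tendsto_lintegral_three {X : Type*} [MeasurableSpace X] (μ : Measure X) (hμ : μ univ ≠ ⊤)
    {a b c : X → ℝ≥0∞} {b' c' : ℕ → X → ℝ≥0∞}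
    (ha : Measurable a) (hb : Measurable b) (hc : Measurable c) (hb' : ∀ n, Measurable (b' n))
    (hc' : ∀ n, Measurable (c' n)) (q1 : ∫⁻ t, a t ∂μ ≠ ⊤) (q2 : ∫⁻ t, b t ∂μ ≠ ⊤)
    (q3 : ∫⁻ t, c t ∂μ ≠ ⊤) (T2 : Tendsto (fun n => ∫⁻ t, b' n t ∂μ) atTop (𝓝 0))
    (T3 : Tendsto (fun n => ∫⁻ t, c' n t ∂μ) atTop (𝓝 0)) :
    Tendsto (fun n => ∫⁻ t, (a t ^ (1 / 4 : ℝ) * b' n t ^ (1 / 4 : ℝ) * c t ^ (1 / 4 : ℝ) +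
      (a t ^ (1 / 4 : ℝ) * b t ^ (1 / 4 : ℝ) * c' n t ^ (1 / 4 : ℝ) +
       a t ^ (1 / 4 : ℝ) * b' n t ^ (1 / 4 : ℝ) * c' n t ^ (1 / 4 : ℝ))) ∂μ) atTop (𝓝 0) := by
  have T2 := T2.ennrpow_const (1 / 4 : ℝ)
  have T3 := T3.ennrpow_const (1 / 4 : ℝ)
  rw [ENNReal.zero_rpow_of_pos (by norm_num)] at T2 T3
  have r : ∀ {x : ℝ≥0∞}, x ≠ ⊤ → x ^ (1 / 4 : ℝ) ≠ ⊤ := fun h =>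
    ENNReal.rpow_ne_top_of_nonneg (by norm_num) h
  have L1 := ENNReal.Tendsto.mul_const (b := (∫⁻ t, c t ∂μ) ^ (1 / 4 : ℝ))
    (ENNReal.Tendsto.const_mul (a := (∫⁻ t, a t ∂μ) ^ (1 / 4 : ℝ)) T2 (Or.inr (r q1)))
    (Or.inr (r q3))
  have L2 := ENNReal.Tendsto.const_mul (a := (∫⁻ t, a t ∂μ) ^ (1 / 4 : ℝ) *
    (∫⁻ t, b t ∂μ) ^ (1 / 4 : ℝ)) T3 (Or.inr (ENNReal.mul_ne_top (r q1) (r q2)))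
  have L3 := ENNReal.Tendsto.mul (ENNReal.Tendsto.const_mul
    (a := (∫⁻ t, a t ∂μ) ^ (1 / 4 : ℝ)) T2 (Or.inr (r q1)))
    (Or.inr ENNReal.zero_ne_top) T3 (Or.inr (by simp))
  have L := ENNReal.Tendsto.mul_const (b := μ univ ^ (1 / 4 : ℝ)) (L1.add (L2.add L3)) (Or.inr (r hμ))
  simp only [mul_zero, zero_mul, add_zero] at L
  refine tendsto_of_tendsto_of_tendsto_of_le_of_le tendsto_const_nhds L (fun _ => zero_le) (fun n => ?_)
  have b2 := hb' n; have b3 := hc' n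
  dsimp only
  rw [lintegral_add_left (by fun_prop), lintegral_add_left (by fun_prop)]
  refine (add_le_add (lintegral_three_le μ ha b2 hc) (add_le_add (lintegral_three_le μ ha hb b3)
    (lintegral_three_le μ ha b2 b3))).trans (le_of_eq ?_)
  ring

lemma Rep.continuousOn_tri_trunc (h1 : Rep α t0 t1 u1 f1) (h2 : Rep α t0 t1 u2 f2)
    (h3 : Rep α t0 t1 u3 f3)
    (i1 : ∀ k, Integrable (fun τ => f1 (k, τ))) (i2 : ∀ k, Integrable (fun τ => f2 (k, τ)))
    (i3 : ∀ k, Integrable (fun τ => f3 (k, τ))) (Λ : Finset ℤ) (k : ℤ) :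
    ContinuousOn (fun t => tri (u1 t) (FracNLS.trunc Λ (u2 t)) (FracNLS.trunc Λ (u3 t)) k) (Icc t0 t1) := by
  have : ContinuousOn (fun t => ∑ k2 ∈ Λ, ∑ k3 ∈ Λ,
      (ex (t * symbol α (k + k2 - k3)) * wave (fun τ => f1 (k + k2 - k3, τ)) t) *
      conj (ex (t * symbol α k2) * wave (fun τ => f2 (k2, τ)) t) *
      (ex (t * symbol α k3) * wave (fun τ => f3 (k3, τ)) t)) (Icc t0 t1) := by
    refine Continuous.continuousOn (continuous_finsetSum _ fun k2 _ => continuous_finsetSum _ fun k3 _ => ?_)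
    have c1 := continuous_wave (i1 (k + k2 - k3))
    have c2 := continuous_wave (i2 k2)
    have c3 := continuous_wave (i3 k3)
    have c2' : Continuous fun t => conj (ex (t * symbol α k2) * wave (fun τ => f2 (k2, τ)) t) :=
      Complex.continuous_conj.comp (by fun_prop)
    fun_prop
  refine this.congr fun t ht => ?_
  rw [tri_trunc]
  simp_rw [h1.coeff_eq _ ht, h2.coeff_eq _ ht, h3.coeff_eq _ ht]

/-- The error of truncating the second and third factor. -/
lemma tri_sub_trunc_le (h1 : Rep α t0 t1 u1 f1) (h2 : Rep α t0 t1 u2 f2)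
    (h3 : Rep α t0 t1 u3 f3) (n : ℕ) (k : ℤ) {t : ℝ} (ht : t ∈ Icc t0 t1)
    (hf1 : N4 (u1 t) < ⊤) (hf2 : N4 (u2 t) < ⊤) :
    ‖tri (u1 t) (u2 t) (u3 t) k -
      tri (u1 t) (FracNLS.trunc (window n) (u2 t)) (FracNLS.trunc (window n) (u3 t)) k‖ₑ ≤
      quarticTail α f1 ∅ t ^ (1 / 4 : ℝ) * quarticTail α f2 (window n) t ^ (1 / 4 : ℝ) *
        quarticTail α f3 ∅ t ^ (1 / 4 : ℝ) +
      (quarticTail α f1 ∅ t ^ (1 / 4 : ℝ) * quarticTail α f2 ∅ t ^ (1 / 4 : ℝ) *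
        quarticTail α f3 (window n) t ^ (1 / 4 : ℝ) +
       quarticTail α f1 ∅ t ^ (1 / 4 : ℝ) * quarticTail α f2 (window n) t ^ (1 / 4 : ℝ) *
        quarticTail α f3 (window n) t ^ (1 / 4 : ℝ)) := by
  set g := u2 t
  set g' := FracNLS.trunc (window n) (u2 t) with hg'
  set h := u3 t
  set h' := FracNLS.trunc (window n) (u3 t) with hh'
  have hN : N4 g' < ⊤ := by
    rw [N4_eq]; exact ENNReal.rpow_lt_top_of_nonneg (by norm_num) (Q4_trunc _ _).1.ne
  have e : tri (u1 t) g h k - tri (u1 t) g' h' k = tri (u1 t) (g - g') h k + tri (u1 t) g' (h - h') k := by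
    rw [tri_sub_snd hf1 hf2 hN, tri_sub_trd hf1 hN]; ring
  have b1 : N4 (u1 t) ≤ quarticTail α f1 ∅ t ^ (1 / 4 : ℝ) := by
    rw [N4_eq]; exact ENNReal.rpow_le_rpow (h1.Q4_le ht) (by norm_num)
  have b2 : N4 g ≤ quarticTail α f2 ∅ t ^ (1 / 4 : ℝ) := by
    rw [N4_eq]; exact ENNReal.rpow_le_rpow (h2.Q4_le ht) (by norm_num)
  have b3 : N4 h ≤ quarticTail α f3 ∅ t ^ (1 / 4 : ℝ) := by
    rw [N4_eq]; exact ENNReal.rpow_le_rpow (h3.Q4_le ht) (by norm_num)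
  have b2' : N4 (g - g') ≤ quarticTail α f2 (window n) t ^ (1 / 4 : ℝ) := by
    rw [N4_eq]; exact ENNReal.rpow_le_rpow (h2.Q4_tail_le _ ht) (by norm_num)
  have b3' : N4 (h - h') ≤ quarticTail α f3 (window n) t ^ (1 / 4 : ℝ) := by
    rw [N4_eq]; exact ENNReal.rpow_le_rpow (h3.Q4_tail_le _ ht) (by norm_num)
  have b4 : N4 g' ≤ quarticTail α f2 ∅ t ^ (1 / 4 : ℝ) + quarticTail α f2 (window n) t ^ (1 / 4 : ℝ) := by
    calc N4 g' = N4 (g - (g - g')) := by rw [sub_sub_cancel]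
      _ ≤ _ := (N4_sub_le _ _).trans (add_le_add b2 b2')
  rw [e]
  refine (enorm_add_le _ _).trans (add_le_add ?_ ?_)
  · refine (tri_enorm_le _ _ _ _).trans ?_
    gcongr
  · refine (tri_enorm_le _ _ _ _).trans ?_
    rw [← add_mul, ← mul_add]
    gcongr

lemma ae_N4_lt_top (hα : 1 / 2 < α) (hα1 : α < 1) (ht : t0 ≤ t1) (h : Rep α t0 t1 u f)
    (hfin : nrm (bexp α) (w0 α) (absn f) < ⊤) :
    ∀ᵐ t ∂(volume.restrict (Icc t0 t1)), N4 (u t) < ⊤ := by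
  obtain ⟨C, hC, hY⟩ := lintegral_quarticTail_le hα hα1
  have hi := fun k => integrable_row hα (fun k => one_le_w0 hα1 k) h.meas hfin k
  have h1 : ∫⁻ t in Icc t0 t1, quarticTail α f ∅ t ≠ ⊤ := by
    refine ((hY t0 t1 u f ht h hfin ∅).trans_lt ?_).ne
    refine ENNReal.mul_lt_top (ENNReal.mul_lt_top hC.lt_top ENNReal.ofReal_lt_top) ?_
    exact ENNReal.pow_lt_top ((nrm_mono le_rfl (cut_le _ _)).trans_lt hfin)
  filter_upwards [ae_lt_top (measurable_quarticTail hi ∅) h1, ae_restrict_mem measurableSet_Icc] with t h2 h3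
  rw [N4_eq]
  exact ENNReal.rpow_lt_top_of_nonneg (by norm_num) ((h.Q4_le h3).trans_lt h2).ne

/-- The truncation error is dominated by functions tending to zero in mean. -/
lemma exists_truncation_error (hα : 1 / 2 < α) (hα1 : α < 1) (ht : t0 ≤ t1)
    (h1 : Rep α t0 t1 u1 f1) (h2 : Rep α t0 t1 u2 f2) (h3 : Rep α t0 t1 u3 f3)
    (n1 : nrm (bexp α) (w0 α) (absn f1) < ⊤) (n2 : nrm (bexp α) (w0 α) (absn f2) < ⊤)
    (n3 : nrm (bexp α) (w0 α) (absn f3) < ⊤) :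
    ∃ E : ℕ → ℝ → ℝ≥0∞, (∀ n, Measurable (E n)) ∧
      Tendsto (fun n => ∫⁻ t in Icc t0 t1, E n t) atTop (𝓝 0) ∧
      ∀ n k, ∀ᵐ t ∂(volume.restrict (Icc t0 t1)), ‖tri (u1 t) (u2 t) (u3 t) k -
        tri (u1 t) (FracNLS.trunc (window n) (u2 t)) (FracNLS.trunc (window n) (u3 t)) k‖ₑ ≤ E n t := by
  obtain ⟨C, hC, hY⟩ := lintegral_quarticTail_le hα hα1
  have hw01 : 1 ≤ w0 α := fun k => one_le_w0 hα1 k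
  have i1 := fun k => integrable_row hα hw01 h1.meas n1 k
  have i2 := fun k => integrable_row hα hw01 h2.meas n2 k
  have i3 := fun k => integrable_row hα hw01 h3.meas n3 k
  have hfin : ∀ (u : ℝ → L2) (f : ℤ × ℝ → ℂ), Rep α t0 t1 u f →
      nrm (bexp α) (w0 α) (absn f) < ⊤ → ∀ Λ, ∫⁻ t in Icc t0 t1, quarticTail α f Λ t ≠ ⊤ := by
    intro u f h hf Λ
    refine ((hY t0 t1 u f ht h hf Λ).trans_lt ?_).ne
    refine ENNReal.mul_lt_top (ENNReal.mul_lt_top hC.lt_top ENNReal.ofReal_lt_top) ?_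
    exact ENNReal.pow_lt_top ((nrm_mono le_rfl (cut_le _ _)).trans_lt hf)
  have htail : ∀ (u : ℝ → L2) (f : ℤ × ℝ → ℂ), Rep α t0 t1 u f →
      nrm (bexp α) (w0 α) (absn f) < ⊤ →
      Tendsto (fun n => ∫⁻ t in Icc t0 t1, quarticTail α f (window n) t) atTop (𝓝 0) := by
    intro u f h hf
    refine tendsto_of_tendsto_of_tendsto_of_le_of_le tendsto_const_nhds ?_ (fun _ => zero_le)
      (fun n => hY t0 t1 u f ht h hf (window n))
    have := ENNReal.Tendsto.pow (n := 4) (tendsto_nrm_tail (measurable_absn h.meas) hf)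
    have := ENNReal.Tendsto.const_mul (a := C * tfac α (t1 - t0)) this
      (Or.inr (ENNReal.mul_ne_top hC ENNReal.ofReal_ne_top))
    simpa using this
  have m1 := fun Λ => measurable_quarticTail (α := α) i1 Λ
  have m2 := fun Λ => measurable_quarticTail (α := α) i2 Λ
  have m3 := fun Λ => measurable_quarticTail (α := α) i3 Λ
  have hT := tendsto_lintegral_three (a := quarticTail α f1 ∅) (b := quarticTail α f2 ∅)
      (c := quarticTail α f3 ∅) (b' := fun n => quarticTail α f2 (window n))
      (c' := fun n => quarticTail α f3 (window n)) (volume.restrict (Icc t0 t1)) (by simp)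
      (m1 ∅) (m2 ∅) (m3 ∅) (fun n => m2 (window n))
      (fun n => m3 (window n)) (hfin u1 f1 h1 n1 ∅) (hfin u2 f2 h2 n2 ∅) (hfin u3 f3 h3 n3 ∅)
      (htail u2 f2 h2 n2) (htail u3 f3 h3 n3)
  refine ⟨fun n t =>
      quarticTail α f1 ∅ t ^ (1 / 4 : ℝ) * quarticTail α f2 (window n) t ^ (1 / 4 : ℝ) *
        quarticTail α f3 ∅ t ^ (1 / 4 : ℝ) +
      (quarticTail α f1 ∅ t ^ (1 / 4 : ℝ) * quarticTail α f2 ∅ t ^ (1 / 4 : ℝ) *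
        quarticTail α f3 (window n) t ^ (1 / 4 : ℝ) +
       quarticTail α f1 ∅ t ^ (1 / 4 : ℝ) * quarticTail α f2 (window n) t ^ (1 / 4 : ℝ) *
        quarticTail α f3 (window n) t ^ (1 / 4 : ℝ)), fun n => ?_, ?_, fun n k => ?_⟩
  · exact (measurable_three (m1 ∅) (m2 _) (m3 ∅)).add
      ((measurable_three (m1 ∅) (m2 ∅) (m3 _)).add (measurable_three (m1 ∅) (m2 _) (m3 _)))
  · exact hT
  · filter_upwards [ae_N4_lt_top hα hα1 ht h1 n1, ae_N4_lt_top hα hα1 ht h2 n2,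
      ae_restrict_mem measurableSet_Icc] with t a1 a2 a3
    exact tri_sub_trunc_le h1 h2 h3 n k a3 a1 a2

/-- For functions given by densities the cubic product is integrable in time, and its time Fourier
transform is controlled by the trilinear majorant. -/
theorem integrable_tri_and_osc_le (hα : 1 / 2 < α) (hα1 : α < 1) (ht : t0 ≤ t1)
    (h1 : Rep α t0 t1 u1 f1) (h2 : Rep α t0 t1 u2 f2) (h3 : Rep α t0 t1 u3 f3)
    (n1 : nrm (bexp α) (w0 α) (absn f1) < ⊤) (n2 : nrm (bexp α) (w0 α) (absn f2) < ⊤)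
    (n3 : nrm (bexp α) (w0 α) (absn f3) < ⊤) :
    (∀ k, IntegrableOn (fun t => tri (u1 t) (u2 t) (u3 t) k) (Icc t0 t1)) ∧
    ∀ z, ‖osc α t0 t1 u1 u2 u3 z‖ₑ ≤
      tfac α (t1 - t0) * majorant α 1 (absn f1) (absn f2) (absn f3) z := by
  have hw01 : 1 ≤ w0 α := fun k => one_le_w0 hα1 k
  have i1 := fun k => integrable_row hα hw01 h1.meas n1 k
  have i2 := fun k => integrable_row hα hw01 h2.meas n2 k
  have i3 := fun k => integrable_row hα hw01 h3.meas n3 k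
  obtain ⟨E, mE, hEt, hb⟩ := exists_truncation_error hα hα1 ht h1 h2 h3 n1 n2 n3
  set μ : Measure ℝ := volume.restrict (Icc t0 t1) with hμ
  have hTc := fun n k => h1.continuousOn_tri_trunc h2 h3 i1 i2 i3 (window n) k
  have hTi : ∀ n k, Integrable (fun t => tri (u1 t) (FracNLS.trunc (window n) (u2 t))
      (FracNLS.trunc (window n) (u3 t)) k) μ := fun n k => (hTc n k).integrableOn_Icc
  have hint : ∀ k, Integrable (fun t => tri (u1 t) (u2 t) (u3 t) k) μ := by
    intro k
    -- Along a subsequence with summable mean errors the truncated products converge for almost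
    -- every `t`. This gives measurability in time of the full product.
    have hsel : ∀ j : ℕ, ∃ n, ∫⁻ t, E n t ∂μ < 2⁻¹ ^ j := fun j =>
      ((tendsto_order.1 hEt).2 _ (ENNReal.pow_pos (by simp) j)).exists
    choose n hn using hsel
    have hsum : ∫⁻ t, ∑' j, E (n j) t ∂μ ≠ ⊤ := by
      rw [lintegral_tsum fun j => (mE _).aemeasurable]
      refine ((ENNReal.tsum_le_tsum fun j => (hn j).le).trans_lt ?_).ne
      rw [ENNReal.tsum_geometric]
      simp
    have haem : AEStronglyMeasurable (fun t => tri (u1 t) (u2 t) (u3 t) k) μ := by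
      refine aestronglyMeasurable_of_tendsto_ae atTop (fun j => (hTi (n j) k).aestronglyMeasurable) ?_
      filter_upwards [ae_lt_top (Measurable.tsum fun j => mE _) hsum, ae_all_iff.2 fun j => hb (n j) k]
        with t s1 s2
      have := ENNReal.tendsto_atTop_zero_of_tsum_ne_top s1.ne
      rw [tendsto_iff_edist_tendsto_0]
      refine tendsto_of_tendsto_of_tendsto_of_le_of_le tendsto_const_nhds this (fun _ => zero_le)
        (fun j => ?_)
      rw [edist_comm, edist_eq_enorm_sub]
      exact s2 j
    refine ⟨haem, ?_⟩
    have hE0 : ∫⁻ t, E (n 0) t ∂μ < ⊤ := (hn 0).trans_le (by simp)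
    have hT0 := (hTi (n 0) k).2
    calc ∫⁻ t, ‖tri (u1 t) (u2 t) (u3 t) k‖ₑ ∂μ ≤ ∫⁻ t, (E (n 0) t + ‖tri (u1 t)
          (FracNLS.trunc (window (n 0)) (u2 t)) (FracNLS.trunc (window (n 0)) (u3 t)) k‖ₑ) ∂μ := by
          refine lintegral_mono_ae ?_
          filter_upwards [hb (n 0) k] with t s
          refine le_trans ?_ (add_le_add_left s _)
          refine le_trans (le_of_eq ?_) (enorm_add_le _ _)
          rw [sub_add_cancel]
      _ < ⊤ := by
          rw [lintegral_add_left (mE _)]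
          exact ENNReal.add_lt_top.2 ⟨hE0, hT0⟩
  refine ⟨hint, fun z => ?_⟩
  -- The trilinear bound for the truncated product is uniform in `n`, and the remaining error tends
  -- to zero as `n → ∞`.
  have hlim : ∀ n, ‖osc α t0 t1 u1 u2 u3 z‖ₑ ≤ ∫⁻ t, E n t ∂μ +
      tfac α (t1 - t0) * majorant α 1 (absn f1) (absn f2) (absn f3) z := by
    intro n
    have hex : ∀ F : ℝ → ℂ, Integrable F μ → IntervalIntegrable
        (fun t => ex (-(t * (z.2 + symbol α z.1))) * F t) volume t0 t1 := by
      intro F hF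
      rw [intervalIntegrable_iff_integrableOn_Icc_of_le ht]
      refine hF.bdd_mul (c := 1) (by fun_prop) (ae_of_all _ fun t => by simp)
    have e : osc α t0 t1 u1 u2 u3 z = (∫ t in t0..t1, ex (-(t * (z.2 + symbol α z.1))) *
        (tri (u1 t) (u2 t) (u3 t) z.1 - tri (u1 t) (FracNLS.trunc (window n) (u2 t))
          (FracNLS.trunc (window n) (u3 t)) z.1)) +
        osc α t0 t1 u1 (fun t => FracNLS.trunc (window n) (u2 t))
          (fun t => FracNLS.trunc (window n) (u3 t)) z := by
      unfold osc
      rw [← intervalIntegral.integral_add (hex (fun t => tri (u1 t) (u2 t) (u3 t) z.1 -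
        tri (u1 t) (FracNLS.trunc (window n) (u2 t)) (FracNLS.trunc (window n) (u3 t)) z.1)
        ((hint z.1).sub (hTi n z.1))) (hex _ (hTi n z.1))]
      refine intervalIntegral.integral_congr fun t _ => ?_
      ring
    rw [e]
    refine (enorm_add_le _ _).trans (add_le_add ?_ ?_)
    · rw [intervalIntegral.integral_of_le ht, ← integral_Icc_eq_integral_Ioc]
      refine (enorm_integral_le_lintegral_enorm _).trans ?_
      refine lintegral_mono_ae ?_
      filter_upwards [hb n z.1] with t s
      rwa [enorm_mul, enorm_ex, one_mul]
    · refine (osc_trunc_le hα hα1 ht h1 h2 h3 i1 i2 i3 (window n) z).trans ?_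
      gcongr
      refine majorant_le_majorant (fun k1 k2 k3 τ1 τ2 τ3 => ?_) z
      gcongr <;> exact cut_le _ _ _
  have := hEt.add_const (tfac α (t1 - t0) * majorant α 1 (absn f1) (absn f2) (absn f3) z)
  rw [zero_add] at this
  exact ge_of_tendsto' this hlim

end

section

open scoped ComplexConjugate FourierTransform

/-! ### Densities from the Duhamel formula -/

/-- The time Fourier transform of the window `[0, L]`. -/
def windowKernel (L τ : ℝ) : ℂ := ∫ t in 0..L, ex (-τ * t)

/-- The moving integral is the convolution of `h` with the indicator of `[0, L]`, so its Fourier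
transform is the product of `windowKernel` and the transform of `h`. Fourier inversion holds
pointwise because the convolution is continuous and the product is integrable. -/
lemma integral_window_eq_wave {h : ℝ → ℂ} (hh : Integrable h) {L : ℝ} (hL : 0 ≤ L)
    (hK : Integrable fun τ => windowKernel L τ * wave h (-τ)) (t : ℝ) :
    ∫ s in (t - L)..t, h s =
      wave (fun τ => ((2 * π : ℝ) : ℂ)⁻¹ * (windowKernel L τ * wave h (-τ))) t := by
  set χ : ℝ → ℂ := (Icc 0 L).indicator 1 with hχ
  have hχi : Integrable χ := by
    rw [hχ, integrable_indicator_iff measurableSet_Icc]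
    exact (continuous_const (y := (1 : ℂ))).integrableOn_Icc
  set F : ℝ → ℂ := convolution χ h (ContinuousLinearMap.mul ℂ ℂ) volume with hF
  have hFe : F = fun t => ∫ s in (t - L)..t, h s := by
    ext t
    simp only [hF, convolution, ContinuousLinearMap.mul_apply']
    have : (fun s => χ s * h (t - s)) = (Icc 0 L).indicator (fun s => h (t - s)) := by
      ext s
      by_cases hs : s ∈ Icc 0 L <;> simp [hχ, hs]
    rw [this, integral_indicator measurableSet_Icc, integral_Icc_eq_integral_Ioc,
      ← intervalIntegral.integral_of_le hL, intervalIntegral.integral_comp_sub_left (fun s => h s)]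
    simp
  have hFi : Integrable F := hχi.integrable_convolution _ hh
  have hFc : Continuous F := by
    rw [hFe]
    have hii : ∀ a b, IntervalIntegrable h volume a b := fun a b => hh.intervalIntegrable
    have h1 := intervalIntegral.continuous_primitive hii 0
    have : (fun t => ∫ s in (t - L)..t, h s) =
        fun t => (∫ s in (0 : ℝ)..t, h s) - ∫ s in (0 : ℝ)..(t - L), h s := by
      ext t
      rw [intervalIntegral.integral_interval_sub_left (hii _ _) (hii _ _)]
    rw [this]
    exact h1.sub (h1.comp (by fun_prop))
  have hft : ∀ (g : ℝ → ℂ) (ξ : ℝ), 𝓕 g ξ = wave g (-(2 * π * ξ)) := by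
    intro g ξ
    rw [Real.fourier_real_eq_integral_exp_smul]
    unfold wave ex
    refine integral_congr_ae (ae_of_all _ fun s => ?_)
    dsimp only
    rw [smul_eq_mul, mul_comm]
    congr 2
    push_cast; ring
  have hχw : ∀ τ, wave χ (-τ) = windowKernel L τ := by
    intro τ
    unfold wave windowKernel
    have : (fun s => χ s * ex (-τ * s)) = (Icc 0 L).indicator (fun s => ex (-τ * s)) := by
      ext s
      by_cases hs : s ∈ Icc 0 L <;> simp [hχ, hs]
    rw [this, integral_indicator measurableSet_Icc, integral_Icc_eq_integral_Ioc,
      ← intervalIntegral.integral_of_le hL]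
  have hFF : 𝓕 F = fun ξ => windowKernel L (2 * π * ξ) * wave h (-(2 * π * ξ)) := by
    ext ξ
    rw [hF, Real.fourier_mul_convolution_eq hχi hh, hft, hft, hχw]
  have hpi : (0 : ℝ) < 2 * π := Real.two_pi_pos
  have hFFi : Integrable (𝓕 F) := by
    rw [hFF]
    exact hK.comp_mul_left' hpi.ne'
  have := congrFun (hFc.fourierInv_fourier_eq hFi hFFi) t
  rw [← congrFun hFe t, ← this, Real.fourierInv_eq_fourier_neg, hft, hFF]
  unfold wave
  have hsc := Measure.integral_comp_mul_left (fun τ => (windowKernel L τ * ∫ s, h s * ex (-τ * s)) *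
    ex (t * τ)) (2 * π)
  rw [abs_of_pos (by positivity)] at hsc
  have e2 : ∀ τ, ((2 * π : ℝ) : ℂ)⁻¹ * (windowKernel L τ * ∫ s, h s * ex (-τ * s)) * ex (t * τ) =
      ((2 * π : ℝ) : ℂ)⁻¹ * ((windowKernel L τ * ∫ s, h s * ex (-τ * s)) * ex (t * τ)) :=
    fun τ => by ring
  simp_rw [e2]
  rw [integral_const_mul]
  rw [Complex.real_smul] at hsc
  push_cast at hsc ⊢
  rw [← hsc]
  refine integral_congr_ae (ae_of_all _ fun s => ?_)
  dsimp only
  congr 2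
  ring

lemma enorm_integral_ex_le {a b : ℝ} (h : a ≤ b) (τ : ℝ) :
    ‖∫ t in a..b, ex (-τ * t)‖ₑ ≤ ENNReal.ofReal (b - a + 2) * jp (-1) τ := by
  obtain ⟨h1, h2⟩ := norm_integral_ex_le (-τ) h
  unfold jp
  rw [← ENNReal.ofReal_mul (by linarith), ← ofReal_norm]
  refine ENNReal.ofReal_le_ofReal ?_
  rw [Real.rpow_neg_one, ← div_eq_mul_inv, le_div_iff₀ (by positivity)]
  rw [abs_neg] at h2
  linarith

lemma continuous_windowKernel (L : ℝ) (hL : 0 ≤ L) : Continuous (windowKernel L) := by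
  have h1 : Integrable ((Icc 0 L).indicator (1 : ℝ → ℂ)) := by
    rw [integrable_indicator_iff measurableSet_Icc]
    exact (continuous_const (y := (1 : ℂ))).integrableOn_Icc
  have : windowKernel L = fun τ => wave ((Icc 0 L).indicator (1 : ℝ → ℂ)) (-τ) := by
    ext τ
    unfold wave windowKernel
    have : (fun s => (Icc 0 L).indicator (1 : ℝ → ℂ) s * ex (-τ * s)) =
        (Icc 0 L).indicator (fun s => ex (-τ * s)) := by
      ext s
      by_cases hs : s ∈ Icc 0 L <;> simp [hs]
    rw [this, integral_indicator measurableSet_Icc, integral_Icc_eq_integral_Ioc,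
      ← intervalIntegral.integral_of_le hL]
  rw [this]
  exact (continuous_wave h1).comp continuous_neg

lemma nrm_jp_mul (r w) (φ : ℤ × ℝ → ℝ≥0∞) :
    nrm r w (fun z => jp (-1) z.2 * φ z) = nrm (r - 1) w φ := by
  unfold nrm sqNorm
  congr 2
  ext z
  rw [← mul_assoc, mul_assoc (w z.1), jp_mul, ← sub_eq_add_neg]

lemma nrm_seq_mul (r w) (a : ℤ → ℝ≥0∞) {ρ : ℝ → ℝ≥0∞} (hρ : Measurable ρ) :
    nrm r w (fun z => a z.1 * ρ z.2) = (∫⁻ τ, (jp r τ * ρ τ) ^ 2) ^ (1 / 2 : ℝ) * wn w a := by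
  have ha : Measurable a := Measurable.of_discrete
  unfold nrm wn
  rw [sqNorm_eq_tsum (by fun_prop), ← ENNReal.mul_rpow_of_nonneg _ _ (by norm_num),
    ← ENNReal.tsum_mul_left]
  congr 1
  refine tsum_congr fun k => ?_
  rw [mul_pow, mul_left_comm]
  congr 1
  rw [mul_comm, ← lintegral_const_mul _ (by fun_prop)]
  refine lintegral_congr fun τ => ?_
  ring

/-- The density of a function with Duhamel formula `a k + ∫ g k`, where `G (k, ·)` is the Fourier
transform of `g k`. -/
def density (L t0 t1 : ℝ) (a : ℤ → ℂ) (G : ℤ × ℝ → ℂ) (z : ℤ × ℝ) : ℂ :=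
  ((2 * π : ℝ) : ℂ)⁻¹ * (windowKernel L z.2 *
    (G z + ((L : ℝ) : ℂ)⁻¹ * a z.1 * ∫ t in (t0 - L)..t1, ex (-z.2 * t)))

lemma density_sub (L t0 t1 : ℝ) (a : ℤ → ℂ) (G G' : ℤ × ℝ → ℂ) (z : ℤ × ℝ) :
    density L t0 t1 a G z - density L t0 t1 a G' z = density L t0 t1 0 (G - G') z := by
  unfold density
  simp only [Pi.sub_apply, Pi.zero_apply]
  ring

/-- The bound for densities on intervals of length at most `L`. -/
def DensityBound (α L : ℝ) (C : ℝ≥0∞) : Prop :=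
  C ≠ ⊤ ∧ ∀ (t0 t1 : ℝ) (a : ℤ → ℂ) (G : ℤ × ℝ → ℂ) (Γ : ℤ × ℝ → ℝ≥0∞),
    t0 ≤ t1 → t1 - t0 ≤ L → Measurable Γ → absn G ≤ Γ → ∀ w : ℤ → ℝ≥0∞,
    nrm (bexp α) w (absn (density L t0 t1 a G)) ≤
      C * (wn w (fun k => ‖a k‖ₑ) + nrm (bexp α - 1) w Γ)

/-- The window kernel decays like `(1+|τ|)^{-1}`, which turns the exponent `b` into `b - 1` on the
forcing. The datum is multiplied by two such kernels, and `(1+|τ|)^{b-2}` is square integrable. The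
bound depends on `L` only, not on the position of the interval. -/
lemma exists_densityBound {α : ℝ} (hα : 1 / 2 < α) (hα1 : α < 1) {L : ℝ} (hL : 0 < L) :
    ∃ C : ℝ≥0∞, DensityBound α L C := by
  have he := eps_pos hα
  have he' := eps_lt hα hα1
  set I : ℝ≥0∞ := (∫⁻ τ, (jp (bexp α) τ * jp (-2) τ) ^ 2) ^ (1 / 2 : ℝ) with hI
  have hIt : I ≠ ⊤ := by
    refine ENNReal.rpow_ne_top_of_nonneg (by norm_num) ?_
    have : ∀ τ, (jp (bexp α) τ * jp (-2) τ) ^ 2 = jp (-(4 - 2 * bexp α)) τ := by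
      intro τ; rw [jp_mul, jp_sq]; congr 1; ring
    simp_rw [this]
    exact (lintegral_jp_lt_top (by unfold bexp; linarith)).ne
  set c1 : ℝ≥0∞ := ENNReal.ofReal (L + 2) with hc1
  set c2 : ℝ≥0∞ := ‖((L : ℝ) : ℂ)⁻¹‖ₑ * ENNReal.ofReal (2 * L + 2) with hc2
  set c0 : ℝ≥0∞ := ‖((2 * π : ℝ) : ℂ)⁻¹‖ₑ with hc0
  have hc2t : c2 ≠ ⊤ := ENNReal.mul_ne_top enorm_ne_top ENNReal.ofReal_ne_top
  have hc0t : c0 ≠ ⊤ := enorm_ne_top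
  have hc01t : c0 * c1 ≠ ⊤ := ENNReal.mul_ne_top hc0t ENNReal.ofReal_ne_top
  refine ⟨c0 * c1 * (1 + c2 * I), ENNReal.mul_ne_top hc01t (by finiteness),
    fun t0 t1 a G Γ ht htL hΓ hGΓ w => ?_⟩
  have hfb : absn (density L t0 t1 a G) ≤ fun z => c0 * c1 * (jp (-1) z.2 * Γ z + c2 * (‖a z.1‖ₑ * jp (-2) z.2)) := by
    intro ⟨k, τ⟩
    simp only [absn, density, enorm_mul]
    rw [← hc0, mul_assoc c0]
    refine mul_le_mul' le_rfl ?_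
    have b1 : ‖windowKernel L τ‖ₑ ≤ c1 * jp (-1) τ := by
      have := enorm_integral_ex_le hL.le τ
      rwa [sub_zero] at this
    have b2 : ‖∫ t in (t0 - L)..t1, ex (-τ * t)‖ₑ ≤ ENNReal.ofReal (2 * L + 2) * jp (-1) τ := by
      refine (enorm_integral_ex_le (by linarith) τ).trans ?_
      gcongr
      linarith
    calc _ ≤ (c1 * jp (-1) τ) * (Γ (k, τ) + ‖((L : ℝ) : ℂ)⁻¹‖ₑ * ‖a k‖ₑ *
          (ENNReal.ofReal (2 * L + 2) * jp (-1) τ)) := by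
          gcongr
          refine (enorm_add_le _ _).trans ?_
          rw [enorm_mul, enorm_mul]
          gcongr
          exact hGΓ (k, τ)
      _ = c1 * (jp (-1) τ * Γ (k, τ) + c2 * (‖a k‖ₑ * (jp (-1) τ * jp (-1) τ))) := by
          rw [hc2]; ring
      _ = _ := by rw [jp_mul]; norm_num
  have ham : Measurable (fun k : ℤ => ‖a k‖ₑ) := Measurable.of_discrete
  refine (nrm_mono le_rfl hfb).trans ?_
  rw [nrm_const_mul _ (by fun_prop)]
  rw [mul_assoc (c0 * c1)]
  gcongr
  refine (nrm_add_le (φ := fun z => jp (-1) z.2 * Γ z) (φ' := fun z => c2 * (‖a z.1‖ₑ * jp (-2) z.2))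
    (by fun_prop) (by fun_prop)).trans ?_
  rw [nrm_const_mul _ (by fun_prop), nrm_jp_mul, nrm_seq_mul _ _ (fun k => ‖a k‖ₑ) (by fun_prop), ← hI]
  set A := wn w (fun k => ‖a k‖ₑ)
  set B := nrm (bexp α - 1) w Γ
  calc B + c2 * (I * A) = 1 * B + (c2 * I) * A := by ring
    _ ≤ (1 + c2 * I) * B + (1 + c2 * I) * A := by
        gcongr
        · exact le_self_add
        · exact le_add_self
    _ = _ := by ring

/-- For `t` in `[t0, t1]` the window `[t - L, t]` contains `[t0, t]` and lies in `[t0 - L, t1]`. So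
`a k + ∫ g k` is the integral over the window of `g k` cut off to `[t0, t1]` plus the constant `a k
/ L` cut off to `[t0 - L, t1]`. This replaces smooth cutoffs in time. -/
lemma wave_density {α : ℝ} (hα : 1 / 2 < α) {L : ℝ} (hL : 0 < L) {t0 t1 : ℝ}
    {a : ℤ → ℂ} {g : ℤ → ℝ → ℂ} {G : ℤ × ℝ → ℂ} {w : ℤ → ℝ≥0∞} (ht : t0 ≤ t1) (htL : t1 - t0 ≤ L)
    (hg : ∀ k, IntegrableOn (g k) (Icc t0 t1))
    (hw : 1 ≤ w) (hG : ∀ k τ, G (k, τ) = ∫ t in t0..t1, ex (-(t * τ)) * g k t)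
    (hfin : nrm (bexp α) w (absn (density L t0 t1 a G)) < ⊤) :
    Measurable (density L t0 t1 a G) ∧ ∀ k, ∀ t ∈ Icc t0 t1,
      a k + ∫ s in t0..t, g k s = wave (fun τ => density L t0 t1 a G (k, τ)) t := by
  set H : ℤ → ℝ → ℂ := fun k t => (Icc t0 t1).indicator (g k) t +
    (Icc (t0 - L) t1).indicator (fun _ => ((L : ℝ) : ℂ)⁻¹ * a k) t with hH
  have hH1 : ∀ k, Integrable ((Icc t0 t1).indicator (g k)) := fun k =>
    (integrable_indicator_iff measurableSet_Icc).2 (hg k)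
  have hH2 : ∀ k, Integrable ((Icc (t0 - L) t1).indicator (fun _ => ((L : ℝ) : ℂ)⁻¹ * a k)) := fun k =>
    (integrable_indicator_iff measurableSet_Icc).2 (continuous_const.integrableOn_Icc)
  have hHi : ∀ k, Integrable (H k) := fun k => (hH1 k).add (hH2 k)
  have hHw : ∀ k τ, wave (H k) (-τ) = (∫ t in t0..t1, ex (-(t * τ)) * g k t) +
      ((L : ℝ) : ℂ)⁻¹ * a k * ∫ t in (t0 - L)..t1, ex (-τ * t) := by
    intro k τ
    unfold wave
    have e1 : ∀ s, H k s * ex (-τ * s) = (Icc t0 t1).indicator (fun t => ex (-(t * τ)) * g k t) s +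
        (Icc (t0 - L) t1).indicator (fun t => ((L : ℝ) : ℂ)⁻¹ * a k * ex (-τ * t)) s := by
      intro s
      simp only [hH, indicator_apply]
      rw [show -(s * τ) = -τ * s by ring]
      split_ifs <;> ring
    simp_rw [e1]
    rw [integral_add, integral_indicator measurableSet_Icc, integral_indicator measurableSet_Icc,
      integral_Icc_eq_integral_Ioc, integral_Icc_eq_integral_Ioc, ← intervalIntegral.integral_of_le ht,
      ← intervalIntegral.integral_of_le (by linarith), intervalIntegral.integral_const_mul]
    · rw [integrable_indicator_iff measurableSet_Icc]
      exact (hg k).bdd_mul (c := 1) (by fun_prop) (ae_of_all _ fun t => by simp)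
    · rw [integrable_indicator_iff measurableSet_Icc]
      exact Continuous.integrableOn_Icc (by fun_prop)
  have hf : ∀ k τ, density L t0 t1 a G (k, τ) =
      ((2 * π : ℝ) : ℂ)⁻¹ * (windowKernel L τ * wave (H k) (-τ)) := by
    intro k τ
    rw [density, hHw, hG]
  have hfm : Measurable (density L t0 t1 a G) := by
    refine measurable_from_prod_countable_right fun k => ?_
    simp_rw [hf]
    have := (continuous_windowKernel L hL.le)
    have h2 := (continuous_wave (hHi k)).comp continuous_neg
    exact (continuous_const.mul (this.mul h2)).measurable
  refine ⟨hfm, fun k t htt => ?_⟩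
  have hrow := integrable_row hα hw hfm hfin k
  have hKi : Integrable fun τ => windowKernel L τ * wave (H k) (-τ) := by
    have := hrow.const_mul ((2 * π : ℝ) : ℂ)
    refine this.congr (ae_of_all _ fun τ => ?_)
    dsimp only
    rw [hf, ← mul_assoc, mul_inv_cancel₀ (by simp [Real.pi_ne_zero]), one_mul]
  simp_rw [hf]
  rw [← integral_window_eq_wave (hHi k) hL.le hKi t]
  have htt' := htt
  obtain ⟨ha1, ha2⟩ := htt
  simp only [hH]
  rw [intervalIntegral.integral_add (hH1 k).intervalIntegrable (hH2 k).intervalIntegrable]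
  have e1 : ∫ s in (t - L)..t, (Icc t0 t1).indicator (g k) s = ∫ s in t0..t, g k s := by
    rw [intervalIntegral.integral_of_le (by linarith), intervalIntegral.integral_of_le ha1,
      ← integral_indicator measurableSet_Ioc, ← integral_indicator measurableSet_Ioc, indicator_indicator]
    refine integral_congr_ae ?_
    have : ∀ᵐ s : ℝ, s ≠ t0 := by simp [ae_iff]
    filter_upwards [this] with s hs
    refine indicator_eq_indicator ?_ rfl
    simp only [mem_inter_iff, mem_Ioc, mem_Icc]
    constructor
    · rintro ⟨⟨_, h2⟩, h3, _⟩
      exact ⟨lt_of_le_of_ne h3 (Ne.symm hs), h2⟩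
    · rintro ⟨h1, h2⟩
      exact ⟨⟨by linarith, h2⟩, h1.le, by linarith⟩
  have e2 : ∫ s in (t - L)..t, (Icc (t0 - L) t1).indicator (fun _ => ((L : ℝ) : ℂ)⁻¹ * a k) s = a k := by
    rw [intervalIntegral.integral_congr (g := fun _ => ((L : ℝ) : ℂ)⁻¹ * a k)]
    · rw [intervalIntegral.integral_const, Complex.real_smul]
      have : ((L : ℝ) : ℂ) ≠ 0 := by exact_mod_cast hL.ne'
      rw [show t - (t - L) = L by ring, ← mul_assoc, mul_inv_cancel₀ this, one_mul]
    · intro s hs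
      rw [uIcc_of_le (by linarith)] at hs
      have hm : s ∈ Icc (t0 - L) t1 := ⟨by linarith [hs.1], by linarith [hs.2]⟩
      exact indicator_of_mem hm _
  rw [e1, e2, add_comm]

lemma Rep.of_duhamel {α : ℝ} (hα : 1 / 2 < α) {L : ℝ} (hL : 0 < L) {t0 t1 : ℝ} {u : ℝ → L2}
    {a : ℤ → ℂ} {g : ℤ → ℝ → ℂ} {G : ℤ × ℝ → ℂ} {w : ℤ → ℝ≥0∞} (ht : t0 ≤ t1) (htL : t1 - t0 ≤ L)
    (hg : ∀ k, IntegrableOn (g k) (Icc t0 t1))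
    (hu : ∀ k, ∀ t ∈ Icc t0 t1, ex (-(t * symbol α k)) * coeff (u t) k = a k + ∫ s in t0..t, g k s)
    (hw : 1 ≤ w) (hG : ∀ k τ, G (k, τ) = ∫ t in t0..t1, ex (-(t * τ)) * g k t)
    (hfin : nrm (bexp α) w (absn (density L t0 t1 a G)) < ⊤) :
    Rep α t0 t1 u (density L t0 t1 a G) := by
  have h := wave_density hα hL ht htL hg hw hG hfin
  exact ⟨h.1, fun k t htt => (hu k t htt).trans (h.2 k t htt)⟩

/-- One density obeys the bound for all weights at once. Stability needs this, since it measures the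
same difference in a strong norm, for finiteness, and in a weak one, for smallness. -/
lemma exists_rep {α : ℝ} (hα : 1 / 2 < α) {L : ℝ} (hL : 0 < L) {C : ℝ≥0∞}
    (hC : DensityBound α L C) {t0 t1 : ℝ} {u : ℝ → L2} {a : ℤ → ℂ} {g : ℤ → ℝ → ℂ}
    {w : ℤ → ℝ≥0∞} {Γ : ℤ × ℝ → ℝ≥0∞} (ht : t0 ≤ t1) (htL : t1 - t0 ≤ L)
    (hg : ∀ k, IntegrableOn (g k) (Icc t0 t1))
    (hu : ∀ k, ∀ t ∈ Icc t0 t1, ex (-(t * symbol α k)) * coeff (u t) k = a k + ∫ s in t0..t, g k s)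
    (hw : 1 ≤ w) (hΓ : Measurable Γ)
    (hgΓ : ∀ k τ, ‖∫ t in t0..t1, ex (-(t * τ)) * g k t‖ₑ ≤ Γ (k, τ))
    (hΓfin : nrm (bexp α - 1) w Γ < ⊤) (hafin : wn w (fun k => ‖a k‖ₑ) < ⊤) :
    ∃ f, Rep α t0 t1 u f ∧ ∀ w', nrm (bexp α) w' (absn f) ≤
      C * (wn w' (fun k => ‖a k‖ₑ) + nrm (bexp α - 1) w' Γ) := by
  obtain ⟨hC, h⟩ := hC
  set G : ℤ × ℝ → ℂ := fun z => ∫ t in t0..t1, ex (-(t * z.2)) * g z.1 t with hG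
  have hb := h t0 t1 a G Γ ht htL hΓ (fun z => hgΓ z.1 z.2)
  refine ⟨density L t0 t1 a G, Rep.of_duhamel hα hL ht htL hg hu hw (fun k τ => rfl) ?_, hb⟩
  exact (hb w).trans_lt (ENNReal.mul_lt_top hC.lt_top (ENNReal.add_lt_top.2 ⟨hafin, hΓfin⟩))

end

section

open scoped ComplexConjugate

/-! ### Weighted sequence norms and operations on densities -/

lemma wn_eq_lintegral (w a : ℤ → ℝ≥0∞) :
    wn w a = (∫⁻ k, (w k * a k) ^ 2 ∂(Measure.count : Measure ℤ)) ^ (1 / 2 : ℝ) := by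
  rw [lintegral_count]; rfl

lemma wn_add_le (w a a' : ℤ → ℝ≥0∞) : wn w (a + a') ≤ wn w a + wn w a' := by
  have := ENNReal.lintegral_Lp_add_le (p := 2) (μ := (Measure.count : Measure ℤ))
    (f := fun k => w k * a k) (g := fun k => w k * a' k)
    Measurable.of_discrete.aemeasurable Measurable.of_discrete.aemeasurable (by norm_num)
  simp only [ENNReal.rpow_ofNat] at this
  simp only [wn_eq_lintegral]
  refine le_trans (le_of_eq ?_) this
  congr 1
  refine lintegral_congr fun k => ?_
  simp only [Pi.add_apply]
  ring

lemma wn_mono {w w' a a' : ℤ → ℝ≥0∞} (hw : w ≤ w') (ha : a ≤ a') : wn w a ≤ wn w' a' := by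
  unfold wn
  refine ENNReal.rpow_le_rpow (ENNReal.tsum_le_tsum fun k => ?_) (by norm_num)
  gcongr
  · exact hw k
  · exact ha k

lemma wn_const_mul (c : ℝ≥0∞) (w a : ℤ → ℝ≥0∞) : wn (fun k => c * w k) a = c * wn w a := by
  unfold wn
  simp_rw [mul_assoc c, mul_pow c, ENNReal.tsum_mul_left]
  rw [ENNReal.mul_rpow_of_nonneg _ _ (by norm_num), ← ENNReal.rpow_natCast, ← ENNReal.rpow_mul]
  norm_num

lemma wn_weight_add_le (w w' a : ℤ → ℝ≥0∞) : wn (w + w') a ≤ wn w a + wn w' a := by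
  have h := wn_add_le 1 (fun k => w k * a k) (fun k => w' k * a k)
  refine le_trans (le_of_eq ?_) (h.trans (le_of_eq ?_))
  · unfold wn; simp [add_mul]
  · unfold wn; simp

/-- The weighted norm of the Fourier coefficients. -/
def cn (w : ℤ → ℝ≥0∞) (f : L2) : ℝ≥0∞ := wn w (fun k => ‖coeff f k‖ₑ)

lemma cn_add_le (w : ℤ → ℝ≥0∞) (f g : L2) : cn w (f + g) ≤ cn w f + cn w g := by
  refine le_trans (wn_mono le_rfl fun k => ?_) (wn_add_le _ _ _)
  simp only [coeff_add, Pi.add_apply]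
  exact enorm_add_le _ _

lemma cn_sub_comm (w : ℤ → ℝ≥0∞) (f g : L2) : cn w (f - g) = cn w (g - f) := by
  unfold cn
  congr 1; ext k
  rw [coeff_sub, coeff_sub, enorm_sub_rev]

lemma cn_le_add_sub (w : ℤ → ℝ≥0∞) (f g : L2) : cn w f ≤ cn w g + cn w (f - g) := by
  simpa using cn_add_le w g (f - g)

lemma cn_sub_le (w : ℤ → ℝ≥0∞) (f g : L2) : cn w (f - g) ≤ cn w f + cn w g := by
  refine le_trans (wn_mono le_rfl fun k => ?_) (wn_add_le _ _ _)
  simp only [coeff_sub, Pi.add_apply]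
  exact enorm_sub_le

lemma cn_mono {w w' : ℤ → ℝ≥0∞} (h : w ≤ w') (f : L2) : cn w f ≤ cn w' f := wn_mono h le_rfl

/-- The constant of the embedding into continuous functions of time. -/
def embConst (α : ℝ) : ℝ≥0∞ := (∫⁻ τ, jp (-(2 * bexp α)) τ) ^ (1 / 2 : ℝ)

lemma embConst_ne_top {α : ℝ} (hα : 1 / 2 < α) : embConst α ≠ ⊤ :=
  ENNReal.rpow_ne_top_of_nonneg (by norm_num) (lintegral_jp_bexp hα)

variable {α t0 t1 : ℝ} {u v : ℝ → L2} {f g : ℤ × ℝ → ℂ}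

lemma Rep.enorm_coeff_le (h : Rep α t0 t1 u f) {t : ℝ} (ht : t ∈ Icc t0 t1) (k : ℤ) :
    ‖coeff (u t) k‖ₑ ≤ ∫⁻ τ, absn f (k, τ) := by
  rw [h.coeff_eq k ht, enorm_mul, enorm_ex, one_mul]
  refine (enorm_integral_le_lintegral_enorm _).trans (le_of_eq ?_)
  refine lintegral_congr fun τ => ?_
  rw [enorm_mul, enorm_ex, mul_one, absn]

lemma Rep.cn_le (h : Rep α t0 t1 u f) (w : ℤ → ℝ≥0∞) {t : ℝ} (ht : t ∈ Icc t0 t1) :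
    cn w (u t) ≤ embConst α * nrm (bexp α) w (absn f) :=
  (wn_mono le_rfl (h.enorm_coeff_le ht)).trans (wn_row_le α w (measurable_absn h.meas))

lemma Rep.mono (h : Rep α t0 t1 u f) {s0 s1 : ℝ} (h0 : t0 ≤ s0) (h1 : s1 ≤ t1) : Rep α s0 s1 u f :=
  ⟨h.meas, fun k t ht => h.eq k t ⟨h0.trans ht.1, ht.2.trans h1⟩⟩

lemma Rep.congr (h : Rep α t0 t1 u f) (huv : ∀ t ∈ Icc t0 t1, v t = u t) : Rep α t0 t1 v f :=
  ⟨h.meas, fun k t ht => by rw [huv t ht]; exact h.eq k t ht⟩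

lemma wave_sub {g g' : ℝ → ℂ} (hg : Integrable g) (hg' : Integrable g') (t : ℝ) :
    wave (fun τ => g τ - g' τ) t = wave g t - wave g' t := by
  unfold wave
  rw [← integral_sub]
  · simp_rw [sub_mul]
  · exact hg.mul_bdd (c := 1) (by fun_prop) (ae_of_all _ fun τ => by simp)
  · exact hg'.mul_bdd (c := 1) (by fun_prop) (ae_of_all _ fun τ => by simp)

lemma Rep.sub (hu : Rep α t0 t1 u f) (hv : Rep α t0 t1 v g)
    (hf : ∀ k, Integrable (fun τ => f (k, τ))) (hg : ∀ k, Integrable (fun τ => g (k, τ))) :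
    Rep α t0 t1 (fun t => u t - v t) (f - g) := by
  refine ⟨hu.meas.sub hv.meas, fun k t ht => ?_⟩
  have := wave_sub (hf k) (hg k) t
  simp only [Pi.sub_apply]
  rw [this, ← hu.eq k t ht, ← hv.eq k t ht, coeff_sub, mul_sub]

lemma nrm_absn_sub_le {r : ℝ} {w : ℤ → ℝ≥0∞} (hf : Measurable f) (hg : Measurable g) :
    nrm r w (absn (f - g)) ≤ nrm r w (absn f) + nrm r w (absn g) := by
  refine le_trans (nrm_mono le_rfl fun z => ?_) (nrm_add_le (measurable_absn hf) (measurable_absn hg))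
  simp only [absn, Pi.sub_apply, Pi.add_apply]
  exact enorm_sub_le

/-- The trilinear estimate in the norm with weight `w`, where the weight `W` is used for two of
the three factors. -/
structure TriPair (α : ℝ) (D : ℝ≥0∞) (w W : ℤ → ℝ≥0∞) : Prop where
  one_le : 1 ≤ w
  w0_le : w0 α ≤ W
  le : ∀ (j : Fin 3) (φ1 φ2 φ3 : ℤ × ℝ → ℝ≥0∞), Measurable φ1 → Measurable φ2 → Measurable φ3 →
    nrm (bexp α - 1) w (majorant α 1 φ1 φ2 φ3) ≤
      D * (nrm (bexp α) (if 0 = j then w else W) φ1 * nrm (bexp α) (if 1 = j then w else W) φ2 *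
        nrm (bexp α) (if 2 = j then w else W) φ3)

lemma exists_triPair_one (hα : 1 / 2 < α) (hα1 : α < 1) : ∃ D : ℝ≥0∞, D ≠ ⊤ ∧ TriPair α D 1 (w0 α) := by
  obtain ⟨C, hC, h⟩ := majorant_triWeight hα hα1
  exact ⟨C, hC, le_rfl, le_rfl, h⟩

lemma exists_triPair_self (hα : 1 / 2 < α) (hα1 : α < 1) : ∃ C : ℝ≥0∞, C ≠ ⊤ ∧
    ∀ D w, IsWeight α D w → TriPair α (D * C) w w := by
  obtain ⟨C, hC, h⟩ := majorant_weight hα hα1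
  refine ⟨C, hC, fun D w hw => ⟨fun k => (one_le_w0 hα1 k).trans (hw.w0_le k), hw.w0_le, ?_⟩⟩
  intro j φ1 φ2 φ3 m1 m2 m3
  simpa using h D w hw φ1 φ2 φ3 m1 m2 m3

lemma TriPair.mono {D D' : ℝ≥0∞} {w W : ℤ → ℝ≥0∞} (h : TriPair α D w W) (hD : D ≤ D') :
    TriPair α D' w W :=
  ⟨h.one_le, h.w0_le, fun j φ1 φ2 φ3 m1 m2 m3 => (h.le j φ1 φ2 φ3 m1 m2 m3).trans (by gcongr)⟩

/-! ### Differences of cubic terms -/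

lemma intervalIntegrable_osc {F : ℝ → ℂ} (ht : t0 ≤ t1) (hF : IntegrableOn F (Icc t0 t1)) (y : ℝ) :
    IntervalIntegrable (fun t => ex (-(t * y)) * F t) volume t0 t1 := by
  rw [intervalIntegrable_iff_integrableOn_Icc_of_le ht]
  exact hF.bdd_mul (c := 1) (by fun_prop) (ae_of_all _ fun t => by simp)

/-- The majorant of the difference of two cubic terms. -/
def diffMajorant (α : ℝ) (f g h : ℤ × ℝ → ℂ) (z : ℤ × ℝ) : ℝ≥0∞ :=
  majorant α 1 (absn h) (absn f) (absn f) z + (majorant α 1 (absn g) (absn h) (absn f) z +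
    majorant α 1 (absn g) (absn g) (absn h) z)

lemma measurable_diffMajorant {h : ℤ × ℝ → ℂ} (hf : Measurable f) (hg : Measurable g)
    (hh : Measurable h) : Measurable (diffMajorant α f g h) := by
  have a := measurable_absn hf
  have b := measurable_absn hg
  have c := measurable_absn hh
  exact (measurable_majorant c a a).add ((measurable_majorant b c a).add (measurable_majorant b b c))

/-- The three terms come from telescoping, with `u - v` in the first, second and third place in
turn. The pointwise algebra is valid for almost every time, when both functions are in `L⁴`. -/
lemma osc_sub_osc_le (hα : 1 / 2 < α) (hα1 : α < 1) (ht : t0 ≤ t1) {h : ℤ × ℝ → ℂ}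
    (hu : Rep α t0 t1 u f) (hv : Rep α t0 t1 v g) (hh : Rep α t0 t1 (fun t => u t - v t) h)
    (nf : nrm (bexp α) (w0 α) (absn f) < ⊤) (ng : nrm (bexp α) (w0 α) (absn g) < ⊤)
    (nh : nrm (bexp α) (w0 α) (absn h) < ⊤) (z : ℤ × ℝ) :
    ‖osc α t0 t1 u u u z - osc α t0 t1 v v v z‖ₑ ≤ tfac α (t1 - t0) * diffMajorant α f g h z := by
  obtain ⟨I1, B1⟩ := integrable_tri_and_osc_le hα hα1 ht hh hu hu nh nf nf
  obtain ⟨I2, B2⟩ := integrable_tri_and_osc_le hα hα1 ht hv hh hu ng nh nf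
  obtain ⟨I3, B3⟩ := integrable_tri_and_osc_le hα hα1 ht hv hv hh ng ng nh
  obtain ⟨I4, B4⟩ := integrable_tri_and_osc_le hα hα1 ht hu hu hu nf nf nf
  obtain ⟨I5, B5⟩ := integrable_tri_and_osc_le hα hα1 ht hv hv hv ng ng ng
  have e : osc α t0 t1 u u u z - osc α t0 t1 v v v z = osc α t0 t1 (fun t => u t - v t) u u z +
      (osc α t0 t1 v (fun t => u t - v t) u z + osc α t0 t1 v v (fun t => u t - v t) z) := by
    unfold osc
    rw [← intervalIntegral.integral_add (intervalIntegrable_osc ht (I2 z.1) _)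
      (intervalIntegrable_osc ht (I3 z.1) _), ← intervalIntegral.integral_add
      (intervalIntegrable_osc ht (I1 z.1) _) ((intervalIntegrable_osc ht (I2 z.1) _).add
      (intervalIntegrable_osc ht (I3 z.1) _)), ← intervalIntegral.integral_sub
      (intervalIntegrable_osc ht (I4 z.1) _) (intervalIntegrable_osc ht (I5 z.1) _)]
    rw [intervalIntegral.integral_of_le ht, intervalIntegral.integral_of_le ht,
      ← integral_Icc_eq_integral_Ioc, ← integral_Icc_eq_integral_Ioc]
    refine integral_congr_ae ?_
    filter_upwards [ae_N4_lt_top hα hα1 ht hu nf, ae_N4_lt_top hα hα1 ht hv ng] with t a b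
    rw [tri_sub_fst a b a, tri_sub_snd b a b, tri_sub_trd b b]
    ring
  rw [e]
  unfold diffMajorant
  rw [mul_add, mul_add]
  exact (enorm_add_le _ _).trans (add_le_add (B1 z) ((enorm_add_le _ _).trans (add_le_add (B2 z) (B3 z))))

lemma nrm_diffMajorant_le {D ρ : ℝ≥0∞} {w W : ℤ → ℝ≥0∞} (P : TriPair α D w W) {h : ℤ × ℝ → ℂ}
    (hf : Measurable f) (hg : Measurable g) (hh : Measurable h)
    (nf : nrm (bexp α) W (absn f) ≤ ρ) (ng : nrm (bexp α) W (absn g) ≤ ρ) :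
    nrm (bexp α - 1) w (diffMajorant α f g h) ≤ 3 * D * ρ ^ 2 * nrm (bexp α) w (absn h) := by
  have a := measurable_absn hf
  have b := measurable_absn hg
  have c := measurable_absn hh
  have h1 := P.le 0 _ _ _ c a a
  have h2 := P.le 1 _ _ _ b c a
  have h3 := P.le 2 _ _ _ b b c
  simp only [Fin.isValue, ↓reduceIte, one_ne_zero, Fin.reduceEq, zero_ne_one] at h1 h2 h3
  unfold diffMajorant
  refine (nrm_add_le (measurable_majorant c a a) ((measurable_majorant b c a).add
    (measurable_majorant b b c))).trans ?_
  refine (add_le_add h1 ((nrm_add_le (measurable_majorant b c a) (measurable_majorant b b c)).trans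
    (add_le_add h2 h3))).trans ?_
  calc _ ≤ D * (nrm (bexp α) w (absn h) * ρ * ρ) + (D * (ρ * nrm (bexp α) w (absn h) * ρ) +
        D * (ρ * ρ * nrm (bexp α) w (absn h))) := by gcongr
    _ = _ := by ring

end

section

open scoped ComplexConjugate

/-! ### Solutions in the interaction picture -/

variable {α γ t0 t1 : ℝ} {χ : Set ℤ} {u v : ℝ → L2} {f g : ℤ × ℝ → ℂ} {w W : ℤ → ℝ≥0∞}
  {C D : ℝ≥0∞}

/-- The coefficient `-iγ 1_χ(k)` of the nonlinearity. -/
def forcingCoeff (γ : ℝ) (χ : Set ℤ) (k : ℤ) : ℂ := -(Complex.I * γ) * χ.indicator 1 k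

lemma enorm_forcingCoeff_le (hγ : |γ| ≤ 1) (χ : Set ℤ) (k : ℤ) : ‖forcingCoeff γ χ k‖ₑ ≤ 1 := by
  have h : ‖forcingCoeff γ χ k‖ ≤ 1 := by
    unfold forcingCoeff
    rw [norm_mul, norm_neg, norm_mul, Complex.norm_I, one_mul, Complex.norm_real, Real.norm_eq_abs]
    by_cases hk : k ∈ χ <;> simp [hk, hγ]
  rw [← ofReal_norm]
  exact ENNReal.ofReal_le_one.2 h

/-- The time derivative of the Fourier coefficients in the interaction picture. -/
def forcing (α γ : ℝ) (χ : Set ℤ) (u : ℝ → L2) (k : ℤ) (s : ℝ) : ℂ :=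
  forcingCoeff γ χ k * (ex (-(s * symbol α k)) * tri (u s) (u s) (u s) k)

/-- The Duhamel formula on `[t0, t1]` for the equation with nonlinearity projected to `χ`. -/
def Duhamel (α γ : ℝ) (χ : Set ℤ) (t0 t1 : ℝ) (u : ℝ → L2) : Prop :=
  ∀ k, ∀ t ∈ Icc t0 t1, ex (-(t * symbol α k)) * coeff (u t) k =
    ex (-(t0 * symbol α k)) * coeff (u t0) k + ∫ s in t0..t, forcing α γ χ u k s

/-- A function with a density of finite norm. -/
def HasRep (α t0 t1 : ℝ) (W : ℤ → ℝ≥0∞) (u : ℝ → L2) : Prop :=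
  ∃ f, Rep α t0 t1 u f ∧ nrm (bexp α) W (absn f) < ⊤

/-- Solutions on `[t0, t1]` of the equation with nonlinearity projected to `χ`. -/
structure Sol (α γ : ℝ) (χ : Set ℤ) (t0 t1 : ℝ) (W : ℤ → ℝ≥0∞) (u : ℝ → L2) : Prop where
  rep : HasRep α t0 t1 W u
  duhamel : Duhamel α γ χ t0 t1 u

lemma integral_forcing (α γ : ℝ) (χ : Set ℤ) (t0 t1 : ℝ) (u : ℝ → L2) (k : ℤ) (τ : ℝ) :
    ∫ t in t0..t1, ex (-(t * τ)) * forcing α γ χ u k t =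
      forcingCoeff γ χ k * osc α t0 t1 u u u (k, τ) := by
  unfold osc forcing
  rw [← intervalIntegral.integral_const_mul]
  refine intervalIntegral.integral_congr fun t _ => ?_
  dsimp only
  rw [show -(t * (τ + symbol α k)) = -(t * τ) + -(t * symbol α k) by ring, ex_add]
  ring

lemma integrableOn_forcing (hα : 1 / 2 < α) (hα1 : α < 1) (ht : t0 ≤ t1) (hW : w0 α ≤ W)
    (hu : HasRep α t0 t1 W u) (γ : ℝ) (χ : Set ℤ) (k : ℤ) :
    IntegrableOn (forcing α γ χ u k) (Icc t0 t1) := by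
  obtain ⟨f, hf, nf⟩ := hu
  have nf0 : nrm (bexp α) (w0 α) (absn f) < ⊤ := (nrm_mono hW le_rfl).trans_lt nf
  have := (integrable_tri_and_osc_le hα hα1 ht hf hf hf nf0 nf0 nf0).1 k
  unfold forcing
  exact (this.bdd_mul (c := 1) (by fun_prop) (ae_of_all _ fun t => by simp)).const_mul _

lemma HasRep.mono (h : HasRep α t0 t1 W u) {s0 s1 : ℝ} (h0 : t0 ≤ s0) (h1 : s1 ≤ t1) :
    HasRep α s0 s1 W u := by
  obtain ⟨f, hf, nf⟩ := h
  exact ⟨f, hf.mono h0 h1, nf⟩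

lemma Sol.mono (hα : 1 / 2 < α) (hα1 : α < 1) (hW : w0 α ≤ W) (h : Sol α γ χ t0 t1 W u) {s0 s1 : ℝ}
    (h0 : t0 ≤ s0) (h01 : s0 ≤ s1) (h1 : s1 ≤ t1) : Sol α γ χ s0 s1 W u := by
  refine ⟨h.rep.mono h0 h1, fun k t ht => ?_⟩
  have hi := integrableOn_forcing hα hα1 (h0.trans (h01.trans h1)) hW h.rep γ χ k
  rw [h.duhamel k t ⟨h0.trans ht.1, ht.2.trans h1⟩, h.duhamel k s0 ⟨h0, h01.trans h1⟩, add_assoc,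
    intervalIntegral.integral_add_adjacent_intervals]
  · rw [intervalIntegrable_iff_integrableOn_Icc_of_le h0]
    exact hi.mono_set (Icc_subset_Icc le_rfl (h01.trans h1))
  · rw [intervalIntegrable_iff_integrableOn_Icc_of_le ht.1]
    exact hi.mono_set (Icc_subset_Icc h0 (ht.2.trans h1))

lemma HasRep.congr (h : HasRep α t0 t1 W u) (huv : ∀ t ∈ Icc t0 t1, v t = u t) :
    HasRep α t0 t1 W v := by
  obtain ⟨f, hf, nf⟩ := h
  exact ⟨f, hf.congr huv, nf⟩

lemma Sol.congr (h : Sol α γ χ t0 t1 W u) (ht : t0 ≤ t1) (huv : ∀ t ∈ Icc t0 t1, v t = u t) :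
    Sol α γ χ t0 t1 W v := by
  refine ⟨h.rep.congr huv, fun k t htt => ?_⟩
  rw [huv t htt, huv t0 ⟨le_rfl, ht⟩, h.duhamel k t htt]
  congr 1
  refine intervalIntegral.integral_congr fun s hs => ?_
  rw [uIcc_of_le htt.1] at hs
  unfold forcing
  rw [huv s ⟨hs.1, hs.2.trans htt.2⟩]

lemma HasRep.cn_lt_top (hα : 1 / 2 < α) (h : HasRep α t0 t1 W u) {t : ℝ} (ht : t ∈ Icc t0 t1) :
    cn W (u t) < ⊤ := by
  obtain ⟨f, hf, nf⟩ := h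
  exact (hf.cn_le W ht).trans_lt (ENNReal.mul_lt_top (embConst_ne_top hα).lt_top nf)

lemma wn_amp (w : ℤ → ℝ≥0∞) (t : ℝ) (g : L2) :
    wn w (fun k => ‖ex (-(t * symbol α k)) * coeff g k‖ₑ) = cn w g := by
  unfold cn
  congr 1; ext k
  rw [enorm_mul, enorm_ex, one_mul]

lemma TriPair.nrm_le_of_le {ρ : ℝ≥0∞} (P : TriPair α D W W) (hf : Measurable f)
    (nf : nrm (bexp α) W (absn f) ≤ ρ) :
    nrm (bexp α - 1) W (majorant α 1 (absn f) (absn f) (absn f)) ≤ D * ρ ^ 3 := by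
  have m := measurable_absn hf
  refine (P.le 0 _ _ _ m m m).trans ?_
  simp only [ite_self]
  calc _ ≤ D * (ρ * ρ * ρ) := by gcongr
    _ = _ := by ring

/-- Concatenation of the Duhamel formula on adjacent intervals, with a bound for a density on the
union. -/
lemma duhamel_concat (hα : 1 / 2 < α) (hα1 : α < 1) {L : ℝ} (hL : 0 < L) (hC : DensityBound α L C)
    (P : TriPair α D W W) (hγ : |γ| ≤ 1) {a m c : ℝ} (ham : a ≤ m) (hmc : m ≤ c) (hcL : c - a ≤ L)
    {ρ σ : ℝ≥0∞} (hD : D ≠ ⊤) (hρ : ρ ≠ ⊤) (hσ1 : tfac α (m - a) ≤ σ) (hσ2 : tfac α (c - m) ≤ σ)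
    (hσ : σ ≠ ⊤)
    (h1 : Duhamel α γ χ a m u) (h2 : Duhamel α γ χ m c u)
    (r1 : Rep α a m u f) (r2 : Rep α m c u g) (n1 : nrm (bexp α) W (absn f) ≤ ρ)
    (n2 : nrm (bexp α) W (absn g) ≤ ρ) :
    Duhamel α γ χ a c u ∧ ∃ h, Rep α a c u h ∧
      nrm (bexp α) W (absn h) ≤ C * (cn W (u a) + 2 * (σ * (D * ρ ^ 3))) := by
  have H1 : HasRep α a m W u := ⟨f, r1, n1.trans_lt hρ.lt_top⟩
  have H2 : HasRep α m c W u := ⟨g, r2, n2.trans_lt hρ.lt_top⟩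
  have I1 := integrableOn_forcing hα hα1 ham P.w0_le H1 γ χ
  have I2 := integrableOn_forcing hα hα1 hmc P.w0_le H2 γ χ
  have I1' : ∀ k, IntervalIntegrable (forcing α γ χ u k) volume a m := fun k =>
    (intervalIntegrable_iff_integrableOn_Icc_of_le ham).2 (I1 k)
  have I2' : ∀ k, IntervalIntegrable (forcing α γ χ u k) volume m c := fun k =>
    (intervalIntegrable_iff_integrableOn_Icc_of_le hmc).2 (I2 k)
  have I : ∀ k, IntegrableOn (forcing α γ χ u k) (Icc a c) := fun k =>
    (intervalIntegrable_iff_integrableOn_Icc_of_le (ham.trans hmc)).1 ((I1' k).trans (I2' k))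
  have hd : Duhamel α γ χ a c u := by
    intro k t ht
    rcases le_total t m with htm | htm
    · exact h1 k t ⟨ht.1, htm⟩
    · rw [h2 k t ⟨htm, ht.2⟩, h1 k m ⟨ham, le_rfl⟩, add_assoc,
        intervalIntegral.integral_add_adjacent_intervals (I1' k)]
      exact (I2' k).mono_set (by rw [uIcc_of_le htm, uIcc_of_le hmc]; exact Icc_subset_Icc le_rfl ht.2)
  refine ⟨hd, ?_⟩
  have m1 := measurable_absn r1.meas
  have m2 := measurable_absn r2.meas
  have M1 : Measurable (majorant α 1 (absn f) (absn f) (absn f)) := measurable_majorant m1 m1 m1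
  have M2 : Measurable (majorant α 1 (absn g) (absn g) (absn g)) := measurable_majorant m2 m2 m2
  -- The transform of the forcing over `[a, c]` is the sum of those over the two pieces, so it is
  -- bounded without knowing a density on the union. The Duhamel formula on the union then produces
  -- one.
  set Γ : ℤ × ℝ → ℝ≥0∞ := fun z => σ * majorant α 1 (absn f) (absn f) (absn f) z +
    σ * majorant α 1 (absn g) (absn g) (absn g) z with hΓ
  have n10 : nrm (bexp α) (w0 α) (absn f) < ⊤ :=
    (nrm_mono P.w0_le le_rfl).trans_lt (n1.trans_lt hρ.lt_top)
  have n20 : nrm (bexp α) (w0 α) (absn g) < ⊤ :=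
    (nrm_mono P.w0_le le_rfl).trans_lt (n2.trans_lt hρ.lt_top)
  have hΓn : nrm (bexp α - 1) W Γ ≤ 2 * (σ * (D * ρ ^ 3)) := by
    refine (nrm_add_le (φ := fun z => σ * majorant α 1 (absn f) (absn f) (absn f) z)
      (φ' := fun z => σ * majorant α 1 (absn g) (absn g) (absn g) z) (by fun_prop) (by fun_prop)).trans ?_
    rw [nrm_const_mul _ M1, nrm_const_mul _ M2, two_mul]
    gcongr
    · exact P.nrm_le_of_le r1.meas n1
    · exact P.nrm_le_of_le r2.meas n2
  have hbound : ∀ k τ, ‖∫ t in a..c, ex (-(t * τ)) * forcing α γ χ u k t‖ₑ ≤ Γ (k, τ) := by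
    intro k τ
    have e : ∫ t in a..c, ex (-(t * τ)) * forcing α γ χ u k t =
        forcingCoeff γ χ k * osc α a m u u u (k, τ) + forcingCoeff γ χ k * osc α m c u u u (k, τ) := by
      rw [← integral_forcing, ← integral_forcing, intervalIntegral.integral_add_adjacent_intervals
        (intervalIntegrable_osc ham (I1 k) _) (intervalIntegrable_osc hmc (I2 k) _)]
    have b1 := (integrable_tri_and_osc_le hα hα1 ham r1 r1 r1 n10 n10 n10).2 (k, τ)
    have b2 := (integrable_tri_and_osc_le hα hα1 hmc r2 r2 r2 n20 n20 n20).2 (k, τ)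
    have hc := enorm_forcingCoeff_le hγ χ k
    rw [e]
    refine (enorm_add_le _ _).trans (add_le_add ?_ ?_)
    · rw [enorm_mul]
      refine (mul_le_mul' hc (b1.trans (mul_le_mul' hσ1 le_rfl))).trans (by rw [one_mul])
    · rw [enorm_mul]
      refine (mul_le_mul' hc (b2.trans (mul_le_mul' hσ2 le_rfl))).trans (by rw [one_mul])
  obtain ⟨h, hr, hn⟩ := exists_rep (w := W) hα hL hC (ham.trans hmc) hcL I hd P.one_le
    (by fun_prop) hbound (hΓn.trans_lt (by finiteness)) (by
      rw [wn_amp]; exact H1.cn_lt_top hα ⟨le_rfl, ham⟩)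
  refine ⟨h, hr, (hn W).trans ?_⟩
  rw [wn_amp]
  gcongr

/-- Densities on adjacent intervals do not by themselves combine into one on the union. The equation
is used: the new density comes from the Duhamel formula through `duhamel_concat`. -/
lemma Sol.glue (hα : 1 / 2 < α) (hα1 : α < 1) (P : TriPair α D W W) (hD : D ≠ ⊤) (hγ : |γ| ≤ 1)
    {a m c : ℝ} (ham : a ≤ m) (hmc : m ≤ c) (h1 : Sol α γ χ a m W u) (h2 : Sol α γ χ m c W u) :
    Sol α γ χ a c W u := by
  obtain ⟨f, r1, n1⟩ := h1.rep
  obtain ⟨g, r2, n2⟩ := h2.rep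
  have hL : 0 < max 1 (c - a) := lt_max_of_lt_left one_pos
  obtain ⟨C, hC⟩ := exists_densityBound hα hα1 hL
  set ρ := nrm (bexp α) W (absn f) + nrm (bexp α) W (absn g) with hρ
  set σ := tfac α (m - a) + tfac α (c - m) with hσ
  have hρt : ρ ≠ ⊤ := (ENNReal.add_lt_top.2 ⟨n1, n2⟩).ne
  have hσt : σ ≠ ⊤ := (ENNReal.add_lt_top.2 ⟨ENNReal.ofReal_lt_top, ENNReal.ofReal_lt_top⟩).ne
  obtain ⟨hd, h, hr, hn⟩ := duhamel_concat hα hα1 hL hC P hγ ham hmc (le_max_right _ _) hD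
    hρt (le_self_add) (le_add_self) hσt h1.duhamel h2.duhamel r1 r2 le_self_add le_add_self
  refine ⟨⟨h, hr, hn.trans_lt ?_⟩, hd⟩
  have := h1.rep.cn_lt_top hα ⟨le_rfl, ham⟩
  refine ENNReal.mul_lt_top hC.1.lt_top (ENNReal.add_lt_top.2 ⟨this, by finiteness⟩)

lemma tfac_mono (hα : 1 / 2 < α) {x y : ℝ} (hx : 0 ≤ x) (h : x ≤ y) : tfac α x ≤ tfac α y := by
  have he := eps_pos hα
  unfold tfac
  gcongr

lemma tfac_le (hα : 1 / 2 < α) (hα1 : α < 1) {x : ℝ} (hx : 0 ≤ x) (h : x ≤ 1) :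
    tfac α x ≤ ENNReal.ofReal (16 * x ^ eps α) := by
  have he := eps_lt hα hα1
  unfold tfac
  refine ENNReal.ofReal_le_ofReal ?_
  have : x ≤ x ^ eps α := by
    rcases hx.eq_or_lt with rfl | hx'
    · positivity
    · simpa using Real.rpow_le_rpow_of_exponent_ge hx' h (by linarith : eps α ≤ 1)
  linarith

lemma exists_tfac_mul_le (hα : 1 / 2 < α) {c r : ℝ≥0∞} (hc : c ≠ ⊤) (hr : r ≠ 0) :
    ∃ x : ℝ, 0 < x ∧ tfac α x * c ≤ r := by
  have he := eps_pos hα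
  have h1 : Tendsto (fun x : ℝ => tfac α x) (𝓝[>] 0) (𝓝 0) := by
    have : Continuous fun x : ℝ => 8 * (x ^ eps α + x) := by fun_prop (disch := exact he.le)
    have h := (ENNReal.continuous_ofReal.comp this).tendsto 0
    simp only [Function.comp_def, Real.zero_rpow he.ne', add_zero, mul_zero, ENNReal.ofReal_zero] at h
    exact h.mono_left nhdsWithin_le_nhds
  have h2 := ENNReal.Tendsto.mul_const (b := c) h1 (Or.inr hc)
  rw [zero_mul] at h2
  have h3 := ((tendsto_order.1 h2).2 r (pos_iff_ne_zero.2 hr)).and self_mem_nhdsWithin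
  obtain ⟨x, hx1, hx2⟩ := h3.exists
  exact ⟨x, hx2, hx1.le⟩

/-- A priori bound on short intervals in terms of the size of the solution. -/
lemma Sol.exists_rep_le (hα : 1 / 2 < α) (hα1 : α < 1) (hC : DensityBound α 1 C)
    (P : TriPair α D W W) (hD : D ≠ ⊤) (hγ : |γ| ≤ 1) (ht : t0 ≤ t1) (ht1 : t1 - t0 ≤ 1)
    (hu : Sol α γ χ t0 t1 W u) {R : ℝ≥0∞} (hR0 : R ≠ 0) (hR : R ≠ ⊤)
    (huR : ∀ t ∈ Icc t0 t1, cn W (u t) ≤ R)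
    (hsmall : 24 * C ^ 3 * D * tfac α (t1 - t0) * R ^ 2 ≤ 1) :
    ∃ f, Rep α t0 t1 u f ∧ nrm (bexp α) W (absn f) ≤ 2 * C * R := by
  obtain ⟨F, rF, nF⟩ := hu.rep
  have hCt := hC.1
  set K := nrm (bexp α) W (absn F) with hK
  -- `K` is finite but uncontrolled. On intervals shorter than `x0` even `K` makes the nonlinear
  -- term at most `R`, which starts the induction; there `duhamel_concat` is used with a first piece
  -- reduced to a point.
  obtain ⟨x0, hx0, hx0s⟩ := exists_tfac_mul_le hα (c := 2 * (D * K ^ 3)) (r := R)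
    (by have := nF.ne; finiteness) hR0
  have hdu : ∀ a c, t0 ≤ a → a ≤ c → c ≤ t1 → Duhamel α γ χ a c u := fun a c ha hac hc =>
    (hu.mono hα hα1 P.w0_le ha hac hc).duhamel
  -- Doubling of intervals takes the place of a continuity argument in the length. If both halves
  -- have densities bounded by `2CR`, the union has one bounded by `C (R + 16 C³ D σ R³)`, which is
  -- at most `2CR` again by smallness.
  have key : ∀ n : ℕ, ∀ a c, t0 ≤ a → a ≤ c → c ≤ t1 → c - a ≤ 2 ^ n * x0 →
      ∃ f, Rep α a c u f ∧ nrm (bexp α) W (absn f) ≤ 2 * C * R := by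
    intro n
    induction n with
    | zero =>
      intro a c ha hac hc hx
      rw [pow_zero, one_mul] at hx
      obtain ⟨_, f, rf, nf⟩ := duhamel_concat hα hα1 one_pos hC P hγ le_rfl hac (by linarith) hD nF.ne
        (σ := tfac α x0) (tfac_mono hα (by simp) (by simpa using hx0.le)) (tfac_mono hα (by linarith) hx)
        ENNReal.ofReal_ne_top (hdu a a ha le_rfl (hac.trans hc)) (hdu a c ha hac hc)
        (rF.mono ha (hac.trans hc)) (rF.mono ha hc) le_rfl le_rfl
      refine ⟨f, rf, nf.trans ?_⟩
      calc C * (cn W (u a) + 2 * (tfac α x0 * (D * K ^ 3))) ≤ C * (R + R) := by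
            gcongr
            · exact huR a ⟨ha, hac.trans hc⟩
            · exact le_trans (le_of_eq (by ring)) hx0s
        _ = 2 * C * R := by ring
    | succ n ih =>
      intro a c ha hac hc hx
      rw [pow_succ] at hx
      obtain ⟨f1, r1, n1⟩ := ih a ((a + c) / 2) ha (by linarith) (by linarith) (by linarith)
      obtain ⟨f2, r2, n2⟩ := ih ((a + c) / 2) c (by linarith) (by linarith) hc (by linarith)
      obtain ⟨_, f, rf, nf⟩ := duhamel_concat hα hα1 one_pos hC P hγ (m := (a + c) / 2) (by linarith)
        (by linarith) (by linarith) hD (ρ := 2 * C * R) (by finiteness) (σ := tfac α (t1 - t0))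
        (tfac_mono hα (by linarith) (by linarith)) (tfac_mono hα (by linarith) (by linarith))
        ENNReal.ofReal_ne_top (hdu a _ ha (by linarith) (by linarith))
        (hdu _ c (by linarith) (by linarith) hc) r1 r2 n1 n2
      refine ⟨f, rf, nf.trans ?_⟩
      calc C * (cn W (u a) + 2 * (tfac α (t1 - t0) * (D * (2 * C * R) ^ 3)))
          ≤ C * (R + (24 * C ^ 3 * D * tfac α (t1 - t0) * R ^ 2) * R) := by
            refine mul_le_mul' le_rfl (add_le_add (huR a ⟨ha, hac.trans hc⟩) ?_)
            calc _ = 16 * (C ^ 3 * D * tfac α (t1 - t0) * R ^ 3) := by ring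
              _ ≤ 24 * (C ^ 3 * D * tfac α (t1 - t0) * R ^ 3) := by gcongr; norm_num
              _ = _ := by ring
        _ ≤ C * (R + 1 * R) := by gcongr
        _ = 2 * C * R := by ring
  obtain ⟨n, hn⟩ := exists_nat_gt ((t1 - t0) / x0)
  refine key n t0 t1 le_rfl ht le_rfl ?_
  rw [div_lt_iff₀ hx0] at hn
  have h2 : (n : ℝ) ≤ 2 ^ n := by exact_mod_cast Nat.lt_two_pow_self.le
  nlinarith

end

section

open scoped ComplexConjugate

/-! ### Stability on short intervals -/

variable {α γ t0 t1 : ℝ} {χ : Set ℤ} {u v : ℝ → L2} {f g : ℤ × ℝ → ℂ} {w W : ℤ → ℝ≥0∞}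
  {C D : ℝ≥0∞}

lemma forcingCoeff_univ_mul_sub (γ : ℝ) (χ : Set ℤ) (k : ℤ) (x y : ℂ) :
    forcingCoeff γ univ k * x - forcingCoeff γ χ k * y =
      forcingCoeff γ χ k * (x - y) + forcingCoeff γ χᶜ k * x := by
  unfold forcingCoeff
  by_cases hk : k ∈ χ
  · simp [hk]; ring
  · simp [hk]

lemma enorm_forcingCoeff_le_indicator (hγ : |γ| ≤ 1) (χ : Set ℤ) (k : ℤ) :
    ‖forcingCoeff γ χ k‖ₑ ≤ χ.indicator 1 k := by
  by_cases hk : k ∈ χ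
  · simpa [hk] using enorm_forcingCoeff_le hγ χ k
  · simp [forcingCoeff, hk]

/-- The majorant of the contribution of the frequencies outside `χ`. -/
def outerMajorant (α : ℝ) (χ : Set ℤ) (δ : ℝ) (f : ℤ × ℝ → ℂ) (z : ℤ × ℝ) : ℝ≥0∞ :=
  χᶜ.indicator 1 z.1 * (tfac α δ * majorant α 1 (absn f) (absn f) (absn f) z)

lemma measurable_outerMajorant (δ : ℝ) (hf : Measurable f) : Measurable (outerMajorant α χ δ f) := by
  have m := measurable_absn hf
  have M : Measurable (majorant α 1 (absn f) (absn f) (absn f)) := measurable_majorant m m m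
  have hi : Measurable (χᶜ.indicator (1 : ℤ → ℝ≥0∞)) := Measurable.of_discrete
  unfold outerMajorant
  fun_prop

lemma nrm_outerMajorant_le {ρ : ℝ≥0∞} (P : TriPair α D W W) (δ : ℝ) (hf : Measurable f)
    (nf : nrm (bexp α) W (absn f) ≤ ρ) :
    nrm (bexp α - 1) W (outerMajorant α χ δ f) ≤ tfac α δ * (D * ρ ^ 3) := by
  have m := measurable_absn hf
  have M : Measurable (majorant α 1 (absn f) (absn f) (absn f)) := measurable_majorant m m m
  refine (nrm_mono le_rfl (φ' := fun z => tfac α δ * majorant α 1 (absn f) (absn f) (absn f) z)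
    fun z => ?_).trans ?_
  · unfold outerMajorant
    refine mul_le_of_le_one_left' ?_
    by_cases h : z.1 ∈ χ <;> simp [h]
  · rw [nrm_const_mul _ M]
    gcongr
    exact P.nrm_le_of_le hf nf

lemma outerMajorant_univ (δ : ℝ) (f : ℤ × ℝ → ℂ) : outerMajorant α univ δ f = 0 := by
  ext z; simp [outerMajorant]

/-- The difference of the time Fourier transforms of the nonlinearities of two solutions. -/
lemma enorm_integral_forcing_sub_le (hα : 1 / 2 < α) (hα1 : α < 1) (hγ : |γ| ≤ 1) (ht : t0 ≤ t1)
    {h : ℤ × ℝ → ℂ} (hu : Rep α t0 t1 u f) (hv : Rep α t0 t1 v g)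
    (hh : Rep α t0 t1 (fun t => u t - v t) h)
    (nf : nrm (bexp α) (w0 α) (absn f) < ⊤) (ng : nrm (bexp α) (w0 α) (absn g) < ⊤)
    (nh : nrm (bexp α) (w0 α) (absn h) < ⊤) (k : ℤ) (τ : ℝ) :
    ‖∫ t in t0..t1, ex (-(t * τ)) * (forcing α γ univ u k t - forcing α γ χ v k t)‖ₑ ≤
      tfac α (t1 - t0) * diffMajorant α f g h (k, τ) + outerMajorant α χ (t1 - t0) f (k, τ) := by
  have I1 := integrableOn_forcing hα hα1 ht le_rfl ⟨f, hu, nf⟩ γ univ k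
  have I2 := integrableOn_forcing hα hα1 ht le_rfl ⟨g, hv, ng⟩ γ χ k
  simp_rw [mul_sub]
  rw [intervalIntegral.integral_sub (intervalIntegrable_osc ht I1 _) (intervalIntegrable_osc ht I2 _),
    integral_forcing, integral_forcing, forcingCoeff_univ_mul_sub]
  refine (enorm_add_le _ _).trans (add_le_add ?_ ?_)
  · rw [enorm_mul]
    refine (mul_le_mul' (enorm_forcingCoeff_le hγ χ k)
      (osc_sub_osc_le hα hα1 ht hu hv hh nf ng nh (k, τ))).trans (by rw [one_mul])
  · rw [enorm_mul]
    exact mul_le_mul' (enorm_forcingCoeff_le_indicator hγ _ k)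
      ((integrable_tri_and_osc_le hα hα1 ht hu hu hu nf nf nf).2 (k, τ))

/-- The stability estimate on a short interval. -/
lemma exists_rep_sub_le (hα : 1 / 2 < α) (hα1 : α < 1) (hC : DensityBound α 1 C)
    (P : TriPair α D W W) (P' : TriPair α D w W) (hwW : w ≤ W) (hD : D ≠ ⊤) (hγ : |γ| ≤ 1)
    (ht : t0 ≤ t1) (ht1 : t1 - t0 ≤ 1)
    (hu : Duhamel α γ univ t0 t1 u) (hv : Duhamel α γ χ t0 t1 v) {ρ : ℝ≥0∞} (hρ : ρ ≠ ⊤)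
    (rf : Rep α t0 t1 u f) (nf : nrm (bexp α) W (absn f) ≤ ρ)
    (rg : Rep α t0 t1 v g) (ng : nrm (bexp α) W (absn g) ≤ ρ)
    (hsmall : C * (tfac α (t1 - t0) * (3 * D * ρ ^ 2)) ≤ 2⁻¹) {η : ℝ≥0∞} (hη : η ≠ 0) :
    ∃ h, Rep α t0 t1 (fun t => u t - v t) h ∧ nrm (bexp α) W (absn h) < ⊤ ∧
      nrm (bexp α) w (absn h) ≤ 2 * (C * (cn w (u t0 - v t0) +
        nrm (bexp α - 1) w (outerMajorant α χ (t1 - t0) f))) + η := by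
  have hw01 : 1 ≤ w0 α := fun k => one_le_w0 hα1 k
  have nf0 : nrm (bexp α) (w0 α) (absn f) < ⊤ :=
    (nrm_mono P.w0_le le_rfl).trans_lt (nf.trans_lt hρ.lt_top)
  have ng0 : nrm (bexp α) (w0 α) (absn g) < ⊤ :=
    (nrm_mono P.w0_le le_rfl).trans_lt (ng.trans_lt hρ.lt_top)
  set B := C * (cn w (u t0 - v t0) + nrm (bexp α - 1) w (outerMajorant α χ (t1 - t0) f)) with hB
  set x0 := nrm (bexp α) w (absn (f - g)) with hx0
  have hx0t : nrm (bexp α) W (absn (f - g)) < ⊤ :=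
    (nrm_absn_sub_le rf.meas rg.meas).trans_lt
      (ENNReal.add_lt_top.2 ⟨nf.trans_lt hρ.lt_top, ng.trans_lt hρ.lt_top⟩)
  have hx0t' : x0 < ⊤ := (nrm_mono hwW le_rfl).trans_lt hx0t
  have hd : ∀ k, ∀ t ∈ Icc t0 t1, ex (-(t * symbol α k)) * coeff (u t - v t) k =
      ex (-(t0 * symbol α k)) * coeff (u t0 - v t0) k +
        ∫ s in t0..t, (forcing α γ univ u k s - forcing α γ χ v k s) := by
    intro k t htt
    have I1 := integrableOn_forcing hα hα1 ht le_rfl ⟨f, rf, nf0⟩ γ univ k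
    have I2 := integrableOn_forcing hα hα1 ht le_rfl ⟨g, rg, ng0⟩ γ χ k
    rw [intervalIntegral.integral_sub, coeff_sub, mul_sub, hu k t htt, hv k t htt, coeff_sub]
    · ring
    · rw [intervalIntegrable_iff_integrableOn_Icc_of_le htt.1]
      exact I1.mono_set (Icc_subset_Icc le_rfl htt.2)
    · rw [intervalIntegrable_iff_integrableOn_Icc_of_le htt.1]
      exact I2.mono_set (Icc_subset_Icc le_rfl htt.2)
  -- Reinserting a density of size `y` into the Duhamel formula yields another one of size `B +
  -- y/2`. As it is a different density, `y/2` cannot be absorbed; iteration from `f - g` reduces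
  -- the excess to `2^{-n} x0` instead, and `η` swallows it.
  have key : ∀ n : ℕ, ∃ h, Rep α t0 t1 (fun t => u t - v t) h ∧ nrm (bexp α) W (absn h) < ⊤ ∧
      nrm (bexp α) w (absn h) ≤ 2 * B + 2⁻¹ ^ n * x0 := by
    intro n
    induction n with
    | zero =>
      refine ⟨f - g, rf.sub rg (fun k => integrable_row hα hw01 rf.meas nf0 k)
        (fun k => integrable_row hα hw01 rg.meas ng0 k), hx0t, ?_⟩
      rw [pow_zero, one_mul]
      exact le_add_self
    | succ n ih =>
      obtain ⟨h, rh, nh, bh⟩ := ih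
      have nh0 : nrm (bexp α) (w0 α) (absn h) < ⊤ := (nrm_mono P.w0_le le_rfl).trans_lt nh
      have md := measurable_diffMajorant (α := α) rf.meas rg.meas rh.meas
      have mo := measurable_outerMajorant (α := α) (χ := χ) (t1 - t0) rf.meas
      have hΓ : ∀ w', nrm (bexp α - 1) w' (fun z => tfac α (t1 - t0) * diffMajorant α f g h z +
          outerMajorant α χ (t1 - t0) f z) ≤ tfac α (t1 - t0) * nrm (bexp α - 1) w' (diffMajorant α f g h) +
          nrm (bexp α - 1) w' (outerMajorant α χ (t1 - t0) f) := by
        intro w'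
        refine (nrm_add_le (φ := fun z => tfac α (t1 - t0) * diffMajorant α f g h z) (by fun_prop) mo).trans ?_
        rw [nrm_const_mul _ md]
      have hDW := nrm_diffMajorant_le P rf.meas rg.meas rh.meas nf ng
      have hDw := nrm_diffMajorant_le P' rf.meas rg.meas rh.meas nf ng
      have htf : tfac α (t1 - t0) ≠ ⊤ := ENNReal.ofReal_ne_top
      obtain ⟨h', rh', nh'⟩ := exists_rep (w := W) hα one_pos hC ht ht1
        (fun k => (integrableOn_forcing hα hα1 ht le_rfl ⟨f, rf, nf0⟩ γ univ k).sub
          (integrableOn_forcing hα hα1 ht le_rfl ⟨g, rg, ng0⟩ γ χ k)) hd P.one_le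
        (Γ := fun z => tfac α (t1 - t0) * diffMajorant α f g h z + outerMajorant α χ (t1 - t0) f z)
        (by fun_prop) (fun k τ => enorm_integral_forcing_sub_le hα hα1 hγ ht rf rg rh nf0 ng0 nh0 k τ)
        ((hΓ W).trans_lt (ENNReal.add_lt_top.2 ⟨ENNReal.mul_lt_top htf.lt_top
          (hDW.trans_lt (by have := nh.ne; finiteness)),
          (nrm_outerMajorant_le P _ rf.meas nf).trans_lt (by finiteness)⟩)) (by
          rw [wn_amp]
          exact (rh.cn_le W ⟨le_rfl, ht⟩).trans_lt (ENNReal.mul_lt_top (embConst_ne_top hα).lt_top nh))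
      refine ⟨h', rh', ?_, ?_⟩
      · refine (nh' W).trans_lt (ENNReal.mul_lt_top hC.1.lt_top (ENNReal.add_lt_top.2 ⟨?_, ?_⟩))
        · rw [wn_amp]
          exact (rh.cn_le W ⟨le_rfl, ht⟩).trans_lt (ENNReal.mul_lt_top (embConst_ne_top hα).lt_top nh)
        · exact ((hΓ W).trans_lt (ENNReal.add_lt_top.2 ⟨ENNReal.mul_lt_top htf.lt_top
            (hDW.trans_lt (by have := nh.ne; finiteness)),
            (nrm_outerMajorant_le P _ rf.meas nf).trans_lt (by finiteness)⟩))
      · refine (nh' w).trans ?_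
        rw [wn_amp]
        set y := nrm (bexp α) w (absn h)
        calc C * (cn w (u t0 - v t0) + _) ≤ C * (cn w (u t0 - v t0) +
              (tfac α (t1 - t0) * (3 * D * ρ ^ 2 * y) +
                nrm (bexp α - 1) w (outerMajorant α χ (t1 - t0) f))) :=
              mul_le_mul' le_rfl (add_le_add le_rfl ((hΓ w).trans (add_le_add
                (mul_le_mul' le_rfl hDw) le_rfl)))
          _ = B + (C * (tfac α (t1 - t0) * (3 * D * ρ ^ 2))) * y := by rw [hB]; ring
          _ ≤ B + 2⁻¹ * (2 * B + 2⁻¹ ^ n * x0) := by gcongr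
          _ = B + (2⁻¹ * 2) * B + 2⁻¹ ^ (n + 1) * x0 := by rw [pow_succ]; ring
          _ = 2 * B + 2⁻¹ ^ (n + 1) * x0 := by
            rw [ENNReal.inv_mul_cancel (by norm_num) (by norm_num)]; ring
  have hlim : Tendsto (fun n : ℕ => (2⁻¹ : ℝ≥0∞) ^ n * x0) atTop (𝓝 0) := by
    have := ENNReal.tendsto_pow_atTop_nhds_zero_of_lt_one (r := 2⁻¹) (by norm_num)
    have := ENNReal.Tendsto.mul_const (b := x0) this (Or.inr hx0t'.ne)
    rwa [zero_mul] at this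
  obtain ⟨n, hn⟩ := ((tendsto_order.1 hlim).2 η (pos_iff_ne_zero.2 hη)).exists
  obtain ⟨h, rh, nh, bh⟩ := key n
  exact ⟨h, rh, nh, bh.trans (by gcongr)⟩

end

section

open scoped ComplexConjugate

/-! ### Local existence -/

/-- The element of `L²` with given Fourier coefficients. -/
def synth (a : ℤ → ℂ) : L2 :=
  open Classical in if h : Memℓp a 2 then fourierBasis.repr.symm ⟨a, h⟩ else 0

lemma coeff_synth {a : ℤ → ℂ} (h : wn 1 (fun k => ‖a k‖ₑ) < ⊤) (k : ℤ) : coeff (synth a) k = a k := by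
  have hm : Memℓp a 2 := by
    rw [memℓp_gen_iff (by norm_num)]
    have h1 : ∑' k, ‖a k‖ₑ ^ 2 ≠ ⊤ := by
      intro h2
      simp only [wn, Pi.one_apply, one_mul, h2] at h
      simp at h
    have h2 := ENNReal.summable_toReal h1
    refine h2.congr fun k => ?_
    simp
  rw [coeff_eq_repr, synth, dif_pos hm, LinearIsometryEquiv.apply_symm_apply]

/-- The function of time with a given density. -/
def evol (α : ℝ) (F : ℤ × ℝ → ℂ) (t : ℝ) : L2 :=
  synth fun k => ex (t * symbol α k) * wave (fun τ => F (k, τ)) t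

variable {α γ t0 t1 : ℝ} {χ : Set ℤ} {u v : ℝ → L2} {f g : ℤ × ℝ → ℂ} {w W : ℤ → ℝ≥0∞}
  {C D : ℝ≥0∞}

lemma coeff_evol (hα : 1 / 2 < α) (hW : 1 ≤ W) (hf : Measurable f) (nf : nrm (bexp α) W (absn f) < ⊤)
    (t : ℝ) (k : ℤ) : coeff (evol α f t) k = ex (t * symbol α k) * wave (fun τ => f (k, τ)) t := by
  refine coeff_synth ?_ k
  refine (wn_mono hW (fun k => ?_)).trans_lt ((wn_row_le α W (measurable_absn hf)).trans_lt
    (ENNReal.mul_lt_top (embConst_ne_top hα).lt_top nf))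
  dsimp only
  rw [enorm_mul, enorm_ex, one_mul]
  refine (enorm_integral_le_lintegral_enorm _).trans (le_of_eq ?_)
  refine lintegral_congr fun τ => ?_
  rw [enorm_mul, enorm_ex, mul_one, absn]

lemma rep_evol (hα : 1 / 2 < α) (hW : 1 ≤ W) (hf : Measurable f) (nf : nrm (bexp α) W (absn f) < ⊤)
    (t0 t1 : ℝ) : Rep α t0 t1 (evol α f) f := by
  refine ⟨hf, fun k t _ => ?_⟩
  rw [coeff_evol hα hW hf nf, ← mul_assoc, ex_neg_mul, one_mul]

/-- The measure on frequency space whose `L²` norm is `nrm (bexp α) W`. -/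
def weightMeasure (α : ℝ) (W : ℤ → ℝ≥0∞) : Measure (ℤ × ℝ) :=
  freqMeasure.withDensity fun z => (W z.1 * jp (bexp α) z.2) ^ 2

lemma eLpNorm_weightMeasure (α : ℝ) (W : ℤ → ℝ≥0∞) (hf : Measurable f) :
    eLpNorm f 2 (weightMeasure α W) = nrm (bexp α) W (absn f) := by
  have hW : Measurable W := Measurable.of_discrete
  have hm := measurable_absn hf
  rw [eLpNorm_eq_lintegral_rpow_enorm_toReal (by norm_num) (by norm_num)]
  unfold nrm sqNorm weightMeasure
  rw [lintegral_withDensity_eq_lintegral_mul _ (by fun_prop) (by fun_prop)]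
  simp only [ENNReal.toReal_ofNat, ENNReal.rpow_ofNat, Pi.mul_apply]
  congr 1
  refine lintegral_congr fun z => ?_
  rw [absn]; ring

lemma ae_of_ae_weightMeasure (hW : 1 ≤ W) {p : ℤ × ℝ → Prop} (h : ∀ᵐ z ∂(weightMeasure α W), p z) :
    ∀ᵐ z ∂freqMeasure, p z := by
  have hWm : Measurable W := Measurable.of_discrete
  refine (withDensity_absolutelyContinuous' (by fun_prop) (ae_of_all _ fun z => ?_)).ae_le h
  have h1 : W z.1 ≠ 0 := fun h => by have := hW z.1; simp [h] at this
  exact pow_ne_zero 2 (mul_ne_zero h1 (jp_ne_zero _ _))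

/-- The Duhamel map on densities. -/
def picard (α γ t0 t1 : ℝ) (φ : L2) (F : ℤ × ℝ → ℂ) : ℤ × ℝ → ℂ :=
  density 1 t0 t1 (fun k => ex (-(t0 * symbol α k)) * coeff φ k)
    fun z => forcingCoeff γ univ z.1 * osc α t0 t1 (evol α F) (evol α F) (evol α F) z

lemma nrm_picard_le (hα : 1 / 2 < α) (hα1 : α < 1) (hC : DensityBound α 1 C)
    (P : TriPair α D W W) (hγ : |γ| ≤ 1) (ht : t0 ≤ t1) (ht1 : t1 - t0 ≤ 1) (φ : L2)
    {ρ : ℝ≥0∞} (hρ : ρ ≠ ⊤) (hf : Measurable f) (nf : nrm (bexp α) W (absn f) ≤ ρ) :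
    nrm (bexp α) W (absn (picard α γ t0 t1 φ f)) ≤
      C * (cn W φ + tfac α (t1 - t0) * (D * ρ ^ 3)) := by
  have hfin := nf.trans_lt hρ.lt_top
  have nf0 : nrm (bexp α) (w0 α) (absn f) < ⊤ := (nrm_mono P.w0_le le_rfl).trans_lt hfin
  have hr := rep_evol hα P.one_le hf hfin t0 t1
  have m := measurable_absn hf
  have M : Measurable (majorant α 1 (absn f) (absn f) (absn f)) := measurable_majorant m m m
  refine (hC.2 t0 t1 _ _ (fun z => tfac α (t1 - t0) * majorant α 1 (absn f) (absn f) (absn f) z) ht ht1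
    (by fun_prop) (fun z => ?_) W).trans ?_
  · unfold absn
    rw [enorm_mul]
    refine (mul_le_mul' (enorm_forcingCoeff_le hγ univ z.1)
      ((integrable_tri_and_osc_le hα hα1 ht hr hr hr nf0 nf0 nf0).2 z)).trans ?_
    rw [one_mul]; rfl
  · rw [wn_amp, nrm_const_mul _ M]
    gcongr
    exact P.nrm_le_of_le hf nf

lemma nrm_picard_sub_le (hα : 1 / 2 < α) (hα1 : α < 1) (hC : DensityBound α 1 C)
    (P : TriPair α D W W) (hγ : |γ| ≤ 1) (ht : t0 ≤ t1) (ht1 : t1 - t0 ≤ 1) (φ : L2)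
    {ρ : ℝ≥0∞} (hρ : ρ ≠ ⊤) (hf : Measurable f) (nf : nrm (bexp α) W (absn f) ≤ ρ)
    (hg : Measurable g) (ng : nrm (bexp α) W (absn g) ≤ ρ) :
    nrm (bexp α) W (absn (picard α γ t0 t1 φ f - picard α γ t0 t1 φ g)) ≤
      C * (tfac α (t1 - t0) * (3 * D * ρ ^ 2)) * nrm (bexp α) W (absn (f - g)) := by
  have hw01 : 1 ≤ w0 α := fun k => one_le_w0 hα1 k
  have hffin := nf.trans_lt hρ.lt_top
  have hgfin := ng.trans_lt hρ.lt_top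
  have nf0 : nrm (bexp α) (w0 α) (absn f) < ⊤ := (nrm_mono P.w0_le le_rfl).trans_lt hffin
  have ng0 : nrm (bexp α) (w0 α) (absn g) < ⊤ := (nrm_mono P.w0_le le_rfl).trans_lt hgfin
  have hfg : Measurable (f - g) := hf.sub hg
  have nfg0 : nrm (bexp α) (w0 α) (absn (f - g)) < ⊤ :=
    (nrm_absn_sub_le hf hg).trans_lt (ENNReal.add_lt_top.2 ⟨nf0, ng0⟩)
  have rf := rep_evol hα P.one_le hf hffin t0 t1
  have rg := rep_evol hα P.one_le hg hgfin t0 t1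
  have rh := rf.sub rg (fun k => integrable_row hα hw01 hf nf0 k)
    (fun k => integrable_row hα hw01 hg ng0 k)
  have e : picard α γ t0 t1 φ f - picard α γ t0 t1 φ g = density 1 t0 t1 0
      ((fun z => forcingCoeff γ univ z.1 * osc α t0 t1 (evol α f) (evol α f) (evol α f) z) -
        fun z => forcingCoeff γ univ z.1 * osc α t0 t1 (evol α g) (evol α g) (evol α g) z) := by
    ext z
    exact density_sub _ _ _ _ _ _ _
  have M := measurable_diffMajorant (α := α) hf hg hfg
  rw [e]
  refine (hC.2 t0 t1 _ _ (fun z => tfac α (t1 - t0) * diffMajorant α f g (f - g) z) ht ht1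
    (by fun_prop) (fun z => ?_) W).trans ?_
  · unfold absn
    rw [Pi.sub_apply, ← mul_sub, enorm_mul]
    refine (mul_le_mul' (enorm_forcingCoeff_le hγ univ z.1)
      (osc_sub_osc_le hα hα1 ht rf rg rh nf0 ng0 nfg0 z)).trans ?_
    rw [one_mul]
  · have : wn W (fun k => ‖(0 : ℤ → ℂ) k‖ₑ) = 0 := by simp [wn]
    rw [this, zero_add, nrm_const_mul _ M, mul_assoc C, mul_assoc (tfac α _)]
    gcongr
    exact nrm_diffMajorant_le P hf hg hfg nf ng

lemma picard_spec (hα : 1 / 2 < α) (hα1 : α < 1) (hC : DensityBound α 1 C)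
    (P : TriPair α D W W) (hD : D ≠ ⊤) (hγ : |γ| ≤ 1) (ht : t0 ≤ t1) (ht1 : t1 - t0 ≤ 1) {φ : L2}
    (hφ : cn W φ < ⊤) (hf : Measurable f) (nf : nrm (bexp α) W (absn f) < ⊤) :
    Measurable (picard α γ t0 t1 φ f) ∧ nrm (bexp α) W (absn (picard α γ t0 t1 φ f)) < ⊤ ∧
      ∀ k, ∀ t ∈ Icc t0 t1, ex (-(t0 * symbol α k)) * coeff φ k +
        ∫ s in t0..t, forcing α γ univ (evol α f) k s =
        wave (fun τ => picard α γ t0 t1 φ f (k, τ)) t := by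
  have hr := rep_evol hα P.one_le hf nf t0 t1
  have h1 : nrm (bexp α) W (absn (picard α γ t0 t1 φ f)) < ⊤ :=
    (nrm_picard_le hα hα1 hC P hγ ht ht1 φ nf.ne hf le_rfl).trans_lt
      (ENNReal.mul_lt_top hC.1.lt_top (ENNReal.add_lt_top.2 ⟨hφ, by
        have := nf.ne
        have : tfac α (t1 - t0) ≠ ⊤ := ENNReal.ofReal_ne_top
        finiteness⟩))
  have h2 := wave_density (a := fun k => ex (-(t0 * symbol α k)) * coeff φ k) hα one_pos ht ht1
    (fun k => integrableOn_forcing hα hα1 ht P.w0_le ⟨f, hr, nf⟩ γ univ k) P.one_le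
    (G := fun z => forcingCoeff γ univ z.1 * osc α t0 t1 (evol α f) (evol α f) (evol α f) z)
    (fun k τ => (integral_forcing _ _ _ _ _ _ _ _).symm) h1
  exact ⟨h2.1, h1, h2.2⟩

/-- Local existence. -/
theorem exists_sol (hα : 1 / 2 < α) (hα1 : α < 1) (hC : DensityBound α 1 C)
    (P : TriPair α D W W) (hD : D ≠ ⊤) (hγ : |γ| ≤ 1) (ht : t0 ≤ t1) (ht1 : t1 - t0 ≤ 1) {φ : L2}
    {R : ℝ≥0∞} (hR : R ≠ ⊤) (hφ : cn W φ ≤ R)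
    (hsmall : 24 * C ^ 3 * D * tfac α (t1 - t0) * R ^ 2 ≤ 1) :
    ∃ u, Sol α γ univ t0 t1 W u ∧ u t0 = φ ∧ ∀ t ∈ Icc t0 t1, cn W (u t) ≤ embConst α * (2 * C * R) := by
  have hCt := hC.1
  have htf : tfac α (t1 - t0) ≠ ⊤ := ENNReal.ofReal_ne_top
  have hφt : cn W φ < ⊤ := hφ.trans_lt hR.lt_top
  set ρ := 2 * C * R with hρ
  have hρt : ρ ≠ ⊤ := by finiteness
  have hself : C * (cn W φ + tfac α (t1 - t0) * (D * ρ ^ 3)) ≤ ρ := by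
    calc _ ≤ C * (R + (24 * C ^ 3 * D * tfac α (t1 - t0) * R ^ 2) * R) := by
          refine mul_le_mul' le_rfl (add_le_add hφ ?_)
          calc _ = 8 * (C ^ 3 * D * tfac α (t1 - t0) * R ^ 3) := by rw [hρ]; ring
            _ ≤ 24 * (C ^ 3 * D * tfac α (t1 - t0) * R ^ 3) := by gcongr; norm_num
            _ = _ := by ring
      _ ≤ C * (R + 1 * R) := by gcongr
      _ = ρ := by rw [hρ]; ring
  -- The contraction factor is `3 C D σ (2CR)²`, and asking for at most `1/2` is where the constant
  -- `24 = 2 · 3 · 2²` of the smallness condition comes from.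
  have hcon : C * (tfac α (t1 - t0) * (3 * D * ρ ^ 2)) ≤ 2⁻¹ := by
    rw [ENNReal.le_inv_iff_mul_le]
    refine le_trans (le_of_eq ?_) hsmall
    rw [hρ]; ring
  set μ := weightMeasure α W with hμ
  have hEm : ∀ F : Lp ℂ 2 μ, Measurable (F : ℤ × ℝ → ℂ) := fun F => (Lp.stronglyMeasurable F).measurable
  have hEn : ∀ F : Lp ℂ 2 μ, nrm (bexp α) W (absn (F : ℤ × ℝ → ℂ)) = ‖F‖ₑ := fun F => by
    rw [← eLpNorm_weightMeasure α W (hEm F), Lp.enorm_def]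
  have hEf : ∀ F : Lp ℂ 2 μ, nrm (bexp α) W (absn (F : ℤ × ℝ → ℂ)) < ⊤ := fun F => by
    rw [hEn]; exact enorm_lt_top
  have hspec := fun F : Lp ℂ 2 μ => picard_spec hα hα1 hC P hD hγ ht ht1 hφt (hEm F) (hEf F)
  have hmem : ∀ F : Lp ℂ 2 μ, MemLp (picard α γ t0 t1 φ F) 2 μ := fun F =>
    ⟨(hspec F).1.aestronglyMeasurable, by rw [eLpNorm_weightMeasure α W (hspec F).1]; exact (hspec F).2.1⟩
  set T : Lp ℂ 2 μ → Lp ℂ 2 μ := fun F => (hmem F).toLp with hT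
  have hTn : ∀ F, ‖T F‖ₑ = nrm (bexp α) W (absn (picard α γ t0 t1 φ F)) := fun F => by
    rw [hT, ← eLpNorm_weightMeasure α W (hspec F).1]
    exact Lp.enorm_toLp _
  set s : Set (Lp ℂ 2 μ) := {F | ‖F‖ₑ ≤ ρ} with hs
  have hsc : IsComplete s := (isClosed_le continuous_enorm continuous_const).isComplete
  have hmaps : MapsTo T s s := by
    intro F hF
    simp only [hs, mem_ofPred_eq] at hF ⊢
    rw [hTn]
    exact (nrm_picard_le hα hα1 hC P hγ ht ht1 φ hρt (hEm F) (by rwa [hEn])).trans hself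
  have hlip : ContractingWith 2⁻¹ (hmaps.restrict T s s) := by
    refine ⟨by norm_num, fun F G => ?_⟩
    have hF : ‖(F : Lp ℂ 2 μ)‖ₑ ≤ ρ := F.2
    have hG : ‖(G : Lp ℂ 2 μ)‖ₑ ≤ ρ := G.2
    change edist (T F) (T G) ≤ ((2⁻¹ : NNReal) : ℝ≥0∞) * edist (F : Lp ℂ 2 μ) (G : Lp ℂ 2 μ)
    rw [hT, Lp.edist_toLp_toLp, Lp.edist_def, eLpNorm_weightMeasure α W ((hspec _).1.sub (hspec _).1),
      eLpNorm_weightMeasure α W ((hEm _).sub (hEm _))]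
    refine (nrm_picard_sub_le hα hα1 hC P hγ ht ht1 φ hρt (hEm _) (by rwa [hEn]) (hEm _)
      (by rwa [hEn])).trans ?_
    refine mul_le_mul' ?_ le_rfl
    refine hcon.trans (le_of_eq ?_)
    simp [ENNReal.coe_inv]
  obtain ⟨y, hys, hfix, -⟩ := hlip.exists_fixedPoint' hsc hmaps (x := 0) (by simp [hs])
    (edist_ne_top _ _)
  -- The fixed point is an identity of classes in `L²`. The weights never vanish, so it holds almost
  -- everywhere for the unweighted measure, which is all that the integral `wave` sees.
  have hae : ∀ᵐ z ∂freqMeasure, picard α γ t0 t1 φ y z = (y : ℤ × ℝ → ℂ) z := by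
    have h1 : (T y : ℤ × ℝ → ℂ) =ᵐ[μ] picard α γ t0 t1 φ y := (hmem y).coeFn_toLp
    rw [hfix.eq] at h1
    exact ae_of_ae_weightMeasure P.one_le (h1.symm)
  have hrow : ∀ k, ∀ᵐ τ : ℝ, picard α γ t0 t1 φ y (k, τ) = (y : ℤ × ℝ → ℂ) (k, τ) := by
    have := Measure.ae_ae_of_ae_prod hae
    -- Null sets of the counting measure are empty, so the identity holds for every `k` and almost
    -- every `τ`.
    rw [ae_iff, Measure.count_eq_zero_iff] at this
    intro k
    by_contra hk
    have hm : k ∈ ({a | ¬ ∀ᵐ τ : ℝ, picard α γ t0 t1 φ y (a, τ) = (y : ℤ × ℝ → ℂ) (a, τ)} : Set ℤ) := hk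
    rw [this] at hm
    exact hm
  have hrep := rep_evol hα P.one_le (hEm y) (hEf y) t0 t1
  have hD : ∀ k, ∀ t ∈ Icc t0 t1, ex (-(t * symbol α k)) * coeff (evol α y t) k =
      ex (-(t0 * symbol α k)) * coeff φ k + ∫ s in t0..t, forcing α γ univ (evol α y) k s := by
    intro k t htt
    rw [hrep.eq k t htt, (hspec y).2.2 k t htt]
    unfold wave
    refine integral_congr_ae ?_
    filter_upwards [hrow k] with τ hτ
    rw [hτ]
  have h0 : evol α y t0 = φ := by
    refine coeff_injective fun k => ?_
    have := hD k t0 ⟨le_rfl, ht⟩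
    rw [intervalIntegral.integral_same, add_zero] at this
    exact mul_left_cancel₀ (ex_ne_zero _) this
  refine ⟨evol α y, ⟨⟨y, hrep, hEf y⟩, fun k t htt => ?_⟩, h0, fun t htt => ?_⟩
  · rw [h0]; exact hD k t htt
  · refine (hrep.cn_le W htt).trans ?_
    gcongr
    rw [hEn]; exact hys

end

section

/-! ### Stability on long intervals -/

variable {α γ t0 t1 : ℝ} {χ : Set ℤ} {u v : ℝ → L2} {f g : ℤ × ℝ → ℂ} {w W : ℤ → ℝ≥0∞}
  {C D R θ : ℝ≥0∞}

lemma le_mul_of_forall_le_mul_add {a c X : ℝ≥0∞} (hc : c ≠ ⊤)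
    (h : ∀ η : ℝ≥0∞, η ≠ 0 → a ≤ c * (X + η)) : a ≤ c * X := by
  have h1 : Tendsto (fun n : ℕ => c * (X + (n : ℝ≥0∞)⁻¹)) atTop (𝓝 (c * (X + 0))) :=
    ENNReal.Tendsto.const_mul (ENNReal.tendsto_inv_nat_nhds_zero.const_add X) (Or.inr hc)
  rw [add_zero] at h1
  exact ge_of_tendsto' h1 fun n => h _ (by simp)

/-- The parameters of a short time step: `δ` is small in terms of the size `R`. -/
structure ShortStep (α : ℝ) (C D : ℝ≥0∞) (δ : ℝ) (R : ℝ≥0∞) : Prop where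
  nonneg : 0 ≤ δ
  le_one : δ ≤ 1
  pos : R ≠ 0
  fin : R ≠ ⊤
  small : 24 * C ^ 3 * D * tfac α δ * R ^ 2 ≤ 1

lemma ShortStep.half_le {δ : ℝ} (h : ShortStep α C D δ R) :
    C * (tfac α δ * (3 * D * (2 * C * R) ^ 2)) ≤ 2⁻¹ := by
  rw [ENNReal.le_inv_iff_mul_le]
  refine le_trans (le_of_eq ?_) h.small
  ring

lemma ShortStep.cube_le {δ : ℝ} (h : ShortStep α C D δ R) :
    tfac α δ * (D * (2 * C * R) ^ 3) ≤ R := by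
  calc _ = 8 * (C ^ 3 * D * tfac α δ * R ^ 3) := by ring
    _ ≤ 24 * (C ^ 3 * D * tfac α δ * R ^ 3) := by gcongr; norm_num
    _ = 24 * C ^ 3 * D * tfac α δ * R ^ 2 * R := by ring
    _ ≤ 1 * R := by gcongr; exact h.small
    _ = R := one_mul R

/-- Outside `χ` the weak weight is at most `θ` times the strong one, so discarding these frequencies
of the nonlinearity costs only `θ R` in the weak norm. With `χ` the frequencies up to `M`, this is a
source of the rate `M^{-s}`. -/
lemma nrm_outerMajorant_weight_le {δ : ℝ} (P : TriPair α D W W) (hδ : ShortStep α C D δ R)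
    (hf : Measurable f) (nf : nrm (bexp α) W (absn f) ≤ 2 * C * R)
    (hθ : ∀ k, k ∉ χ → w k ≤ θ * W k) :
    nrm (bexp α - 1) w (outerMajorant α χ δ f) ≤ θ * R := by
  have m := measurable_absn hf
  have M : Measurable (majorant α 1 (absn f) (absn f) (absn f)) := measurable_majorant m m m
  have hWm : Measurable W := Measurable.of_discrete
  set X : ℤ × ℝ → ℝ≥0∞ := fun z => tfac α δ * majorant α 1 (absn f) (absn f) (absn f) z with hX
  have hXm : Measurable X := by fun_prop
  have hXn : nrm (bexp α - 1) W X ≤ R := by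
    rw [hX, nrm_const_mul _ M]
    refine le_trans ?_ hδ.cube_le
    gcongr
    exact P.nrm_le_of_le hf nf
  calc nrm (bexp α - 1) w (outerMajorant α χ δ f)
      = nrm (bexp α - 1) (fun k => w k * χᶜ.indicator 1 k) X :=
        nrm_weight_mul w (χᶜ.indicator 1) X
    _ ≤ nrm (bexp α - 1) (fun k => 1 * (θ * W k)) X := by
        refine nrm_mono (fun k => ?_) le_rfl
        by_cases hk : k ∈ χ
        · simp [hk]
        · simpa [hk] using hθ k hk
    _ = nrm (bexp α - 1) W (fun z => θ * X z) := by
        refine Eq.trans ?_ (nrm_weight_mul (r := bexp α - 1) W (fun _ => θ) X).symm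
        congr 1
        ext k
        ring
    _ = θ * nrm (bexp α - 1) W X := nrm_const_mul _ hXm
    _ ≤ θ * R := by gcongr

/-- Comparison of a solution of the full equation and a solution of a projected one in a short
time step, with a density for the difference. -/
lemma Sol.exists_rep_sub (hα : 1 / 2 < α) (hα1 : α < 1) (hC : DensityBound α 1 C)
    (P : TriPair α D W W) (P' : TriPair α D w W) (hwW : w ≤ W) (hD : D ≠ ⊤) (hγ : |γ| ≤ 1)
    (ht : t0 ≤ t1) (hδ : ShortStep α C D (t1 - t0) R)
    (hu : Sol α γ univ t0 t1 W u) (hv : Sol α γ χ t0 t1 W v)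
    (huR : ∀ t ∈ Icc t0 t1, cn W (u t) ≤ R) (hvR : ∀ t ∈ Icc t0 t1, cn W (v t) ≤ R)
    (hθ : ∀ k, k ∉ χ → w k ≤ θ * W k) {η : ℝ≥0∞} (hη : η ≠ 0) :
    ∃ f g h, Rep α t0 t1 u f ∧ Rep α t0 t1 v g ∧ Rep α t0 t1 (fun t => u t - v t) h ∧
      nrm (bexp α) W (absn f) ≤ 2 * C * R ∧ nrm (bexp α) W (absn g) ≤ 2 * C * R ∧
      nrm (bexp α) W (absn h) < ⊤ ∧
      nrm (bexp α) w (absn h) ≤ 2 * (C * (cn w (u t0 - v t0) + θ * R)) + η := by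
  obtain ⟨f, rf, nf⟩ := hu.exists_rep_le hα hα1 hC P hD hγ ht hδ.le_one hδ.pos hδ.fin huR hδ.small
  obtain ⟨g, rg, ng⟩ := hv.exists_rep_le hα hα1 hC P hD hγ ht hδ.le_one hδ.pos hδ.fin hvR hδ.small
  obtain ⟨h, rh, nh, bh⟩ := exists_rep_sub_le hα hα1 hC P P' hwW hD hγ ht hδ.le_one hu.duhamel
    hv.duhamel (ρ := 2 * C * R) (by have := hC.1; have := hδ.fin; finiteness) rf nf rg ng hδ.half_le hη
  refine ⟨f, g, h, rf, rg, rh, nf, ng, nh, bh.trans ?_⟩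
  gcongr
  exact nrm_outerMajorant_weight_le P hδ rf.meas nf hθ

/-- The growth factor of a short time step. -/
def growth (α : ℝ) (C : ℝ≥0∞) : ℝ≥0∞ := embConst α * (2 * C)

lemma Sol.cn_sub_le_step (hα : 1 / 2 < α) (hα1 : α < 1) (hC : DensityBound α 1 C)
    (P : TriPair α D W W) (P' : TriPair α D w W) (hwW : w ≤ W) (hD : D ≠ ⊤) (hγ : |γ| ≤ 1)
    (ht : t0 ≤ t1) (hδ : ShortStep α C D (t1 - t0) R)
    (hu : Sol α γ univ t0 t1 W u) (hv : Sol α γ χ t0 t1 W v)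
    (huR : ∀ t ∈ Icc t0 t1, cn W (u t) ≤ R) (hvR : ∀ t ∈ Icc t0 t1, cn W (v t) ≤ R)
    (hθ : ∀ k, k ∉ χ → w k ≤ θ * W k) {t : ℝ} (htt : t ∈ Icc t0 t1) :
    cn w (u t - v t) ≤ growth α C * (cn w (u t0 - v t0) + θ * R) := by
  have : cn w (u t - v t) ≤ embConst α * (2 * (C * (cn w (u t0 - v t0) + θ * R))) := by
    refine le_mul_of_forall_le_mul_add (embConst_ne_top hα) fun η hη => ?_
    obtain ⟨f, g, h, rf, rg, rh, nf, ng, nh, bh⟩ := Sol.exists_rep_sub hα hα1 hC P P' hwW hD hγ ht hδ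
      hu hv huR hvR hθ hη
    refine (rh.cn_le w htt).trans ?_
    gcongr
  refine this.trans (le_of_eq ?_)
  unfold growth; ring

/-- Comparison over `n` time steps. -/
lemma Sol.cn_sub_le (hα : 1 / 2 < α) (hα1 : α < 1) (hC : DensityBound α 1 C)
    (P : TriPair α D W W) (P' : TriPair α D w W) (hwW : w ≤ W) (hD : D ≠ ⊤) (hγ : |γ| ≤ 1)
    {δ : ℝ} (hδ : ShortStep α C D δ R) (n : ℕ)
    (hu : Sol α γ univ 0 (n * δ) W u) (hv : Sol α γ χ 0 (n * δ) W v)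
    (huR : ∀ t ∈ Icc 0 (n * δ), cn W (u t) ≤ R) (hvR : ∀ t ∈ Icc 0 (n * δ), cn W (v t) ≤ R)
    (hθ : ∀ k, k ∉ χ → w k ≤ θ * W k) :
    ∀ t ∈ Icc 0 (n * δ), cn w (u t - v t) + θ * R ≤
      (growth α C + 1) ^ n * (cn w (u 0 - v 0) + θ * R) := by
  have h0 := hδ.nonneg
  induction n with
  | zero =>
    intro t ht
    simp only [Nat.cast_zero, zero_mul, Icc_self, mem_singleton_iff] at ht
    simp [ht]
  | succ n ih =>
    have hn : (n : ℝ) * δ ≤ ((n + 1 : ℕ) : ℝ) * δ := by push_cast; nlinarith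
    have hn0 : 0 ≤ (n : ℝ) * δ := by positivity
    have hsub : Icc 0 (n * δ) ⊆ Icc 0 (((n + 1 : ℕ) : ℝ) * δ) := Icc_subset_Icc le_rfl hn
    have hsub' : Icc (n * δ) (((n + 1 : ℕ) : ℝ) * δ) ⊆ Icc 0 (((n + 1 : ℕ) : ℝ) * δ) :=
      Icc_subset_Icc hn0 le_rfl
    have IH := ih (hu.mono hα hα1 P.w0_le le_rfl hn0 hn) (hv.mono hα hα1 P.w0_le le_rfl hn0 hn)
      (fun t ht => huR t (hsub ht)) (fun t ht => hvR t (hsub ht))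
    set Y := cn w (u 0 - v 0) + θ * R with hY
    have hg1 : (1 : ℝ≥0∞) ≤ growth α C + 1 := le_add_self
    intro t ht
    rcases le_total t (n * δ) with htn | htn
    · refine (IH t ⟨ht.1, htn⟩).trans ?_
      gcongr
      exact Nat.le_succ n
    · have e : ((n + 1 : ℕ) : ℝ) * δ - n * δ = δ := by push_cast; ring
      have hs := Sol.cn_sub_le_step hα hα1 hC P P' hwW hD hγ hn (by rw [e]; exact hδ)
        (hu.mono hα hα1 P.w0_le hn0 hn le_rfl) (hv.mono hα hα1 P.w0_le hn0 hn le_rfl)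
        (fun t ht => huR t (hsub' ht)) (fun t ht => hvR t (hsub' ht)) hθ ⟨htn, ht.2⟩
      have hI := IH (n * δ) ⟨hn0, le_rfl⟩
      -- Adding `θ R` to the error makes the recursion homogeneous, so each step multiplies it by
      -- `growth α C + 1`.
      calc cn w (u t - v t) + θ * R
          ≤ growth α C * (cn w (u (n * δ) - v (n * δ)) + θ * R) +
            1 * (cn w (u (n * δ) - v (n * δ)) + θ * R) := by
            refine add_le_add hs ?_
            rw [one_mul]; exact le_add_self
        _ = (growth α C + 1) * (cn w (u (n * δ) - v (n * δ)) + θ * R) := by ring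
        _ ≤ (growth α C + 1) * ((growth α C + 1) ^ n * Y) := by gcongr
        _ = _ := by ring

lemma exists_shortStep (hα : 1 / 2 < α) (hC : C ≠ ⊤) (hD : D ≠ ⊤) (hR0 : R ≠ 0) (hR : R ≠ ⊤)
    {T : ℝ} (hT : 0 < T) : ∃ (n : ℕ) (δ : ℝ), ShortStep α C D δ R ∧ n * δ = T := by
  obtain ⟨x, hx, hxs⟩ := exists_tfac_mul_le hα (c := 24 * C ^ 3 * D * R ^ 2) (r := 1)
    (by finiteness) one_ne_zero
  obtain ⟨n, hn⟩ := exists_nat_gt (T / min x 1)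
  have hm : 0 < min x 1 := lt_min hx one_pos
  have hn0 : (0 : ℝ) < n := (div_pos hT hm).trans hn
  have hd : T / n ≤ min x 1 := by
    rw [div_le_iff₀ hn0, mul_comm]
    rw [div_lt_iff₀ hm] at hn
    exact hn.le
  refine ⟨n, T / n, ⟨by positivity, hd.trans (min_le_right _ _), hR0, hR, ?_⟩, by field_simp⟩
  calc _ = tfac α (T / n) * (24 * C ^ 3 * D * R ^ 2) := by ring
    _ ≤ tfac α x * (24 * C ^ 3 * D * R ^ 2) := by
        gcongr
        exact tfac_mono hα (by positivity) (hd.trans (min_le_left _ _))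
    _ ≤ 1 := hxs

lemma HasRep.exists_cn_le (hα : 1 / 2 < α) (h : HasRep α t0 t1 W u) :
    ∃ B : ℝ≥0∞, B ≠ ⊤ ∧ ∀ t ∈ Icc t0 t1, cn W (u t) ≤ B := by
  obtain ⟨f, hf, nf⟩ := h
  exact ⟨_, (ENNReal.mul_lt_top (embConst_ne_top hα).lt_top nf).ne, fun t ht => hf.cn_le W ht⟩

lemma eq_of_cn_sub_eq_zero (hw : 1 ≤ w) {f g : L2} (h : cn w (f - g) = 0) : f = g := by
  refine coeff_injective fun k => ?_
  have h1 := le_wn w (fun k => ‖coeff (f - g) k‖ₑ) k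
  rw [← cn, h] at h1
  have h2 : ‖coeff (f - g) k‖ₑ = 0 := by
    rcases mul_eq_zero.1 (le_antisymm h1 (zero_le)) with h3 | h3
    · have := hw k; simp [h3] at this
    · exact h3
  rw [enorm_eq_zero, coeff_sub, sub_eq_zero] at h2
  exact h2

/-- Uniqueness. -/
lemma Sol.unique (hα : 1 / 2 < α) (hα1 : α < 1) (P : TriPair α D W W) (hD : D ≠ ⊤) (hγ : |γ| ≤ 1)
    {T : ℝ} (hT : 0 < T) (hu : Sol α γ univ 0 T W u) (hv : Sol α γ univ 0 T W v)
    (h0 : u 0 = v 0) : ∀ t ∈ Icc 0 T, u t = v t := by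
  obtain ⟨C, hC⟩ := exists_densityBound hα hα1 one_pos
  obtain ⟨B1, hB1, h1⟩ := hu.rep.exists_cn_le hα
  obtain ⟨B2, hB2, h2⟩ := hv.rep.exists_cn_le hα
  obtain ⟨n, δ, hδ, hn⟩ := exists_shortStep hα hC.1 hD (R := B1 + B2 + 1) (by simp)
    (by finiteness) hT
  intro t ht
  have := Sol.cn_sub_le (θ := 0) hα hα1 hC P P le_rfl hD hγ hδ n (by rwa [hn]) (by rwa [hn])
    (fun t ht => (h1 t (by rwa [← hn])).trans (by rw [add_assoc]; exact le_self_add))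
    (fun t ht => (h2 t (by rwa [← hn])).trans (by rw [add_comm B1, add_assoc]; exact le_self_add))
    (fun k hk => absurd (mem_univ k) hk) t (by rwa [hn])
  rw [h0, sub_self, zero_mul, add_zero, add_zero] at this
  have h3 : cn W (0 : L2) = 0 := by simp [cn, wn]
  rw [h3, mul_zero] at this
  exact eq_of_cn_sub_eq_zero P.one_le (le_antisymm this (zero_le))

end

section

/-! ### Weights and interpolation -/

/-- The sum of three frequencies is at most three times the largest, which costs `3^s ≤ 3^S`. The
constant is thus uniform over `s ≤ S`. -/
lemma isWeight_jp {α s S : ℝ} (hα1 : α < 1) (h : sexp α ≤ s) (hS : s ≤ S) :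
    IsWeight α (ENNReal.ofReal (3 ^ S)) (fun k => jp s k) := by
  have hs0 : 0 ≤ s := le_trans (by unfold sexp; linarith) h
  refine ⟨fun k1 k2 k3 => ?_, fun k => jp_mono h _, fun k => jp_ne_top _ _⟩
  have key : ∀ m : ℝ, |((k1 - k2 + k3 : ℤ) : ℝ)| ≤ 3 * |m| →
      jp s ((k1 - k2 + k3 : ℤ) : ℝ) ≤ ENNReal.ofReal (3 ^ S) * jp s m := by
    intro m hm
    unfold jp
    rw [← ENNReal.ofReal_mul (by positivity)]
    refine ENNReal.ofReal_le_ofReal ?_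
    calc (1 + |((k1 - k2 + k3 : ℤ) : ℝ)|) ^ s ≤ (3 * (1 + |m|)) ^ s := by
          gcongr; linarith [abs_nonneg m]
      _ = 3 ^ s * (1 + |m|) ^ s := Real.mul_rpow (by norm_num) (by positivity)
      _ ≤ 3 ^ S * (1 + |m|) ^ s := by
          gcongr
          norm_num
  have htri : |((k1 - k2 + k3 : ℤ) : ℝ)| ≤ |(k1 : ℝ)| + |(k2 : ℝ)| + |(k3 : ℝ)| := by
    push_cast
    calc |(k1 : ℝ) - k2 + k3| ≤ |(k1 : ℝ) - k2| + |(k3 : ℝ)| := abs_add_le _ _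
      _ ≤ _ := by gcongr; exact abs_sub _ _
  rcases le_total |(k1 : ℝ)| |(k2 : ℝ)| with h12 | h12
  · rcases le_total |(k2 : ℝ)| |(k3 : ℝ)| with h23 | h23
    · refine (key k3 (by linarith)).trans ?_
      gcongr; exact le_add_self
    · refine (key k2 (by linarith)).trans ?_
      gcongr; exact le_add_self.trans le_self_add
  · rcases le_total |(k1 : ℝ)| |(k3 : ℝ)| with h13 | h13
    · refine (key k3 (by linarith)).trans ?_
      gcongr; exact le_add_self
    · refine (key k1 (by linarith)).trans ?_
      gcongr; exact le_self_add.trans le_self_add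

/-- Quasi-monotonicity is linear in the weight, so the constant does not see `lam`. This allows
`lam` to depend on the size of the solution. -/
lemma IsWeight.add_smul {α : ℝ} {D lam : ℝ≥0∞} {w w' : ℤ → ℝ≥0∞} (h : IsWeight α D w)
    (h' : IsWeight α D w') (hl : lam ≠ ⊤) : IsWeight α D (w + fun k => lam * w' k) := by
  refine ⟨fun k1 k2 k3 => ?_, fun k => (h.w0_le k).trans le_self_add, fun k => ?_⟩
  · simp only [Pi.add_apply]
    calc _ ≤ D * (w k1 + w k2 + w k3) + lam * (D * (w' k1 + w' k2 + w' k3)) := by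
          gcongr
          · exact h.le_sum _ _ _
          · exact h'.le_sum _ _ _
      _ = _ := by ring
  · exact ENNReal.add_ne_top.2 ⟨h.ne_top k, ENNReal.mul_ne_top hl (h'.ne_top k)⟩

/-- Split at `1 + |τ| = M`. An `L²` error of size `M^{-s}` and an `H^s` bound then combine to
`M^{s'-s}`, with no interpolation of exponents in the constants. -/
lemma jp_interpolation {s' s : ℝ} (h0 : 0 ≤ s') (h : s' ≤ s) {M : ℕ} (hM : 1 ≤ M) (τ : ℝ) :
    jp s' τ ≤ ENNReal.ofReal ((M : ℝ) ^ s') + ENNReal.ofReal ((M : ℝ) ^ (s' - s)) * jp s τ := by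
  have hM' : (1 : ℝ) ≤ M := by exact_mod_cast hM
  unfold jp
  rw [← ENNReal.ofReal_mul (by positivity), ← ENNReal.ofReal_add (by positivity) (by positivity)]
  refine ENNReal.ofReal_le_ofReal ?_
  have hx : 0 < 1 + |τ| := by positivity
  rcases le_total (1 + |τ|) M with h1 | h1
  · have : (1 + |τ|) ^ s' ≤ (M : ℝ) ^ s' := by gcongr
    have : 0 ≤ (M : ℝ) ^ (s' - s) * (1 + |τ|) ^ s := by positivity
    linarith
  · have h2 : (1 + |τ|) ^ (s' - s) ≤ (M : ℝ) ^ (s' - s) :=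
      Real.rpow_le_rpow_of_nonpos (by linarith) h1 (by linarith)
    have h3 : (1 + |τ|) ^ s' = (1 + |τ|) ^ (s' - s) * (1 + |τ|) ^ s := by
      rw [← Real.rpow_add hx]; ring_nf
    have : 0 ≤ (M : ℝ) ^ s' := by positivity
    rw [h3]
    nlinarith [Real.rpow_nonneg hx.le s]

lemma cn_interpolation {s' s : ℝ} (h0 : 0 ≤ s') (h : s' ≤ s) {M : ℕ} (hM : 1 ≤ M) (f : L2) :
    cn (fun k => jp s' k) f ≤ ENNReal.ofReal ((M : ℝ) ^ s') * cn 1 f +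
      ENNReal.ofReal ((M : ℝ) ^ (s' - s)) * cn (fun k => jp s k) f := by
  unfold cn
  rw [← wn_const_mul, ← wn_const_mul]
  refine le_trans (wn_mono (fun k => ?_) le_rfl) (wn_weight_add_le _ _ _)
  simp only [Pi.add_apply, Pi.one_apply, mul_one]
  exact jp_interpolation h0 h hM k

lemma one_le_rpow_mul_jp {s : ℝ} (hs : 0 ≤ s) {M : ℕ} (hM : 1 ≤ M) {k : ℤ} (hk : ¬ |k| ≤ (M : ℤ)) :
    1 ≤ ENNReal.ofReal ((M : ℝ) ^ (-s)) * jp s k := by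
  have hM' : (0 : ℝ) < M := by exact_mod_cast hM
  unfold jp
  rw [← ENNReal.ofReal_mul (by positivity), ENNReal.one_le_ofReal, Real.rpow_neg hM'.le, ← div_eq_inv_mul,
    one_le_div (by positivity)]
  have : (M : ℝ) ≤ |(k : ℝ)| := by
    have : (M : ℤ) ≤ |k| := (not_le.1 hk).le
    exact_mod_cast this
  gcongr
  linarith

/-- The frequencies up to `M`. -/
def lowFreq (M : ℕ) : Set ℤ := {k | |k| ≤ (M : ℤ)}

lemma mem_lowFreq {M : ℕ} {k : ℤ} : k ∈ lowFreq M ↔ |k| ≤ (M : ℤ) := Iff.rfl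

lemma coeff_freqProj (M : ℕ) (f : L2) (k : ℤ) :
    coeff (freqProj M f) k = if |k| ≤ (M : ℤ) then coeff f k else 0 := by
  have := coeff_trunc (window M) f k
  simp only [window, Finset.mem_Icc, ← abs_le] at this
  exact this

lemma cn_sub_freqProj_le {s : ℝ} (hs : 0 ≤ s) {M : ℕ} (hM : 1 ≤ M) (f : L2) :
    cn 1 (f - freqProj M f) ≤ ENNReal.ofReal ((M : ℝ) ^ (-s)) * cn (fun k => jp s k) f := by
  unfold cn
  rw [← wn_const_mul]
  unfold wn
  refine ENNReal.rpow_le_rpow (ENNReal.tsum_le_tsum fun k => ?_) (by norm_num)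
  gcongr ?_ ^ 2
  dsimp only [Pi.one_apply]
  rw [coeff_sub, coeff_freqProj]
  split_ifs with hk
  · simp
  · rw [sub_zero]
    gcongr
    exact one_le_rpow_mul_jp hs hM hk

/-! ### Comparison with the truncated flow -/

variable {α γ : ℝ} {C D : ℝ≥0∞}

/-- The weight with a small multiple of the higher Sobolev weight. -/
def mixWeight (α s : ℝ) (lam : ℝ≥0∞) : ℤ → ℝ≥0∞ := w0 α + fun k : ℤ => lam * jp s k

lemma cn_mixWeight_le (α s : ℝ) (lam : ℝ≥0∞) (f : L2) :
    cn (mixWeight α s lam) f ≤ cn (w0 α) f + lam * cn (fun k => jp s k) f := by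
  unfold mixWeight cn
  rw [← wn_const_mul]
  exact wn_weight_add_le _ _ _

/-- A constant `D` that serves for all weights up to regularity `S`. -/
structure UniformTri (α S : ℝ) (D : ℝ≥0∞) : Prop where
  fin : D ≠ ⊤
  base : TriPair α D 1 (w0 α)
  mix : ∀ s, sexp α ≤ s → s ≤ S → ∀ lam : ℝ≥0∞, lam ≠ ⊤ →
    TriPair α D (mixWeight α s lam) (mixWeight α s lam)
  pure : ∀ s, sexp α ≤ s → s ≤ S → TriPair α D (fun k => jp s k) (fun k => jp s k)

lemma exists_uniformTri (hα : 1 / 2 < α) (hα1 : α < 1) (S : ℝ) : ∃ D, UniformTri α S D := by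
  obtain ⟨D1, hD1, h1⟩ := exists_triPair_one hα hα1
  obtain ⟨C, hC, h2⟩ := exists_triPair_self hα hα1
  refine ⟨D1 + ENNReal.ofReal (3 ^ S) * C, by finiteness, h1.mono le_self_add,
    fun s hs hS lam hl => (h2 _ _ ?_).mono le_add_self, fun s hs hS =>
    (h2 _ _ (isWeight_jp hα1 hs hS)).mono le_add_self⟩
  exact (isWeight_jp hα1 le_rfl (hs.trans hS)).add_smul (isWeight_jp hα1 hs hS) hl

lemma TriPair.mono_right {w W W' : ℤ → ℝ≥0∞} {α : ℝ} {D : ℝ≥0∞} (h : TriPair α D w W) (hW : W ≤ W') :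
    TriPair α D w W' := by
  refine ⟨h.one_le, h.w0_le.trans hW, fun j φ1 φ2 φ3 m1 m2 m3 => (h.le j φ1 φ2 φ3 m1 m2 m3).trans ?_⟩
  gcongr <;> refine nrm_mono ?_ le_rfl <;> split_ifs <;> first | exact le_rfl | exact hW

lemma w0_le_mixWeight (α s : ℝ) (lam : ℝ≥0∞) : w0 α ≤ mixWeight α s lam := fun _ => le_self_add

lemma nrm_smul_weight (r : ℝ) (c : ℝ≥0∞) (w : ℤ → ℝ≥0∞) (φ : ℤ × ℝ → ℝ≥0∞) (hφ : Measurable φ) :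
    nrm r (fun k => c * w k) φ = c * nrm r w φ := by
  rw [← nrm_const_mul c hφ]
  refine Eq.trans ?_ (nrm_weight_mul w (fun _ => c) φ).symm
  congr 1; ext k; ring

lemma HasRep.of_smul {t0 t1 : ℝ} {u : ℝ → L2} {w W : ℤ → ℝ≥0∞} {c : ℝ≥0∞} (hc : c ≠ ⊤)
    (h : HasRep α t0 t1 W u) (hw : ∀ k, w k ≤ c * W k) : HasRep α t0 t1 w u := by
  obtain ⟨f, rf, nf⟩ := h
  refine ⟨f, rf, (nrm_mono (w' := fun k => c * W k) hw le_rfl).trans_lt ?_⟩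
  rw [nrm_smul_weight _ _ _ _ (measurable_absn rf.meas)]
  exact ENNReal.mul_lt_top hc.lt_top nf

lemma mixWeight_le {s : ℝ} (hs : sexp α ≤ s) (lam : ℝ≥0∞) (k : ℤ) :
    mixWeight α s lam k ≤ (1 + lam) * jp s k := by
  unfold mixWeight
  rw [add_mul, one_mul]
  exact add_le_add (jp_mono hs _) le_rfl

lemma le_mixWeight (α s : ℝ) {lam : ℝ≥0∞} (h0 : lam ≠ 0) (hl : lam ≠ ⊤) (k : ℤ) :
    jp s k ≤ lam⁻¹ * mixWeight α s lam k := by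
  unfold mixWeight
  rw [Pi.add_apply, mul_add, ← mul_assoc, ENNReal.inv_mul_cancel h0 hl, one_mul]
  exact le_add_self

/-- The `L²` distance between a solution and a solution of the truncated equation. -/
lemma cn_sub_truncated_le (hα : 1 / 2 < α) (hα1 : α < 1) (hC : DensityBound α 1 C) {S : ℝ}
    (hD : UniformTri α S D) (hγ : |γ| ≤ 1) {s : ℝ} (hs : sexp α ≤ s) (hS : s ≤ S)
    {A B q R : ℝ≥0∞} (hA0 : A ≠ 0) (hAB : A ≤ B) (hB : B ≠ ⊤) (hq : 1 ≤ q)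
    (hqR : (q + 1) * A ≤ R) {δ : ℝ} (hδ : ShortStep α C D δ R) (n : ℕ) {M : ℕ} (hM : 1 ≤ M)
    {u v : ℝ → L2} (hu : Sol α γ univ 0 (n * δ) (fun k => jp s k) u)
    (hv : Sol α γ (lowFreq M) 0 (n * δ) (fun k => jp s k) v)
    (hu0 : ∀ t ∈ Icc 0 (n * δ), cn (w0 α) (u t) ≤ q * A)
    (hus : ∀ t ∈ Icc 0 (n * δ), cn (fun k => jp s k) (u t) ≤ B)
    (hvs : ∀ t ∈ Icc 0 (n * δ), cn (fun k => jp s k) (v t) ≤ A)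
    (hini : v 0 = freqProj M (u 0)) (hiniA : cn (fun k => jp s k) (u 0) ≤ A) :
    ∀ t ∈ Icc 0 (n * δ), cn 1 (u t - v t) ≤
      ENNReal.ofReal ((M : ℝ) ^ (-s)) * ((growth α C + 1) ^ n * (A + A⁻¹ * B * R)) := by
  have hs0 : 0 ≤ s := le_trans (by unfold sexp; linarith) hs
  have hB0 : B ≠ 0 := fun h => hA0 (le_antisymm (hAB.trans h.le) (zero_le))
  have hAt : A ≠ ⊤ := fun h => hB (top_le_iff.1 (h ▸ hAB))
  -- With `lam = A / B` the mixed norms are at most `(q+1) A`, however large the `H^s` bound `B` is.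
  -- The step length thus depends on `A` alone, and the ratio `B / A = lam⁻¹` enters only as a
  -- factor of the error.
  set lam : ℝ≥0∞ := A * B⁻¹ with hlam
  have hl0 : lam ≠ 0 := mul_ne_zero hA0 (ENNReal.inv_ne_zero.2 hB)
  have hlt : lam ≠ ⊤ := ENNReal.mul_ne_top hAt (ENNReal.inv_ne_top.2 hB0)
  have hlB : lam * B = A := by
    rw [hlam, mul_assoc, ENNReal.inv_mul_cancel hB0 hB, mul_one]
  have hlinv : lam⁻¹ = A⁻¹ * B := by
    rw [hlam, ENNReal.mul_inv (Or.inl hA0) (Or.inl hAt), inv_inv]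
  have P := hD.mix s hs hS lam hlt
  have P' := hD.base.mono_right (w0_le_mixWeight α s lam)
  have hu' : Sol α γ univ 0 (n * δ) (mixWeight α s lam) u :=
    ⟨hu.rep.of_smul (by finiteness) (mixWeight_le hs lam), hu.duhamel⟩
  have hv' : Sol α γ (lowFreq M) 0 (n * δ) (mixWeight α s lam) v :=
    ⟨hv.rep.of_smul (by finiteness) (mixWeight_le hs lam), hv.duhamel⟩
  intro t ht
  have h1 : 1 ≤ mixWeight α s lam := P.one_le
  -- Comparison in `L²` with the mixed weight as strong norm. For `|k| > M` one has `1 ≤ M^{-s}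
  -- (1+|k|)^s`, and `(1+|k|)^s` is at most `lam⁻¹` times the mixed weight, whence `θ`.
  have key := Sol.cn_sub_le (θ := ENNReal.ofReal ((M : ℝ) ^ (-s)) * lam⁻¹) hα hα1 hC P P' h1 hD.fin hγ hδ n
    hu' hv'
    (fun t ht => (cn_mixWeight_le α s lam _).trans (le_trans (by
      calc _ ≤ q * A + lam * B := by gcongr; exacts [hu0 t ht, hus t ht]
        _ = (q + 1) * A := by rw [hlB]; ring) hqR))
    (fun t ht => (cn_mixWeight_le α s lam _).trans (le_trans (by
      calc _ ≤ A + lam * B := by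
            gcongr
            · exact (cn_mono (fun k => jp_mono hs _) _).trans (hvs t ht)
            · exact (hvs t ht).trans hAB
        _ = (1 + 1) * A := by rw [hlB]; ring
        _ ≤ (q + 1) * A := by gcongr) hqR))
    (fun k hk => by
      rw [mul_assoc]
      refine (one_le_rpow_mul_jp hs0 hM (k := k) hk).trans ?_
      gcongr
      exact le_mixWeight α s hl0 hlt k) t ht
  refine (le_self_add.trans key).trans ?_
  rw [hini]
  calc _ ≤ (growth α C + 1) ^ n * (ENNReal.ofReal ((M : ℝ) ^ (-s)) * A +
        ENNReal.ofReal ((M : ℝ) ^ (-s)) * lam⁻¹ * R) := by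
        gcongr
        exact (cn_sub_freqProj_le hs0 hM (u 0)).trans (by gcongr)
    _ = _ := by rw [hlinv]; ring

end

section

/-! ### Global existence and continuous dependence -/

variable {α γ : ℝ} {C D R : ℝ≥0∞} {w W V : ℤ → ℝ≥0∞} {u v : ℝ → L2}

lemma ShortStep.mono {δ δ' : ℝ} {R' : ℝ≥0∞} (hα : 1 / 2 < α) (h : ShortStep α C D δ R) (h0 : 0 ≤ δ')
    (hδ : δ' ≤ δ) (hR0 : R' ≠ 0) (hR : R' ≤ R) : ShortStep α C D δ' R' := by
  refine ⟨h0, hδ.trans h.le_one, hR0, (hR.trans_lt h.fin.lt_top).ne, le_trans ?_ h.small⟩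
  have := tfac_mono hα h0 hδ
  gcongr

/-- Two weights play different roles: the norm in `W` fixes the length of the step, while the
solution is to stay in the class of `V`. The constant `c` only transfers finiteness and does not
affect the step. -/
lemma Sol.extend (hα : 1 / 2 < α) (hα1 : α < 1) (hC : DensityBound α 1 C)
    (P : TriPair α D W W) (P' : TriPair α D V V) (hD : D ≠ ⊤) (hγ : |γ| ≤ 1) {c : ℝ≥0∞} (hc : c ≠ ⊤)
    (hVW : ∀ k, V k ≤ c * W k) {a δ : ℝ} (ha : 0 ≤ a) (hδ : ShortStep α C D δ R)
    (hu : Sol α γ univ 0 a V u) (hR : cn W (u a) ≤ R) :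
    ∃ v, Sol α γ univ 0 (a + δ) V v ∧ (∀ t ∈ Icc 0 a, v t = u t) ∧
      ∀ t ∈ Icc a (a + δ), cn W (v t) ≤ growth α C * R := by
  have h0 := hδ.nonneg
  obtain ⟨u', hs, h1, h2⟩ := exists_sol (t0 := a) (t1 := a + δ) hα hα1 hC P hD hγ (by linarith)
    (by linarith [hδ.le_one]) hδ.fin hR (by rw [add_sub_cancel_left]; exact hδ.small)
  set v : ℝ → L2 := fun t => if t ≤ a then u t else u' t with hv
  have e1 : ∀ t ∈ Icc 0 a, v t = u t := fun t ht => if_pos ht.2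
  have e2 : ∀ t ∈ Icc a (a + δ), v t = u' t := by
    intro t ht
    simp only [hv]
    split_ifs with h
    · rw [le_antisymm h ht.1, h1]
    · rfl
  have s2 : Sol α γ univ a (a + δ) V u' := ⟨hs.rep.of_smul hc hVW, hs.duhamel⟩
  refine ⟨v, Sol.glue hα hα1 P' hD hγ ha (by linarith) (hu.congr ha e1) (s2.congr (by linarith) e2), e1,
    fun t ht => ?_⟩
  rw [e2 t ht]
  refine (h2 t ht).trans (le_of_eq ?_)
  unfold growth; ring

lemma cn_jp_le_mixWeight (α s : ℝ) {lam : ℝ≥0∞} (h0 : lam ≠ 0) (hl : lam ≠ ⊤) (f : L2) :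
    cn (fun k => jp s k) f ≤ lam⁻¹ * cn (mixWeight α s lam) f := by
  unfold cn
  rw [← wn_const_mul]
  exact wn_mono (fun k => le_mixWeight α s h0 hl k) le_rfl

/-- Global existence from the bound on one solution of the truncated equation. -/
theorem exists_global_sol (hα : 1 / 2 < α) (hα1 : α < 1) (hC : DensityBound α 1 C) {S : ℝ}
    (hD : UniformTri α S D) (hγ : |γ| ≤ 1) {s : ℝ} (hs : sexp α ≤ s) (hS : s ≤ S)
    {A : ℝ≥0∞} (hA0 : A ≠ 0) (hA : A ≠ ⊤) {δ : ℝ}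
    (hδ : ShortStep α C D δ ((3 * growth α C + 3) * A)) (n : ℕ) {N : ℕ} (hN1 : 1 ≤ N)
    (hN : ENNReal.ofReal ((N : ℝ) ^ (sexp α - s)) * ((growth α C + 1) ^ n *
      (A + A⁻¹ * ((3 * growth α C + 1) ^ n * A) * ((3 * growth α C + 3) * A)) +
      2 * ((3 * growth α C + 1) ^ n * A)) ≤ A)
    {u0 : L2} (hu0 : cn (fun k => jp s k) u0 ≤ A) {uN : ℝ → L2}
    (hsN : Sol α γ (lowFreq N) 0 (n * δ) (fun k => jp s k) uN)
    (hbN : ∀ t ∈ Icc 0 (n * δ), cn (fun k => jp s k) (uN t) ≤ A) (hN0 : uN 0 = freqProj N u0) :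
    ∃ u, Sol α γ univ 0 (n * δ) (fun k => jp s k) u ∧ u 0 = u0 ∧ ∀ t ∈ Icc 0 (n * δ),
      cn (w0 α) (u t) ≤ 2 * A ∧ cn (fun k => jp s k) (u t) ≤ (3 * growth α C + 1) ^ n * A := by
  have hg : growth α C ≠ ⊤ := by
    have := hC.1; have := embConst_ne_top hα; unfold growth; finiteness
  set κ := growth α C with hκ
  -- At the start of a step the mixed norm is at most `2A + A`, and during it at most `3 κ A`. So
  -- `(3κ + 2) A` bounds the critical norm throughout, and one more `A` accounts for the `H^s` part
  -- of the mixed norm.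
  set R := (3 * κ + 3) * A with hR
  have h0 := hδ.nonneg
  have hP := hD.pure s hs hS
  have hw0s : w0 α ≤ fun k : ℤ => jp s k := fun k => jp_mono hs _
  have h3A : 3 * A ≤ R := by rw [hR]; gcongr; exact le_add_self
  have h3A0 : 3 * A ≠ 0 := mul_ne_zero (by norm_num) hA0
  -- The `H^s` bound may grow by the factor `3κ + 1` in each step. The critical norm, which governs
  -- the step length, must return below `2A` each time, and closeness to `uN` ensures this.
  have key : ∀ m : ℕ, m ≤ n → ∃ u, Sol α γ univ 0 (m * δ) (fun k => jp s k) u ∧ u 0 = u0 ∧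
      ∀ t ∈ Icc 0 (m * δ), cn (w0 α) (u t) ≤ 2 * A ∧
        cn (fun k => jp s k) (u t) ≤ (3 * κ + 1) ^ m * A := by
    intro m
    induction m with
    | zero =>
      intro _
      have hδ0 := hδ.mono hα le_rfl h0 h3A0 h3A
      obtain ⟨u, hu, hu1, -⟩ := exists_sol (t0 := 0) (t1 := 0) hα hα1 hC hP hD.fin hγ le_rfl (by simp)
        hδ0.fin (hu0.trans (le_mul_of_one_le_left' (by norm_num))) (by simpa using hδ0.small)
      refine ⟨u, by simpa using hu, hu1, fun t ht => ?_⟩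
      simp only [Nat.cast_zero, zero_mul, Icc_self, mem_singleton_iff] at ht
      rw [ht, hu1, pow_zero, one_mul]
      exact ⟨((cn_mono hw0s _).trans hu0).trans (le_mul_of_one_le_left' (by norm_num)), hu0⟩
    | succ m ih =>
      intro hmn
      obtain ⟨u, hu, hu1, hub⟩ := ih (by omega)
      set B := (3 * κ + 1) ^ m * A with hB
      have hBt : B ≠ ⊤ := by finiteness
      have h1κ : 1 ≤ 3 * κ + 1 := le_add_self
      have hAB : A ≤ B := le_mul_of_one_le_left' (one_le_pow_of_one_le' h1κ m)
      have hB0 : B ≠ 0 := fun h => hA0 (le_antisymm (hAB.trans h.le) (zero_le))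
      -- `lam` is chosen anew in each step, according to the current `H^s` bound.
      set lam := A * B⁻¹ with hlam
      have hl0 : lam ≠ 0 := mul_ne_zero hA0 (ENNReal.inv_ne_zero.2 hBt)
      have hlt : lam ≠ ⊤ := ENNReal.mul_ne_top hA (ENNReal.inv_ne_top.2 hB0)
      have hlB : lam * B = A := by rw [hlam, mul_assoc, ENNReal.inv_mul_cancel hB0 hBt, mul_one]
      have hlA : lam⁻¹ * A = B := by
        rw [hlam, ENNReal.mul_inv (Or.inl hA0) (Or.inl hA), inv_inv, mul_comm A⁻¹, mul_assoc,
          ENNReal.inv_mul_cancel hA0 hA, mul_one]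
      have hm0 : 0 ≤ (m : ℝ) * δ := by positivity
      have em : ((m + 1 : ℕ) : ℝ) * δ = m * δ + δ := by push_cast; ring
      obtain ⟨v, hv, hve, hvb⟩ := Sol.extend hα hα1 hC (hD.mix s hs hS lam hlt) hP hD.fin hγ
        (ENNReal.inv_ne_top.2 hl0) (fun k => le_mixWeight α s hl0 hlt k) hm0
        (hδ.mono hα h0 le_rfl h3A0 h3A) hu (by
          refine (cn_mixWeight_le α s lam _).trans ?_
          obtain ⟨b1, b2⟩ := hub _ ⟨hm0, le_rfl⟩
          calc _ ≤ 2 * A + lam * B := by gcongr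
            _ = 3 * A := by rw [hlB]; ring)
      rw [← em] at hv hvb
      have hv0 : v 0 = u0 := by rw [hve 0 ⟨le_rfl, hm0⟩, hu1]
      have hmn' : ((m + 1 : ℕ) : ℝ) * δ ≤ n * δ := by
        have : ((m + 1 : ℕ) : ℝ) ≤ n := by exact_mod_cast hmn
        gcongr
      have hsub : Icc 0 (((m + 1 : ℕ) : ℝ) * δ) ⊆ Icc 0 (n * δ) := Icc_subset_Icc le_rfl hmn'
      have hvs : ∀ t ∈ Icc 0 (((m + 1 : ℕ) : ℝ) * δ),
          cn (fun k => jp s k) (v t) ≤ (3 * κ + 1) ^ (m + 1) * A := by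
        intro t ht
        rcases le_total t (m * δ) with h | h
        · rw [hve t ⟨ht.1, h⟩]
          refine (hub t ⟨ht.1, h⟩).2.trans ?_
          exact mul_le_mul' (pow_le_pow_right' h1κ (Nat.le_succ m)) le_rfl
        · refine (cn_jp_le_mixWeight α s hl0 hlt _).trans ?_
          calc _ ≤ lam⁻¹ * (κ * (3 * A)) := by gcongr; exact hvb t ⟨h, ht.2⟩
            _ = 3 * κ * (lam⁻¹ * A) := by ring
            _ ≤ (3 * κ + 1) * (lam⁻¹ * A) := by gcongr; exact le_self_add
            _ = _ := by rw [hlA, hB]; ring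
      have hv0' : ∀ t ∈ Icc 0 (((m + 1 : ℕ) : ℝ) * δ), cn (w0 α) (v t) ≤ (3 * κ + 2) * A := by
        intro t ht
        rcases le_total t (m * δ) with h | h
        · rw [hve t ⟨ht.1, h⟩]
          refine (hub t ⟨ht.1, h⟩).1.trans ?_
          gcongr; exact le_add_self
        · refine (cn_mono (w0_le_mixWeight α s lam) _).trans ((hvb t ⟨h, ht.2⟩).trans ?_)
          calc κ * (3 * A) = (3 * κ) * A := by ring
            _ ≤ _ := by gcongr; exact le_self_add
      set B' := (3 * κ + 1) ^ (m + 1) * A with hB'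
      have hAB' : A ≤ B' := le_mul_of_one_le_left' (one_le_pow_of_one_le' h1κ _)
      have hBn : B' ≤ (3 * κ + 1) ^ n * A := by
        exact mul_le_mul' (pow_le_pow_right' h1κ hmn) le_rfl
      have hL2 := cn_sub_truncated_le (q := 3 * κ + 2) hα hα1 hC hD hγ hs hS hA0 hAB' (by finiteness)
        (le_trans (by norm_num) (le_add_self (a := (2 : ℝ≥0∞)) (b := 3 * κ)))
        (le_of_eq (by rw [hR]; ring)) hδ (m + 1) hN1 hv
        (hsN.mono hα hα1 hP.w0_le le_rfl (by positivity) hmn') hv0' hvs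
        (fun t ht => hbN t (hsub ht)) (by rw [hN0, hv0]) (by rw [hv0]; exact hu0)
      refine ⟨v, hv, hv0, fun t ht => ⟨?_, hvs t ht⟩⟩
      have hNr : (0 : ℝ) < N := by exact_mod_cast hN1
      have hs0 : 0 ≤ sexp α := by unfold sexp; linarith
      -- The `L²` comparison on the whole interval reached so far, interpolated with the `H^s`
      -- bounds, gives `N^{sexp α - s}` times a constant depending on `A` and `n`. By `hN` this is
      -- at most `A`.
      have hclose : cn (w0 α) (v t - uN t) ≤ A := by
        refine (cn_interpolation hs0 hs hN1 _).trans (le_trans ?_ hN)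
        have h1 := hL2 t ht
        have h2 : cn (fun k => jp s k) (v t - uN t) ≤ 2 * B' := by
          refine (cn_sub_le _ _ _).trans ?_
          rw [two_mul]
          exact add_le_add (hvs t ht) ((hbN t (hsub ht)).trans hAB')
        calc _ ≤ ENNReal.ofReal ((N : ℝ) ^ sexp α) * (ENNReal.ofReal ((N : ℝ) ^ (-s)) *
                ((κ + 1) ^ (m + 1) * (A + A⁻¹ * B' * R))) +
                ENNReal.ofReal ((N : ℝ) ^ (sexp α - s)) * (2 * B') := by gcongr
          _ = ENNReal.ofReal ((N : ℝ) ^ (sexp α - s)) *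
                ((κ + 1) ^ (m + 1) * (A + A⁻¹ * B' * R) + 2 * B') := by
              rw [← mul_assoc, ← ENNReal.ofReal_mul (by positivity), ← Real.rpow_add hNr,
                ← sub_eq_add_neg]
              ring
          _ ≤ _ := by
              gcongr
              exact le_add_self
      calc cn (w0 α) (v t) ≤ cn (w0 α) (uN t) + cn (w0 α) (v t - uN t) := cn_le_add_sub _ _ _
        _ ≤ A + A := add_le_add ((cn_mono hw0s _).trans (hbN t (hsub ht))) hclose
        _ = 2 * A := (two_mul A).symm
  exact key n le_rfl

/-- Solutions with nearby data. -/
theorem exists_near_sol (hα : 1 / 2 < α) (hα1 : α < 1) (hC : DensityBound α 1 C)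
    (P : TriPair α D W W) (hD : D ≠ ⊤) (hγ : |γ| ≤ 1) {B : ℝ≥0∞} {δ : ℝ}
    (hδ : ShortStep α C D δ ((growth α C + 1) * (B + 1))) (n : ℕ)
    (hu : Sol α γ univ 0 (n * δ) W u) (huB : ∀ t ∈ Icc 0 (n * δ), cn W (u t) ≤ B)
    {η : ℝ≥0∞} (hη : (growth α C + 1) ^ n * η ≤ 1) {v0 : L2} (hv0 : cn W (u 0 - v0) ≤ η) :
    ∃ v, Sol α γ univ 0 (n * δ) W v ∧ v 0 = v0 ∧ ∀ t ∈ Icc 0 (n * δ),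
      cn W (u t - v t) ≤ (growth α C + 1) ^ n * η := by
  set κ := growth α C with hκ
  set R := (κ + 1) * (B + 1) with hR
  have h0 := hδ.nonneg
  have h1κ : 1 ≤ κ + 1 := le_add_self
  have hB1 : B + 1 ≤ R := le_mul_of_one_le_left' h1κ
  have hB10 : B + 1 ≠ 0 := by simp
  -- Bootstrap over the steps: closeness keeps `v` below `B + 1`, one extension gives at most `R`,
  -- and stability from time `0` restores closeness with the factor `(κ+1)^{m+1}`. This factor stays
  -- harmless up to `m = n` by the choice of `η`.
  have key : ∀ m : ℕ, m ≤ n → ∃ v, Sol α γ univ 0 (m * δ) W v ∧ v 0 = v0 ∧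
      ∀ t ∈ Icc 0 (m * δ), cn W (u t - v t) ≤ (κ + 1) ^ m * η := by
    intro m
    induction m with
    | zero =>
      intro _
      have hδ0 := hδ.mono hα le_rfl h0 hB10 hB1
      have hη1 : η ≤ 1 := le_trans (le_mul_of_one_le_left' (one_le_pow_of_one_le' h1κ n)) hη
      have hcn : cn W v0 ≤ B + 1 := by
        refine (cn_le_add_sub W v0 (u 0)).trans (add_le_add (huB 0 ⟨le_rfl, by positivity⟩) ?_)
        rw [cn_sub_comm]
        exact hv0.trans hη1
      obtain ⟨v, hv, hv1, -⟩ := exists_sol (t0 := 0) (t1 := 0) hα hα1 hC P hD hγ le_rfl (by simp)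
        hδ0.fin hcn (by simpa using hδ0.small)
      refine ⟨v, by simpa using hv, hv1, fun t ht => ?_⟩
      simp only [Nat.cast_zero, zero_mul, Icc_self, mem_singleton_iff] at ht
      rw [ht, hv1, pow_zero, one_mul]
      exact hv0
    | succ m ih =>
      intro hmn
      obtain ⟨v, hv, hv1, hvb⟩ := ih (by omega)
      have hm0 : 0 ≤ (m : ℝ) * δ := by positivity
      have em : ((m + 1 : ℕ) : ℝ) * δ = m * δ + δ := by push_cast; ring
      have hmn' : ((m + 1 : ℕ) : ℝ) * δ ≤ n * δ := by
        have : ((m + 1 : ℕ) : ℝ) ≤ n := by exact_mod_cast hmn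
        gcongr
      have hmle : (m : ℝ) * δ ≤ ((m + 1 : ℕ) : ℝ) * δ := by rw [em]; linarith
      have hsub : Icc 0 (((m + 1 : ℕ) : ℝ) * δ) ⊆ Icc 0 (n * δ) := Icc_subset_Icc le_rfl hmn'
      have hpow : (κ + 1) ^ m * η ≤ 1 := by
        refine le_trans ?_ hη
        exact mul_le_mul' (pow_le_pow_right' h1κ (by omega)) le_rfl
      have hold : ∀ t ∈ Icc 0 (m * δ), cn W (v t) ≤ B + 1 := by
        intro t ht
        refine (cn_le_add_sub W (v t) (u t)).trans (add_le_add (huB t (hsub ⟨ht.1, ht.2.trans hmle⟩)) ?_)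
        rw [cn_sub_comm]
        exact (hvb t ht).trans hpow
      obtain ⟨v', hv', hve, hvb'⟩ := Sol.extend (c := 1) hα hα1 hC P P hD hγ ENNReal.one_ne_top
        (fun k => by simp) hm0 (hδ.mono hα h0 le_rfl hB10 hB1) hv (hold _ ⟨hm0, le_rfl⟩)
      rw [← em] at hv' hvb'
      have hv0' : v' 0 = v0 := by rw [hve 0 ⟨le_rfl, hm0⟩, hv1]
      refine ⟨v', hv', hv0', fun t ht => ?_⟩
      have := Sol.cn_sub_le (θ := 0) hα hα1 hC P P le_rfl hD hγ hδ (m + 1)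
        (hu.mono hα hα1 P.w0_le le_rfl (by positivity) hmn') hv'
        (fun t ht => (huB t (hsub ht)).trans (le_self_add.trans hB1)) (fun t ht => by
          rcases le_total t (m * δ) with h | h
          · rw [hve t ⟨ht.1, h⟩]
            exact (hold t ⟨ht.1, h⟩).trans hB1
          · refine (hvb' t ⟨h, ht.2⟩).trans ?_
            rw [hR]; gcongr; exact le_self_add)
        (fun k hk => absurd (mem_univ k) hk) t ht
      rw [zero_mul, add_zero, add_zero, hv0'] at this
      refine this.trans ?_
      gcongr
  exact key n le_rfl

/-- A density for the difference of two nearby solutions on a long interval. -/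
theorem exists_rep_sub_long (hα : 1 / 2 < α) (hα1 : α < 1) (hC : DensityBound α 1 C)
    (P : TriPair α D W W) (hD : D ≠ ⊤) (hγ : |γ| ≤ 1) {δ : ℝ} (hδ : ShortStep α C D δ R) (n : ℕ)
    {L : ℝ} (hL : 0 < L) (hnL : n * δ ≤ L) {CL : ℝ≥0∞} (hCL : DensityBound α L CL)
    (hu : Sol α γ univ 0 (n * δ) W u) (hv : Sol α γ univ 0 (n * δ) W v)
    (huR : ∀ t ∈ Icc 0 (n * δ), cn W (u t) ≤ R) (hvR : ∀ t ∈ Icc 0 (n * δ), cn W (v t) ≤ R)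
    {e : ℝ≥0∞} (he : e ≠ ⊤) (he0 : e ≠ 0) (hsub : ∀ t ∈ Icc 0 (n * δ), cn W (u t - v t) ≤ e) :
    ∃ h, Rep α 0 (n * δ) (fun t => u t - v t) h ∧ nrm (bexp α) W (absn h) ≤
      CL * (e + n * (tfac α δ * (3 * D * (2 * C * R) ^ 2 * (2 * (C * e) + e)))) := by
  have h0 := hδ.nonneg
  have hRt := hδ.fin
  have hCt := hC.1
  have htf : tfac α δ ≠ ⊤ := ENNReal.ofReal_ne_top
  set E := tfac α δ * (3 * D * (2 * C * R) ^ 2 * (2 * (C * e) + e)) with hE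
  have hEt : E ≠ ⊤ := by finiteness
  have hn0 : 0 ≤ (n : ℝ) * δ := by positivity
  have I1 := integrableOn_forcing hα hα1 hn0 P.w0_le hu.rep γ univ
  have I2 := integrableOn_forcing hα hα1 hn0 P.w0_le hv.rep γ univ
  have I : ∀ k, IntegrableOn (fun t => forcing α γ univ u k t - forcing α γ univ v k t)
      (Icc 0 (n * δ)) := fun k => (I1 k).sub (I2 k)
  -- Restriction norms on the steps do not add up, but the time transforms of the forcing do. The
  -- majorants are accumulated over the steps, and the Duhamel formula is applied once on the whole
  -- interval.
  have key : ∀ m : ℕ, m ≤ n → ∃ Γ : ℤ × ℝ → ℝ≥0∞, Measurable Γ ∧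
      (∀ k τ, ‖∫ t in 0..(m * δ), ex (-(t * τ)) *
        (forcing α γ univ u k t - forcing α γ univ v k t)‖ₑ ≤ Γ (k, τ)) ∧
      nrm (bexp α - 1) W Γ ≤ m * E := by
    intro m
    induction m with
    | zero =>
      intro _
      exact ⟨0, measurable_zero, fun k τ => by simp, by simp [nrm, sqNorm]⟩
    | succ m ih =>
      intro hmn
      obtain ⟨Γ, hΓm, hΓ, hΓn⟩ := ih (by omega)
      have hm0 : 0 ≤ (m : ℝ) * δ := by positivity
      have em : ((m + 1 : ℕ) : ℝ) * δ = m * δ + δ := by push_cast; ring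
      have hmn' : ((m + 1 : ℕ) : ℝ) * δ ≤ n * δ := by
        have : ((m + 1 : ℕ) : ℝ) ≤ n := by exact_mod_cast hmn
        gcongr
      have hmle : (m : ℝ) * δ ≤ ((m + 1 : ℕ) : ℝ) * δ := by rw [em]; linarith
      have ed : ((m + 1 : ℕ) : ℝ) * δ - m * δ = δ := by rw [em]; ring
      have hss : Icc (m * δ) (((m + 1 : ℕ) : ℝ) * δ) ⊆ Icc 0 (n * δ) := Icc_subset_Icc hm0 hmn'
      obtain ⟨f, g, h, rf, rg, rh, nf, ng, nh, bh⟩ := Sol.exists_rep_sub (θ := 0) hα hα1 hC P P le_rfl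
        hD hγ hmle (by rw [ed]; exact hδ) (hu.mono hα hα1 P.w0_le hm0 hmle hmn')
        (hv.mono hα hα1 P.w0_le hm0 hmle hmn') (fun t ht => huR t (hss ht))
        (fun t ht => hvR t (hss ht)) (fun k hk => absurd (mem_univ k) hk) he0
      have hρ : 2 * C * R < ⊤ := by finiteness
      have md := measurable_diffMajorant (α := α) rf.meas rg.meas rh.meas
      refine ⟨fun z => Γ z + tfac α δ * diffMajorant α f g h z, by fun_prop, fun k τ => ?_, ?_⟩
      · have hi1 : IntervalIntegrable (fun t => ex (-(t * τ)) *
            (forcing α γ univ u k t - forcing α γ univ v k t)) volume 0 (m * δ) :=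
          intervalIntegrable_osc hm0 ((I k).mono_set (Icc_subset_Icc le_rfl (hmle.trans hmn'))) τ
        have hi2 : IntervalIntegrable (fun t => ex (-(t * τ)) *
            (forcing α γ univ u k t - forcing α γ univ v k t)) volume (m * δ) (((m + 1 : ℕ) : ℝ) * δ) :=
          intervalIntegrable_osc hmle ((I k).mono_set hss) τ
        rw [← intervalIntegral.integral_add_adjacent_intervals hi1 hi2]
        refine (enorm_add_le _ _).trans (add_le_add (hΓ k τ) ?_)
        have := enorm_integral_forcing_sub_le (χ := univ) hα hα1 hγ hmle rf rg rh
          ((nrm_mono P.w0_le le_rfl).trans_lt (nf.trans_lt hρ))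
          ((nrm_mono P.w0_le le_rfl).trans_lt (ng.trans_lt hρ))
          ((nrm_mono P.w0_le le_rfl).trans_lt nh) k τ
        rwa [outerMajorant_univ, Pi.zero_apply, add_zero, ed] at this
      · refine (nrm_add_le (φ' := fun z => tfac α δ * diffMajorant α f g h z) hΓm (by fun_prop)).trans ?_
        rw [nrm_const_mul _ md]
        push_cast
        rw [add_mul, one_mul]
        refine add_le_add hΓn ?_
        refine (mul_le_mul' le_rfl ((nrm_diffMajorant_le P rf.meas rg.meas rh.meas nf ng).trans
          (mul_le_mul' le_rfl bh))).trans ?_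
        rw [hE, zero_mul, add_zero]
        gcongr
        exact hsub _ ⟨hm0, hmle.trans hmn'⟩
  obtain ⟨Γ, hΓm, hΓ, hΓn⟩ := key n le_rfl
  obtain ⟨h, rh, bh⟩ := exists_rep (w := W) (u := fun t => u t - v t)
    (a := fun k => ex (-(0 * symbol α k)) * coeff (u 0 - v 0) k) hα hL hCL hn0 (by linarith) I
    (fun k t ht => by
      have J1 : IntervalIntegrable (forcing α γ univ u k) volume 0 t :=
        (intervalIntegrable_iff_integrableOn_Icc_of_le ht.1).2
          ((I1 k).mono_set (Icc_subset_Icc le_rfl ht.2))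
      have J2 : IntervalIntegrable (forcing α γ univ v k) volume 0 t :=
        (intervalIntegrable_iff_integrableOn_Icc_of_le ht.1).2
          ((I2 k).mono_set (Icc_subset_Icc le_rfl ht.2))
      rw [intervalIntegral.integral_sub J1 J2, coeff_sub, mul_sub, hu.duhamel k t ht,
        hv.duhamel k t ht, coeff_sub]
      ring) P.one_le hΓm hΓ (hΓn.trans_lt (by finiteness)) (by
      rw [wn_amp]; exact (hsub 0 ⟨le_rfl, hn0⟩).trans_lt he.lt_top)
  refine ⟨h, rh, (bh W).trans ?_⟩
  rw [wn_amp]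
  gcongr
  exact hsub 0 ⟨le_rfl, hn0⟩

end

section

/-! ### Comparison of the norms -/

lemma rpow_one_add_sq_le {r : ℝ} (hr : 0 ≤ r) (x : ℝ) : (1 + x ^ 2) ^ r ≤ (1 + |x|) ^ (2 * r) := by
  rw [Real.rpow_mul (by positivity)]
  gcongr
  rw [Real.rpow_two]
  nlinarith [abs_nonneg x, sq_abs x]

lemma rpow_one_add_abs_le {r : ℝ} (hr : 0 ≤ r) (x : ℝ) :
    (1 + |x|) ^ (2 * r) ≤ 2 ^ r * (1 + x ^ 2) ^ r := by
  rw [Real.rpow_mul (by positivity), ← Real.mul_rpow (by norm_num) (by positivity)]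
  gcongr
  rw [Real.rpow_two]
  nlinarith [abs_nonneg x, sq_abs x, sq_nonneg (1 - |x|)]

lemma ofReal_weight_le {b s : ℝ} (hb : 0 ≤ b) (hs : 0 ≤ s) (x y : ℝ) :
    ENNReal.ofReal ((1 + x ^ 2) ^ b * (1 + y ^ 2) ^ s) ≤ jp s y ^ 2 * jp b x ^ 2 := by
  rw [jp_sq, jp_sq, jp, jp, ← ENNReal.ofReal_mul (by positivity), mul_comm]
  refine ENNReal.ofReal_le_ofReal ?_
  gcongr <;> exact rpow_one_add_sq_le ‹_› _

lemma le_ofReal_weight {b s : ℝ} (hb : 0 ≤ b) (hs : 0 ≤ s) (x y : ℝ) :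
    jp s y ^ 2 * jp b x ^ 2 ≤
      ENNReal.ofReal (2 ^ s * 2 ^ b) * ENNReal.ofReal ((1 + x ^ 2) ^ b * (1 + y ^ 2) ^ s) := by
  rw [jp_sq, jp_sq, jp, jp, ← ENNReal.ofReal_mul (by positivity), ← ENNReal.ofReal_mul (by positivity)]
  refine ENNReal.ofReal_le_ofReal ?_
  calc _ ≤ (2 ^ s * (1 + y ^ 2) ^ s) * (2 ^ b * (1 + x ^ 2) ^ b) := by
        gcongr <;> exact rpow_one_add_abs_le ‹_› _
    _ = _ := by ring

lemma hsNorm_le_cn {s : ℝ} (hs : 0 ≤ s) (f : L2) : hsNorm s f ≤ cn (fun k => jp s k) f := by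
  unfold hsNorm cn wn
  gcongr with k
  rw [mul_pow, jp_sq, jp]
  gcongr
  exact rpow_one_add_sq_le hs _

lemma cn_le_hsNorm {s : ℝ} (hs : 0 ≤ s) (f : L2) :
    cn (fun k => jp s k) f ≤ ENNReal.ofReal (2 ^ (s / 2)) * hsNorm s f := by
  have h2 : ENNReal.ofReal (2 ^ (s / 2)) = ENNReal.ofReal (2 ^ s) ^ (1 / 2 : ℝ) := by
    rw [ENNReal.ofReal_rpow_of_nonneg (by positivity) (by norm_num), ← Real.rpow_mul (by norm_num)]
    ring_nf
  rw [h2]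
  unfold hsNorm cn wn
  rw [← ENNReal.mul_rpow_of_nonneg _ _ (by norm_num), ← ENNReal.tsum_mul_left]
  gcongr with k
  rw [mul_pow, jp_sq, jp, ← mul_assoc, ← ENNReal.ofReal_mul (by positivity)]
  gcongr
  exact rpow_one_add_abs_le hs _

variable {α s T : ℝ} {u : ℝ → L2} {f : ℤ × ℝ → ℂ}

lemma sqNorm_absn (hf : Measurable f) (b : ℝ) (w : ℤ → ℝ≥0∞) :
    sqNorm b w (absn f) = ∑' k, ∫⁻ τ, w k ^ 2 * jp b τ ^ 2 * ‖f (k, τ)‖ₑ ^ 2 := by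
  rw [sqNorm_eq_tsum (measurable_absn hf)]
  congr 1; ext k
  rw [← lintegral_const_mul _ (by unfold absn; fun_prop)]
  refine lintegral_congr fun τ => ?_
  unfold absn; ring

/-- Shifting `τ` by the symbol undoes the interaction picture, and the factor `2π` matches the
inversion formula in `IsExtensionTransform`. So a density is the transform of an extension. -/
lemma xsbNorm_le (hα : 1 / 2 < α) (hs : 0 ≤ s) (h : Rep α 0 T u f) :
    xsbNorm α s (bexp α) T u ≤ ENNReal.ofReal (2 * π) * nrm (bexp α) (fun k => jp s k) (absn f) := by
  have hb : 0 ≤ bexp α := by linarith [half_lt_bexp hα]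
  set F : ℤ → ℝ → ℂ := fun k τ => ((2 * π : ℝ) : ℂ) * f (k, τ - symbol α k) with hF
  have hfm := h.meas
  have hext : IsExtensionTransform T u F := by
    intro k
    refine ⟨by apply Measurable.aestronglyMeasurable; fun_prop, fun t ht => ?_⟩
    rw [h.coeff_eq k ht]
    have e : ∀ τ, F k τ * Complex.exp (Complex.I * ((t * τ : ℝ) : ℂ)) =
        ((2 * π : ℝ) : ℂ) * (ex (t * symbol α k) *
          (fun τ => f (k, τ) * ex (t * τ)) (τ - symbol α k)) := by
      intro τ
      have : ex (t * τ) = ex (t * symbol α k) * ex (t * (τ - symbol α k)) := by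
        rw [← ex_add]; ring_nf
      change ((2 * π : ℝ) : ℂ) * f (k, τ - symbol α k) * ex (t * τ) = _
      rw [this]; ring
    simp_rw [e]
    rw [integral_const_mul, integral_const_mul,
      integral_sub_right_eq_self (fun τ => f (k, τ) * ex (t * τ)) (symbol α k), ← mul_assoc,
      inv_mul_cancel₀ (by exact_mod_cast two_pi_pos.ne'), one_mul]
    rfl
  have hen : xsbEnergy α s (bexp α) F ≤
      ENNReal.ofReal (2 * π) ^ 2 * sqNorm (bexp α) (fun k => jp s k) (absn f) := by
    rw [sqNorm_absn hfm, ← ENNReal.tsum_mul_left]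
    refine ENNReal.tsum_le_tsum fun k => ?_
    rw [← lintegral_const_mul _ (by fun_prop)]
    rw [← lintegral_sub_right_eq_self (fun τ => ENNReal.ofReal (2 * π) ^ 2 *
      (jp s k ^ 2 * jp (bexp α) τ ^ 2 * ‖f (k, τ)‖ₑ ^ 2)) (symbol α k)]
    refine lintegral_mono fun τ => ?_
    dsimp only [hF]
    rw [enorm_mul, mul_pow, show ‖((2 * π : ℝ) : ℂ)‖ₑ = ENNReal.ofReal (2 * π) by
      rw [← ofReal_norm, Complex.norm_real, Real.norm_of_nonneg two_pi_pos.le]]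
    calc _ ≤ jp s k ^ 2 * jp (bexp α) (τ - symbol α k) ^ 2 *
          (ENNReal.ofReal (2 * π) ^ 2 * ‖f (k, τ - symbol α k)‖ₑ ^ 2) := by
          gcongr
          exact ofReal_weight_le hb hs _ _
      _ = _ := by ring
  unfold xsbNorm nrm
  rw [show ENNReal.ofReal (2 * π) = (ENNReal.ofReal (2 * π) ^ 2) ^ (1 / 2 : ℝ) by
      rw [← ENNReal.rpow_natCast, ← ENNReal.rpow_mul]; simp,
    ← ENNReal.mul_rpow_of_nonneg _ _ (by norm_num)]
  gcongr
  exact (iInf₂_le F hext).trans hen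

/-- The inverse shift makes a density out of the transform of an extension of finite energy. The
rows are first replaced by measurable representatives; joint measurability is then automatic because
there are countably many rows. -/
lemma hasRep_of_xsbNorm_lt_top (hα : 1 / 2 < α) (hs : 0 ≤ s) (h : xsbNorm α s (bexp α) T u < ⊤) :
    HasRep α 0 T (fun k => jp s k) u := by
  have hb : 0 ≤ bexp α := by linarith [half_lt_bexp hα]
  obtain ⟨F, hext, hen⟩ : ∃ F, IsExtensionTransform T u F ∧ xsbEnergy α s (bexp α) F < ⊤ := by
    by_contra! hcon
    have : (⨅ (F : ℤ → ℝ → ℂ) (_ : IsExtensionTransform T u F), xsbEnergy α s (bexp α) F) = ⊤ := by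
      simpa using hcon
    simp [xsbNorm, this] at h
  set G : ℤ → ℝ → ℂ := fun k => (hext k).1.mk (F k) with hG
  have hGm : ∀ k, Measurable (G k) := fun k => (hext k).1.stronglyMeasurable_mk.measurable
  have hGF : ∀ k, F k =ᵐ[volume] G k := fun k => (hext k).1.ae_eq_mk
  set f : ℤ × ℝ → ℂ := fun z => ((2 * π : ℝ) : ℂ)⁻¹ * G z.1 (z.2 + symbol α z.1) with hf
  have hfm : Measurable f := measurable_from_prod_countable_right fun k => by
    have := hGm k
    change Measurable fun τ => ((2 * π : ℝ) : ℂ)⁻¹ * G k (τ + symbol α k)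
    fun_prop
  refine ⟨f, ⟨hfm, fun k t ht => ?_⟩, ?_⟩
  · rw [(hext k).2 t ht]
    have e : ∀ τ, f (k, τ) * ex (t * τ) = ((2 * π : ℝ) : ℂ)⁻¹ * (ex (-(t * symbol α k)) *
        (fun τ => G k τ * ex (t * τ)) (τ + symbol α k)) := by
      intro τ
      have : ex (t * τ) = ex (-(t * symbol α k)) * ex (t * (τ + symbol α k)) := by
        rw [← ex_add]; ring_nf
      rw [this]; simp only [hf]; ring
    unfold wave
    simp_rw [e]
    rw [integral_const_mul, integral_const_mul,
      integral_add_right_eq_self (fun τ => G k τ * ex (t * τ)) (symbol α k),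
      integral_congr_ae (g := fun τ => G k τ * ex (t * τ))]
    · ring
    · filter_upwards [hGF k] with τ h1
      rw [h1]; rfl
  · have hle : sqNorm (bexp α) (fun k => jp s k) (absn f) ≤
        ‖((2 * π : ℝ) : ℂ)⁻¹‖ₑ ^ 2 * ENNReal.ofReal (2 ^ s * 2 ^ bexp α) * xsbEnergy α s (bexp α) F := by
      rw [sqNorm_absn hfm, xsbEnergy, ← ENNReal.tsum_mul_left]
      refine ENNReal.tsum_le_tsum fun k => ?_
      have e1 : ∫⁻ τ, ENNReal.ofReal ((1 + (τ - symbol α k) ^ 2) ^ bexp α * (1 + (k : ℝ) ^ 2) ^ s) *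
          ‖F k τ‖ₑ ^ 2 = ∫⁻ τ, ENNReal.ofReal ((1 + τ ^ 2) ^ bexp α * (1 + (k : ℝ) ^ 2) ^ s) *
          ‖G k (τ + symbol α k)‖ₑ ^ 2 := by
        rw [← lintegral_sub_right_eq_self (fun τ => ENNReal.ofReal ((1 + τ ^ 2) ^ bexp α *
          (1 + (k : ℝ) ^ 2) ^ s) * ‖G k (τ + symbol α k)‖ₑ ^ 2) (symbol α k)]
        refine lintegral_congr_ae ?_
        filter_upwards [hGF k] with τ h1
        rw [h1, sub_add_cancel]
      rw [e1, ← lintegral_const_mul' _ _ (by finiteness)]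
      refine lintegral_mono fun τ => ?_
      simp only [hf, enorm_mul, mul_pow]
      calc _ ≤ ENNReal.ofReal (2 ^ s * 2 ^ bexp α) * ENNReal.ofReal ((1 + τ ^ 2) ^ bexp α *
            (1 + (k : ℝ) ^ 2) ^ s) * (‖((2 * π : ℝ) : ℂ)⁻¹‖ₑ ^ 2 * ‖G k (τ + symbol α k)‖ₑ ^ 2) := by
            exact mul_le_mul' (le_ofReal_weight hb hs _ _) le_rfl
        _ = _ := by ring
    unfold nrm
    exact ENNReal.rpow_lt_top_of_nonneg (by norm_num) (hle.trans_lt (by finiteness)).ne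

end

section

/-! ### Solutions in the sense of the Duhamel formula and in the interaction picture -/

variable {α γ s T t0 t1 : ℝ} {u : ℝ → L2} {u₀ : L2} {W : ℤ → ℝ≥0∞}

/-- Dominated convergence in `k`: each coefficient is continuous in time, and the `τ`-integrals of
the density bound all coefficients uniformly in time by a sequence of finite weighted `ℓ²` norm. -/
lemma HasRep.tendsto_cn_sub (hα : 1 / 2 < α) (hW : 1 ≤ W) (h : HasRep α t0 t1 W u) {t : ℝ}
    (ht : t ∈ Icc t0 t1) : Tendsto (fun r => cn W (u r - u t)) (𝓝[Icc t0 t1] t) (𝓝 0) := by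
  obtain ⟨f, hf, nf⟩ := h
  have hWm : Measurable W := Measurable.of_discrete
  have hi := integrable_row hα hW hf.meas nf
  set a : ℤ → ℝ≥0∞ := fun k => ∫⁻ τ, absn f (k, τ) with ha
  have hb : ∫⁻ k, (2 * (W k * a k)) ^ 2 ∂(Measure.count : Measure ℤ) ≠ ⊤ := by
    have h1 : wn W a < ⊤ := (wn_row_le α W (measurable_absn hf.meas)).trans_lt
      (ENNReal.mul_lt_top (embConst_ne_top hα).lt_top nf)
    rw [wn_eq_lintegral] at h1
    simp_rw [mul_pow (2 : ℝ≥0∞)]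
    rw [lintegral_const_mul' _ _ (by norm_num)]
    refine ENNReal.mul_ne_top (by norm_num) fun h2 => ?_
    simp [h2] at h1
  have hcont : ∀ k, Tendsto (fun r => (W k * ‖coeff (u r - u t) k‖ₑ) ^ 2) (𝓝[Icc t0 t1] t) (𝓝 0) := by
    intro k
    have hWk : W k ≠ ⊤ ∨ (a k = 0) := by
      by_contra! hcon
      have := ENNReal.ne_top_of_tsum_ne_top (by rwa [lintegral_count] at hb) k
      simp [hcon.1, hcon.2] at this
    rcases hWk with hWk | hak
    · have hc : Continuous fun r => ex (r * symbol α k) * wave (fun τ => f (k, τ)) r := by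
        have := continuous_wave (hi k)
        fun_prop
      have h1 : Tendsto (fun r => ‖ex (r * symbol α k) * wave (fun τ => f (k, τ)) r -
          ex (t * symbol α k) * wave (fun τ => f (k, τ)) t‖ₑ) (𝓝[Icc t0 t1] t) (𝓝 0) := by
        have h0 := ((hc.sub continuous_const).enorm.tendsto t (f := fun r =>
          ‖ex (r * symbol α k) * wave (fun τ => f (k, τ)) r -
          ex (t * symbol α k) * wave (fun τ => f (k, τ)) t‖ₑ))
        rw [sub_self, enorm_zero] at h0
        exact h0.mono_left nhdsWithin_le_nhds
      have h2 := ENNReal.Tendsto.pow (n := 2) (ENNReal.Tendsto.const_mul (a := W k) h1 (Or.inr hWk))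
      rw [mul_zero, zero_pow two_ne_zero] at h2
      refine h2.congr' ?_
      filter_upwards [self_mem_nhdsWithin] with r hr
      rw [coeff_sub, hf.coeff_eq k hr, hf.coeff_eq k ht]
    · refine tendsto_const_nhds.congr' ?_
      filter_upwards [self_mem_nhdsWithin] with r hr
      have z : ∀ r ∈ Icc t0 t1, coeff (u r) k = 0 := fun r hr => by
        have := hf.enorm_coeff_le hr k
        rw [← enorm_eq_zero]; exact le_antisymm (this.trans hak.le) zero_le
      rw [coeff_sub, z r hr, z t ht]; simp
  have key : Tendsto (fun r => ∫⁻ k, (W k * ‖coeff (u r - u t) k‖ₑ) ^ 2 ∂(Measure.count : Measure ℤ))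
      (𝓝[Icc t0 t1] t) (𝓝 (∫⁻ _, 0 ∂(Measure.count : Measure ℤ))) := by
    refine tendsto_lintegral_filter_of_dominated_convergence (fun k => (2 * (W k * a k)) ^ 2)
      (Eventually.of_forall fun r => Measurable.of_discrete) ?_ hb (ae_of_all _ hcont)
    filter_upwards [self_mem_nhdsWithin] with r hr
    refine ae_of_all _ fun k => ?_
    gcongr ?_ ^ 2
    rw [coeff_sub]
    calc _ ≤ W k * (a k + a k) := by
          gcongr
          exact enorm_sub_le.trans (add_le_add (hf.enorm_coeff_le hr k) (hf.enorm_coeff_le ht k))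
      _ = _ := by ring
  rw [lintegral_zero] at key
  have := (ENNReal.continuous_rpow_const (y := 1 / 2)).tendsto 0 |>.comp key
  rw [ENNReal.zero_rpow_of_pos (by norm_num)] at this
  refine this.congr fun r => ?_
  unfold cn
  rw [wn_eq_lintegral]; rfl

lemma duhamel_rhs_eq (α γ : ℝ) (u : ℝ → L2) (c : ℂ) (k : ℤ) (t : ℝ) :
    Complex.exp (Complex.I * ((t * symbol α k : ℝ) : ℂ)) * c
      - Complex.I * (γ : ℂ) * ∫ τ in (0 : ℝ)..t,
          Complex.exp (Complex.I * (((t - τ) * symbol α k : ℝ) : ℂ)) * cubicCoeff (u τ) k =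
    ex (t * symbol α k) * (c + ∫ s in 0..t, forcing α γ univ u k s) := by
  have e : ∀ τ, Complex.I * (γ : ℂ) *
      (Complex.exp (Complex.I * (((t - τ) * symbol α k : ℝ) : ℂ)) * cubicCoeff (u τ) k) =
      -ex (t * symbol α k) * forcing α γ univ u k τ := by
    intro τ
    change Complex.I * (γ : ℂ) * (ex ((t - τ) * symbol α k) * _) = _
    rw [cubicCoeff_eq_tri, show (t - τ) * symbol α k = t * symbol α k + -(τ * symbol α k) by ring,
      ex_add, forcing, forcingCoeff, indicator_of_mem (mem_univ k), Pi.one_apply]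
    ring
  rw [← intervalIntegral.integral_const_mul, intervalIntegral.integral_congr fun τ _ => e τ,
    intervalIntegral.integral_const_mul]
  change ex _ * c - _ = _
  ring

lemma coeff_eq_iff_interaction {k : ℤ} {t : ℝ} {x y : ℂ} :
    x = ex (t * symbol α k) * y ↔ ex (-(t * symbol α k)) * x = y := by
  constructor
  · rintro rfl
    rw [← mul_assoc, ex_neg_mul, one_mul]
  · rintro rfl
    rw [← mul_assoc, mul_comm (ex _), ex_neg_mul, one_mul]

/-- All requirements beyond the Duhamel formula come from the density: continuity in `H^s`,
membership in `X^{s,b}_T`, and, through the Strichartz estimate, an `L⁴` bound at almost every time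
and integrability of the cubic coefficients. -/
theorem Sol.isSolution (hα : 1 / 2 < α) (hα1 : α < 1) (hs : sexp α ≤ s) (hT : 0 ≤ T)
    (h : Sol α γ univ 0 T (fun k => jp s k) u) (h0 : u 0 = u₀) :
    IsSolution α γ s (bexp α) T u₀ u := by
  have hs0 : 0 ≤ s := le_trans (by unfold sexp; linarith) hs
  have hW : w0 α ≤ fun k : ℤ => jp s k := fun k => jp_mono hs _
  have h1W : 1 ≤ fun k : ℤ => jp s k := le_trans (fun k => one_le_w0 hα1 k) hW
  have hint := integrableOn_forcing hα hα1 hT hW h.rep γ univ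
  obtain ⟨f, hf, nf⟩ := id h.rep
  have nf0 : nrm (bexp α) (w0 α) (absn f) < ⊤ := (nrm_mono hW le_rfl).trans_lt nf
  refine ⟨fun t ht => ⟨(hsNorm_le_cn hs0 _).trans_lt (h.rep.cn_lt_top hα ht), ?_⟩, ?_, ?_, fun k => ?_,
    fun k t ht => ?_⟩
  · exact tendsto_of_tendsto_of_tendsto_of_le_of_le tendsto_const_nhds
      (h.rep.tendsto_cn_sub hα h1W ht) (fun _ => zero_le) fun r => hsNorm_le_cn hs0 _
  · exact (xsbNorm_le hα hs0 hf).trans_lt (ENNReal.mul_lt_top ENNReal.ofReal_lt_top nf)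
  · filter_upwards [ae_N4_lt_top hα hα1 hT hf nf0] with t ht
    exact MemLp.mono_exponent (q := 4) ⟨Lp.aestronglyMeasurable _, ht⟩ (by norm_num)
  · simp_rw [cubicCoeff_eq_tri]
    exact (integrable_tri_and_osc_le hα hα1 hT hf hf hf nf0 nf0 nf0).1 k
  · rw [duhamel_rhs_eq, coeff_eq_iff_interaction, h.duhamel k t ht, h0]
    simp

theorem IsSolution.sol (hα : 1 / 2 < α) (hs : 0 ≤ s) (hT : 0 ≤ T)
    (h : IsSolution α γ s (bexp α) T u₀ u) :
    Sol α γ univ 0 T (fun k => jp s k) u ∧ u 0 = u₀ := by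
  have h0 : u 0 = u₀ := coeff_injective fun k => by
    have := h.duhamel k 0 ⟨le_rfl, hT⟩
    simpa using this
  refine ⟨⟨hasRep_of_xsbNorm_lt_top hα hs h.mem_xsb, fun k t ht => ?_⟩, h0⟩
  have := h.duhamel k t ht
  rw [duhamel_rhs_eq, coeff_eq_iff_interaction] at this
  rw [this, h0]
  simp

end

section

open scoped ComplexConjugate

/-! ### Solutions of the truncated equation -/

variable {α γ s T : ℝ} {v : ℝ → L2} {u₀ : L2} {M : ℕ}

lemma wn_lt_top_of_support {w a : ℤ → ℝ≥0∞} (Λ : Finset ℤ) (hw : ∀ k, w k ≠ ⊤) (ha : ∀ k, a k ≠ ⊤)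
    (h : ∀ k, k ∉ Λ → a k = 0) : wn w a < ⊤ := by
  unfold wn
  refine ENNReal.rpow_lt_top_of_nonneg (by norm_num) ?_
  rw [tsum_eq_sum (s := Λ) fun k hk => by simp [h k hk]]
  exact (ENNReal.sum_lt_top.2 fun k _ =>
    ENNReal.pow_lt_top (ENNReal.mul_lt_top (hw k).lt_top (ha k).lt_top)).ne

lemma hasDerivAt_ex_neg (c t : ℝ) :
    HasDerivAt (fun t : ℝ => ex (-(t * c))) (-(Complex.I * c) * ex (-(t * c))) t := by
  have h := hasDerivAt_ex (-c) t
  have e : (fun t : ℝ => ex (-c * t)) = fun t => ex (-(t * c)) := by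
    funext t; congr 1; ring
  rw [e] at h
  refine h.congr_deriv ?_
  rw [show -c * t = -(t * c) by ring]
  push_cast; ring

/-- Integration by parts once; the boundary terms limit the decay to `1/τ`. -/
lemma exists_fourier_decay (hT : 0 < T) {g : ℝ → ℂ} (hg : ContDiffOn ℝ 1 g (Icc 0 T)) :
    ∃ K : ℝ, ∀ τ, ‖∫ t in 0..T, ex (-(t * τ)) * g t‖ₑ ≤ ENNReal.ofReal K * jp (-1) τ := by
  have hU := uniqueDiffOn_Icc hT
  have hd := hg.continuousOn_derivWithin hU le_rfl
  obtain ⟨B, hB⟩ := isCompact_Icc.exists_bound_of_continuousOn hg.continuousOn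
  obtain ⟨B', hB'⟩ := isCompact_Icc.exists_bound_of_continuousOn hd
  have hl : (0 : ℝ) ∈ Icc 0 T := ⟨le_rfl, hT.le⟩
  have hr : T ∈ Icc 0 T := ⟨hT.le, le_rfl⟩
  have hex : ∀ τ, Continuous fun t : ℝ => ex (-(t * τ)) := fun τ => by fun_prop
  have i1 : ∀ τ, IntervalIntegrable (fun t => ex (-(t * τ)) * g t) volume 0 T := fun τ =>
    (((hex τ).continuousOn.mul hg.continuousOn).mono (uIcc_of_le hT.le).subset).intervalIntegrable
  have i2 : ∀ τ, IntervalIntegrable (fun t => ex (-(t * τ)) * derivWithin g (Icc 0 T) t) volume 0 T :=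
    fun τ => (((hex τ).continuousOn.mul hd).mono (uIcc_of_le hT.le).subset).intervalIntegrable
  refine ⟨B * T + (B + B + B' * T), fun τ => ?_⟩
  set J := ∫ t in 0..T, ex (-(t * τ)) * g t with hJ
  have b1 : ‖J‖ ≤ B * T := by
    have := intervalIntegral.norm_integral_le_of_norm_le_const (a := 0) (b := T) (C := B)
      (f := fun t => ex (-(t * τ)) * g t) fun t ht => by
        rw [uIoc_of_le hT.le] at ht
        rw [norm_mul, norm_ex, one_mul]
        exact hB t ⟨ht.1.le, ht.2⟩
    simpa [abs_of_pos hT] using this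
  have b2 : ‖∫ t in 0..T, ex (-(t * τ)) * derivWithin g (Icc 0 T) t‖ ≤ B' * T := by
    have := intervalIntegral.norm_integral_le_of_norm_le_const (a := 0) (b := T) (C := B')
      (f := fun t => ex (-(t * τ)) * derivWithin g (Icc 0 T) t) fun t ht => by
        rw [uIoc_of_le hT.le] at ht
        rw [norm_mul, norm_ex, one_mul]
        exact hB' t ⟨ht.1.le, ht.2⟩
    simpa [abs_of_pos hT] using this
  have ftc : ∫ t in 0..T, (-(Complex.I * τ) * (ex (-(t * τ)) * g t) +
      ex (-(t * τ)) * derivWithin g (Icc 0 T) t) = ex (-(T * τ)) * g T - ex (-(0 * τ)) * g 0 := by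
    refine intervalIntegral.integral_eq_sub_of_hasDerivAt_of_le hT.le
      (f := fun t => ex (-(t * τ)) * g t) ((hex τ).continuousOn.mul hg.continuousOn) (fun t ht => ?_)
      (((i1 τ).const_mul _).add (i2 τ))
    have h1 : HasDerivAt g (derivWithin g (Icc 0 T) t) t :=
      ((hg.differentiableOn one_ne_zero t (Ioo_subset_Icc_self ht)).hasDerivWithinAt).hasDerivAt
        (Icc_mem_nhds ht.1 ht.2)
    exact ((hasDerivAt_ex_neg τ t).mul h1).congr_deriv (by ring)
  rw [intervalIntegral.integral_add ((i1 τ).const_mul _) (i2 τ), intervalIntegral.integral_const_mul,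
    ← hJ] at ftc
  have b3 : |τ| * ‖J‖ ≤ B + B + B' * T := by
    have e : -(Complex.I * τ) * J = ex (-(T * τ)) * g T - ex (-(0 * τ)) * g 0 -
        ∫ t in 0..T, ex (-(t * τ)) * derivWithin g (Icc 0 T) t := by rw [← ftc]; ring
    have := congrArg norm e
    rw [norm_mul, norm_neg, norm_mul, Complex.norm_I, one_mul, Complex.norm_real, Real.norm_eq_abs] at this
    rw [this]
    refine (norm_sub_le _ _).trans (add_le_add ((norm_sub_le _ _).trans (add_le_add ?_ ?_)) b2)
    · rw [norm_mul, norm_ex, one_mul]; exact hB _ hr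
    · rw [norm_mul, norm_ex, one_mul]; exact hB _ hl
  rw [← ofReal_norm, jp, ← ENNReal.ofReal_mul (by linarith [norm_nonneg J, mul_nonneg (abs_nonneg τ) (norm_nonneg J)])]
  refine ENNReal.ofReal_le_ofReal ?_
  rw [Real.rpow_neg_one, ← div_eq_mul_inv, le_div_iff₀ (by positivity)]
  linarith

lemma IsTruncatedSolution.hasDerivWithinAt (h : IsTruncatedSolution α γ M T u₀ v) (k : ℤ) {t : ℝ}
    (ht : t ∈ Icc 0 T) : HasDerivWithinAt (fun r => ex (-(r * symbol α k)) * coeff (v r) k)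
      (forcing α γ (lowFreq M) v k t) (Icc 0 T) t := by
  refine ((hasDerivAt_ex_neg (symbol α k) t).hasDerivWithinAt.mul (h.equation k t ht)).congr_deriv ?_
  rw [forcing, forcingCoeff, ← cubicCoeff_eq_tri]
  by_cases hk : |k| ≤ (M : ℤ)
  · rw [indicator_of_mem (mem_lowFreq.2 hk), if_pos hk, Pi.one_apply]; ring
  · rw [indicator_of_notMem (by rwa [mem_lowFreq]), if_neg hk]; ring

lemma IsTruncatedSolution.coeff_eq_zero (h : IsTruncatedSolution α γ M T u₀ v) {k : ℤ}
    (hk : ¬ |k| ≤ (M : ℤ)) {t : ℝ} (ht : t ∈ Icc 0 T) : coeff (v t) k = 0 := by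
  have h1 : ∀ t ∈ Icc 0 T, HasDerivWithinAt (fun r => ex (-(r * symbol α k)) * coeff (v r) k) 0
      (Icc 0 T) t := fun t ht => by
    have := h.hasDerivWithinAt k ht
    rwa [forcing, forcingCoeff, indicator_of_notMem (by rwa [mem_lowFreq]), mul_zero, zero_mul] at this
  have h2 := constant_of_derivWithin_zero (f := fun r => ex (-(r * symbol α k)) * coeff (v r) k)
    (a := 0) (b := T) (fun t ht => (h1 t ht).differentiableWithinAt)
    (fun t ht => (h1 t (Ico_subset_Icc_self ht)).derivWithin
      (uniqueDiffOn_Icc (ht.1.trans_lt ht.2) t (Ico_subset_Icc_self ht))) t ht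
  rw [h.init, coeff_freqProj, if_neg hk, mul_zero] at h2
  exact (mul_eq_zero.1 h2).resolve_left (ex_ne_zero _)

/-- With finitely many active frequencies the cubic coefficients are polynomials in the coefficients
and their conjugates. Continuity of the coefficients makes the right side of the equation
continuous, so they are `C¹`, and then so is the forcing. -/
lemma IsTruncatedSolution.contDiffOn (hT : 0 < T) (h : IsTruncatedSolution α γ M T u₀ v) (k : ℤ) :
    ContDiffOn ℝ 1 (forcing α γ (lowFreq M) v k) (Icc 0 T) := by
  have hc : ∀ k, ContinuousOn (fun t => coeff (v t) k) (Icc 0 T) := fun k t ht =>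
    (h.equation k t ht).continuousWithinAt
  have htr : ∀ t ∈ Icc 0 T, v t = trunc (window M) (v t) := fun t ht => coeff_injective fun k => by
    rw [coeff_trunc]
    simp only [window, Finset.mem_Icc, ← abs_le]
    split_ifs with hk
    · rfl
    · exact h.coeff_eq_zero hk ht
  set p : ℤ → ℝ → ℂ := fun k t => ∑ k2 ∈ window M, ∑ k3 ∈ window M,
    coeff (v t) (k + k2 - k3) * conj (coeff (v t) k2) * coeff (v t) k3 with hp
  have hpe : ∀ k, ∀ t ∈ Icc 0 T, tri (v t) (v t) (v t) k = p k t := fun k t ht => by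
    have := tri_trunc (window M) (v t) (v t) (v t) k
    rwa [← htr t ht] at this
  have hpc : ∀ k, ContinuousOn (p k) (Icc 0 T) := fun k => by
    refine continuousOn_finsetSum _ fun k2 _ => continuousOn_finsetSum _ fun k3 _ => ?_
    exact ((hc _).mul (Complex.continuous_conj.comp_continuousOn (hc _))).mul (hc _)
  have hC1 : ∀ k, ContDiffOn ℝ 1 (fun t => coeff (v t) k) (Icc 0 T) := fun k => by
    rw [contDiffOn_one_iff_derivWithin (uniqueDiffOn_Icc hT)]
    refine ⟨fun t ht => (h.equation k t ht).differentiableWithinAt, ?_⟩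
    have hcont : ContinuousOn (fun t => Complex.I * ((symbol α k : ℂ) * coeff (v t) k
        - (γ : ℂ) * (if |k| ≤ (M : ℤ) then p k t else 0))) (Icc 0 T) := by
      have h1 := hc k
      have h2 := hpc k
      split_ifs <;> fun_prop
    refine hcont.congr fun t ht => ?_
    rw [(h.equation k t ht).derivWithin (uniqueDiffOn_Icc hT t ht), cubicCoeff_eq_tri, hpe k t ht]
  have hpC : ContDiffOn ℝ 1 (p k) (Icc 0 T) := by
    refine ContDiffOn.sum fun k2 _ => ContDiffOn.sum fun k3 _ => ?_
    exact ((hC1 _).mul (Complex.conjCLE.contDiff.comp_contDiffOn (hC1 _))).mul (hC1 _)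
  have hexC : ContDiff ℝ 1 fun t : ℝ => ex (-(t * symbol α k)) := by
    unfold ex
    exact (contDiff_const.mul (Complex.ofRealCLM.contDiff.comp
      (contDiff_id.mul contDiff_const).neg)).cexp
  refine ((contDiffOn_const (c := forcingCoeff γ (lowFreq M) k)).mul
    (hexC.contDiffOn.mul hpC)).congr fun t ht => ?_
  rw [forcing, hpe k t ht]

lemma sq_lintegral_jp_lt_top {r : ℝ} (hr : r < -(1 / 2)) : ∫⁻ τ, jp r τ ^ 2 < ⊤ := by
  have : ∀ τ, jp r τ ^ 2 = jp (-(-(2 * r))) τ := fun τ => by rw [jp_sq, neg_neg]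
  simp_rw [this]
  exact lintegral_jp_lt_top (by linarith)

/-- A `C¹` forcing has transform `O(1/|τ|)`, and `(1+|τ|)^{b-2}` is square integrable. Together with
finite frequency support this gives a density of finite norm. No quantitative bound is needed, since
`Sol.exists_rep_le` later supplies one from the `H^s` bound. -/
theorem IsTruncatedSolution.sol (hα : 1 / 2 < α) (hα1 : α < 1) (hs : 0 ≤ s) (hT : 0 < T)
    (h : IsTruncatedSolution α γ M T u₀ v) : Sol α γ (lowFreq M) 0 T (fun k => jp s k) v := by
  have hC1 := h.contDiffOn hT
  have hd : Duhamel α γ (lowFreq M) 0 T v := by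
    intro k t ht
    have ht' : Icc 0 t ⊆ Icc 0 T := Icc_subset_Icc le_rfl ht.2
    have := intervalIntegral.integral_eq_sub_of_hasDerivAt_of_le ht.1
      (f := fun r => ex (-(r * symbol α k)) * coeff (v r) k) (f' := forcing α γ (lowFreq M) v k)
      (fun r hr => ((h.hasDerivWithinAt k (ht' hr)).continuousWithinAt).mono ht')
      (fun r hr => (h.hasDerivWithinAt k (ht' (Ioo_subset_Icc_self hr))).hasDerivAt
        (Icc_mem_nhds hr.1 (hr.2.trans_le ht.2)))
      (((hC1 k).continuousOn.mono ((uIcc_of_le ht.1).subset.trans ht')).intervalIntegrable)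
    rw [this]; ring
  refine ⟨?_, hd⟩
  choose K hK using fun k => exists_fourier_decay hT (hC1 k)
  set a : ℤ → ℝ≥0∞ := fun k => if k ∈ window M then ENNReal.ofReal (K k) else 0 with ha
  obtain ⟨C, hC⟩ := exists_densityBound hα hα1 hT
  have hjp : ∀ k : ℤ, jp s k ≠ ⊤ := fun k => jp_ne_top _ _
  have hwin : ∀ k, k ∉ window M → ¬ |k| ≤ (M : ℤ) := fun k hk => by
    rwa [window, Finset.mem_Icc, ← abs_le] at hk
  have hwa : wn (fun k => jp s k) a < ⊤ := by
    refine wn_lt_top_of_support (window M) hjp (fun k => ?_) fun k hk => if_neg hk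
    simp only [ha]; split_ifs <;> finiteness
  have hw0 : wn (fun k => jp s k) (fun k => ‖ex (-(0 * symbol α k)) * coeff (v 0) k‖ₑ) < ⊤ := by
    refine wn_lt_top_of_support (window M) hjp (fun k => enorm_ne_top) fun k hk => ?_
    simp [h.coeff_eq_zero (hwin k hk) ⟨le_rfl, hT.le⟩]
  have hΓ : nrm (bexp α - 1) (fun k => jp s k) (fun z => a z.1 * jp (-1) z.2) < ⊤ := by
    rw [nrm_seq_mul _ _ _ (measurable_jp _)]
    refine ENNReal.mul_lt_top (ENNReal.rpow_lt_top_of_nonneg (by norm_num) ?_) hwa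
    simp_rw [jp_mul]
    refine (sq_lintegral_jp_lt_top ?_).ne
    have := eps_lt hα hα1
    unfold bexp; linarith
  have h1 : 1 ≤ fun k : ℤ => jp s k := fun k => by
    unfold jp
    simp only [Pi.one_apply, ENNReal.one_le_ofReal]
    exact Real.one_le_rpow (by linarith [abs_nonneg (k : ℝ)]) hs
  have hdec : ∀ k τ, ‖∫ t in 0..T, ex (-(t * τ)) * forcing α γ (lowFreq M) v k t‖ₑ ≤
      (fun z : ℤ × ℝ => a z.1 * jp (-1) z.2) (k, τ) := fun k τ => by
    by_cases hk : k ∈ window M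
    · exact (hK k τ).trans (le_of_eq (by simp only [ha, if_pos hk]))
    · have : ∀ t, forcing α γ (lowFreq M) v k t = 0 := fun t => by
        rw [forcing, forcingCoeff, indicator_of_notMem (by rw [mem_lowFreq]; exact hwin k hk), mul_zero,
          zero_mul]
      simp [this]
  obtain ⟨f, rf, nf⟩ := exists_rep hα hT hC hT.le (by simp)
    (fun k => (hC1 k).continuousOn.integrableOn_Icc) hd h1 (by fun_prop) hdec hΓ hw0
  refine ⟨f, rf, (nf _).trans_lt ?_⟩
  have := hC.1
  finiteness

end

section

/-! ### Well-posedness -/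

variable {α γ s T : ℝ} {u : ℝ → L2} {u₀ : L2} {C D : ℝ≥0∞}

lemma Sol.isUniqueSolution (hα : 1 / 2 < α) (hα1 : α < 1) (hs : sexp α ≤ s) (hT : 0 < T)
    (hγ : |γ| ≤ 1) (h : Sol α γ univ 0 T (fun k => jp s k) u) (h0 : u 0 = u₀) :
    IsUniqueSolution α γ s (bexp α) T u₀ u := by
  have hs0 : 0 ≤ s := le_trans (by unfold sexp; linarith) hs
  refine ⟨h.isSolution hα hα1 hs hT.le h0, fun w hw t ht => ?_⟩
  obtain ⟨D, hD⟩ := exists_uniformTri hα hα1 s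
  obtain ⟨h1, h2⟩ := hw.sol hα hs0 hT.le
  exact h1.unique hα hα1 (hD.pure s hs le_rfl) hD.fin hγ hT h (h2.trans h0.symm) t ht

/-- Nearby data are continued step by step alongside `u` (`exists_near_sol`). Closeness uniformly in
time is then upgraded to closeness in `X^{s,b}_T` by `exists_rep_sub_long`. -/
theorem Sol.wellPosedOn (hα : 1 / 2 < α) (hα1 : α < 1) (hs : sexp α ≤ s) (hT : 0 < T)
    (hγ : |γ| ≤ 1) (h : Sol α γ univ 0 T (fun k => jp s k) u) (h0 : u 0 = u₀) :
    WellPosedOn α γ s (bexp α) T u₀ := by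
  have hs0 : 0 ≤ s := le_trans (by unfold sexp; linarith) hs
  refine ⟨u, h.isUniqueSolution hα hα1 hs hT hγ h0, fun ε hε => ?_⟩
  obtain ⟨D, hD⟩ := exists_uniformTri hα hα1 s
  have P := hD.pure s hs le_rfl
  have hDt := hD.fin
  obtain ⟨C, hC⟩ := exists_densityBound hα hα1 one_pos
  have hCt := hC.1
  obtain ⟨B, hB, hBu⟩ := h.rep.exists_cn_le hα
  have hκ : growth α C ≠ ⊤ := by
    have := embConst_ne_top hα; unfold growth; finiteness
  set κ := growth α C with hκ_def
  obtain ⟨n, δ, hδ, rfl⟩ := exists_shortStep hα hCt hDt (R := (κ + 1) * (B + 1)) (by simp)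
    (by finiteness) hT
  obtain ⟨CL, hCL⟩ := exists_densityBound hα hα1 hT
  have hCLt := hCL.1
  set R := (κ + 1) * (B + 1) with hR
  have hRt : R ≠ ⊤ := hδ.fin
  have htf : tfac α δ ≠ ⊤ := ENNReal.ofReal_ne_top
  -- The bound of `exists_rep_sub_long` is linear in the uniform distance `e`. With its constant and
  -- the factor `2π`, `K e` bounds the `X^{s,b}_T` distance, so `e = min 1 ε / (K+1)` makes both
  -- distances at most `ε`.
  set K := ENNReal.ofReal (2 * π) * (CL * (1 + n * (tfac α δ * (3 * D * (2 * C * R) ^ 2 *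
    (2 * C + 1))))) with hK
  have hKt : K ≠ ⊤ := by finiteness
  set e := min 1 (ENNReal.ofReal ε) / (K + 1) with he
  have hm0 : min 1 (ENNReal.ofReal ε) ≠ 0 := (lt_min one_pos (ENNReal.ofReal_pos.2 hε)).ne'
  have hmt : min 1 (ENNReal.ofReal ε) ≠ ⊤ := (min_lt_of_left_lt ENNReal.one_lt_top).ne
  have he0 : e ≠ 0 := ENNReal.div_ne_zero.2 ⟨hm0, by finiteness⟩
  have het : e ≠ ⊤ := ENNReal.div_ne_top hmt (by simp)
  have heK : (K + 1) * e = min 1 (ENNReal.ofReal ε) :=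
    ENNReal.mul_div_cancel (by simp) (by finiteness)
  have hle : e ≤ min 1 (ENNReal.ofReal ε) := heK ▸ le_mul_of_one_le_left' le_add_self
  have hKe : K * e ≤ ENNReal.ofReal ε :=
    (mul_le_mul' le_self_add le_rfl).trans (heK.le.trans (min_le_right _ _))
  have hp0 : (κ + 1) ^ n ≠ 0 := pow_ne_zero _ (by simp)
  have hpt : (κ + 1) ^ n ≠ ⊤ := by finiteness
  -- The flow may expand the initial distance by `(κ+1)^n`. A further division by `2^{s/2}` below
  -- passes from the weights `1 + |k|` to `1 + k²`.
  set η := e / (κ + 1) ^ n with hη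
  have hηe : (κ + 1) ^ n * η = e := ENNReal.mul_div_cancel hp0 hpt
  have h2s : ENNReal.ofReal (2 ^ (s / 2)) ≠ 0 := (ENNReal.ofReal_pos.2 (by positivity)).ne'
  have hq0 : η / ENNReal.ofReal (2 ^ (s / 2)) ≠ 0 :=
    ENNReal.div_ne_zero.2 ⟨ENNReal.div_ne_zero.2 ⟨he0, hpt⟩, ENNReal.ofReal_ne_top⟩
  have hqt : η / ENNReal.ofReal (2 ^ (s / 2)) ≠ ⊤ :=
    ENNReal.div_ne_top (ENNReal.div_ne_top het hp0) h2s
  refine ⟨(η / ENNReal.ofReal (2 ^ (s / 2))).toReal, ENNReal.toReal_pos hq0 hqt, fun v₀ hv₀ => ?_⟩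
  rw [ENNReal.ofReal_toReal hqt] at hv₀
  have hcn : cn (fun k => jp s k) (u 0 - v₀) ≤ η := by
    rw [h0, cn_sub_comm]
    refine (cn_le_hsNorm hs0 _).trans ((mul_le_mul' le_rfl hv₀.le).trans ?_)
    rw [ENNReal.mul_div_cancel h2s ENNReal.ofReal_ne_top]
  obtain ⟨v, hv, hv0, hvu⟩ := exists_near_sol hα hα1 hC P hDt hγ hδ n h hBu
    (by rw [hηe]; exact hle.trans (min_le_left _ _)) hcn
  rw [hηe] at hvu
  have hvu' : ∀ t ∈ Icc 0 (n * δ), cn (fun k => jp s k) (v t - u t) ≤ e := fun t ht => by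
    rw [cn_sub_comm]; exact hvu t ht
  have hB1 : B + 1 ≤ R := le_mul_of_one_le_left' le_add_self
  refine ⟨v, hv.isUniqueSolution hα hα1 hs hT hγ hv0, ?_, fun t ht => ?_⟩
  · obtain ⟨f, rf, nf⟩ := exists_rep_sub_long hα hα1 hC P hDt hγ hδ n hT le_rfl hCL hv h
      (fun t ht => ((cn_le_add_sub _ _ (u t)).trans (add_le_add (hBu t ht)
        ((hvu' t ht).trans (hle.trans (min_le_left _ _))))).trans hB1)
      (fun t ht => (hBu t ht).trans (le_self_add.trans hB1)) het he0 hvu'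
    refine (xsbNorm_le hα hs0 rf).trans ((mul_le_mul' le_rfl nf).trans (le_trans (le_of_eq ?_) hKe))
    rw [hK]; ring
  · exact (hsNorm_le_cn hs0 _).trans ((hvu' t ht).trans (hle.trans (min_le_right _ _)))

/-! ### Quantitative choice of the time step -/

/-- Smallness asks for `δ^ε A² ≲ 1`, that is `δ` of order `(1+A)^{-2/ε}`. The number of steps is `T
/ δ` rounded up, and this is where the exponent `C₂ = 2/ε` originates. -/
lemma exists_uniform_shortStep (hα : 1 / 2 < α) (hα1 : α < 1) (hC : C ≠ ⊤) (hD : D ≠ ⊤) {c : ℝ≥0∞}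
    (hc0 : c ≠ 0) (hc : c ≠ ⊤) : ∃ Q : ℝ, 0 < Q ∧ ∀ A T : ℝ, 0 < A → 0 < T → ∃ (n : ℕ) (δ : ℝ),
      ShortStep α C D δ (c * ENNReal.ofReal A) ∧ n * δ = T ∧
      n ≤ 1 + Q * (1 + A) ^ (2 / eps α) * T := by
  have he := eps_pos hα
  set Z := 24 * C ^ 3 * D * c ^ 2 * ENNReal.ofReal 16 with hZ
  have hZt : Z ≠ ⊤ := by finiteness
  set p := max 1 Z.toReal with hp
  have hp1 : 1 ≤ p := le_max_left _ _
  have hZp : Z ≤ ENNReal.ofReal p := by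
    rw [← ENNReal.ofReal_toReal hZt]
    exact ENNReal.ofReal_le_ofReal (le_max_right _ _)
  refine ⟨p ^ (1 / eps α), by positivity, fun A T hA hT => ?_⟩
  set δ₀ := (p * (1 + A) ^ 2) ^ (-(1 / eps α)) with hδ₀
  have hq1 : 1 ≤ p * (1 + A) ^ 2 := one_le_mul_of_one_le_of_one_le hp1 (one_le_pow₀ (by linarith))
  have hδpos : 0 < δ₀ := by positivity
  have hδ1 : δ₀ ≤ 1 := Real.rpow_le_one_of_one_le_of_nonpos hq1 (by simp; positivity)
  have hinv : T / δ₀ = p ^ (1 / eps α) * (1 + A) ^ (2 / eps α) * T := by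
    rw [hδ₀, Real.rpow_neg (by positivity), div_inv_eq_mul, Real.mul_rpow (by positivity) (by positivity),
      ← Real.rpow_natCast (1 + A) 2, ← Real.rpow_mul (by positivity)]
    rw [show ((2 : ℕ) : ℝ) * (1 / eps α) = 2 / eps α by push_cast; ring]
    ring
  have hn0 : 0 < ⌈T / δ₀⌉₊ := Nat.ceil_pos.2 (by positivity)
  have hn0' : (0 : ℝ) < ⌈T / δ₀⌉₊ := by exact_mod_cast hn0
  have hδle : T / ⌈T / δ₀⌉₊ ≤ δ₀ := by
    rw [div_le_iff₀ hn0', mul_comm, ← div_le_iff₀ hδpos]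
    exact Nat.le_ceil _
  have hδ0 : 0 ≤ T / ⌈T / δ₀⌉₊ := by positivity
  refine ⟨⌈T / δ₀⌉₊, T / ⌈T / δ₀⌉₊, ⟨hδ0, hδle.trans hδ1, mul_ne_zero hc0
    (ENNReal.ofReal_pos.2 hA).ne', by finiteness, ?_⟩, by field_simp, ?_⟩
  · set δ := T / ⌈T / δ₀⌉₊
    have h1 : δ ^ eps α ≤ (p * (1 + A) ^ 2)⁻¹ := by
      calc δ ^ eps α ≤ δ₀ ^ eps α := by gcongr
        _ = (p * (1 + A) ^ 2)⁻¹ := by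
          rw [hδ₀, ← Real.rpow_mul (by positivity), show -(1 / eps α) * eps α = -1 by field_simp,
            Real.rpow_neg_one]
    have h2 : tfac α δ ≤ ENNReal.ofReal 16 * ENNReal.ofReal (p * (1 + A) ^ 2)⁻¹ := by
      refine (tfac_le hα hα1 hδ0 (hδle.trans hδ1)).trans ?_
      rw [← ENNReal.ofReal_mul (by norm_num)]
      refine ENNReal.ofReal_le_ofReal ?_
      gcongr
    calc 24 * C ^ 3 * D * tfac α δ * (c * ENNReal.ofReal A) ^ 2
        ≤ 24 * C ^ 3 * D * (ENNReal.ofReal 16 * ENNReal.ofReal (p * (1 + A) ^ 2)⁻¹) *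
            (c * ENNReal.ofReal A) ^ 2 := by gcongr
      _ = Z * (ENNReal.ofReal (p * (1 + A) ^ 2)⁻¹ * ENNReal.ofReal A ^ 2) := by rw [hZ]; ring
      _ ≤ ENNReal.ofReal p * (ENNReal.ofReal (p * (1 + A) ^ 2)⁻¹ * ENNReal.ofReal A ^ 2) := by gcongr
      _ = ENNReal.ofReal (p * ((p * (1 + A) ^ 2)⁻¹ * A ^ 2)) := by
          rw [← ENNReal.ofReal_pow hA.le, ← ENNReal.ofReal_mul (by positivity),
            ← ENNReal.ofReal_mul (by positivity)]
      _ ≤ 1 := by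
          rw [ENNReal.ofReal_le_one, mul_inv]
          have hpp : 0 < p := by positivity
          rw [show p * (p⁻¹ * ((1 + A) ^ 2)⁻¹ * A ^ 2) = A ^ 2 / (1 + A) ^ 2 by field_simp]
          rw [div_le_one (by positivity)]
          gcongr; linarith
  · rw [← hinv, add_comm]
    exact (Nat.ceil_lt_add_one (by positivity)).le

/-- The bound on `n` turns `Λ^n` into `Λ` times an exponential. If `T ≥ 1`, the prefactor is
absorbed as well, because `A ≤ (1+A)^θ` and `x ≤ e^x`; the summand `c Λ` in the exponent makes room
for it. -/
lemma exponential_bounds {c Λ Q θ A T : ℝ} (hc : 0 < c) (hΛ : 1 ≤ Λ) (hθ : 1 ≤ θ)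
    (hA : 0 < A) (hT : 0 < T) {n : ℕ} (hn : n ≤ 1 + Q * (1 + A) ^ θ * T) :
    c * A * Λ ^ n ≤ c * Λ * A * Real.exp ((Real.log Λ * Q + c * Λ) * (1 + A) ^ θ * T) ∧
    (1 ≤ T → c * A * Λ ^ n ≤ Real.exp ((Real.log Λ * Q + c * Λ) * (1 + A) ^ θ * T)) := by
  have hΛ0 : 0 < Λ := by linarith
  have hl : 0 ≤ Real.log Λ := Real.log_nonneg hΛ
  have hX : 0 < (1 + A) ^ θ := by positivity
  have h1 : Λ ^ n ≤ Λ * Real.exp (Real.log Λ * Q * (1 + A) ^ θ * T) := by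
    rw [← Real.rpow_natCast]
    refine (Real.rpow_le_rpow_of_exponent_le hΛ hn).trans (le_of_eq ?_)
    rw [Real.rpow_add hΛ0, Real.rpow_one, Real.rpow_def_of_pos hΛ0]
    congr 2; ring
  have h2 : c * A * Λ ^ n ≤ c * Λ * A * Real.exp (Real.log Λ * Q * (1 + A) ^ θ * T) := by
    calc _ ≤ c * A * (Λ * Real.exp (Real.log Λ * Q * (1 + A) ^ θ * T)) := by gcongr
      _ = _ := by ring
  have hcT : 0 ≤ c * Λ * (1 + A) ^ θ * T := by positivity
  refine ⟨h2.trans ?_, fun hT1 => h2.trans ?_⟩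
  · gcongr
    nlinarith
  · have h3 : A ≤ (1 + A) ^ θ := by
      calc A ≤ (1 + A) ^ (1 : ℝ) := by rw [Real.rpow_one]; linarith
        _ ≤ _ := Real.rpow_le_rpow_of_exponent_le (by linarith) hθ
    have h4 : c * Λ * A ≤ Real.exp (c * Λ * (1 + A) ^ θ * T) := by
      have h5 : c * Λ * A ≤ c * Λ * (1 + A) ^ θ * T := by
        calc c * Λ * A ≤ c * Λ * (1 + A) ^ θ := by gcongr
          _ ≤ _ := le_mul_of_one_le_right (by positivity) hT1
      linarith [Real.add_one_le_exp (c * Λ * (1 + A) ^ θ * T)]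
    calc _ ≤ Real.exp (c * Λ * (1 + A) ^ θ * T) * Real.exp (Real.log Λ * Q * (1 + A) ^ θ * T) := by
          gcongr
      _ = _ := by rw [← Real.exp_add]; congr 1; ring

lemma exists_forall_rpow_mul_le {r : ℝ} (hr : 0 < r) {K A : ℝ≥0∞} (hK : K ≠ ⊤) (hA : A ≠ 0) :
    ∃ N₀ : ℕ, 1 ≤ N₀ ∧ ∀ N : ℕ, N₀ ≤ N → ENNReal.ofReal ((N : ℝ) ^ (-r)) * K ≤ A := by
  have h1 : Tendsto (fun N : ℕ => ENNReal.ofReal ((N : ℝ) ^ (-r)) * K) atTop (𝓝 0) := by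
    have h2 := ENNReal.tendsto_ofReal ((tendsto_rpow_neg_atTop hr).comp tendsto_natCast_atTop_atTop)
    have h3 := ENNReal.Tendsto.mul_const (b := K) h2 (Or.inr hK)
    simpa using h3
  have h4 := h1.eventually_le_const (pos_iff_ne_zero.2 hA)
  obtain ⟨N₁, hN₁⟩ := eventually_atTop.1 h4
  exact ⟨max 1 N₁, le_max_left _ _, fun N hN => hN₁ N ((le_max_right _ _).trans hN)⟩

/-! ### The main estimate -/

/-- The distance between a solution and a solution of the truncated equation. -/
lemma hsNorm_sub_truncated_le (hα : 1 / 2 < α) (hα1 : α < 1) (hC : DensityBound α 1 C) {S : ℝ}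
    (hD : UniformTri α S D) (hγ : |γ| ≤ 1) (hs : sexp α ≤ s) (hS : s ≤ S) {A : ℝ≥0∞} (hA0 : A ≠ 0)
    (hA : A ≠ ⊤) {δ : ℝ} (hδ : ShortStep α C D δ ((3 * growth α C + 3) * A)) (n : ℕ) {M : ℕ}
    (hM : 1 ≤ M) {v : ℝ → L2} (hu : Sol α γ univ 0 (n * δ) (fun k => jp s k) u)
    (hv : Sol α γ (lowFreq M) 0 (n * δ) (fun k => jp s k) v)
    (hub : ∀ t ∈ Icc 0 (n * δ), cn (w0 α) (u t) ≤ 2 * A ∧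
      cn (fun k => jp s k) (u t) ≤ (3 * growth α C + 1) ^ n * A)
    (hvs : ∀ t ∈ Icc 0 (n * δ), cn (fun k => jp s k) (v t) ≤ A)
    (hini : v 0 = freqProj M (u 0)) (hiniA : cn (fun k => jp s k) (u 0) ≤ A) {s' : ℝ} (hs' : 0 ≤ s')
    (hss : s' ≤ s) {t : ℝ} (ht : t ∈ Icc 0 (n * δ)) :
    hsNorm s' (u t - v t) ≤ ENNReal.ofReal ((M : ℝ) ^ (s' - s)) *
      ((3 * growth α C + 6) * A * ((growth α C + 1) * (3 * growth α C + 1)) ^ n) := by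
  have hκ : growth α C ≠ ⊤ := by
    have := hC.1; have := embConst_ne_top hα; unfold growth; finiteness
  set κ := growth α C with hκ_def
  set X := (3 * κ + 1) ^ n with hX
  set Y := (κ + 1) ^ n with hY
  have hX1 : 1 ≤ X := one_le_pow_of_one_le' le_add_self n
  have hY1 : 1 ≤ Y := one_le_pow_of_one_le' le_add_self n
  have hAX : A ≤ X * A := le_mul_of_one_le_left' hX1
  have hMr : (0 : ℝ) < M := by exact_mod_cast hM
  have h1 := cn_sub_truncated_le (q := 2) (B := X * A) hα hα1 hC hD hγ hs hS hA0 hAX (by finiteness)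
    (by norm_num) (mul_le_mul' ((le_of_eq (by norm_num)).trans (le_add_self (a := (3 : ℝ≥0∞)))) le_rfl) hδ n hM hu hv
    (fun t ht => (hub t ht).1) (fun t ht => (hub t ht).2) hvs hini hiniA t ht
  have h2 : cn (fun k => jp s k) (u t - v t) ≤ 2 * (X * A) := by
    refine le_trans ?_ (two_mul (X * A)).ge
    exact (cn_sub_le _ _ _).trans (add_le_add (hub t ht).2 ((hvs t ht).trans hAX))
  -- The `H^s` bound is `B = X A`, so the factor `A⁻¹ B` from the mixed weight is just `X`. The
  -- final bound is therefore linear in `A`.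
  have h3 : A⁻¹ * (X * A) * ((3 * κ + 3) * A) = X * ((3 * κ + 3) * A) := by
    rw [mul_comm X A, ← mul_assoc A⁻¹, ENNReal.inv_mul_cancel hA0 hA, one_mul]
  rw [h3] at h1
  refine (hsNorm_le_cn hs' _).trans ((cn_interpolation hs' hss hM _).trans ?_)
  calc _ ≤ ENNReal.ofReal ((M : ℝ) ^ s') * (ENNReal.ofReal ((M : ℝ) ^ (-s)) *
        (Y * (A + X * ((3 * κ + 3) * A)))) + ENNReal.ofReal ((M : ℝ) ^ (s' - s)) * (2 * (X * A)) := by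
        gcongr
    _ = ENNReal.ofReal ((M : ℝ) ^ (s' - s)) *
        (1 * (Y * A) + Y * (X * ((3 * κ + 3) * A)) + 2 * (1 * (X * A))) := by
        rw [← mul_assoc, ← ENNReal.ofReal_mul (by positivity), ← Real.rpow_add hMr, ← sub_eq_add_neg]
        ring
    _ ≤ ENNReal.ofReal ((M : ℝ) ^ (s' - s)) *
        (X * (Y * A) + Y * (X * ((3 * κ + 3) * A)) + 2 * (Y * (X * A))) := by gcongr
    _ = _ := by rw [mul_pow, ← hX, ← hY]; ring

/-- All constants are fixed from `α` and `S` before `s`, `A` and `T` appear; only the number of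
steps and `N₀` depend on these. The solution built from one bounded `uN` is then compared with every
bounded `uM`. -/
theorem wellPosed_and_truncation_estimate (hα : 1 / 2 < α) (hα' : α < 1) (S : ℝ) :
    ∃ C₀ C₁ : ℝ, 0 < C₀ ∧ 0 < C₁ ∧
        ∀ γ : ℝ, (γ = 1 ∨ γ = -1) →
        ∀ s : ℝ, (1 - α) / 2 < s → s ≤ S →
        ∀ A T : ℝ, 0 < T → ∃ N₀ : ℕ,
        ∀ u₀ : L2, hsNorm s u₀ < ENNReal.ofReal A →
        ∀ (N : ℕ) (uN : ℝ → L2), N₀ ≤ N → StaysInBall α γ s A T N u₀ uN →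
          WellPosedOn α γ s (bexp α) T u₀ ∧
          ∀ u : ℝ → L2, IsSolution α γ s (bexp α) T u₀ u →
          ∀ (M : ℕ) (uM : ℝ → L2), 1 ≤ M → StaysInBall α γ s A T M u₀ uM →
            ∀ s' : ℝ, 0 ≤ s' → s' < s → ∀ t ∈ Set.Icc 0 T,
              hsNorm s' (u t - uM t) ≤ ENNReal.ofReal
                (C₀ * A * Real.exp (C₁ * (1 + A) ^ (2 / eps α) * T) * (M : ℝ) ^ (s' - s)) ∧
              (1 ≤ T → hsNorm s' (u t - uM t) ≤ ENNReal.ofReal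
                (Real.exp (C₁ * (1 + A) ^ (2 / eps α) * T) * (M : ℝ) ^ (s' - s))) := by
  have he := eps_pos hα
  have he1 := eps_lt hα hα'
  have hθ : 1 ≤ 2 / eps α := by rw [le_div_iff₀ he]; linarith
  obtain ⟨D, hD⟩ := exists_uniformTri hα hα' S
  obtain ⟨C, hC⟩ := exists_densityBound hα hα' one_pos
  have hDt := hD.fin
  have hCt := hC.1
  have hκ : growth α C ≠ ⊤ := by
    have := embConst_ne_top hα; unfold growth; finiteness
  set κ := growth α C with hκ_def
  have h2S : 0 < (2 : ℝ) ^ (S / 2) := by positivity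
  -- The cost of passing from the weight `(1+k²)^{s/2}` of `hsNorm` to `(1+|k|)^s`, uniformly for `s
  -- ≤ S`.
  set a := ENNReal.ofReal (2 ^ (S / 2)) with ha
  have ha0 : a ≠ 0 := (ENNReal.ofReal_pos.2 h2S).ne'
  have hat : a ≠ ⊤ := ENNReal.ofReal_ne_top
  obtain ⟨Q, hQ, hstep⟩ := exists_uniform_shortStep hα hα' hCt hDt (c := (3 * κ + 3) * a)
    (mul_ne_zero (by simp) ha0) (by finiteness)
  set c := ((3 * κ + 6) * a).toReal with hc_def
  have hct : (3 * κ + 6) * a ≠ ⊤ := by finiteness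
  have hc : 0 < c := ENNReal.toReal_pos (mul_ne_zero (by simp) ha0) hct
  set Λ := ((κ + 1) * (3 * κ + 1)).toReal with hΛ_def
  have hΛt : (κ + 1) * (3 * κ + 1) ≠ ⊤ := by finiteness
  have hΛ : 1 ≤ Λ := by
    rw [hΛ_def, ← ENNReal.toReal_one]
    exact ENNReal.toReal_mono hΛt (one_le_mul le_add_self le_add_self)
  have hl : 0 ≤ Real.log Λ := Real.log_nonneg hΛ
  refine ⟨c * Λ, Real.log Λ * Q + c * Λ, by positivity, by positivity, fun γ hγ' s hs hS A T hT => ?_⟩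
  have hγ : |γ| ≤ 1 := by rcases hγ' with rfl | rfl <;> simp
  have hs0 : 0 ≤ s := by linarith
  -- For `A ≤ 0` no datum has norm below `ENNReal.ofReal A = 0`, and any `N₀` will do.
  rcases le_or_gt A 0 with hA | hA
  · refine ⟨0, fun u₀ hu₀ => ?_⟩
    rw [ENNReal.ofReal_of_nonpos hA] at hu₀
    exact absurd hu₀ not_lt_zero
  obtain ⟨n, δ, hδ, hnT, hn⟩ := hstep A T hA hT
  rw [mul_assoc] at hδ
  set A' := a * ENNReal.ofReal A with hA'
  have hA0 : A' ≠ 0 := mul_ne_zero ha0 (ENNReal.ofReal_pos.2 hA).ne'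
  have hAt : A' ≠ ⊤ := by finiteness
  have hAi : A'⁻¹ ≠ ⊤ := ENNReal.inv_ne_top.2 hA0
  -- The strict inequality `s > (1-α)/2` gives a negative power of `N` to beat a constant that
  -- depends on `A` and `n`, and not on the datum.
  obtain ⟨N₀, hN₀, hN⟩ := exists_forall_rpow_mul_le (r := s - sexp α) (by unfold sexp; linarith)
    (K := (κ + 1) ^ n * (A' + A'⁻¹ * ((3 * κ + 1) ^ n * A') * ((3 * κ + 3) * A')) +
      2 * ((3 * κ + 1) ^ n * A')) (by finiteness) hA0
  rw [neg_sub] at hN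
  have hcn : ∀ f : L2, hsNorm s f < ENNReal.ofReal A → cn (fun k => jp s k) f ≤ A' := fun f hf => by
    refine (cn_le_hsNorm hs0 f).trans (mul_le_mul' (ENNReal.ofReal_le_ofReal ?_) hf.le)
    gcongr
    norm_num
  refine ⟨N₀, fun u₀ hu₀ N uN hNN hball => ?_⟩
  have hsol : ∀ M v, StaysInBall α γ s A T M u₀ v →
      Sol α γ (lowFreq M) 0 (n * δ) (fun k => jp s k) v ∧
      ∀ t ∈ Icc 0 (n * δ), cn (fun k => jp s k) (v t) ≤ A' := fun M v hv => by
    rw [hnT]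
    exact ⟨hv.1.sol hα hα' hs0 hT, fun t ht => hcn _ (hv.2 t ht)⟩
  obtain ⟨w, hw, hw0, hwb⟩ := exists_global_sol hα hα' hC hD hγ hs.le hS hA0 hAt hδ n
    (hN₀.trans hNN) (hN N hNN) (hcn _ hu₀) (hsol N uN hball).1 (hsol N uN hball).2 hball.1.init
  have hwT : Sol α γ univ 0 T (fun k => jp s k) w := by rwa [hnT] at hw
  refine ⟨hwT.wellPosedOn hα hα' hs.le hT hγ hw0, fun u hu M uM hM hballM s' hs' hss t ht => ?_⟩
  have huw : u t = w t := (hwT.isUniqueSolution hα hα' hs.le hT hγ hw0).2 u hu ht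
  have hMr : (0 : ℝ) < M := by exact_mod_cast hM
  have key := hsNorm_sub_truncated_le hα hα' hC hD hγ hs.le hS hA0 hAt hδ n hM hw (hsol M uM hballM).1
    hwb (hsol M uM hballM).2 (by rw [hw0]; exact hballM.1.init) (by rw [hw0]; exact hcn _ hu₀) hs' hss.le
    (t := t) (by rwa [hnT])
  have hconst : (3 * κ + 6) * A' * ((κ + 1) * (3 * κ + 1)) ^ n = ENNReal.ofReal (c * A * Λ ^ n) := by
    rw [ENNReal.ofReal_mul (by positivity), ENNReal.ofReal_mul hc.le, ENNReal.ofReal_pow (by positivity),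
      hc_def, hΛ_def, ENNReal.ofReal_toReal hct, ENNReal.ofReal_toReal hΛt, hA']
    ring
  rw [hconst, ← ENNReal.ofReal_mul (by positivity), mul_comm ((M : ℝ) ^ (s' - s)), ← huw] at key
  obtain ⟨b1, b2⟩ := exponential_bounds hc hΛ hθ hA hT hn
  refine ⟨key.trans (ENNReal.ofReal_le_ofReal ?_), fun hT1 => key.trans (ENNReal.ofReal_le_ofReal ?_)⟩
  · gcongr
  · exact mul_le_mul_of_nonneg_right (b2 hT1) (by positivity)

end

end FracNLS

end

theorem mainTheorem2 (α : ℝ) (hα : 1 / 2 < α) (hα' : α < 1) :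
    ∃ b C₂ : ℝ, 1 / 2 < b ∧ 0 < C₂ ∧
      ∀ S : ℝ, ∃ C₀ C₁ : ℝ, 0 < C₀ ∧ 0 < C₁ ∧
        ∀ γ : ℝ, (γ = 1 ∨ γ = -1) →
        ∀ s : ℝ, (1 - α) / 2 < s → s ≤ S →
        ∀ A T : ℝ, 0 < T → ∃ N₀ : ℕ,
        ∀ u₀ : FracNLS.L2, FracNLS.hsNorm s u₀ < ENNReal.ofReal A →
        ∀ (N : ℕ) (uN : ℝ → FracNLS.L2), N₀ ≤ N →
          FracNLS.StaysInBall α γ s A T N u₀ uN →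
          FracNLS.WellPosedOn α γ s b T u₀ ∧
          ∀ u : ℝ → FracNLS.L2, FracNLS.IsSolution α γ s b T u₀ u →
          ∀ (M : ℕ) (uM : ℝ → FracNLS.L2), 1 ≤ M →
            FracNLS.StaysInBall α γ s A T M u₀ uM →
            ∀ s' : ℝ, 0 ≤ s' → s' < s → ∀ t ∈ Set.Icc 0 T,
              FracNLS.hsNorm s' (u t - uM t) ≤
                ENNReal.ofReal
                  (C₀ * A * Real.exp (C₁ * (1 + A) ^ C₂ * T) * (M : ℝ) ^ (s' - s)) ∧
              (1 ≤ T → FracNLS.hsNorm s' (u t - uM t) ≤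
                ENNReal.ofReal
                  (Real.exp (C₁ * (1 + A) ^ C₂ * T) * (M : ℝ) ^ (s' - s))) := by
  exact ⟨FracNLS.bexp α, 2 / FracNLS.eps α, FracNLS.half_lt_bexp hα,
    div_pos two_pos (FracNLS.eps_pos hα),
    fun S => FracNLS.wellPosed_and_truncation_estimate hα hα' S⟩
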